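/- Theorem 1.3. Let $n \ge 3$ and $d \ge 0$ be integers and let $c_1 \in \mathbb{R}$. There is a constant $\kappa_0 > 0$, depending only on $n$, $d$ and $c_1$, with the following property. Let $(M, g)$ be a complete, non-compact smooth Riemannian manifold of dimension $n$, with Riemann tensor $R_{\alpha\beta\mu\lambda}$ and Ricci tensor $R_{\alpha\beta}$ (signs such that a space of constant curvature $K$ has $R_{\alpha\beta\mu\lambda} = K(g_{\alpha\mu}g_{\beta\lambda} - g_{\alpha\lambda}g_{\beta\mu})$ and $R_{\alpha\beta} = (n-1)K g_{\alpha\beta}$). Assume that at every point $$R_{\alpha\beta}\Lambda^{\alpha}{}_{\lambda}\Lambda^{\beta\lambda} - \tfrac12 R_{\alpha\beta\mu\lambda}\Lambda^{\alpha\beta}\Lambda^{\mu\lambda} \ge 0 \quad\text{for all skew-symmetric } \Lambda_{\alpha\beta},$$ and that $$\Big(\int_M |u|^{\frac{2n}{n-2}}\Big)^{\frac{n-2}{n}} \le c_1 \int_M |Du|^2 \quad\text{for all } u \in H^{1,2}(M).$$ Let $G$ be a compact Lie group of dimension $d$ with semisimple Lie algebra $\mathfrak g$, and let $A$ be a smooth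 connection on a smooth principal $G$-bundle over $M$, with field strength $F_{\mu\lambda} = \partial_\mu A_\lambda - \partial_\lambda A_\mu + [A_\mu, A_\lambda]$ in local gauges, that satisfies the Yang–Mills equation $g^{\alpha\mu} F_{\mu\lambda;\alpha} = 0$, where the semicolon is the full covariant derivative (by $A$ and the Levi-Civita connection). Put $|F|^2 = -\operatorname{tr}(\operatorname{ad}F_{\mu\lambda}\,\operatorname{ad}F^{\mu\lambda})$, the trace being taken over $\mathfrak g$ and the sum over all indices $\mu,\lambda$. Then either $A$ is flat, i.e. $F \equiv 0$, or $$\Big(\int_M |F|^{\frac n2}\Big)^{\frac 2n} \ge \kappa_0,$$ where the left-hand side may be $+\infty$. -/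

import Mathlib

open MeasureTheory Bundle
open scoped Manifold ContDiff

universe u v w

noncomputable section

/-- A smooth real Lie group has the regularity that Mathlib requires for the Lie algebra
structure on `GroupLieAlgebra`. -/
instance YangMills.lieGroup_minSmoothness {d : ℕ} {G : Type v} [TopologicalSpace G]
    [ChartedSpace (EuclideanSpace ℝ (Fin d)) G] [Group G] [h : LieGroup (𝓡 d) ∞ G] :
    LieGroup (𝓡 d) (minSmoothness ℝ 3) G := by
  have h3 : LieGroup (𝓡 d) 3 G := inferInstance
  simpa using h3

namespace YangMills

/-- The partial derivative in the direction of the `i`-th coordinate of `ℝⁿ`. -/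
def pd {n : ℕ} {F : Type*} [AddCommGroup F] [Module ℝ F] [TopologicalSpace F] (i : Fin n)
    (f : EuclideanSpace ℝ (Fin n) → F) (y : EuclideanSpace ℝ (Fin n)) : F :=
  fderiv ℝ f y (EuclideanSpace.single i 1)

/-! ### Riemannian geometry in the charts `chartAt _ c`, `c : M`

All objects attached to the chart at `c` are functions of the coordinates `y ∈ ℝⁿ`; only their
values for `y` in the target of the chart are meaningful. -/

section Riemannian

variable {n : ℕ} {M : Type u} [TopologicalSpace M] [ChartedSpace (EuclideanSpace ℝ (Fin n)) M]

/-- The coordinate vector field `∂ᵢ` of the chart at `c`, at the point with coordinates `y`. -/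
def coordVec (c : M) (i : Fin n) (y : EuclideanSpace ℝ (Fin n)) :
    TangentSpace (𝓡 n) ((chartAt (EuclideanSpace ℝ (Fin n)) c).symm y) :=
  mfderiv (𝓡 n) (𝓡 n) (chartAt (EuclideanSpace ℝ (Fin n)) c).symm y
    (EuclideanSpace.single i (1 : ℝ) : EuclideanSpace ℝ (Fin n))

variable [RiemannianBundle (fun x : M ↦ TangentSpace (𝓡 n) x)]

/-- The matrix `(g_{ij})` of the metric in the chart at `c`. -/
def metric (c : M) (y : EuclideanSpace ℝ (Fin n)) : Matrix (Fin n) (Fin n) ℝ :=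
  Matrix.of fun i j ↦ inner ℝ (coordVec c i y) (coordVec c j y)

/-- The matrix `(g^{ij})`, the inverse of `(g_{ij})`. -/
def metricInv (c : M) (y : EuclideanSpace ℝ (Fin n)) : Matrix (Fin n) (Fin n) ℝ :=
  (metric c y)⁻¹

/-- The Christoffel symbols `Γ^k_{ij}` of the Levi-Civita connection. -/
def christoffel (c : M) (k i j : Fin n) (y : EuclideanSpace ℝ (Fin n)) : ℝ :=
  (1 / 2) * ∑ l, metricInv c y k l *
    (pd i (fun z ↦ metric c z j l) y + pd j (fun z ↦ metric c z i l) y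
      - pd l (fun z ↦ metric c z i j) y)

/-- The Riemann tensor `R^a_{bml}`:
`∂_m Γ^a_{lb} - ∂_l Γ^a_{mb} + Γ^a_{mt} Γ^t_{lb} - Γ^a_{lt} Γ^t_{mb}`. -/
def riemannUp (c : M) (a b m l : Fin n) (y : EuclideanSpace ℝ (Fin n)) : ℝ :=
  pd m (christoffel c a l b) y - pd l (christoffel c a m b) y
    + ∑ t, (christoffel c a m t y * christoffel c t l b y
      - christoffel c a l t y * christoffel c t m b y)

/-- The Riemann tensor `R_{abml} = g_{as} R^s_{bml}`. With this sign a space of constant curvature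
`K` has `R_{abml} = K (g_{am} g_{bl} - g_{al} g_{bm})`. -/
def riemann (c : M) (a b m l : Fin n) (y : EuclideanSpace ℝ (Fin n)) : ℝ :=
  ∑ s, metric c y a s * riemannUp c s b m l y

/-- The Ricci tensor `R_{bl} = R^a_{bal}` (positive on round spheres). -/
def ricci (c : M) (b l : Fin n) (y : EuclideanSpace ℝ (Fin n)) : ℝ :=
  ∑ a, riemannUp c a b a l y

/-- `Λ^{ab} = g^{ai} g^{bj} Λ_{ij}`. -/
def raise (c : M) (L : Matrix (Fin n) (Fin n) ℝ) (y : EuclideanSpace ℝ (Fin n)) (a b : Fin n) : ℝ :=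
  ∑ i, ∑ j, metricInv c y a i * metricInv c y b j * L i j

variable (n M) in
/-- The curvature condition
`R_{ab} Λ^a_l Λ^{bl} - ½ R_{abml} Λ^{ab} Λ^{ml} ≥ 0` for all skew-symmetric `Λ`. -/
def NonnegCurvatureOnTwoForms : Prop :=
  ∀ (c : M), ∀ y ∈ (chartAt (EuclideanSpace ℝ (Fin n)) c).target,
    ∀ L : Matrix (Fin n) (Fin n) ℝ, (∀ i j, L j i = -L i j) →
      0 ≤ (∑ a, ∑ b, ∑ l, ricci c a b y * (∑ i, metricInv c y a i * L i l) * raise c L y b l)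
        - (1 / 2) * ∑ a, ∑ b, ∑ m, ∑ l, riemann c a b m l y * raise c L y a b * raise c L y m l

section Volume

variable [MeasurableSpace M]

/-- The measure `√(det g) dy` in the chart at `c`, as a measure on `M` carried by the domain of
that chart. -/
def chartVolume (c : M) : Measure M :=
  (((volume : Measure (EuclideanSpace ℝ (Fin n))).restrict
      (chartAt (EuclideanSpace ℝ (Fin n)) c).target).withDensity
    (fun y ↦ ENNReal.ofReal (Real.sqrt (metric c y).det))).map
      (chartAt (EuclideanSpace ℝ (Fin n)) c).symm

variable (n M) in
/-- The Riemannian volume measure. The measures `chartVolume c` agree on the intersections of the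
chart domains; their supremum, the smallest measure that dominates all of them, is the measure
that is given by `√(det g) dy` in each of the charts. -/
def riemannianVolume : Measure M := ⨆ c : M, chartVolume (n := n) c

/-- `u ∈ H^{1,2}(M)`, with weak gradient `X`: both are square integrable, and in each chart the
function `⟨X, ∂ᵢ⟩` is the `i`-th weak partial derivative of `u`. -/
structure IsH12 (u : M → ℝ) (X : ∀ x : M, TangentSpace (𝓡 n) x) : Prop where
  memLp : MemLp u 2 (riemannianVolume n M)
  aestronglyMeasurable_grad : ∀ (c : M) (i : Fin n),
    AEStronglyMeasurable
      (fun y ↦ inner ℝ (X ((chartAt (EuclideanSpace ℝ (Fin n)) c).symm y)) (coordVec c i y))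
      ((volume : Measure (EuclideanSpace ℝ (Fin n))).restrict
        (chartAt (EuclideanSpace ℝ (Fin n)) c).target)
  lintegral_grad_lt_top : ∫⁻ x, ‖X x‖ₑ ^ 2 ∂(riemannianVolume n M) < ⊤
  weak_deriv : ∀ (c : M) (i : Fin n) (ψ : EuclideanSpace ℝ (Fin n) → ℝ), ContDiff ℝ ∞ ψ →
    HasCompactSupport ψ → tsupport ψ ⊆ (chartAt (EuclideanSpace ℝ (Fin n)) c).target →
    ∫ y in (chartAt (EuclideanSpace ℝ (Fin n)) c).target,
        u ((chartAt (EuclideanSpace ℝ (Fin n)) c).symm y) * pd i ψ y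
      = -∫ y in (chartAt (EuclideanSpace ℝ (Fin n)) c).target,
        inner ℝ (X ((chartAt (EuclideanSpace ℝ (Fin n)) c).symm y)) (coordVec c i y) * ψ y

variable (n M) in
/-- The global Sobolev inequality
`(∫ |u|^{2n/(n-2)})^{(n-2)/n} ≤ c₁ ∫ |Du|²` for all `u ∈ H^{1,2}(M)`. -/
def SobolevInequality (c₁ : ℝ) : Prop :=
  ∀ (u : M → ℝ) (X : ∀ x : M, TangentSpace (𝓡 n) x), IsH12 u X →
    (∫⁻ x, ‖u x‖ₑ ^ (2 * (n : ℝ) / ((n : ℝ) - 2)) ∂(riemannianVolume n M))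
        ^ (((n : ℝ) - 2) / (n : ℝ))
      ≤ ENNReal.ofReal c₁ * ∫⁻ x, ‖X x‖ₑ ^ 2 ∂(riemannianVolume n M)

end Volume

end Riemannian

/-! ### Principal bundles and connections -/

section Bundles

variable {n d : ℕ}
  (M : Type u) [TopologicalSpace M] [ChartedSpace (EuclideanSpace ℝ (Fin n)) M]
  (G : Type v) [TopologicalSpace G] [ChartedSpace (EuclideanSpace ℝ (Fin d)) G] [Group G]
  (P : Type w) [TopologicalSpace P] [ChartedSpace (EuclideanSpace ℝ (Fin (n + d))) P]

/-- A smooth principal `G`-bundle with total space `P` over `M`: a smooth right action of `G` on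
`P`, and around each `b : M` a local trivialization, given by the local section `sec b` over the
open set `dom b` and the group coordinate `coord b` with `p = sec b (proj p) · coord b p`. -/
structure PrincipalBundle where
  /-- the bundle projection -/
  proj : P → M
  /-- the right action of the structure group -/
  act : P → G → P
  /-- the local gauges -/
  sec : M → M → P
  /-- the domains of the local gauges -/
  dom : M → Set M
  /-- the fibre coordinate of the trivialization that belongs to a local gauge -/
  coord : M → P → G
  contMDiff_proj : ContMDiff (𝓡 (n + d)) (𝓡 n) ∞ proj
  contMDiff_act : ContMDiff ((𝓡 (n + d)).prod (𝓡 d)) (𝓡 (n + d)) ∞ (fun q : P × G ↦ act q.1 q.2)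
  act_one : ∀ p, act p 1 = p
  act_mul : ∀ p g h, act p (g * h) = act (act p g) h
  proj_act : ∀ p g, proj (act p g) = proj p
  isOpen_dom : ∀ b, IsOpen (dom b)
  mem_dom : ∀ b, b ∈ dom b
  proj_sec : ∀ b, ∀ x ∈ dom b, proj (sec b x) = x
  contMDiffOn_sec : ∀ b, ContMDiffOn (𝓡 n) (𝓡 (n + d)) ∞ (sec b) (dom b)
  contMDiffOn_coord : ∀ b, ContMDiffOn (𝓡 (n + d)) (𝓡 d) ∞ (coord b) (proj ⁻¹' dom b)
  act_coord : ∀ b, ∀ p ∈ proj ⁻¹' dom b, act (sec b (proj p)) (coord b p) = p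
  coord_act : ∀ b, ∀ x ∈ dom b, ∀ g, coord b (act (sec b x) g) = g

variable {G}

/-- The adjoint representation `Ad g`, the derivative at `1` of `h ↦ g h g⁻¹`. -/
def Ad (g : G) (ξ : GroupLieAlgebra (𝓡 d) G) : GroupLieAlgebra (𝓡 d) G :=
  (mfderiv (𝓡 d) (𝓡 d) (fun h : G ↦ g * h * g⁻¹) 1 ξ : EuclideanSpace ℝ (Fin d))

variable {M P} [IsManifold (𝓡 (n + d)) ∞ P]

/-- A smooth connection on a principal bundle: a smooth Lie algebra valued one-form on `P` that is
equivariant and reproduces the generators of the action. -/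
structure Connection (B : PrincipalBundle (n := n) (d := d) M G P) where
  /-- the connection form -/
  form : ∀ p : P, TangentSpace (𝓡 (n + d)) p →L[ℝ] GroupLieAlgebra (𝓡 d) G
  contMDiff_form : ContMDiff (M' := EuclideanSpace ℝ (Fin d)) (𝓡 (n + d)).tangent (𝓡 d) ∞
    (fun v : TangentBundle (𝓡 (n + d)) P ↦ (form v.proj v.snd : EuclideanSpace ℝ (Fin d)))
  equivariant : ∀ (p : P) (g : G) (v : TangentSpace (𝓡 (n + d)) p),
    form (B.act p g)
        (mfderiv (𝓡 (n + d)) (𝓡 (n + d)) (fun q : P ↦ B.act q g) p v) = Ad g⁻¹ (form p v)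
  vertical : ∀ (p : P) (ξ : GroupLieAlgebra (𝓡 d) G),
    form (B.act p 1) (mfderiv (𝓡 d) (𝓡 (n + d)) (fun g : G ↦ B.act p g) 1 ξ) = ξ

namespace Connection

variable {B : PrincipalBundle (n := n) (d := d) M G P} (A : Connection B)

/-- The coordinates `y` of the points that lie in the chart at `c` and in the domain of the local
gauge at `b`. -/
def localDom (_ : Connection B) (c b : M) : Set (EuclideanSpace ℝ (Fin n)) :=
  {y | y ∈ (chartAt (EuclideanSpace ℝ (Fin n)) c).target ∧
    (chartAt (EuclideanSpace ℝ (Fin n)) c).symm y ∈ B.dom b}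

/-- The components `A_μ` of the gauge potential, the pull-back of the connection form by the local
gauge at `b`, in the chart at `c`. -/
def potential (c b : M) (μ : Fin n) (y : EuclideanSpace ℝ (Fin n)) : GroupLieAlgebra (𝓡 d) G :=
  A.form (B.sec b ((chartAt (EuclideanSpace ℝ (Fin n)) c).symm y))
    (mfderiv (𝓡 n) (𝓡 (n + d))
      (fun z ↦ B.sec b ((chartAt (EuclideanSpace ℝ (Fin n)) c).symm z)) y
      (EuclideanSpace.single μ (1 : ℝ) : EuclideanSpace ℝ (Fin n)))

/-- The field strength `F_{μl} = ∂_μ A_l - ∂_l A_μ + [A_μ, A_l]`. -/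
def fieldStrength (c b : M) (μ l : Fin n) (y : EuclideanSpace ℝ (Fin n)) :
    GroupLieAlgebra (𝓡 d) G :=
  pd μ (A.potential c b l) y - pd l (A.potential c b μ) y
    + ⁅A.potential c b μ y, A.potential c b l y⁆

/-- The connection is flat: its field strength vanishes identically. -/
def IsFlat : Prop :=
  ∀ (c b : M), ∀ y ∈ A.localDom c b, ∀ μ l : Fin n, A.fieldStrength c b μ l y = 0

variable [RiemannianBundle (fun x : M ↦ TangentSpace (𝓡 n) x)]

/-- The full covariant derivative
`F_{μl;a} = ∂_a F_{μl} + [A_a, F_{μl}] - Γ^s_{aμ} F_{sl} - Γ^s_{al} F_{μs}`. -/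
def covDeriv (c b : M) (μ l a : Fin n) (y : EuclideanSpace ℝ (Fin n)) :
    GroupLieAlgebra (𝓡 d) G :=
  pd a (A.fieldStrength c b μ l) y + ⁅A.potential c b a y, A.fieldStrength c b μ l y⁆
    - ∑ s, christoffel c s a μ y • A.fieldStrength c b s l y
    - ∑ s, christoffel c s a l y • A.fieldStrength c b μ s y

/-- The Yang–Mills equation `F^a_{l;a} = g^{aμ} F_{μl;a} = 0`. -/
def IsYangMills : Prop :=
  ∀ (c b : M), ∀ y ∈ A.localDom c b, ∀ l : Fin n,
    ∑ a, ∑ μ, metricInv c y a μ • A.covDeriv c b μ l a y = 0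

variable [LieGroup (𝓡 d) ∞ G]

/-- The energy density `F² = -tr (ad F_{μl} ad F^{μl})` at `x`, computed in the chart at `x` and
the local gauge at `x`; the trace form is the Killing form of the Lie algebra. -/
def energyDensity (x : M) : ℝ :=
  ∑ μ, ∑ l, ∑ a, ∑ b,
    metricInv x (chartAt (EuclideanSpace ℝ (Fin n)) x x) μ a *
    metricInv x (chartAt (EuclideanSpace ℝ (Fin n)) x x) l b *
    -killingForm ℝ (GroupLieAlgebra (𝓡 d) G)
      (A.fieldStrength x x μ l (chartAt (EuclideanSpace ℝ (Fin n)) x x))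
      (A.fieldStrength x x a b (chartAt (EuclideanSpace ℝ (Fin n)) x x))

/-- `(∫_M |F|^{n/2})^{2/n}` with `|F| = √(F²)`, with values in `[0, ∞]`. -/
def energy [MeasurableSpace M] : ENNReal :=
  (∫⁻ x, ENNReal.ofReal (Real.sqrt (A.energyDensity x)) ^ ((n : ℝ) / 2) ∂(riemannianVolume n M))
    ^ (2 / (n : ℝ))

end Connection

end Bundles

end YangMills

end

/-! Let `e = |F|²`. The Bianchi identity, the Ricci identity and the Yang–Mills equation give a
Weitzenböck formula in which `Δe` equals `2|∇F|²`, plus a term in the curvature of `M`, plus a term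
cubic in `F`. The curvature hypothesis says that the second term is nonnegative on each component of
`F` in an orthonormal basis of the Lie algebra. The cubic term is at most `4 n³ e^(3/2)` in absolute
value, because the bracket has norm at most one with respect to minus the Killing form. Kato's
inequality `|∇e|² ≤ 4 e |∇F|²` turns the first term into `|∇e|² / (2a)` for any `a ≥ e`. The outcome
is `gradSq_div_sub_le_laplacian`.

Small energy then forces `e = 0`. Testing this inequality with `η² (e + δ)^(n/4 - 1)` and
integrating by parts leaves the gradient term with coefficient `(n/4 - 1) + 1/2 = (n - 2)/4`, which
is positive for `n ≥ 3` because of the `1/2` from Kato. Hence `u = η (e + δ)^(n/8)` satisfies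
`∫|du|² ≤ C₁ ∫|dη|² (e + δ)^(n/4) + C₂ ∫ u² √e` (`lintegral_cometric_le`). Hölder bounds the last
integral by the square of the `L^(2n/(n-2))` norm of `u` times the energy, so the Sobolev inequality
absorbs it when the energy is small (`sobolev_le`). With cutoffs of slope `1/R`, and `δ` small
depending on `R`, the other term tends to zero as `R → ∞` (`eq_zero_of_energy_le`).

Two kinds of preparation are needed. On the algebraic side, averaging over Haar measure gives an
`Ad`-invariant inner product, and semisimplicity then makes the Killing form negative definite, so
that `e` is a genuine squared norm. The density is defined at each point in the chart and gauge of
that very point; its smoothness rests on the transformation law of curvature, hence on the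
derivative of `Ad` and the Maurer–Cartan equation, both read off from the second derivative of the
multiplication at the identity. On the analytic side, the cutoffs are functions of the distance:
Hopf–Rinow makes their supports compact, and Rademacher's theorem allows integration by parts
against them. -/

noncomputable section

local notation "𝔼" n:max => EuclideanSpace ℝ (Fin n)

namespace YangMills

/-! ### Partial derivatives -/

section PartialDerivatives

variable {n : ℕ} {F : Type*} [NormedAddCommGroup F] [NormedSpace ℝ F]
  {F' : Type*} [NormedAddCommGroup F'] [NormedSpace ℝ F']

theorem differentiableAt_of_contDiffOn {U : Set (𝔼 n)} (hU : IsOpen U) {f : 𝔼 n → F} {y : 𝔼 n} (hy : y ∈ U)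
    (hf : ContDiffOn ℝ ∞ f U) : DifferentiableAt ℝ f y :=
  (hf.contDiffAt (hU.mem_nhds hy)).differentiableAt (by simp)

theorem contDiffOn_pd {U : Set (𝔼 n)} (hU : IsOpen U) {f : 𝔼 n → F} (hf : ContDiffOn ℝ ∞ f U)
    (i : Fin n) : ContDiffOn ℝ ∞ (pd i f) U :=
  (hf.fderiv_of_isOpen (m := ∞) hU (by simp)).clm_apply contDiffOn_const

theorem pd_add {f g : 𝔼 n → F} {y : 𝔼 n} (i : Fin n) (hf : DifferentiableAt ℝ f y)
    (hg : DifferentiableAt ℝ g y) : pd i (fun z ↦ f z + g z) y = pd i f y + pd i g y := by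
  simp [pd, fderiv_fun_add hf hg]

theorem pd_sub {f g : 𝔼 n → F} {y : 𝔼 n} (i : Fin n) (hf : DifferentiableAt ℝ f y)
    (hg : DifferentiableAt ℝ g y) : pd i (fun z ↦ f z - g z) y = pd i f y - pd i g y := by
  simp [pd, fderiv_fun_sub hf hg]

theorem pd_sum {ι : Type*} (s : Finset ι) {f : ι → 𝔼 n → F} {y : 𝔼 n} (i : Fin n)
    (hf : ∀ j ∈ s, DifferentiableAt ℝ (f j) y) :
    pd i (fun z ↦ ∑ j ∈ s, f j z) y = ∑ j ∈ s, pd i (f j) y := by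
  simp [pd, fderiv_fun_sum hf]

theorem pd_smul {f : 𝔼 n → ℝ} {g : 𝔼 n → F} {y : 𝔼 n} (i : Fin n) (hf : DifferentiableAt ℝ f y)
    (hg : DifferentiableAt ℝ g y) :
    pd i (fun z ↦ f z • g z) y = pd i f y • g y + f y • pd i g y := by
  simp [pd, fderiv_fun_smul hf hg, add_comm]

theorem pd_mul {f g : 𝔼 n → ℝ} {y : 𝔼 n} (i : Fin n) (hf : DifferentiableAt ℝ f y)
    (hg : DifferentiableAt ℝ g y) :
    pd i (fun z ↦ f z * g z) y = pd i f y * g y + f y * pd i g y := by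
  simpa using pd_smul i hf hg

theorem pd_bilin {F'' : Type*} [NormedAddCommGroup F''] [NormedSpace ℝ F'']
    (b : F →L[ℝ] F' →L[ℝ] F'') {f : 𝔼 n → F} {g : 𝔼 n → F'} {y : 𝔼 n} (i : Fin n)
    (hf : DifferentiableAt ℝ f y) (hg : DifferentiableAt ℝ g y) :
    pd i (fun z ↦ b (f z) (g z)) y = b (pd i f y) (g y) + b (f y) (pd i g y) := by
  have := (b.hasFDerivAt_of_bilinear hf.hasFDerivAt hg.hasFDerivAt).fderiv
  simp [pd, this, add_comm]

theorem pd_const (c : F) (i : Fin n) (y : 𝔼 n) : pd i (fun _ ↦ c) y = 0 := by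
  simp [pd]

theorem pd_const_mul {f : 𝔼 n → ℝ} {y : 𝔼 n} (c : ℝ) (i : Fin n) (hf : DifferentiableAt ℝ f y) :
    pd i (fun z ↦ c * f z) y = c * pd i f y := by
  simp [pd, fderiv_const_mul hf]

theorem pd_clm (L : F →L[ℝ] F') {f : 𝔼 n → F} {y : 𝔼 n} (i : Fin n)
    (hf : DifferentiableAt ℝ f y) : pd i (fun z ↦ L (f z)) y = L (pd i f y) := by
  have := (L.hasFDerivAt.comp y hf.hasFDerivAt).fderiv
  simp only [pd]
  change (fderiv ℝ (L ∘ f) y) _ = _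
  rw [this]; rfl

theorem pd_congr {U : Set (𝔼 n)} (hU : IsOpen U) {f g : 𝔼 n → F} {y : 𝔼 n} (hy : y ∈ U) (i : Fin n)
    (h : ∀ z ∈ U, f z = g z) : pd i f y = pd i g y := by
  simp only [pd]
  rw [Filter.EventuallyEq.fderiv_eq (Filter.eventuallyEq_of_mem (hU.mem_nhds hy) h)]

theorem pd_comm {U : Set (𝔼 n)} (hU : IsOpen U) {f : 𝔼 n → F} {y : 𝔼 n} (hy : y ∈ U)
    (hf : ContDiffOn ℝ ∞ f U) (i j : Fin n) : pd i (pd j f) y = pd j (pd i f) y := by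
  have h1 := hf.contDiffAt (hU.mem_nhds hy)
  have hd : DifferentiableAt ℝ (fderiv ℝ f) y :=
    (h1.fderiv_right (m := ∞) (by simp)).differentiableAt (by simp)
  have hs : IsSymmSndFDerivAt ℝ f y := h1.isSymmSndFDerivAt (by simp; norm_cast)
  have key : ∀ i j : Fin n, pd i (pd j f) y =
      fderiv ℝ (fderiv ℝ f) y (EuclideanSpace.single i 1) (EuclideanSpace.single j 1) := by
    intro i j
    have : HasFDerivAt (fun z ↦ fderiv ℝ f z (EuclideanSpace.single j 1))
        ((ContinuousLinearMap.apply ℝ F (EuclideanSpace.single j (1 : ℝ))).comp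
          (fderiv ℝ (fderiv ℝ f) y)) y :=
      (ContinuousLinearMap.apply ℝ F (EuclideanSpace.single j (1 : ℝ))).hasFDerivAt.comp y
        hd.hasFDerivAt
    change fderiv ℝ (fun z ↦ fderiv ℝ f z (EuclideanSpace.single j 1)) y _ = _
    rw [this.fderiv]; rfl
  rw [key, key, hs]

end PartialDerivatives

/-! ### The curvature of a connection on two-tensors with values in a Lie algebra -/

section Tensors

variable {n : ℕ} {V : Type*} [NormedAddCommGroup V] [InnerProductSpace ℝ V]
  (br : V →L[ℝ] V →L[ℝ] V)

/-- The action of `(X, M) ∈ V × 𝔤𝔩(n)` on `V`-valued covariant two-tensors. -/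
def tensorAct (X : V) (M : Matrix (Fin n) (Fin n) ℝ) (T : Fin n → Fin n → V) (i j : Fin n) : V :=
  br X (T i j) - ∑ s, M s i • T s j - ∑ s, M s j • T i s

theorem tensorAct_add (X : V) (M : Matrix (Fin n) (Fin n) ℝ) (S T : Fin n → Fin n → V)
    (i j : Fin n) : tensorAct br X M (fun i j ↦ S i j + T i j) i j
      = tensorAct br X M S i j + tensorAct br X M T i j := by
  simp only [tensorAct, map_add, smul_add, Finset.sum_add_distrib]
  abel

/-- The bracket part is a representation by the Jacobi identity. A matrix acts on each lower index
by minus its transpose, which again respects commutators. This is the algebraic core of the Ricci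
identity. -/
theorem tensorAct_commutator
    (hjac : ∀ x y z, br (br x y) z = br x (br y z) - br y (br x z))
    (X Y : V) (M N : Matrix (Fin n) (Fin n) ℝ)
    (T : Fin n → Fin n → V) (i j : Fin n) :
    tensorAct br X M (tensorAct br Y N T) i j - tensorAct br Y N (tensorAct br X M T) i j
      = tensorAct br (br X Y) (M * N - N * M) T i j := by
  have h1 : ∀ (M N : Matrix (Fin n) (Fin n) ℝ), ∑ s, M s i • ∑ t, N t s • T t j
      = ∑ s, (N * M) s i • T s j := by
    intro M N
    simp only [Finset.smul_sum, Matrix.mul_apply, Finset.sum_smul, smul_smul]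
    rw [Finset.sum_comm]
    exact Finset.sum_congr rfl fun _ _ ↦ Finset.sum_congr rfl fun _ _ ↦ by rw [mul_comm]
  have h2 : ∀ (M N : Matrix (Fin n) (Fin n) ℝ), ∑ s, M s j • ∑ t, N t s • T i t
      = ∑ s, (N * M) s j • T i s := by
    intro M N
    simp only [Finset.smul_sum, Matrix.mul_apply, Finset.sum_smul, smul_smul]
    rw [Finset.sum_comm]
    exact Finset.sum_congr rfl fun _ _ ↦ Finset.sum_congr rfl fun _ _ ↦ by rw [mul_comm]
  -- Terms with one matrix on each index do not depend on the order, so they cancel in the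
  -- commutator.
  have h3 : ∀ (M N : Matrix (Fin n) (Fin n) ℝ), ∑ s, M s i • ∑ t, N t j • T s t
      = ∑ s, N s j • ∑ t, M t i • T t s := by
    intro M N
    simp only [Finset.smul_sum, smul_smul]
    rw [Finset.sum_comm]
    exact Finset.sum_congr rfl fun _ _ ↦ Finset.sum_congr rfl fun _ _ ↦ by rw [mul_comm]
  simp only [tensorAct, map_sub, map_sum, map_smul, smul_sub, Finset.sum_sub_distrib, hjac,
    Matrix.sub_apply, sub_smul, h1, h2]
  rw [h3 M N, h3 N M]
  abel

variable (A : Fin n → 𝔼 n → V) (Γ : Fin n → 𝔼 n → Matrix (Fin n) (Fin n) ℝ)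

/-- The covariant derivative in the direction `k` of a two-tensor. -/
def tensorD (T : Fin n → Fin n → 𝔼 n → V) (k i j : Fin n) (y : 𝔼 n) : V :=
  pd k (T i j) y + tensorAct br (A k y) (Γ k y) (fun a b ↦ T a b y) i j

/-- The second covariant derivative of a two-tensor, first in the direction `k`, then `l`. -/
def tensorD₂ (T : Fin n → Fin n → 𝔼 n → V) (l k i j : Fin n) (y : 𝔼 n) : V :=
  pd l (tensorD br A Γ T k i j) y
    + tensorAct br (A l y) (Γ l y) (fun a b ↦ tensorD br A Γ T k a b y) i j
    - ∑ s, Γ l y s k • tensorD br A Γ T s i j y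

/-- The curvature of the connection `A`. -/
def curv (l k : Fin n) (y : 𝔼 n) : V :=
  pd l (A k) y - pd k (A l) y + br (A l y) (A k y)

/-- The curvature of the linear connection with coefficients `Γ`. -/
def linCurv (s i l k : Fin n) (y : 𝔼 n) : ℝ :=
  pd l (fun z ↦ Γ k z s i) y - pd k (fun z ↦ Γ l z s i) y
    + ∑ t, (Γ l y s t * Γ k y t i - Γ k y s t * Γ l y t i)

variable {A Γ} {U : Set (𝔼 n)}

theorem contDiffOn_tensorAct {A' : 𝔼 n → V} {Γ' : 𝔼 n → Matrix (Fin n) (Fin n) ℝ}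
    (hA : ContDiffOn ℝ ∞ A' U) (hΓ : ∀ s i, ContDiffOn ℝ ∞ (fun z ↦ Γ' z s i) U)
    {T : Fin n → Fin n → 𝔼 n → V}
    (hT : ∀ i j, ContDiffOn ℝ ∞ (T i j) U) (i j : Fin n) :
    ContDiffOn ℝ ∞ (fun z ↦ tensorAct br (A' z) (Γ' z) (fun a b ↦ T a b z) i j) U := by
  unfold tensorAct
  refine ((ContDiffOn.clm_apply (br.contDiff.comp_contDiffOn hA) (hT i j)).sub ?_).sub ?_
  · exact ContDiffOn.sum fun s _ ↦ (hΓ s i).smul (hT s j)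
  · exact ContDiffOn.sum fun s _ ↦ (hΓ s j).smul (hT i s)

theorem pd_tensorAct (hU : IsOpen U) {A' : 𝔼 n → V} {Γ' : 𝔼 n → Matrix (Fin n) (Fin n) ℝ}
    (hA : ContDiffOn ℝ ∞ A' U) (hΓ : ∀ s i, ContDiffOn ℝ ∞ (fun z ↦ Γ' z s i) U)
    {T : Fin n → Fin n → 𝔼 n → V}
    (hT : ∀ i j, ContDiffOn ℝ ∞ (T i j) U) (l i j : Fin n) {y : 𝔼 n} (hy : y ∈ U) :
    pd l (fun z ↦ tensorAct br (A' z) (Γ' z) (fun a b ↦ T a b z) i j) y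
      = tensorAct br (pd l A' y) (Matrix.of fun s i ↦ pd l (fun z ↦ Γ' z s i) y)
          (fun a b ↦ T a b y) i j
        + tensorAct br (A' y) (Γ' y) (fun a b ↦ pd l (T a b) y) i j := by
  have dA := differentiableAt_of_contDiffOn hU hy hA
  have dΓ := fun s i ↦ differentiableAt_of_contDiffOn hU hy (hΓ s i)
  have dT := fun s i ↦ differentiableAt_of_contDiffOn hU hy (hT s i)
  have d1 : DifferentiableAt ℝ (fun z ↦ br (A' z) (T i j z)) y :=
    ((br.differentiableAt).comp y dA).clm_apply (dT i j)
  have d2 : ∀ i j s, DifferentiableAt ℝ (fun z ↦ Γ' z s i • T s j z) y :=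
    fun i j s ↦ (dΓ s i).smul (dT s j)
  have d3 : ∀ i j s, DifferentiableAt ℝ (fun z ↦ Γ' z s j • T i s z) y :=
    fun i j s ↦ (dΓ s j).smul (dT i s)
  simp only [tensorAct]
  rw [pd_sub l (d1.fun_sub (DifferentiableAt.fun_sum fun s _ ↦ d2 i j s))
      (DifferentiableAt.fun_sum fun s _ ↦ d3 i j s),
    pd_sub l d1 (DifferentiableAt.fun_sum fun s _ ↦ d2 i j s),
    pd_sum _ l fun s _ ↦ d2 i j s, pd_sum _ l fun s _ ↦ d3 i j s, pd_bilin br l dA (dT i j)]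
  simp only [pd_smul l (dΓ _ _) (dT _ _), Finset.sum_add_distrib, Matrix.of_apply]
  abel

theorem contDiffOn_tensorD (hU : IsOpen U) (hA : ∀ k, ContDiffOn ℝ ∞ (A k) U)
    (hΓ : ∀ k s i, ContDiffOn ℝ ∞ (fun z ↦ Γ k z s i) U)
    {T : Fin n → Fin n → 𝔼 n → V}
    (hT : ∀ i j, ContDiffOn ℝ ∞ (T i j) U) (k i j : Fin n) :
    ContDiffOn ℝ ∞ (tensorD br A Γ T k i j) U :=
  (contDiffOn_pd hU (hT i j) k).add (contDiffOn_tensorAct br (hA k) (hΓ k) hT i j)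

/-- The Ricci identity: the commutator of second covariant derivatives is the curvature. -/
theorem tensorD₂_sub (hU : IsOpen U)
    (hjac : ∀ x y z, br (br x y) z = br x (br y z) - br y (br x z))
    (hA : ∀ k, ContDiffOn ℝ ∞ (A k) U)
    (hΓ : ∀ k s i, ContDiffOn ℝ ∞ (fun z ↦ Γ k z s i) U)
    (hsymm : ∀ y ∈ U, ∀ k s i, Γ k y s i = Γ i y s k)
    {T : Fin n → Fin n → 𝔼 n → V}
    (hT : ∀ i j, ContDiffOn ℝ ∞ (T i j) U) (l k i j : Fin n) {y : 𝔼 n} (hy : y ∈ U) :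
    tensorD₂ br A Γ T l k i j y - tensorD₂ br A Γ T k l i j y
      = br (curv br A l k y) (T i j y) - ∑ s, linCurv Γ s i l k y • T s j y
        - ∑ s, linCurv Γ s j l k y • T i s y := by
  -- The mixed terms, one coefficient times one derivative of `T`, are symmetric in `l` and `k` once
  -- those of `hact` are added, so only derivatives of the coefficients and their commutators
  -- survive.
  have hpd : ∀ l k, pd l (tensorD br A Γ T k i j) y = pd l (pd k (T i j)) y
      + (tensorAct br (pd l (A k) y) (Matrix.of fun s i ↦ pd l (fun z ↦ Γ k z s i) y)
          (fun a b ↦ T a b y) i j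
        + tensorAct br (A k y) (Γ k y) (fun a b ↦ pd l (T a b) y) i j) := by
    intro l k
    rw [← pd_tensorAct br hU (hA k) (hΓ k) hT l i j hy]
    exact pd_add l (differentiableAt_of_contDiffOn hU hy (contDiffOn_pd hU (hT i j) k))
      (differentiableAt_of_contDiffOn hU hy (contDiffOn_tensorAct br (hA k) (hΓ k) hT i j))
  have hact : ∀ l k, tensorAct br (A l y) (Γ l y) (fun a b ↦ tensorD br A Γ T k a b y) i j
      = tensorAct br (A l y) (Γ l y) (fun a b ↦ pd k (T a b) y) i j
        + tensorAct br (A l y) (Γ l y)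
          (tensorAct br (A k y) (Γ k y) (fun a b ↦ T a b y)) i j :=
    fun l k ↦ tensorAct_add br _ _ _ _ i j
  have hc := tensorAct_commutator br hjac (A l y) (A k y) (Γ l y) (Γ k y)
    (fun a b ↦ T a b y) i j
  -- Absence of torsion: the Christoffel term on the index of differentiation is the same in both
  -- orders.
  have hss : ∑ s, Γ l y s k • tensorD br A Γ T s i j y
      = ∑ s, Γ k y s l • tensorD br A Γ T s i j y :=
    Finset.sum_congr rfl fun s _ ↦ by rw [hsymm y hy]
  have hR : br (curv br A l k y) (T i j y) - ∑ s, linCurv Γ s i l k y • T s j y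
        - ∑ s, linCurv Γ s j l k y • T i s y
      = tensorAct br (pd l (A k) y) (Matrix.of fun s i ↦ pd l (fun z ↦ Γ k z s i) y)
          (fun a b ↦ T a b y) i j
        - tensorAct br (pd k (A l) y) (Matrix.of fun s i ↦ pd k (fun z ↦ Γ l z s i) y)
          (fun a b ↦ T a b y) i j
        + tensorAct br (br (A l y) (A k y)) (Γ l y * Γ k y - Γ k y * Γ l y)
          (fun a b ↦ T a b y) i j := by
    simp only [tensorAct, curv, linCurv, map_add, map_sub, add_smul, sub_smul,
      add_apply, sub_apply, Finset.sum_add_distrib,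
      Finset.sum_sub_distrib, Matrix.sub_apply, Matrix.mul_apply, Matrix.of_apply]
    abel
  rw [hR, ← hc]
  simp only [tensorD₂, hpd, hact, hss]
  rw [pd_comm hU hy (hT i j) l k]
  abel

end Tensors

end YangMills

namespace YangMills

/-! ### Derivatives of the inverse metric and of the volume density -/

section MetricCalculus

variable {n : ℕ} {U : Set (𝔼 n)} {g : 𝔼 n → Matrix (Fin n) (Fin n) ℝ}

theorem contDiffOn_det {m : ℕ} {h : 𝔼 n → Matrix (Fin m) (Fin m) ℝ}
    (hh : ∀ i j, ContDiffOn ℝ ∞ (fun z ↦ h z i j) U) :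
    ContDiffOn ℝ ∞ (fun z ↦ (h z).det) U := by
  simp only [Matrix.det_apply']
  exact ContDiffOn.sum fun σ _ ↦ contDiffOn_const.mul (contDiffOn_prod fun i _ ↦ hh _ _)

theorem contDiffOn_matrix_inv (hg : ∀ i j, ContDiffOn ℝ ∞ (fun z ↦ g z i j) U)
    (hdet : ∀ y ∈ U, (g y).det ≠ 0) (i j : Fin n) :
    ContDiffOn ℝ ∞ (fun z ↦ (g z)⁻¹ i j) U := by
  simp only [Matrix.inv_def, Ring.inverse_eq_inv', Matrix.smul_apply, smul_eq_mul,
    Matrix.adjugate_apply]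
  refine ((contDiffOn_det hg).inv hdet).mul (contDiffOn_det fun a b ↦ ?_)
  simp only [Matrix.updateRow_apply]
  split_ifs
  · exact contDiffOn_const
  · exact hg a b

/-- The connection matrices `(Γ_i)^s_j` of the Levi-Civita connection of the metric `g`. -/
def leviCivita (g : 𝔼 n → Matrix (Fin n) (Fin n) ℝ) (i : Fin n) (y : 𝔼 n) :
    Matrix (Fin n) (Fin n) ℝ :=
  Matrix.of fun s j ↦ (1 / 2) * ∑ l, (g y)⁻¹ s l *
    (pd i (fun z ↦ g z j l) y + pd j (fun z ↦ g z i l) y - pd l (fun z ↦ g z i j) y)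

/-- Smooth symmetric positive definite matrix functions. -/
structure IsMetricOn (g : 𝔼 n → Matrix (Fin n) (Fin n) ℝ) (U : Set (𝔼 n)) : Prop where
  isOpen : IsOpen U
  contDiffOn : ∀ i j, ContDiffOn ℝ ∞ (fun z ↦ g z i j) U
  posDef : ∀ y ∈ U, (g y).PosDef

namespace IsMetricOn

variable (hg : IsMetricOn g U)
include hg

theorem det_pos {y : 𝔼 n} (hy : y ∈ U) : 0 < (g y).det := (hg.posDef y hy).det_pos

theorem isUnit_det {y : 𝔼 n} (hy : y ∈ U) : IsUnit (g y).det := (hg.det_pos hy).ne'.isUnit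

theorem symm {y : 𝔼 n} (hy : y ∈ U) (i j : Fin n) : g y i j = g y j i := by
  have := (hg.posDef y hy).isHermitian.apply j i
  simpa using this

theorem transpose_eq {y : 𝔼 n} (hy : y ∈ U) : (g y).transpose = g y := by
  ext i j; exact hg.symm hy j i

theorem inv_transpose_eq {y : 𝔼 n} (hy : y ∈ U) : ((g y)⁻¹).transpose = (g y)⁻¹ := by
  rw [Matrix.transpose_nonsing_inv, hg.transpose_eq hy]

theorem inv_symm {y : 𝔼 n} (hy : y ∈ U) (i j : Fin n) : (g y)⁻¹ i j = (g y)⁻¹ j i :=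
  congrFun (congrFun (hg.inv_transpose_eq hy) j) i

theorem contDiffOn_inv (i j : Fin n) : ContDiffOn ℝ ∞ (fun z ↦ (g z)⁻¹ i j) U :=
  contDiffOn_matrix_inv hg.contDiffOn (fun _ hy ↦ (hg.det_pos hy).ne') i j

theorem contDiffOn_leviCivita (k s i : Fin n) :
    ContDiffOn ℝ ∞ (fun z ↦ leviCivita g k z s i) U := by
  simp only [leviCivita, Matrix.of_apply]
  refine contDiffOn_const.mul (ContDiffOn.sum fun l _ ↦ (hg.contDiffOn_inv s l).mul ?_)
  exact ((contDiffOn_pd hg.isOpen (hg.contDiffOn i l) k).add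
    (contDiffOn_pd hg.isOpen (hg.contDiffOn k l) i)).sub
    (contDiffOn_pd hg.isOpen (hg.contDiffOn k i) l)

theorem leviCivita_symm {y : 𝔼 n} (hy : y ∈ U) (k s i : Fin n) :
    leviCivita g k y s i = leviCivita g i y s k := by
  simp only [leviCivita, Matrix.of_apply]
  congr 1
  refine Finset.sum_congr rfl fun l _ ↦ ?_
  rw [pd_congr hg.isOpen hy l (fun z hz ↦ hg.symm hz k i)]
  ring

theorem mul_leviCivita {y : 𝔼 n} (hy : y ∈ U) (k i j : Fin n) :
    (g y * leviCivita g k y) i j = (1 / 2) * (pd k (fun z ↦ g z j i) y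
      + pd j (fun z ↦ g z k i) y - pd i (fun z ↦ g z k j) y) := by
  have h : leviCivita g k y = (1 / 2 : ℝ) • ((g y)⁻¹ * Matrix.of fun l j ↦
      (pd k (fun z ↦ g z j l) y + pd j (fun z ↦ g z k l) y - pd l (fun z ↦ g z k j) y)) := by
    ext s j
    simp [leviCivita, Matrix.mul_apply]
  rw [h, Matrix.mul_smul, ← Matrix.mul_assoc, Matrix.mul_nonsing_inv _ (hg.isUnit_det hy),
    Matrix.one_mul]
  simp

/-- Metric compatibility. With its upper index lowered, `Γ_k` is half of `∂_k g` plus a part skew in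
`i, j`, and the skew part cancels against the transpose. -/
theorem pd_eq {y : 𝔼 n} (hy : y ∈ U) (k : Fin n) :
    (Matrix.of fun i j ↦ pd k (fun z ↦ g z i j) y)
      = g y * leviCivita g k y + (leviCivita g k y).transpose * g y := by
  have h : (leviCivita g k y).transpose * g y = (g y * leviCivita g k y).transpose := by
    rw [Matrix.transpose_mul, hg.transpose_eq hy]
  ext i j
  rw [h, Matrix.add_apply, Matrix.transpose_apply, hg.mul_leviCivita hy, hg.mul_leviCivita hy,
    pd_congr hg.isOpen hy k (fun z hz ↦ hg.symm hz j i), Matrix.of_apply]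
  ring

/-- This is `g⁻¹ g = 1` differentiated, with `pd_eq` inserted. -/
theorem pd_inv {y : 𝔼 n} (hy : y ∈ U) (k : Fin n) :
    (Matrix.of fun i j ↦ pd k (fun z ↦ (g z)⁻¹ i j) y)
      = -(leviCivita g k y * (g y)⁻¹) - (g y)⁻¹ * (leviCivita g k y).transpose := by
  have h1 : (Matrix.of fun i j ↦ pd k (fun z ↦ (g z)⁻¹ i j) y) * g y
      + (g y)⁻¹ * (Matrix.of fun i j ↦ pd k (fun z ↦ g z i j) y) = 0 := by
    ext i j
    have d1 := fun l ↦ differentiableAt_of_contDiffOn hg.isOpen hy (hg.contDiffOn_inv i l)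
    have d2 := fun l ↦ differentiableAt_of_contDiffOn hg.isOpen hy (hg.contDiffOn l j)
    have h2 : pd k (fun z ↦ ∑ l, (g z)⁻¹ i l * g z l j) y = 0 := by
      rw [pd_congr hg.isOpen hy k (g := fun _ ↦ (1 : Matrix (Fin n) (Fin n) ℝ) i j), pd_const]
      intro z hz
      rw [← Matrix.mul_apply, Matrix.nonsing_inv_mul _ (hg.isUnit_det hz)]
    rw [pd_sum _ _ fun l _ ↦ (d1 l).fun_mul (d2 l)] at h2
    simp only [pd_mul k (d1 _) (d2 _), Finset.sum_add_distrib] at h2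
    simpa [Matrix.mul_apply] using h2
  have h3 := congrArg (· * (g y)⁻¹) h1
  simp only [add_mul, zero_mul] at h3
  rw [Matrix.mul_assoc, Matrix.mul_nonsing_inv _ (hg.isUnit_det hy), Matrix.mul_one,
    hg.pd_eq hy k] at h3
  rw [eq_neg_of_add_eq_zero_left h3, Matrix.mul_add, Matrix.add_mul, ← Matrix.mul_assoc,
    Matrix.nonsing_inv_mul _ (hg.isUnit_det hy), Matrix.one_mul,
    Matrix.mul_assoc ((g y)⁻¹), Matrix.mul_assoc _ (g y),
    Matrix.mul_nonsing_inv _ (hg.isUnit_det hy), Matrix.mul_one]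
  abel

end IsMetricOn

/-- Jacobi's formula for the derivative of a determinant. -/
theorem pd_det {m : ℕ} {h : 𝔼 n → Matrix (Fin m) (Fin m) ℝ} {y : 𝔼 n}
    (hh : ∀ i j, DifferentiableAt ℝ (fun z ↦ h z i j) y) (k : Fin n) :
    pd k (fun z ↦ (h z).det) y
      = ((h y).adjugate * Matrix.of fun i j ↦ pd k (fun z ↦ h z i j) y).trace := by
  -- By Cramer's rule the trace is a sum of determinants with one column differentiated, which is
  -- what the Leibniz expansion produces.
  have h1 : ((h y).adjugate * Matrix.of fun i j ↦ pd k (fun z ↦ h z i j) y).trace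
      = ∑ i, ((h y).updateCol i (fun j ↦ pd k (fun z ↦ h z j i) y)).det := by
    simp only [Matrix.trace, Matrix.diag_apply]
    refine Finset.sum_congr rfl fun i _ ↦ ?_
    rw [← Matrix.cramer_apply, Matrix.cramer_eq_adjugate_mulVec]
    simp [Matrix.mul_apply, Matrix.mulVec, dotProduct]
  have hd : HasFDerivAt (fun z ↦ (h z).det) (∑ σ : Equiv.Perm (Fin m),
      ((Equiv.Perm.sign σ : ℤ) : ℝ) • ∑ i, (∏ j ∈ Finset.univ.erase i, h y (σ j) j) •
        fderiv ℝ (fun z ↦ h z (σ i) i) y) y := by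
    simp only [Matrix.det_apply']
    refine HasFDerivAt.fun_sum fun σ _ ↦ HasFDerivAt.const_mul ?_ _
    exact HasFDerivAt.finsetProd fun i _ ↦ (hh (σ i) i).hasFDerivAt
  rw [h1, pd, hd.fderiv]
  simp only [pd, sum_apply, smul_apply, Matrix.det_apply', smul_eq_mul]
  rw [Finset.sum_comm]
  refine Finset.sum_congr rfl fun σ _ ↦ ?_
  rw [Finset.mul_sum]
  refine Finset.sum_congr rfl fun i _ ↦ ?_
  rw [← Finset.mul_prod_erase _ _ (Finset.mem_univ i), Matrix.updateCol_self]
  rw [Finset.prod_congr rfl fun j hj ↦ Matrix.updateCol_ne (Finset.ne_of_mem_erase hj)]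
  ring

/-- Jacobi's formula gives `½ tr (g⁻¹ ∂_k g)` for the logarithmic derivative of the density, and by
metric compatibility each of the two summands of `∂_k g` contributes `tr Γ_k`. -/
theorem IsMetricOn.pd_sqrt_det (hg : IsMetricOn g U) {y : 𝔼 n} (hy : y ∈ U) (k : Fin n) :
    pd k (fun z ↦ Real.sqrt (g z).det) y
      = Real.sqrt (g y).det * (leviCivita g k y).trace := by
  have hd : DifferentiableAt ℝ (fun z ↦ (g z).det) y :=
    differentiableAt_of_contDiffOn hg.isOpen hy (contDiffOn_det hg.contDiffOn)
  have h1 : pd k (fun z ↦ (g z).det) y = 2 * (g y).det * (leviCivita g k y).trace := by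
    have hadj : (g y).adjugate = (g y).det • (g y)⁻¹ := by
      rw [Matrix.inv_def, smul_smul, Ring.mul_inverse_cancel _ (hg.isUnit_det hy), one_smul]
    rw [pd_det (fun i j ↦ differentiableAt_of_contDiffOn hg.isOpen hy (hg.contDiffOn i j)),
      hg.pd_eq hy, hadj, Matrix.smul_mul, Matrix.trace_smul, Matrix.mul_add, Matrix.trace_add,
      ← Matrix.mul_assoc, Matrix.nonsing_inv_mul _ (hg.isUnit_det hy), Matrix.one_mul,
      Matrix.trace_mul_comm, Matrix.mul_assoc, Matrix.mul_nonsing_inv _ (hg.isUnit_det hy),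
      Matrix.mul_one, Matrix.trace_transpose, smul_eq_mul]
    ring
  have h2 := (hd.hasFDerivAt.sqrt (hg.det_pos hy).ne').fderiv
  have h3 : Real.sqrt (g y).det * Real.sqrt (g y).det = (g y).det :=
    Real.mul_self_sqrt (hg.det_pos hy).le
  have h4 : 0 < Real.sqrt (g y).det := Real.sqrt_pos.2 (hg.det_pos hy)
  simp only [pd] at h1 ⊢
  rw [h2, smul_apply, h1, smul_eq_mul]
  field_simp
  rw [pow_two, h3]

/-- The Laplace-Beltrami operator of the metric `g`. -/
def laplacian (g : 𝔼 n → Matrix (Fin n) (Fin n) ℝ) (f : 𝔼 n → ℝ) (y : 𝔼 n) : ℝ :=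
  ∑ k, ∑ l, (g y)⁻¹ k l * (pd k (pd l f) y - ∑ s, leviCivita g k y s l * pd s f y)

/-- The Laplace-Beltrami operator in divergence form. -/
theorem IsMetricOn.sum_pd_sqrt_det_mul (hg : IsMetricOn g U) {f : 𝔼 n → ℝ}
    (hf : ContDiffOn ℝ ∞ f U) {y : 𝔼 n} (hy : y ∈ U) :
    ∑ k, pd k (fun z ↦ Real.sqrt (g z).det * ∑ l, (g z)⁻¹ k l * pd l f z) y
      = Real.sqrt (g y).det * laplacian g f y := by
  have hd : DifferentiableAt ℝ (fun z ↦ Real.sqrt (g z).det) y :=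
    (differentiableAt_of_contDiffOn hg.isOpen hy (contDiffOn_det hg.contDiffOn)).sqrt
      (hg.det_pos hy).ne'
  have dI := fun k l ↦ differentiableAt_of_contDiffOn hg.isOpen hy (hg.contDiffOn_inv k l)
  have df := fun l ↦ differentiableAt_of_contDiffOn hg.isOpen hy (contDiffOn_pd hg.isOpen hf l)
  have hI : ∀ k i j, pd k (fun z ↦ (g z)⁻¹ i j) y = -(∑ s, leviCivita g k y i s * (g y)⁻¹ s j)
      - ∑ s, (g y)⁻¹ i s * leviCivita g k y j s := by
    intro k i j
    have := congrFun (congrFun (hg.pd_inv hy k) i) j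
    simpa [Matrix.mul_apply] using this
  have h1 : ∀ k, pd k (fun z ↦ Real.sqrt (g z).det * ∑ l, (g z)⁻¹ k l * pd l f z) y
      = Real.sqrt (g y).det * ((leviCivita g k y).trace * (∑ l, (g y)⁻¹ k l * pd l f y)
        + ∑ l, (pd k (fun z ↦ (g z)⁻¹ k l) y * pd l f y + (g y)⁻¹ k l * pd k (pd l f) y)) := by
    intro k
    rw [pd_mul k hd (DifferentiableAt.fun_sum fun l _ ↦ (dI k l).fun_mul (df l)),
      hg.pd_sqrt_det hy, pd_sum _ _ fun l _ ↦ (dI k l).fun_mul (df l)]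
    simp only [pd_mul k (dI _ _) (df _)]
    ring
  simp only [h1, ← Finset.mul_sum, laplacian]
  congr 1
  simp only [Finset.sum_add_distrib, hI, sub_mul, neg_mul, mul_sub, Finset.sum_sub_distrib,
    Finset.sum_neg_distrib, Matrix.trace, Matrix.diag_apply]
  -- The derivative of the density cancels one of the two Christoffel terms of `∂g⁻¹`; the symmetry
  -- of `Γ` identifies the two contractions. The other Christoffel term is the one in the Hessian.
  have h2 : ∑ k, ∑ l, (∑ s, leviCivita g k y k s * (g y)⁻¹ s l) * pd l f y
      = ∑ k, (∑ s, leviCivita g k y s s) * ∑ l, (g y)⁻¹ k l * pd l f y := by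
    simp only [Finset.sum_mul, Finset.mul_sum]
    rw [Finset.sum_congr rfl fun k _ ↦ Finset.sum_comm, Finset.sum_comm]
    refine Finset.sum_congr rfl fun k _ ↦ ?_
    rw [Finset.sum_comm]
    refine Finset.sum_congr rfl fun l _ ↦ Finset.sum_congr rfl fun s _ ↦ ?_
    rw [hg.leviCivita_symm hy s s k]
    ring
  have h3 : ∑ k, ∑ l, (∑ s, (g y)⁻¹ k s * leviCivita g k y l s) * pd l f y
      = ∑ k, ∑ l, (g y)⁻¹ k l * ∑ s, leviCivita g k y s l * pd s f y := by
    simp only [Finset.sum_mul, Finset.mul_sum]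
    refine Finset.sum_congr rfl fun k _ ↦ ?_
    rw [Finset.sum_comm]
    refine Finset.sum_congr rfl fun l _ ↦ Finset.sum_congr rfl fun s _ ↦ by ring
  rw [h2, h3]
  ring

end MetricCalculus

end YangMills

namespace YangMills

/-! ### Contraction of two-tensors -/

section Pairing

variable {n : ℕ} {V : Type*} [NormedAddCommGroup V] [InnerProductSpace ℝ V]

/-- The contraction `M^{ia} N^{jb} ⟨S_{ij}, T_{ab}⟩`. -/
def pairing (M N : Matrix (Fin n) (Fin n) ℝ) (S T : Fin n → Fin n → V) : ℝ :=
  ∑ i, ∑ a, M i a * ∑ j, ∑ b, N j b * inner ℝ (S i j) (T a b)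

variable (M N : Matrix (Fin n) (Fin n) ℝ) (S S' T T' : Fin n → Fin n → V)

theorem pairing_swap : pairing M N S T = pairing N M (fun i j ↦ S j i) (fun i j ↦ T j i) := by
  simp only [pairing, Finset.mul_sum]
  rw [Finset.sum_congr rfl fun i _ ↦ Finset.sum_comm, Finset.sum_comm]
  refine Finset.sum_congr rfl fun j _ ↦ ?_
  rw [Finset.sum_congr rfl fun i _ ↦ Finset.sum_comm, Finset.sum_comm]
  exact Finset.sum_congr rfl fun _ _ ↦ Finset.sum_congr rfl fun _ _ ↦
    Finset.sum_congr rfl fun _ _ ↦ by ring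

theorem pairing_comm : pairing M N S T = pairing M.transpose N.transpose T S := by
  simp only [pairing, Matrix.transpose_apply]
  rw [Finset.sum_comm]
  refine Finset.sum_congr rfl fun i _ ↦ Finset.sum_congr rfl fun a _ ↦ ?_
  rw [Finset.sum_comm]
  refine congrArg _ (Finset.sum_congr rfl fun _ _ ↦ Finset.sum_congr rfl fun _ _ ↦ ?_)
  rw [real_inner_comm]

theorem pairing_add_left : pairing M N (fun i j ↦ S i j + S' i j) T
    = pairing M N S T + pairing M N S' T := by
  simp only [pairing, inner_add_left, mul_add, Finset.sum_add_distrib]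

theorem pairing_sub_left : pairing M N (fun i j ↦ S i j - S' i j) T
    = pairing M N S T - pairing M N S' T := by
  simp only [pairing, inner_sub_left, mul_sub, Finset.sum_sub_distrib]

theorem pairing_add_right : pairing M N S (fun i j ↦ T i j + T' i j)
    = pairing M N S T + pairing M N S T' := by
  simp only [pairing, inner_add_right, mul_add, Finset.sum_add_distrib]

theorem pairing_sub_right : pairing M N S (fun i j ↦ T i j - T' i j)
    = pairing M N S T - pairing M N S T' := by
  simp only [pairing, inner_sub_right, mul_sub, Finset.sum_sub_distrib]

theorem pairing_smul_left (c : ℝ) : pairing M N (fun i j ↦ c • S i j) T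
    = c * pairing M N S T := by
  simp only [pairing, real_inner_smul_left, Finset.mul_sum]
  exact Finset.sum_congr rfl fun _ _ ↦ Finset.sum_congr rfl fun _ _ ↦
    Finset.sum_congr rfl fun _ _ ↦ Finset.sum_congr rfl fun _ _ ↦ by ring

theorem pairing_sum_smul_left {ι : Type*} (s : Finset ι) (c : ι → ℝ)
    (S : ι → Fin n → Fin n → V) :
    pairing M N (fun i j ↦ ∑ k ∈ s, c k • S k i j) T = ∑ k ∈ s, c k * pairing M N (S k) T := by
  let L : (Fin n → Fin n → V) →ₗ[ℝ] ℝ :=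
    { toFun := fun S ↦ pairing M N S T
      map_add' := fun S S' ↦ pairing_add_left M N S S' T
      map_smul' := fun c S ↦ pairing_smul_left M N S T c }
  have h := map_sum L (fun k ↦ c k • S k) s
  simp only [map_smul] at h
  refine Eq.trans (congrArg L ?_) h
  ext i j
  simp

theorem pairing_neg_sub (M' M'' : Matrix (Fin n) (Fin n) ℝ) :
    pairing (-M' - M'') N S T = -pairing M' N S T - pairing M'' N S T := by
  simp only [pairing, Matrix.sub_apply, Matrix.neg_apply, sub_mul, neg_mul,
    Finset.sum_sub_distrib, Finset.sum_neg_distrib]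

/-- Regrouping of sums. It carries a Christoffel matrix from the inverse metric over to the tensor,
which is how `∂g⁻¹` completes `∂T` to `∇T`. -/
theorem pairing_mul_left (Γ : Matrix (Fin n) (Fin n) ℝ) :
    pairing (Γ * M) N S T = pairing M N (fun i j ↦ ∑ s, Γ s i • S s j) T := by
  have h : ∀ i a, ∑ j, ∑ b, N j b * inner ℝ (∑ s, Γ s i • S s j) (T a b)
      = ∑ s, Γ s i * ∑ j, ∑ b, N j b * inner ℝ (S s j) (T a b) := by
    intro i a
    simp only [sum_inner, real_inner_smul_left, Finset.mul_sum]
    rw [Finset.sum_congr rfl fun i _ ↦ Finset.sum_comm, Finset.sum_comm]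
    exact Finset.sum_congr rfl fun _ _ ↦ Finset.sum_congr rfl fun _ _ ↦
      Finset.sum_congr rfl fun _ _ ↦ by ring
  simp only [pairing, h]
  suffices H : ∀ q : Fin n → Fin n → ℝ, ∑ i, ∑ a, (Γ * M) i a * q i a
      = ∑ i, ∑ a, M i a * ∑ s, Γ s i * q s a from H _
  intro q
  simp only [Matrix.mul_apply, Finset.sum_mul, Finset.mul_sum]
  rw [Finset.sum_congr rfl fun i _ ↦ Finset.sum_comm, Finset.sum_comm]
  refine Finset.sum_congr rfl fun i _ ↦ ?_
  rw [Finset.sum_comm]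
  exact Finset.sum_congr rfl fun _ _ ↦ Finset.sum_congr rfl fun _ _ ↦ by ring

theorem pairing_mul_right (Γ : Matrix (Fin n) (Fin n) ℝ) :
    pairing (M * Γ.transpose) N S T = pairing M N S (fun i j ↦ ∑ s, Γ s i • T s j) := by
  rw [pairing_comm, Matrix.transpose_mul, Matrix.transpose_transpose, pairing_mul_left,
    pairing_comm]
  simp

/-- With respect to a square root of the metric the contraction is a sum of inner products. -/
theorem pairing_eq_sum_inner {B : Matrix (Fin n) (Fin n) ℝ} (hB : M = B.transpose * B) :
    pairing M M S T = ∑ p, ∑ q, inner ℝ (∑ i, ∑ j, (B p i * B q j) • S i j)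
      (∑ i, ∑ j, (B p i * B q j) • T i j) := by
  subst hB
  have h : ∀ p q, inner ℝ (∑ i, ∑ j, (B p i * B q j) • S i j)
      (∑ i, ∑ j, (B p i * B q j) • T i j)
      = ∑ i, ∑ a, ∑ j, ∑ b, B p i * B p a * (B q j * B q b * inner ℝ (S i j) (T a b)) := by
    intro p q
    rw [real_inner_comm]
    simp only [sum_inner, inner_sum, real_inner_smul_left, real_inner_smul_right]
    refine Finset.sum_congr rfl fun i _ ↦ ?_
    rw [Finset.sum_comm]
    refine Finset.sum_congr rfl fun a _ ↦ Finset.sum_congr rfl fun j _ ↦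
      Finset.sum_congr rfl fun b _ ↦ ?_
    rw [real_inner_comm]
    ring
  simp only [h, pairing, Matrix.mul_apply, Matrix.transpose_apply, Finset.mul_sum, Finset.sum_mul]
  symm
  rw [Finset.sum_congr rfl fun p _ ↦ Finset.sum_comm, Finset.sum_comm]
  refine Finset.sum_congr rfl fun i _ ↦ ?_
  rw [Finset.sum_congr rfl fun p _ ↦ Finset.sum_comm, Finset.sum_comm]
  refine Finset.sum_congr rfl fun a _ ↦ ?_
  rw [Finset.sum_congr rfl fun p _ ↦ Finset.sum_comm, Finset.sum_comm]
  refine Finset.sum_congr rfl fun j _ ↦ ?_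
  rw [Finset.sum_congr rfl fun p _ ↦ Finset.sum_comm, Finset.sum_comm]
  refine Finset.sum_congr rfl fun b _ ↦ ?_
  rw [Finset.sum_comm]

end Pairing

/-! ### Derivatives of contractions -/

section Laplacian

variable {n : ℕ} {V : Type*} [NormedAddCommGroup V] [InnerProductSpace ℝ V]
  (br : V →L[ℝ] V →L[ℝ] V) {U : Set (𝔼 n)} {g : 𝔼 n → Matrix (Fin n) (Fin n) ℝ}
  {A : Fin n → 𝔼 n → V} {S T : Fin n → Fin n → 𝔼 n → V}

theorem contDiffOn_pairing (hg : IsMetricOn g U) (hS : ∀ i j, ContDiffOn ℝ ∞ (S i j) U)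
    (hT : ∀ i j, ContDiffOn ℝ ∞ (T i j) U) :
    ContDiffOn ℝ ∞ (fun z ↦ pairing (g z)⁻¹ (g z)⁻¹ (fun i j ↦ S i j z) (fun i j ↦ T i j z)) U := by
  simp only [pairing]
  exact ContDiffOn.sum fun i _ ↦ ContDiffOn.sum fun a _ ↦ (hg.contDiffOn_inv i a).mul
    (ContDiffOn.sum fun j _ ↦ ContDiffOn.sum fun b _ ↦ (hg.contDiffOn_inv j b).mul
      ((hS i j).inner ℝ (hT a b)))

/-- The Levi-Civita connection and an ad-invariant inner product are compatible with
contractions. -/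
theorem pd_pairing (hg : IsMetricOn g U)
    (hinv : ∀ x y z : V, inner ℝ (br x y) z = -inner ℝ y (br x z))
    (hS : ∀ i j, ContDiffOn ℝ ∞ (S i j) U) (hT : ∀ i j, ContDiffOn ℝ ∞ (T i j) U)
    (k : Fin n) {y : 𝔼 n} (hy : y ∈ U) :
    pd k (fun z ↦ pairing (g z)⁻¹ (g z)⁻¹ (fun i j ↦ S i j z) (fun i j ↦ T i j z)) y
      = pairing (g y)⁻¹ (g y)⁻¹ (fun i j ↦ tensorD br A (leviCivita g) S k i j y)
          (fun i j ↦ T i j y)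
        + pairing (g y)⁻¹ (g y)⁻¹ (fun i j ↦ S i j y)
          (fun i j ↦ tensorD br A (leviCivita g) T k i j y) := by
  have dI := fun i j ↦ differentiableAt_of_contDiffOn hg.isOpen hy (hg.contDiffOn_inv i j)
  have dS := fun i j ↦ differentiableAt_of_contDiffOn hg.isOpen hy (hS i j)
  have dT := fun i j ↦ differentiableAt_of_contDiffOn hg.isOpen hy (hT i j)
  have hin : ∀ i j a b, pd k (fun z ↦ inner ℝ (S i j z) (T a b z)) y
      = inner ℝ (pd k (S i j) y) (T a b y) + inner ℝ (S i j y) (pd k (T a b) y) :=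
    fun i j a b ↦ pd_bilin (innerSL ℝ) k (dS i j) (dT a b)
  have d1 : ∀ i j a b, DifferentiableAt ℝ
      (fun z ↦ (g z)⁻¹ j b * inner ℝ (S i j z) (T a b z)) y :=
    fun i j a b ↦ (dI j b).fun_mul ((dS i j).inner ℝ (dT a b))
  have d2 : ∀ i j a, DifferentiableAt ℝ
      (fun z ↦ ∑ b, (g z)⁻¹ j b * inner ℝ (S i j z) (T a b z)) y :=
    fun i j a ↦ DifferentiableAt.fun_sum fun b _ ↦ d1 i j a b
  have d3 : ∀ i a, DifferentiableAt ℝ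
      (fun z ↦ ∑ j, ∑ b, (g z)⁻¹ j b * inner ℝ (S i j z) (T a b z)) y :=
    fun i a ↦ DifferentiableAt.fun_sum fun j _ ↦ d2 i j a
  have d4 : ∀ i a, DifferentiableAt ℝ
      (fun z ↦ (g z)⁻¹ i a * ∑ j, ∑ b, (g z)⁻¹ j b * inner ℝ (S i j z) (T a b z)) y :=
    fun i a ↦ (dI i a).fun_mul (d3 i a)
  set D : Matrix (Fin n) (Fin n) ℝ := Matrix.of fun i j ↦ pd k (fun z ↦ (g z)⁻¹ i j) y with hD
  have h1 : pd k (fun z ↦ pairing (g z)⁻¹ (g z)⁻¹ (fun i j ↦ S i j z) (fun i j ↦ T i j z)) y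
      = pairing D (g y)⁻¹ (fun i j ↦ S i j y) (fun i j ↦ T i j y)
        + pairing (g y)⁻¹ D (fun i j ↦ S i j y) (fun i j ↦ T i j y)
        + pairing (g y)⁻¹ (g y)⁻¹ (fun i j ↦ pd k (S i j) y) (fun i j ↦ T i j y)
        + pairing (g y)⁻¹ (g y)⁻¹ (fun i j ↦ S i j y) (fun i j ↦ pd k (T i j) y) := by
    simp only [pairing]
    rw [pd_sum _ _ fun i _ ↦ DifferentiableAt.fun_sum fun a _ ↦ d4 i a]
    simp only [← Finset.sum_add_distrib]
    refine Finset.sum_congr rfl fun i _ ↦ ?_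
    rw [pd_sum _ _ fun a _ ↦ d4 i a]
    refine Finset.sum_congr rfl fun a _ ↦ ?_
    rw [pd_mul k (dI i a) (d3 i a), pd_sum _ _ fun j _ ↦ d2 i j a]
    simp only [pd_sum Finset.univ k fun b _ ↦ d1 i _ a b,
      pd_mul k (dI _ _) ((dS _ _).inner ℝ (dT _ _)), hin, hD, Matrix.of_apply, mul_add,
      Finset.sum_add_distrib]
    ring
  -- The derivative of the first factor `g⁻¹` supplies exactly the Christoffel terms on the first
  -- index of both covariant derivatives; `h3` does the same for the second index.
  have h2 : ∀ S T : Fin n → Fin n → V, pairing D (g y)⁻¹ S T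
      = - pairing (g y)⁻¹ (g y)⁻¹ (fun i j ↦ ∑ s, leviCivita g k y s i • S s j) T
        - pairing (g y)⁻¹ (g y)⁻¹ S (fun i j ↦ ∑ s, leviCivita g k y s i • T s j) := by
    intro S T
    rw [hD, hg.pd_inv hy, pairing_neg_sub, pairing_mul_left, pairing_mul_right]
  have h3 : ∀ S T : Fin n → Fin n → V, pairing (g y)⁻¹ D S T
      = - pairing (g y)⁻¹ (g y)⁻¹ (fun i j ↦ ∑ s, leviCivita g k y s j • S i s) T
        - pairing (g y)⁻¹ (g y)⁻¹ S (fun i j ↦ ∑ s, leviCivita g k y s j • T i s) := by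
    intro S T
    rw [pairing_swap, h2, pairing_swap, pairing_swap _ _ (fun i j ↦ S j i)]
  -- The bracket terms of the two covariant derivatives cancel because the inner product is
  -- ad-invariant.
  have h4 : pairing (g y)⁻¹ (g y)⁻¹ (fun i j ↦ br (A k y) (S i j y)) (fun i j ↦ T i j y)
      + pairing (g y)⁻¹ (g y)⁻¹ (fun i j ↦ S i j y) (fun i j ↦ br (A k y) (T i j y)) = 0 := by
    simp only [pairing, hinv, mul_neg, Finset.sum_neg_distrib]
    ring
  rw [h1, h2, h3]
  simp only [tensorD, tensorAct]
  rw [pairing_add_left, pairing_sub_left, pairing_sub_left, pairing_add_right, pairing_sub_right,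
    pairing_sub_right]
  linarith

/-- The Bochner formula for the squared norm of a two-tensor. -/
theorem laplacian_pairing_self (hg : IsMetricOn g U)
    (hinv : ∀ x y z : V, inner ℝ (br x y) z = -inner ℝ y (br x z))
    (hA : ∀ k, ContDiffOn ℝ ∞ (A k) U) (hT : ∀ i j, ContDiffOn ℝ ∞ (T i j) U)
    {y : 𝔼 n} (hy : y ∈ U) :
    laplacian g (fun z ↦ pairing (g z)⁻¹ (g z)⁻¹ (fun i j ↦ T i j z) (fun i j ↦ T i j z)) y
      = 2 * (pairing (g y)⁻¹ (g y)⁻¹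
          (fun i j ↦ ∑ k, ∑ l, (g y)⁻¹ k l • tensorD₂ br A (leviCivita g) T k l i j y)
          (fun i j ↦ T i j y)
        + ∑ k, ∑ l, (g y)⁻¹ k l * pairing (g y)⁻¹ (g y)⁻¹
          (fun i j ↦ tensorD br A (leviCivita g) T k i j y)
          (fun i j ↦ tensorD br A (leviCivita g) T l i j y)) := by
  have hTT := fun k i j ↦ contDiffOn_tensorD br hg.isOpen hA hg.contDiffOn_leviCivita hT k i j
  have hc : ∀ {y : 𝔼 n}, y ∈ U → ∀ S T : Fin n → Fin n → V,
      pairing (g y)⁻¹ (g y)⁻¹ S T = pairing (g y)⁻¹ (g y)⁻¹ T S := by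
    intro y hy S T
    rw [pairing_comm, hg.inv_transpose_eq hy]
  have h1 : ∀ l, ∀ z ∈ U, pd l (fun z ↦ pairing (g z)⁻¹ (g z)⁻¹ (fun i j ↦ T i j z)
      (fun i j ↦ T i j z)) z = 2 * pairing (g z)⁻¹ (g z)⁻¹
        (fun i j ↦ tensorD br A (leviCivita g) T l i j z) (fun i j ↦ T i j z) := by
    intro l z hz
    rw [pd_pairing br (A := A) hg hinv hT hT l hz, hc hz (fun i j ↦ T i j z)]
    ring
  have h2 : ∀ k l, pd k (pd l (fun z ↦ pairing (g z)⁻¹ (g z)⁻¹ (fun i j ↦ T i j z)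
      (fun i j ↦ T i j z))) y = 2 * (pairing (g y)⁻¹ (g y)⁻¹
        (fun i j ↦ tensorD br A (leviCivita g) (tensorD br A (leviCivita g) T l) k i j y)
        (fun i j ↦ T i j y) + pairing (g y)⁻¹ (g y)⁻¹
          (fun i j ↦ tensorD br A (leviCivita g) T l i j y)
          (fun i j ↦ tensorD br A (leviCivita g) T k i j y)) := by
    intro k l
    rw [pd_congr hg.isOpen hy k (h1 l), pd_const_mul _ _ (differentiableAt_of_contDiffOn hg.isOpen
      hy (contDiffOn_pairing hg (hTT l) hT)), pd_pairing br (A := A) hg hinv (hTT l) hT k hy]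
  -- The Christoffel term of the scalar Hessian is matched by the term of `tensorD₂` on the index of
  -- differentiation.
  have h3 : ∀ k l, pairing (g y)⁻¹ (g y)⁻¹ (fun i j ↦ tensorD₂ br A (leviCivita g) T k l i j y)
      (fun i j ↦ T i j y) = pairing (g y)⁻¹ (g y)⁻¹
        (fun i j ↦ tensorD br A (leviCivita g) (tensorD br A (leviCivita g) T l) k i j y)
        (fun i j ↦ T i j y) - ∑ s, leviCivita g k y s l * pairing (g y)⁻¹ (g y)⁻¹
        (fun i j ↦ tensorD br A (leviCivita g) T s i j y) (fun i j ↦ T i j y) := by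
    intro k l
    rw [← pairing_sum_smul_left, ← pairing_sub_left]
    rfl
  have h4 : pairing (g y)⁻¹ (g y)⁻¹
      (fun i j ↦ ∑ k, ∑ l, (g y)⁻¹ k l • tensorD₂ br A (leviCivita g) T k l i j y)
      (fun i j ↦ T i j y) = ∑ k, ∑ l, (g y)⁻¹ k l * pairing (g y)⁻¹ (g y)⁻¹
        (fun i j ↦ tensorD₂ br A (leviCivita g) T k l i j y) (fun i j ↦ T i j y) := by
    have := pairing_sum_smul_left (g y)⁻¹ (g y)⁻¹ (fun i j ↦ T i j y) Finset.univ (fun _ ↦ (1 : ℝ))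
      (fun k i j ↦ ∑ l, (g y)⁻¹ k l • tensorD₂ br A (leviCivita g) T k l i j y)
    simp only [one_smul, one_mul] at this
    rw [this]
    exact Finset.sum_congr rfl fun k _ ↦ pairing_sum_smul_left _ _ _ _ _ _
  rw [h4]
  simp only [laplacian, h2, h3, h1 _ y hy, Finset.mul_sum, ← Finset.sum_add_distrib, mul_add,
    mul_sub]
  refine Finset.sum_congr rfl fun k _ ↦ Finset.sum_congr rfl fun l _ ↦ ?_
  rw [hc hy (fun i j ↦ tensorD br A (leviCivita g) T l i j y)]
  simp only [← Finset.mul_sum]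
  have : ∑ s, leviCivita g k y s l * (2 * pairing (g y)⁻¹ (g y)⁻¹
      (fun i j ↦ tensorD br A (leviCivita g) T s i j y) (fun i j ↦ T i j y))
      = 2 * ∑ s, leviCivita g k y s l * pairing (g y)⁻¹ (g y)⁻¹
      (fun i j ↦ tensorD br A (leviCivita g) T s i j y) (fun i j ↦ T i j y) := by
    rw [Finset.mul_sum]
    exact Finset.sum_congr rfl fun s _ ↦ by ring
  rw [this]
  ring

end Laplacian

end YangMills

namespace YangMills

/-! ### The Weitzenböck formula for Yang-Mills fields -/

section Weitzenboeck

variable {n : ℕ} {V : Type*} [NormedAddCommGroup V] [InnerProductSpace ℝ V]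
  (br : V →L[ℝ] V →L[ℝ] V) {U : Set (𝔼 n)} {g : 𝔼 n → Matrix (Fin n) (Fin n) ℝ}
  {A : Fin n → 𝔼 n → V} {T : Fin n → Fin n → 𝔼 n → V}

theorem contDiffOn_curv (hU : IsOpen U) (hA : ∀ k, ContDiffOn ℝ ∞ (A k) U) (i j : Fin n) :
    ContDiffOn ℝ ∞ (curv br A i j) U :=
  ((contDiffOn_pd hU (hA j) i).sub (contDiffOn_pd hU (hA i) j)).add
    (ContDiffOn.clm_apply (br.contDiff.comp_contDiffOn (hA i)) (hA j))

theorem curv_antisymm (hanti : ∀ x y, br x y = -br y x) (i j : Fin n) (y : 𝔼 n) :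
    curv br A i j y = -curv br A j i y := by
  simp only [curv]
  rw [hanti (A i y)]
  abel

theorem tensorD_antisymm {Γ : Fin n → 𝔼 n → Matrix (Fin n) (Fin n) ℝ}
    (hT : ∀ i j, T i j = fun y ↦ -T j i y) (k i j : Fin n) :
    tensorD br A Γ T k i j = fun y ↦ -tensorD br A Γ T k j i y := by
  have hT' : ∀ i j y, T i j y = -T j i y := fun i j y ↦ congrFun (hT i j) y
  ext1 y
  simp only [tensorD, tensorAct]
  have h1 : pd k (T i j) y = -pd k (T j i) y := by
    rw [hT i j]; simp [pd, fderiv_fun_neg]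
  have h2 : ∑ s, Γ k y s i • T s j y = -∑ s, Γ k y s i • T j s y := by
    rw [← Finset.sum_neg_distrib]
    exact Finset.sum_congr rfl fun s _ ↦ by rw [hT' s j, smul_neg]
  have h3 : ∑ s, Γ k y s j • T i s y = -∑ s, Γ k y s j • T s i y := by
    rw [← Finset.sum_neg_distrib]
    exact Finset.sum_congr rfl fun s _ ↦ by rw [hT' i s, smul_neg]
  rw [h1, h2, h3, hT' i j, map_neg]
  abel

theorem tensorD₂_antisymm {Γ : Fin n → 𝔼 n → Matrix (Fin n) (Fin n) ℝ}
    (hT : ∀ i j, T i j = fun y ↦ -T j i y) (l k i j : Fin n) (y : 𝔼 n) :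
    tensorD₂ br A Γ T l k i j y = -tensorD₂ br A Γ T l k j i y := by
  have h1 := tensorD_antisymm br (A := A) (Γ := Γ) hT
  have h2 := congrFun (tensorD_antisymm br (A := A) (Γ := Γ) (h1 k) l i j) y
  have h3 : ∑ s, Γ l y s k • tensorD br A Γ T s i j y
      = -∑ s, Γ l y s k • tensorD br A Γ T s j i y := by
    rw [← Finset.sum_neg_distrib]
    exact Finset.sum_congr rfl fun s _ ↦ by rw [h1 s i j, smul_neg]
  simp only [tensorD] at h2
  simp only [tensorD₂, tensorD]
  simp only [tensorD] at h3
  rw [h2, h3]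
  abel

/-- The Bianchi identity. -/
theorem tensorD_curv_cyclic (hU : IsOpen U) {Γ : Fin n → 𝔼 n → Matrix (Fin n) (Fin n) ℝ}
    (hanti : ∀ x y, br x y = -br y x)
    (hjac : ∀ x y z, br (br x y) z = br x (br y z) - br y (br x z))
    (hA : ∀ k, ContDiffOn ℝ ∞ (A k) U)
    (hsymm : ∀ y ∈ U, ∀ k s i, Γ k y s i = Γ i y s k) (k i j : Fin n) {y : 𝔼 n} (hy : y ∈ U) :
    tensorD br A Γ (curv br A) k i j y + tensorD br A Γ (curv br A) i j k y
      + tensorD br A Γ (curv br A) j k i y = 0 := by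
  have dA := fun i ↦ differentiableAt_of_contDiffOn hU hy (hA i)
  have dpA := fun i j ↦ differentiableAt_of_contDiffOn hU hy (contDiffOn_pd hU (hA i) j)
  have hpd : ∀ k i j, pd k (curv br A i j) y = pd k (pd i (A j)) y - pd k (pd j (A i)) y
      + (br (pd k (A i) y) (A j y) + br (A i y) (pd k (A j) y)) := by
    intro k i j
    rw [← pd_bilin br k (dA i) (dA j), ← pd_sub k (dpA j i) (dpA i j)]
    exact pd_add k ((dpA j i).fun_sub (dpA i j))
      (((br.differentiableAt).comp y (dA i)).clm_apply (dA j))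
  -- Skew-symmetry of the curvature and symmetry of `Γ` make the Christoffel terms cancel in pairs
  -- over the cyclic sum.
  have hΓ : ∀ k i j, ∑ s, Γ k y s i • curv br A s j y
      = - ∑ s, Γ i y s k • curv br A j s y := by
    intro k i j
    rw [← Finset.sum_neg_distrib]
    exact Finset.sum_congr rfl fun s _ ↦ by
      rw [hsymm y hy, curv_antisymm br hanti s j, smul_neg]
  simp only [tensorD, tensorAct, hpd]
  rw [hΓ k i j, hΓ i j k, hΓ j k i]
  simp only [curv, map_add, map_sub]
  -- Second derivatives of the potential cancel by symmetry, first derivatives by skew-symmetry of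
  -- the bracket, and double brackets by the Jacobi identity.
  rw [pd_comm hU hy (hA j) k i, pd_comm hU hy (hA i) k j, pd_comm hU hy (hA k) i j,
    hanti (pd k (A i) y), hanti (pd i (A j) y), hanti (pd j (A k) y),
    show br (A k y) (br (A i y) (A j y)) = -br (A i y) (br (A j y) (A k y))
      - br (A j y) (br (A k y) (A i y)) by
      have := hjac (A i y) (A j y) (A k y)
      rw [hanti] at this
      rw [neg_eq_iff_eq_neg.1 this, hanti (A k y) (A i y), map_neg]
      abel]
  abel

/-- The derivative of the Bianchi identity. -/
theorem tensorD₂_curv_cyclic (hU : IsOpen U) {Γ : Fin n → 𝔼 n → Matrix (Fin n) (Fin n) ℝ}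
    (hanti : ∀ x y, br x y = -br y x)
    (hjac : ∀ x y z, br (br x y) z = br x (br y z) - br y (br x z))
    (hA : ∀ k, ContDiffOn ℝ ∞ (A k) U)
    (hΓ : ∀ k s i, ContDiffOn ℝ ∞ (fun z ↦ Γ k z s i) U)
    (hsymm : ∀ y ∈ U, ∀ k s i, Γ k y s i = Γ i y s k) (l k i j : Fin n) {y : 𝔼 n} (hy : y ∈ U) :
    tensorD₂ br A Γ (curv br A) l k i j y + tensorD₂ br A Γ (curv br A) l i j k y
      + tensorD₂ br A Γ (curv br A) l j k i y = 0 := by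
  have hB := fun k i j ↦ tensorD_curv_cyclic br hU hanti hjac hA hsymm k i j hy
  have dD := fun k i j ↦ differentiableAt_of_contDiffOn hU hy
    (contDiffOn_tensorD br hU hA hΓ (contDiffOn_curv br hU hA) k i j)
  have h1 : pd l (tensorD br A Γ (curv br A) k i j) y + pd l (tensorD br A Γ (curv br A) i j k) y
      + pd l (tensorD br A Γ (curv br A) j k i) y = 0 := by
    rw [← pd_add l (dD k i j) (dD i j k), ← pd_add l ((dD k i j).fun_add (dD i j k)) (dD j k i),
      pd_congr hU hy l fun z hz ↦ tensorD_curv_cyclic br hU hanti hjac hA hsymm k i j hz, pd_const]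
  have h2 : br (A l y) (tensorD br A Γ (curv br A) k i j y)
      + br (A l y) (tensorD br A Γ (curv br A) i j k y)
      + br (A l y) (tensorD br A Γ (curv br A) j k i y) = 0 := by
    rw [← map_add, ← map_add, hB, map_zero]
  -- Each remaining group of Christoffel terms is the Bianchi identity with one of its three indices
  -- replaced by the summation index.
  have h3 : ∀ c : Fin n → ℝ, ∀ i j, ∑ s, c s • tensorD br A Γ (curv br A) s i j y
      + ∑ s, c s • tensorD br A Γ (curv br A) i j s y
      + ∑ s, c s • tensorD br A Γ (curv br A) j s i y = 0 := by
    intro c i j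
    simp only [← Finset.sum_add_distrib, ← smul_add, hB, smul_zero, Finset.sum_const_zero]
  simp only [tensorD₂, tensorAct]
  linear_combination (norm := module) h1 + h2 - h3 (fun s ↦ Γ l y s k) i j - h3 (fun s ↦ Γ l y s i) j k
    - h3 (fun s ↦ Γ l y s j) k i

/-- The derivative of the Yang-Mills equation. -/
theorem sum_tensorD₂_eq_zero (hg : IsMetricOn g U) (hA : ∀ k, ContDiffOn ℝ ∞ (A k) U)
    (hT : ∀ i j, ContDiffOn ℝ ∞ (T i j) U)
    (hYM : ∀ y ∈ U, ∀ j, ∑ k, ∑ l, (g y)⁻¹ k l • tensorD br A (leviCivita g) T k l j y = 0)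
    (i j : Fin n) {y : 𝔼 n} (hy : y ∈ U) :
    ∑ k, ∑ l, (g y)⁻¹ k l • tensorD₂ br A (leviCivita g) T i k l j y = 0 := by
  have dI := fun i j ↦ differentiableAt_of_contDiffOn hg.isOpen hy (hg.contDiffOn_inv i j)
  have dD := fun k i j ↦ differentiableAt_of_contDiffOn hg.isOpen hy
    (contDiffOn_tensorD br hg.isOpen hA hg.contDiffOn_leviCivita hT k i j)
  have h1 : ∑ k, ∑ l, (pd i (fun z ↦ (g z)⁻¹ k l) y • tensorD br A (leviCivita g) T k l j y
      + (g y)⁻¹ k l • pd i (tensorD br A (leviCivita g) T k l j) y) = 0 := by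
    have := pd_congr hg.isOpen hy i (fun z hz ↦ hYM z hz j)
    rw [pd_const, pd_sum _ _ fun k _ ↦ DifferentiableAt.fun_sum fun l _ ↦
      (dI k l).fun_smul (dD k l j)] at this
    simpa only [pd_sum Finset.univ i fun l _ ↦ (dI _ l).fun_smul (dD _ l j),
      pd_smul i (dI _ _) (dD _ _ _)] using this
  have hI : ∀ k l, pd i (fun z ↦ (g z)⁻¹ k l) y = -(∑ s, leviCivita g i y k s * (g y)⁻¹ s l)
      - ∑ s, (g y)⁻¹ k s * leviCivita g i y l s := by
    intro k l
    have := congrFun (congrFun (hg.pd_inv hy i) k) l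
    simpa [Matrix.mul_apply] using this
  set D := fun k l j ↦ tensorD br A (leviCivita g) T k l j y with hD
  -- Here and in `h3`, the derivative of `g⁻¹` cancels the Christoffel terms on the two contracted
  -- indices: the contraction commutes with `∇`.
  have h2 : ∑ k, ∑ l, (∑ s, leviCivita g i y k s * (g y)⁻¹ s l) • D k l j
      = ∑ k, ∑ l, (g y)⁻¹ k l • ∑ s, leviCivita g i y s k • D s l j := by
    simp only [Finset.sum_smul, Finset.smul_sum, smul_smul]
    rw [Finset.sum_congr rfl fun k _ ↦ Finset.sum_comm, Finset.sum_comm]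
    refine Finset.sum_congr rfl fun k _ ↦ ?_
    rw [Finset.sum_comm]
    exact Finset.sum_congr rfl fun _ _ ↦ Finset.sum_congr rfl fun _ _ ↦ by rw [mul_comm]
  have h3 : ∑ k, ∑ l, (∑ s, (g y)⁻¹ k s * leviCivita g i y l s) • D k l j
      = ∑ k, ∑ l, (g y)⁻¹ k l • ∑ s, leviCivita g i y s l • D k s j := by
    simp only [Finset.sum_smul, Finset.smul_sum, smul_smul]
    refine Finset.sum_congr rfl fun k _ ↦ ?_
    rw [Finset.sum_comm]
  have h4 : ∑ k, ∑ l, (g y)⁻¹ k l • br (A i y) (D k l j) = 0 := by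
    have := congrArg (br (A i y)) (hYM y hy j)
    simpa only [map_sum, map_smul, map_zero] using this
  -- The Christoffel term on the free index is the Yang–Mills equation for the index `s`, hence
  -- zero.
  have h5 : ∑ k, ∑ l, (g y)⁻¹ k l • ∑ s, leviCivita g i y s j • D k l s = 0 := by
    have : ∑ s, leviCivita g i y s j • ∑ k, ∑ l, (g y)⁻¹ k l • D k l s = 0 := by
      simp only [hD, hYM y hy, smul_zero, Finset.sum_const_zero]
    rw [← this]
    simp only [Finset.smul_sum, smul_smul]
    rw [Finset.sum_congr rfl fun k _ ↦ Finset.sum_comm, Finset.sum_comm]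
    exact Finset.sum_congr rfl fun _ _ ↦ Finset.sum_congr rfl fun _ _ ↦
      Finset.sum_congr rfl fun _ _ ↦ by rw [mul_comm]
  simp only [hI, sub_smul, neg_smul, Finset.sum_add_distrib, Finset.sum_sub_distrib,
    Finset.sum_neg_distrib] at h1
  simp only [tensorD₂, tensorAct, smul_sub, smul_add, Finset.sum_add_distrib,
    Finset.sum_sub_distrib]
  change _ + (_ - _ - _) - _ = _
  linear_combination (norm := module) h1 + h2 + h3 + h4 - h5

end Weitzenboeck

end YangMills

namespace YangMills

/-! ### Symmetries of the Riemann tensor -/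

section CurvatureSymmetries

variable {n : ℕ} {U : Set (𝔼 n)} {g : 𝔼 n → Matrix (Fin n) (Fin n) ℝ}

theorem linCurv_antisymm (Γ : Fin n → 𝔼 n → Matrix (Fin n) (Fin n) ℝ) (s i l k : Fin n) (y : 𝔼 n) :
    linCurv Γ s i l k y = -linCurv Γ s i k l y := by
  simp only [linCurv, Finset.sum_sub_distrib]
  ring

/-- Without torsion the two lower indices of `Γ` may be exchanged, after which all derivative terms
and all quadratic terms cancel in pairs. -/
theorem linCurv_cyclic {Γ : Fin n → 𝔼 n → Matrix (Fin n) (Fin n) ℝ} (hU : IsOpen U)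
    (hsymm : ∀ y ∈ U, ∀ k s i, Γ k y s i = Γ i y s k) (s i l k : Fin n) {y : 𝔼 n} (hy : y ∈ U) :
    linCurv Γ s i l k y + linCurv Γ s l k i y + linCurv Γ s k i l y = 0 := by
  simp only [linCurv, Finset.sum_sub_distrib]
  have h1 : ∀ l k i, pd l (fun z ↦ Γ k z s i) y = pd l (fun z ↦ Γ i z s k) y :=
    fun l k i ↦ pd_congr hU hy l fun z hz ↦ hsymm z hz k s i
  have h2 : ∀ l k i, ∑ t, Γ l y s t * Γ k y t i = ∑ t, Γ l y s t * Γ i y t k :=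
    fun l k i ↦ Finset.sum_congr rfl fun t _ ↦ by rw [hsymm y hy k t i]
  rw [h1 l k i, h1 k l i, h1 i k l, h2 l k i, h2 k l i, h2 i k l]
  ring

/-- The curvature of the Levi-Civita connection is skew-symmetric in the first pair of indices. -/
theorem IsMetricOn.sum_mul_linCurv_antisymm (hg : IsMetricOn g U) (a b m l : Fin n) {y : 𝔼 n}
    (hy : y ∈ U) : ∑ s, g y a s * linCurv (leviCivita g) s b m l y
      = -∑ s, g y b s * linCurv (leviCivita g) s a m l y := by
  -- The metric is treated as a two-tensor with values in `ℝ`, zero bracket and zero potential. It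
  -- is parallel, so the Ricci identity applied to it says that the curvature acts on it by zero.
  have hD : ∀ k i j, ∀ z ∈ U, tensorD (V := ℝ) 0 0 (leviCivita g) (fun i j z ↦ g z i j) k i j z
      = 0 := by
    intro k i j z hz
    have := congrFun (congrFun (hg.pd_eq hz k) i) j
    simp only [Matrix.of_apply, Matrix.add_apply, Matrix.mul_apply, Matrix.transpose_apply] at this
    simp only [tensorD, tensorAct, this, smul_eq_mul, zero_apply]
    rw [Finset.sum_congr rfl fun s _ ↦ mul_comm (g z i s) _]
    ring
  have hD₂ : ∀ l k i j,
      tensorD₂ (V := ℝ) 0 0 (leviCivita g) (fun i j z ↦ g z i j) l k i j y = 0 := by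
    intro l k i j
    simp only [tensorD₂, tensorAct, hD _ _ _ y hy]
    rw [pd_congr hg.isOpen hy l (hD k i j), pd_const]
    simp
  have h := tensorD₂_sub (V := ℝ) (A := 0) 0 hg.isOpen (by simp) (fun _ ↦ contDiffOn_const)
    hg.contDiffOn_leviCivita (fun y hy ↦ hg.leviCivita_symm hy) hg.contDiffOn m l a b hy
  rw [hD₂, hD₂] at h
  simp only [zero_apply, smul_eq_mul] at h
  have h1 : ∑ s, g y a s * linCurv (leviCivita g) s b m l y
      = ∑ s, linCurv (leviCivita g) s b m l y * g y a s :=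
    Finset.sum_congr rfl fun s _ ↦ mul_comm _ _
  have h2 : ∑ s, g y b s * linCurv (leviCivita g) s a m l y
      = ∑ s, linCurv (leviCivita g) s a m l y * g y s b :=
    Finset.sum_congr rfl fun s _ ↦ by rw [hg.symm hy b s, mul_comm]
  rw [h1, h2]
  linarith

end CurvatureSymmetries

/-! ### Pointwise algebra of the Weitzenböck terms -/

section Algebra

variable {n : ℕ}

/-- The contraction of the curvature terms of the Ricci identity for a two-form with the two-form
is the Weitzenböck quadratic form. -/
theorem sum_curvature_contraction {g I : Matrix (Fin n) (Fin n) ℝ} (hgI : g * I = 1)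
    (hg : g.transpose = g) (hI : I.transpose = I) (R : Fin n → Fin n → Fin n → Fin n → ℝ)
    (hR₁ : ∀ s i l k, R s i l k = -R s i k l)
    (hR₂ : ∀ s i l k, R s i l k + R s l k i + R s k i l = 0)
    (hR₃ : ∀ a b m l, ∑ s, g a s * R s b m l = -∑ s, g b s * R s a m l)
    (L : Matrix (Fin n) (Fin n) ℝ) (hL : ∀ i j, L j i = -L i j) (W : Matrix (Fin n) (Fin n) ℝ)
    (hW : ∀ a b, W a b = ∑ i, ∑ j, I a i * I b j * L i j) :
    ∑ i, ∑ j, W i j * ∑ k, ∑ l, I k l * (∑ s, R s j l i * L s k + ∑ s, R s k l i * L j s)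
      = (∑ a, ∑ b, ∑ l, (∑ s, R s a s b) * (∑ i, I a i * L i l) * W b l)
        - (1 / 2) * ∑ a, ∑ b, ∑ m, ∑ l, (∑ s, g a s * R s b m l) * W a b * W m l := by
  have hIg : I * g = 1 := mul_eq_one_comm.1 hgI
  have hLt : L.transpose = -L := by ext i j; exact hL i j
  have hWm : W = I * L * I := by
    ext a b
    rw [hW, Matrix.mul_assoc, Matrix.mul_apply]
    refine Finset.sum_congr rfl fun i _ ↦ ?_
    rw [Matrix.mul_apply, Finset.mul_sum]
    refine Finset.sum_congr rfl fun j _ ↦ ?_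
    rw [show I j b = I b j from congrFun (congrFun hI b) j]
    ring
  have hWt : ∀ i j, W j i = -W i j := by
    have : W.transpose = -W := by
      rw [hWm, Matrix.transpose_mul, Matrix.transpose_mul, hI, hLt]
      simp [Matrix.mul_assoc]
    exact fun i j ↦ congrFun (congrFun this i) j
  set Rl : Fin n → Fin n → Fin n → Fin n → ℝ := fun a b m l ↦ ∑ s, g a s * R s b m l with hRl
  have hRl₂ : ∀ a i l k, Rl a i l k + Rl a l k i + Rl a k i l = 0 := by
    intro a i l k
    simp only [hRl, ← Finset.sum_add_distrib, ← mul_add, hR₂, mul_zero, Finset.sum_const_zero]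
  have hRl₁ : ∀ a i l k, Rl a i l k = -Rl a i k l := by
    intro a i l k
    simp only [hRl, ← Finset.sum_neg_distrib]
    exact Finset.sum_congr rfl fun s _ ↦ by rw [hR₁]; ring
  set X := ∑ a, ∑ l, ∑ i, ∑ j, Rl a j l i * W a l * W i j with hX
  have hX₁ : ∑ a, ∑ l, ∑ i, ∑ j, Rl a i j l * W a l * W i j = X := by
    refine Finset.sum_congr rfl fun a _ ↦ Finset.sum_congr rfl fun l _ ↦ ?_
    rw [Finset.sum_comm]
    refine Finset.sum_congr rfl fun i _ ↦ Finset.sum_congr rfl fun j _ ↦ ?_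
    rw [hWt i j, hRl₁ a j l i]
    ring
  -- Contract the first Bianchi identity with `W ⊗ W`: two of its three terms equal `X`, and the
  -- third is the full curvature contraction. This is the source of the factor `1/2`.
  have hX₂ : 2 * X = -∑ a, ∑ b, ∑ m, ∑ l, Rl a b m l * W a b * W m l := by
    have : X + ∑ a, ∑ l, ∑ i, ∑ j, Rl a l i j * W a l * W i j
        + ∑ a, ∑ l, ∑ i, ∑ j, Rl a i j l * W a l * W i j = 0 := by
      simp only [hX, ← Finset.sum_add_distrib, ← add_mul, hRl₂, zero_mul, Finset.sum_const_zero]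
    rw [hX₁] at this
    linarith
  -- Lowering the upper index of the curvature with `g` raises the remaining index of `L`, so that
  -- both copies of the two-form appear as `W`.
  have h₁ : ∑ i, ∑ j, W i j * ∑ k, ∑ l, I k l * ∑ s, R s j l i * L s k = X := by
    have hgW : g * W = L * I := by
      rw [hWm, ← Matrix.mul_assoc, ← Matrix.mul_assoc, hgI, Matrix.one_mul]
    have e1 : ∀ i j, ∑ k, ∑ l, I k l * ∑ s, R s j l i * L s k
        = ∑ l, ∑ s, R s j l i * (L * I) s l := by
      intro i j
      rw [Finset.sum_comm]
      refine Finset.sum_congr rfl fun l _ ↦ ?_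
      simp only [Matrix.mul_apply, Finset.mul_sum]
      rw [Finset.sum_comm]
      exact Finset.sum_congr rfl fun _ _ ↦ Finset.sum_congr rfl fun _ _ ↦ by ring
    have e2 : ∀ i j, ∑ l, ∑ s, R s j l i * (L * I) s l = ∑ l, ∑ a, Rl a j l i * W a l := by
      intro i j
      refine Finset.sum_congr rfl fun l _ ↦ ?_
      have e0 : ∀ s, (L * I) s l = ∑ a, g s a * W a l := fun s ↦ by
        rw [← hgW, Matrix.mul_apply]
      simp only [e0, hRl, Finset.mul_sum, Finset.sum_mul]
      rw [Finset.sum_comm]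
      refine Finset.sum_congr rfl fun a _ ↦ Finset.sum_congr rfl fun s _ ↦ ?_
      rw [show g s a = g a s from congrFun (congrFun hg a) s]
      ring
    simp only [e1, e2]
    simp only [hX, Finset.mul_sum]
    rw [Finset.sum_congr rfl fun i _ ↦ Finset.sum_congr rfl fun j _ ↦ Finset.sum_comm]
    rw [Finset.sum_congr rfl fun i _ ↦ Finset.sum_comm, Finset.sum_comm]
    refine Finset.sum_congr rfl fun a _ ↦ ?_
    rw [Finset.sum_congr rfl fun i _ ↦ Finset.sum_comm, Finset.sum_comm]
    exact Finset.sum_congr rfl fun _ _ ↦ Finset.sum_congr rfl fun _ _ ↦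
      Finset.sum_congr rfl fun _ _ ↦ by ring
  have h₂ : ∑ i, ∑ j, W i j * ∑ k, ∑ l, I k l * ∑ s, R s k l i * L j s
      = ∑ a, ∑ b, ∑ l, (∑ s, R s a s b) * (∑ i, I a i * L i l) * W b l := by
    set K : Matrix (Fin n) (Fin n) ℝ := Matrix.of fun s i ↦ ∑ k, ∑ l, I k l * R s k l i with hK
    set Ric : Matrix (Fin n) (Fin n) ℝ := Matrix.of fun a b ↦ ∑ s, R s a s b with hRic
    -- Skew-symmetry in the first pair of indices moves the contraction to the upper index, at the
    -- cost of a sign.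
    have e1 : g * K = -Ric := by
      ext a i
      have : (g * K) a i = ∑ k, ∑ l, I k l * Rl a k l i := by
        simp only [Matrix.mul_apply, hK, Matrix.of_apply, hRl, Finset.mul_sum]
        rw [Finset.sum_comm]
        refine Finset.sum_congr rfl fun k _ ↦ ?_
        rw [Finset.sum_comm]
        exact Finset.sum_congr rfl fun _ _ ↦ Finset.sum_congr rfl fun _ _ ↦ by ring
      rw [this]
      have : ∀ k l, Rl a k l i = -∑ t, g k t * R t a l i := fun k l ↦ hR₃ a k l i
      simp only [this, mul_neg, Finset.sum_neg_distrib, Matrix.neg_apply, hRic, Matrix.of_apply]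
      congr 1
      rw [Finset.sum_comm]
      refine Finset.sum_congr rfl fun l _ ↦ ?_
      have e : ∑ k, I k l * ∑ t, g k t * R t a l i = ∑ t, (I * g) l t * R t a l i := by
        simp only [Matrix.mul_apply, Finset.mul_sum, Finset.sum_mul]
        rw [Finset.sum_comm]
        refine Finset.sum_congr rfl fun _ _ ↦ Finset.sum_congr rfl fun k _ ↦ ?_
        rw [show I k l = I l k from congrFun (congrFun hI l) k]
        ring
      rw [e, hIg]
      simp [Matrix.one_apply]
    have e2 : K = -(I * Ric) := by
      rw [← Matrix.mul_neg, ← e1, ← Matrix.mul_assoc, hIg, Matrix.one_mul]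
    have e3 : ∑ i, ∑ j, W i j * ∑ k, ∑ l, I k l * ∑ s, R s k l i * L j s
        = (W * (L * K)).trace := by
      simp only [Matrix.trace, Matrix.diag_apply, Matrix.mul_apply, hK, Matrix.of_apply]
      refine Finset.sum_congr rfl fun i _ ↦ Finset.sum_congr rfl fun j _ ↦ congrArg _ ?_
      simp only [Finset.mul_sum]
      rw [Finset.sum_congr rfl fun i _ ↦ Finset.sum_comm, Finset.sum_comm]
      exact Finset.sum_congr rfl fun _ _ ↦ Finset.sum_congr rfl fun _ _ ↦
        Finset.sum_congr rfl fun _ _ ↦ by ring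
    have e4 : ∑ a, ∑ b, ∑ l, (∑ s, R s a s b) * (∑ i, I a i * L i l) * W b l
        = (W * ((I * L).transpose * Ric)).trace := by
      simp only [Matrix.trace, Matrix.diag_apply, Matrix.mul_apply (M := W)]
      rw [Finset.sum_comm]
      refine Finset.sum_congr rfl fun b _ ↦ ?_
      rw [Finset.sum_comm]
      refine Finset.sum_congr rfl fun l _ ↦ ?_
      rw [Matrix.mul_apply, Finset.mul_sum]
      refine Finset.sum_congr rfl fun a _ ↦ ?_
      rw [Matrix.transpose_apply, Matrix.mul_apply, hRic, Matrix.of_apply]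
      ring
    rw [e3, e4, e2, Matrix.transpose_mul, hLt, hI]
    simp [Matrix.mul_assoc]
  have hsplit : ∑ i, ∑ j, W i j * ∑ k, ∑ l, I k l
        * (∑ s, R s j l i * L s k + ∑ s, R s k l i * L j s)
      = ∑ i, ∑ j, W i j * ∑ k, ∑ l, I k l * ∑ s, R s j l i * L s k
        + ∑ i, ∑ j, W i j * ∑ k, ∑ l, I k l * ∑ s, R s k l i * L j s := by
    simp only [mul_add, Finset.sum_add_distrib]
  rw [hsplit, h₁, h₂]
  linarith

variable {V : Type*} [NormedAddCommGroup V] [InnerProductSpace ℝ V]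

/-- Expansion in an orthonormal basis. It splits a form with values in `V` into real two-forms, to
each of which the curvature hypothesis applies. -/
theorem pairing_eq_sum_pairing [FiniteDimensional ℝ V] {ι : Type*} [Fintype ι]
    (b : OrthonormalBasis ι ℝ V) (M N : Matrix (Fin n) (Fin n) ℝ) (S T : Fin n → Fin n → V) :
    pairing M N S T = ∑ α, ∑ i, ∑ j, (inner ℝ (b α) (S i j)) *
      ∑ c, ∑ d, M i c * N j d * inner ℝ (b α) (T c d) := by
  have h : pairing M N S T
      = ∑ i, ∑ j, inner ℝ (S i j) (∑ c, ∑ d, (M i c * N j d) • T c d) := by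
    simp only [pairing, inner_sum, real_inner_smul_right, Finset.mul_sum]
    refine Finset.sum_congr rfl fun i _ ↦ ?_
    rw [Finset.sum_comm]
    exact Finset.sum_congr rfl fun _ _ ↦ Finset.sum_congr rfl fun _ _ ↦
      Finset.sum_congr rfl fun _ _ ↦ by ring
  rw [h, Finset.sum_congr rfl fun i _ ↦ Finset.sum_congr rfl fun j _ ↦
    (b.sum_inner_mul_inner (S i j) _).symm]
  rw [Finset.sum_congr rfl fun i _ ↦ Finset.sum_comm, Finset.sum_comm]
  refine Finset.sum_congr rfl fun α _ ↦ Finset.sum_congr rfl fun i _ ↦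
    Finset.sum_congr rfl fun j _ ↦ ?_
  rw [real_inner_comm]
  simp only [inner_sum, real_inner_smul_right]

/-- The cubic term of the Weitzenböck formula is bounded by the cube of the norm. -/
theorem abs_pairing_bracket_le (br : V →L[ℝ] V →L[ℝ] V) (hbr : ∀ x y, ‖br x y‖ ≤ ‖x‖ * ‖y‖)
    {M B : Matrix (Fin n) (Fin n) ℝ} (hB : M = B.transpose * B) (T : Fin n → Fin n → V) :
    |pairing M M (fun i j ↦ ∑ k, ∑ l, M k l • br (T l i) (T j k)) T|
      ≤ n ^ 3 * (pairing M M T T * Real.sqrt (pairing M M T T)) := by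
  -- The components of `T` in the orthonormal frame determined by `B`. In this frame the metric
  -- disappears, and each component is bounded by the norm of `T`.
  set H : Fin n → Fin n → V := fun p q ↦ ∑ i, ∑ j, (B p i * B q j) • T i j with hH
  have h1 : ∀ p q, ∑ i, ∑ j, (B p i * B q j) • ∑ k, ∑ l, M k l • br (T l i) (T j k)
      = ∑ m, br (H m p) (H q m) := by
    intro p q
    simp only [hH, hB, Matrix.mul_apply, Matrix.transpose_apply, map_sum, sum_apply, map_smul,
      smul_apply, Finset.smul_sum, Finset.sum_smul, smul_smul]
    rw [Finset.sum_comm]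
    symm
    rw [Finset.sum_comm]
    refine Finset.sum_congr rfl fun j _ ↦ ?_
    rw [Finset.sum_comm]
    symm
    rw [Finset.sum_comm]
    refine Finset.sum_congr rfl fun k _ ↦ ?_
    rw [Finset.sum_comm]
    symm
    rw [Finset.sum_comm]
    refine Finset.sum_congr rfl fun l _ ↦ ?_
    rw [Finset.sum_comm]
    exact Finset.sum_congr rfl fun _ _ ↦ Finset.sum_congr rfl fun _ _ ↦ by congr 1; ring
  have h2 : pairing M M T T = ∑ p, ∑ q, ‖H p q‖ ^ 2 := by
    rw [pairing_eq_sum_inner M T T hB]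
    simp only [real_inner_self_eq_norm_sq]
    rfl
  set e := pairing M M T T with he
  have h0 : 0 ≤ e := by rw [h2]; positivity
  have h3 : ∀ p q, ‖H p q‖ ≤ Real.sqrt e := by
    intro p q
    apply Real.le_sqrt_of_sq_le
    rw [h2]
    exact (Finset.single_le_sum (f := fun q ↦ ‖H p q‖ ^ 2) (fun _ _ ↦ by positivity)
      (Finset.mem_univ q)).trans (Finset.single_le_sum (f := fun p ↦ ∑ q, ‖H p q‖ ^ 2)
        (fun _ _ ↦ by positivity) (Finset.mem_univ p))
  rw [pairing_eq_sum_inner M _ T hB]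
  simp only [h1]
  change |∑ p, ∑ q, inner ℝ (∑ m, br (H m p) (H q m)) (H p q)| ≤ _
  -- One factor `n` comes from the inner sum over `m`; the sum over the pairs `p, q` later
  -- contributes the factor `n²`.
  have h4 : ∀ p q, |inner ℝ (∑ m, br (H m p) (H q m)) (H p q)| ≤ n * (e * Real.sqrt e) := by
    intro p q
    have hs : ‖∑ m, br (H m p) (H q m)‖ ≤ n * e := by
      refine (norm_sum_le _ _).trans ?_
      have : ∀ m ∈ Finset.univ, ‖br (H m p) (H q m)‖ ≤ e := fun m _ ↦ by
        refine (hbr _ _).trans ?_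
        rw [← Real.mul_self_sqrt h0]
        exact mul_le_mul (h3 _ _) (h3 _ _) (norm_nonneg _) (Real.sqrt_nonneg _)
      simpa using Finset.sum_le_card_nsmul _ _ _ this
    calc _ ≤ _ := abs_real_inner_le_norm _ _
      _ ≤ (n * e) * Real.sqrt e := by gcongr; exact h3 p q
      _ = _ := by ring
  calc _ ≤ ∑ p, ∑ q, |inner ℝ (∑ m, br (H m p) (H q m)) (H p q)| :=
        (Finset.abs_sum_le_sum_abs _ _).trans
          (Finset.sum_le_sum fun _ _ ↦ Finset.abs_sum_le_sum_abs _ _)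
    _ ≤ ∑ p : Fin n, ∑ q : Fin n, n * (e * Real.sqrt e) :=
        Finset.sum_le_sum fun p _ ↦ Finset.sum_le_sum fun q _ ↦ h4 p q
    _ = _ := by simp; ring

end Algebra

end YangMills

namespace YangMills

/-! ### Kato's inequality and the Bochner inequality -/

section Bochner

variable {n : ℕ} {V : Type*} [NormedAddCommGroup V] [InnerProductSpace ℝ V]

theorem pairing_neg_right (M N : Matrix (Fin n) (Fin n) ℝ) (S T : Fin n → Fin n → V) :
    pairing M N S (fun i j ↦ -T i j) = -pairing M N S T := by
  simp only [pairing, inner_neg_right, mul_neg, Finset.sum_neg_distrib]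

theorem pairing_self_nonneg {M B : Matrix (Fin n) (Fin n) ℝ} (hB : M = B.transpose * B)
    (S : Fin n → Fin n → V) : 0 ≤ pairing M M S S := by
  rw [pairing_eq_sum_inner M S S hB]
  exact Finset.sum_nonneg fun _ _ ↦ Finset.sum_nonneg fun _ _ ↦ real_inner_self_nonneg

theorem pairing_sq_le {M B : Matrix (Fin n) (Fin n) ℝ} (hB : M = B.transpose * B)
    (S T : Fin n → Fin n → V) :
    pairing M M S T ^ 2 ≤ pairing M M S S * pairing M M T T := by
  rw [pairing_eq_sum_inner M S T hB, pairing_eq_sum_inner M S S hB, pairing_eq_sum_inner M T T hB]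
  simp only [← Fintype.sum_prod_type', real_inner_self_eq_norm_sq]
  refine le_trans ?_ (Finset.sum_mul_sq_le_sq_mul_sq _ _ _)
  refine sq_le_sq.2 ((Finset.abs_sum_le_sum_abs _ _).trans (le_trans ?_ (le_abs_self _)))
  exact Finset.sum_le_sum fun _ _ ↦ abs_real_inner_le_norm _ _

/-- The squared norm of the gradient. -/
def gradSq (g : 𝔼 n → Matrix (Fin n) (Fin n) ℝ) (f : 𝔼 n → ℝ) (y : 𝔼 n) : ℝ :=
  ∑ k, ∑ l, (g y)⁻¹ k l * pd k f y * pd l f y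

variable (br : V →L[ℝ] V →L[ℝ] V) {U : Set (𝔼 n)} {g : 𝔼 n → Matrix (Fin n) (Fin n) ℝ}
  {A : Fin n → 𝔼 n → V} {T : Fin n → Fin n → 𝔼 n → V}

open scoped MatrixOrder in
theorem IsMetricOn.exists_inv_eq (hg : IsMetricOn g U) {y : 𝔼 n} (hy : y ∈ U) :
    ∃ B : Matrix (Fin n) (Fin n) ℝ, (g y)⁻¹ = B.transpose * B := by
  obtain ⟨B, hB⟩ := CStarAlgebra.nonneg_iff_eq_star_mul_self.mp
    (Matrix.nonneg_iff_posSemidef.2 (hg.posDef y hy).inv.posSemidef)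
  exact ⟨B, hB⟩

/-- Kato's inequality. -/
theorem gradSq_pairing_self_le (hg : IsMetricOn g U)
    (hinv : ∀ x y z : V, inner ℝ (br x y) z = -inner ℝ y (br x z))
    (hT : ∀ i j, ContDiffOn ℝ ∞ (T i j) U) {y : 𝔼 n} (hy : y ∈ U) :
    gradSq g (fun z ↦ pairing (g z)⁻¹ (g z)⁻¹ (fun i j ↦ T i j z) (fun i j ↦ T i j z)) y
      ≤ 4 * pairing (g y)⁻¹ (g y)⁻¹ (fun i j ↦ T i j y) (fun i j ↦ T i j y) *
        ∑ k, ∑ l, (g y)⁻¹ k l * pairing (g y)⁻¹ (g y)⁻¹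
          (fun i j ↦ tensorD br A (leviCivita g) T k i j y)
          (fun i j ↦ tensorD br A (leviCivita g) T l i j y)
    ∧ 0 ≤ ∑ k, ∑ l, (g y)⁻¹ k l * pairing (g y)⁻¹ (g y)⁻¹
          (fun i j ↦ tensorD br A (leviCivita g) T k i j y)
          (fun i j ↦ tensorD br A (leviCivita g) T l i j y) := by
  obtain ⟨B, hB⟩ := hg.exists_inv_eq hy
  set D := fun k i j ↦ tensorD br A (leviCivita g) T k i j y with hD
  have hc : ∀ S T : Fin n → Fin n → V,
      pairing (g y)⁻¹ (g y)⁻¹ S T = pairing (g y)⁻¹ (g y)⁻¹ T S := by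
    intro S T
    rw [pairing_comm, hg.inv_transpose_eq hy]
  -- Covariant derivatives along an orthonormal frame. Both `|∇T|²` and `|∇e|²` become sums over the
  -- frame, and Cauchy–Schwarz is applied in each direction separately.
  set X : Fin n → Fin n → Fin n → V := fun m i j ↦ ∑ k, B m k • D k i j with hX
  have h1 : ∀ l, pd l (fun z ↦ pairing (g z)⁻¹ (g z)⁻¹ (fun i j ↦ T i j z)
      (fun i j ↦ T i j z)) y = 2 * pairing (g y)⁻¹ (g y)⁻¹ (D l) (fun i j ↦ T i j y) := by
    intro l
    rw [pd_pairing br (A := A) hg hinv hT hT l hy, hc (fun i j ↦ T i j y)]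
    simp only [hD]
    ring
  have hXT : ∀ m S, pairing (g y)⁻¹ (g y)⁻¹ (X m) S
      = ∑ k, B m k * pairing (g y)⁻¹ (g y)⁻¹ (D k) S :=
    fun m S ↦ pairing_sum_smul_left _ _ _ _ _ _
  have hI : ∀ k l, (g y)⁻¹ k l = ∑ m, B m k * B m l := by
    intro k l
    rw [hB]
    simp [Matrix.mul_apply]
  have hN : ∑ k, ∑ l, (g y)⁻¹ k l * pairing (g y)⁻¹ (g y)⁻¹ (D k) (D l)
      = ∑ m, pairing (g y)⁻¹ (g y)⁻¹ (X m) (X m) := by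
    have : ∀ m, pairing (g y)⁻¹ (g y)⁻¹ (X m) (X m)
        = ∑ k, ∑ l, B m k * B m l * pairing (g y)⁻¹ (g y)⁻¹ (D k) (D l) := by
      intro m
      rw [hXT]
      refine Finset.sum_congr rfl fun k _ ↦ ?_
      rw [hc, hXT, Finset.mul_sum]
      exact Finset.sum_congr rfl fun l _ ↦ by rw [hc (D l)]; ring
    simp only [this]
    symm
    rw [Finset.sum_comm]
    refine Finset.sum_congr rfl fun k _ ↦ ?_
    rw [Finset.sum_comm]
    exact Finset.sum_congr rfl fun l _ ↦ by rw [hI, Finset.sum_mul]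
  have hG : gradSq g (fun z ↦ pairing (g z)⁻¹ (g z)⁻¹ (fun i j ↦ T i j z) (fun i j ↦ T i j z)) y
      = 4 * ∑ m, pairing (g y)⁻¹ (g y)⁻¹ (X m) (fun i j ↦ T i j y) ^ 2 := by
    simp only [gradSq, h1, hXT, pow_two, Finset.sum_mul_sum]
    rw [Finset.sum_comm]
    simp only [Finset.mul_sum]
    rw [Finset.sum_comm]
    symm
    rw [Finset.sum_comm]
    refine Finset.sum_congr rfl fun k _ ↦ ?_
    rw [Finset.sum_comm]
    refine Finset.sum_congr rfl fun l _ ↦ ?_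
    rw [hI, Finset.sum_mul, Finset.sum_mul]
    exact Finset.sum_congr rfl fun m _ ↦ by ring
  change gradSq g _ y ≤ 4 * _ * (∑ k, ∑ l, (g y)⁻¹ k l * pairing (g y)⁻¹ (g y)⁻¹ (D k) (D l))
    ∧ 0 ≤ ∑ k, ∑ l, (g y)⁻¹ k l * pairing (g y)⁻¹ (g y)⁻¹ (D k) (D l)
  rw [hN, hG]
  refine ⟨?_, Finset.sum_nonneg fun m _ ↦ pairing_self_nonneg hB _⟩
  rw [mul_assoc]
  refine mul_le_mul_of_nonneg_left ?_ (by norm_num)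
  rw [Finset.mul_sum]
  refine Finset.sum_le_sum fun m _ ↦ ?_
  rw [mul_comm]
  exact pairing_sq_le hB _ _

/-- The Bianchi identity rewrites `∇_l ∇_k F_ij` by terms in which `k` is an index of `F`. The Ricci
identity then moves `∇_l` next to `F`, where the trace over `k, l` is a divergence and vanishes by
the Yang–Mills equation. Only the commutators `Y` remain. -/
theorem sum_inv_smul_tensorD₂ (hg : IsMetricOn g U)
    (hanti : ∀ x y, br x y = -br y x)
    (hjac : ∀ x y z, br (br x y) z = br x (br y z) - br y (br x z))
    (hA : ∀ k, ContDiffOn ℝ ∞ (A k) U)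
    (hYM : ∀ y ∈ U, ∀ j, ∑ k, ∑ l, (g y)⁻¹ k l •
      tensorD br A (leviCivita g) (curv br A) k l j y = 0) {y : 𝔼 n} (hy : y ∈ U)
    (Y : Fin n → Fin n → V) (hY : ∀ i j, Y i j = ∑ k, ∑ l, (g y)⁻¹ k l •
      (br (curv br A l i y) (curv br A j k y)
        - ∑ s, linCurv (leviCivita g) s j l i y • curv br A s k y
        - ∑ s, linCurv (leviCivita g) s k l i y • curv br A j s y)) (i j : Fin n) :
    ∑ k, ∑ l, (g y)⁻¹ k l • tensorD₂ br A (leviCivita g) (curv br A) k l i j y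
      = Y j i - Y i j := by
  have hU := hg.isOpen
  have hΓ := hg.contDiffOn_leviCivita
  have hΓs : ∀ y ∈ U, ∀ k s i, leviCivita g k y s i = leviCivita g i y s k :=
    fun y hy ↦ hg.leviCivita_symm hy
  have hF := contDiffOn_curv br hU hA
  have hFa : ∀ i j, curv br A i j = fun y ↦ -curv br A j i y :=
    fun i j ↦ funext fun y ↦ curv_antisymm br hanti i j y
  set D := fun l k i j ↦ tensorD₂ br A (leviCivita g) (curv br A) l k i j y with hD
  have h1 : ∀ l i j k, D l i j k = D i l j k + (br (curv br A l i y) (curv br A j k y)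
        - ∑ s, linCurv (leviCivita g) s j l i y • curv br A s k y
        - ∑ s, linCurv (leviCivita g) s k l i y • curv br A j s y) := by
    intro l i j k
    rw [← tensorD₂_sub br hU hjac hA hΓ hΓs hF l i j k hy]
    simp only [hD]
    abel
  have h2 : ∀ l k i j, D l k i j = -D l k j i := fun l k i j ↦ tensorD₂_antisymm br hFa l k i j y
  -- With `∇_i` outermost, the trace inside is the divergence of `F`, up to a sign.
  have h3 : ∀ i j, ∑ k, ∑ l, (g y)⁻¹ k l • D i l j k = 0 := by
    intro i j
    rw [Finset.sum_comm, ← neg_eq_zero, ← sum_tensorD₂_eq_zero br hg hA hF hYM i j hy]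
    simp only [← Finset.sum_neg_distrib]
    refine Finset.sum_congr rfl fun k _ ↦ Finset.sum_congr rfl fun l _ ↦ ?_
    rw [h2, hg.inv_symm hy, smul_neg, neg_neg]
  have h4 : ∀ i j, ∑ k, ∑ l, (g y)⁻¹ k l • D l i j k = Y i j := by
    intro i j
    simp only [h1 _ i j, smul_add, Finset.sum_add_distrib, h3, zero_add, hY]
  have h5 : ∀ l k, D l k i j = -D l i j k + D l j i k := by
    intro l k
    have := tensorD₂_curv_cyclic br hU hanti hjac hA hΓ hΓs l k i j hy
    change D l k i j + D l i j k + D l j k i = 0 at this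
    rw [h2 l j i k, ← sub_eq_zero, ← this]
    abel
  rw [Finset.sum_comm, ← h4, ← h4, ← Finset.sum_sub_distrib]
  refine Finset.sum_congr rfl fun k _ ↦ ?_
  rw [← Finset.sum_sub_distrib]
  refine Finset.sum_congr rfl fun l _ ↦ ?_
  change (g y)⁻¹ l k • D l k i j = _
  rw [h5, hg.inv_symm hy l k, smul_add, smul_neg]
  abel

/-- The Bochner inequality for the energy density of a Yang-Mills field. -/
theorem gradSq_div_sub_le_laplacian [FiniteDimensional ℝ V] (hg : IsMetricOn g U)
    (hanti : ∀ x y, br x y = -br y x)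
    (hjac : ∀ x y z, br (br x y) z = br x (br y z) - br y (br x z))
    (hinv : ∀ x y z : V, inner ℝ (br x y) z = -inner ℝ y (br x z))
    (hbr : ∀ x y, ‖br x y‖ ≤ ‖x‖ * ‖y‖)
    (hA : ∀ k, ContDiffOn ℝ ∞ (A k) U)
    (hYM : ∀ y ∈ U, ∀ j, ∑ k, ∑ l, (g y)⁻¹ k l •
      tensorD br A (leviCivita g) (curv br A) k l j y = 0)
    {y : 𝔼 n} (hy : y ∈ U)
    (hcurv : ∀ L : Matrix (Fin n) (Fin n) ℝ, (∀ i j, L j i = -L i j) →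
      0 ≤ (∑ a, ∑ b, ∑ l, (∑ s, linCurv (leviCivita g) s a s b y) *
          (∑ i, (g y)⁻¹ a i * L i l) * (∑ i, ∑ j, (g y)⁻¹ b i * (g y)⁻¹ l j * L i j))
        - (1 / 2) * ∑ a, ∑ b, ∑ m, ∑ l, (∑ s, g y a s * linCurv (leviCivita g) s b m l y) *
          (∑ i, ∑ j, (g y)⁻¹ a i * (g y)⁻¹ b j * L i j) *
          (∑ i, ∑ j, (g y)⁻¹ m i * (g y)⁻¹ l j * L i j))
    {e : 𝔼 n → ℝ} (he : e = fun z ↦ pairing (g z)⁻¹ (g z)⁻¹ (fun i j ↦ curv br A i j z)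
      (fun i j ↦ curv br A i j z)) {a : ℝ} (ha : 0 < a) (hea : e y ≤ a) :
    gradSq g e y / (2 * a) - 4 * n ^ 3 * (e y * Real.sqrt (e y)) ≤ laplacian g e y := by
  obtain ⟨B, hB⟩ := hg.exists_inv_eq hy
  have hF := contDiffOn_curv br hg.isOpen hA
  have hFa := curv_antisymm br (A := A) hanti
  set F : Fin n → Fin n → V := fun i j ↦ curv br A i j y with hFdef
  set R := fun s b m l ↦ linCurv (leviCivita g) s b m l y with hR
  -- `Y₁` collects the commutators in the Lie algebra, cubic after pairing with `F`; `Y₂` collects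
  -- those with the Riemann tensor.
  set Y₁ : Fin n → Fin n → V := fun i j ↦ ∑ k, ∑ l, (g y)⁻¹ k l • br (F l i) (F j k) with hY₁
  set Y₂ : Fin n → Fin n → V := fun i j ↦ ∑ k, ∑ l, (g y)⁻¹ k l •
    (∑ s, R s j l i • F s k + ∑ s, R s k l i • F j s) with hY₂
  have hY : ∀ i j, Y₁ i j - Y₂ i j = ∑ k, ∑ l, (g y)⁻¹ k l •
      (br (curv br A l i y) (curv br A j k y)
        - ∑ s, linCurv (leviCivita g) s j l i y • curv br A s k y
        - ∑ s, linCurv (leviCivita g) s k l i y • curv br A j s y) := by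
    intro i j
    simp only [hY₁, hY₂, ← Finset.sum_sub_distrib, ← smul_sub, sub_sub]
    rfl
  have hD := sum_inv_smul_tensorD₂ br hg hanti hjac hA hYM hy (fun i j ↦ Y₁ i j - Y₂ i j) hY
  have hlap := laplacian_pairing_self br (A := A) hg hinv hA hF hy
  simp only [hD] at hlap
  rw [← he, pairing_sub_left, pairing_swap] at hlap
  have hsw : (fun i j ↦ curv br A j i y) = fun i j ↦ -F i j := by
    ext1 i; ext1 j; exact hFa j i y
  rw [hsw, pairing_neg_right] at hlap
  obtain ⟨hgrad, hN⟩ := gradSq_pairing_self_le br (A := A) hg hinv hF hy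
  rw [← he] at hgrad
  set N := ∑ k, ∑ l, (g y)⁻¹ k l * pairing (g y)⁻¹ (g y)⁻¹
          (fun i j ↦ tensorD br A (leviCivita g) (curv br A) k i j y)
          (fun i j ↦ tensorD br A (leviCivita g) (curv br A) l i j y)
  have hey : e y = pairing (g y)⁻¹ (g y)⁻¹ F F := by rw [he]
  have hb := abs_pairing_bracket_le br hbr hB F
  rw [← hey] at hb
  change |pairing (g y)⁻¹ (g y)⁻¹ Y₁ F| ≤ _ at hb
  -- In each Lie algebra direction the pairing is the Weitzenböck quadratic form of a real two-form,
  -- nonnegative by hypothesis.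
  have hc : 0 ≤ pairing (g y)⁻¹ (g y)⁻¹ Y₂ F := by
    let b := stdOrthonormalBasis ℝ V
    rw [pairing_eq_sum_pairing b]
    refine Finset.sum_nonneg fun α _ ↦ ?_
    set L : Matrix (Fin n) (Fin n) ℝ := Matrix.of fun i j ↦ inner ℝ (b α) (F i j) with hL
    have hLa : ∀ i j, L j i = -L i j := by
      intro i j
      simp only [hL, Matrix.of_apply, hFdef]
      rw [hFa j i, inner_neg_right]
    have hH := sum_curvature_contraction (Matrix.mul_nonsing_inv _ (hg.isUnit_det hy))
      (hg.transpose_eq hy) (hg.inv_transpose_eq hy) R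
      (fun s i l k ↦ linCurv_antisymm _ s i l k y)
      (fun s i l k ↦ linCurv_cyclic hg.isOpen (fun y hy ↦ hg.leviCivita_symm hy) s i l k hy)
      (fun a b m l ↦ hg.sum_mul_linCurv_antisymm a b m l hy) L hLa
      (Matrix.of fun a b ↦ ∑ i, ∑ j, (g y)⁻¹ a i * (g y)⁻¹ b j * L i j) (fun _ _ ↦ rfl)
    refine le_of_le_of_eq (hcurv L hLa) (hH.symm.trans ?_)
    refine Finset.sum_congr rfl fun i _ ↦ Finset.sum_congr rfl fun j _ ↦ ?_
    rw [mul_comm]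
    congr 1
    simp only [hY₂, inner_sum, real_inner_smul_right, inner_add_right, hL, Matrix.of_apply]
  have hb' := (abs_le.1 hb).2
  rw [pairing_sub_left] at hlap
  -- Kato gives `|∇e|² ≤ 4 e N ≤ 4 a N`. An upper bound `a` in place of `e` avoids dividing by zero
  -- at the zeros of `F`.
  have h1 : gradSq g e y / (2 * a) ≤ 2 * N := by
    rw [div_le_iff₀ (by positivity)]
    refine hgrad.trans ?_
    rw [← hey]
    nlinarith [mul_le_mul_of_nonneg_right hea hN]
  -- `Y₁` enters twice, once for each order of `i, j`, and the Bochner formula doubles it again;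
  -- hence the constant `4 n³`.
  have h2 : laplacian g e y = 2 * (-pairing (g y)⁻¹ (g y)⁻¹ Y₁ F + pairing (g y)⁻¹ (g y)⁻¹ Y₂ F
      - pairing (g y)⁻¹ (g y)⁻¹ Y₁ F + pairing (g y)⁻¹ (g y)⁻¹ Y₂ F + N) := by
    rw [hlap]
    ring
  rw [h2]
  linarith

end Bochner

end YangMills

namespace YangMills

/-! ### Lie algebras with an invariant inner product -/

section InvariantForm

variable {L : Type*} [LieRing L] [LieAlgebra ℝ L] [FiniteDimensional ℝ L]

/-- The inner product space structure given by a positive definite bilinear form. -/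
abbrev innerCoreOfForm {L : Type*} [AddCommGroup L] [Module ℝ L] (Q : L →ₗ[ℝ] L →ₗ[ℝ] ℝ)
    (hsymm : ∀ x y, Q x y = Q y x) (hpos : ∀ x, x ≠ 0 → 0 < Q x x) :
    InnerProductSpace.Core ℝ L where
  inner x y := Q x y
  conj_inner_symm x y := hsymm y x
  re_inner_nonneg x := by
    rcases eq_or_ne x 0 with rfl | h
    · simp
    · exact (hpos x h).le
  add_left x y z := by simp
  smul_left x y r := by simp
  definite x h := by
    by_contra hx
    exact (hpos x hx).ne' h

/-- A semisimple Lie algebra has trivial center. -/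
theorem eq_zero_of_lie_eq_zero {L : Type*} [LieRing L] [LieAlgebra ℝ L]
    [LieAlgebra.IsSemisimple ℝ L] {x : L}
    (h : ∀ y : L, ⁅x, y⁆ = 0) : x = 0 := by
  have hx : x ∈ LieAlgebra.center ℝ L :=
    (LieModule.mem_maxTrivSubmodule ℝ L L x).2 fun y ↦ by rw [← lie_skew, h y, neg_zero]
  rw [LieAlgebra.center_eq_bot] at hx
  exact (LieSubmodule.mem_bot x).1 hx

/-- An invariant inner product forces the Killing form of a semisimple Lie algebra to be negative
definite. -/
theorem killingForm_neg_of_invariant [LieAlgebra.IsSemisimple ℝ L] (Q : L →ₗ[ℝ] L →ₗ[ℝ] ℝ)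
    (hsymm : ∀ x y, Q x y = Q y x) (hpos : ∀ x, x ≠ 0 → 0 < Q x x)
    (hinv : ∀ x y z : L, Q ⁅x, y⁆ z = -Q y ⁅x, z⁆) {x : L} (hx : x ≠ 0) :
    killingForm ℝ L x x < 0 := by
  let c := innerCoreOfForm Q hsymm hpos
  let : NormedAddCommGroup L := c.toNormedAddCommGroup
  let : InnerProductSpace ℝ L := InnerProductSpace.ofCore c.toCore
  have hin : ∀ x y : L, inner ℝ x y = Q x y := fun _ _ ↦ rfl
  -- Invariance makes `ad x` skew-adjoint, so the trace of its square is minus its squared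
  -- Hilbert–Schmidt norm.
  have key : killingForm ℝ L x x
      = -∑ i, ‖⁅x, stdOrthonormalBasis ℝ L i⁆‖ ^ 2 := by
    rw [killingForm_apply_apply, LinearMap.trace_eq_sum_inner _ (stdOrthonormalBasis ℝ L),
      ← Finset.sum_neg_distrib]
    refine Finset.sum_congr rfl fun i _ ↦ ?_
    rw [← real_inner_self_eq_norm_sq, hin, hin]
    have := hinv x (stdOrthonormalBasis ℝ L i) ⁅x, stdOrthonormalBasis ℝ L i⁆
    simp only [LinearMap.comp_apply, LieAlgebra.ad_apply]
    linarith
  rw [key, neg_lt_zero]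
  by_contra hle
  have hzero : ∀ i, ⁅x, stdOrthonormalBasis ℝ L i⁆ = 0 := by
    intro i
    have h0 := (Finset.sum_eq_zero_iff_of_nonneg (fun i _ ↦ by positivity)).1
      (le_antisymm (not_lt.1 hle) (Finset.sum_nonneg (fun i _ ↦ by positivity))) i
      (Finset.mem_univ i)
    simpa using h0
  -- If that norm vanishes then `ad x = 0`, so `x` is central, and a semisimple algebra has no
  -- center.
  have had : ∀ y : L, ⁅x, y⁆ = 0 := by
    intro y
    have : (LieAlgebra.ad ℝ L x : L →ₗ[ℝ] L) = 0 :=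
      (stdOrthonormalBasis ℝ L).toBasis.ext fun i ↦ by simpa using hzero i
    exact congrArg (fun T : L →ₗ[ℝ] L ↦ T y) this
  exact hx (eq_zero_of_lie_eq_zero had)

/-- A Lie algebra with negative definite Killing form is isometric to a Euclidean space with a
bracket that is invariant and of norm at most one. -/
theorem exists_euclidean_model {d : ℕ} (hd : Module.finrank ℝ L = d)
    (hneg : ∀ x : L, x ≠ 0 → killingForm ℝ L x x < 0) :
    ∃ (Φ : L ≃ₗ[ℝ] 𝔼 d) (br : 𝔼 d →L[ℝ] 𝔼 d →L[ℝ] 𝔼 d),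
      (∀ x y, inner ℝ (Φ x) (Φ y) = -killingForm ℝ L x y) ∧
      (∀ x y, Φ ⁅x, y⁆ = br (Φ x) (Φ y)) ∧
      (∀ x y, br x y = -br y x) ∧
      (∀ x y z, br (br x y) z = br x (br y z) - br y (br x z)) ∧
      (∀ x y z, inner ℝ (br x y) z = -inner ℝ y (br x z)) ∧
      (∀ x y, ‖br x y‖ ≤ ‖x‖ * ‖y‖) := by
  obtain ⟨Φ, hΦ⟩ : ∃ Φ : L ≃ₗ[ℝ] 𝔼 d, ∀ x y, inner ℝ (Φ x) (Φ y) = -killingForm ℝ L x y := by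
    let c := innerCoreOfForm (-killingForm ℝ L)
      (fun x y ↦ by simp [LieModule.traceForm_comm ℝ L L x y])
      (fun x hx ↦ by simpa using hneg x hx)
    let : NormedAddCommGroup L := c.toNormedAddCommGroup
    let : InnerProductSpace ℝ L := InnerProductSpace.ofCore c.toCore
    let b := (stdOrthonormalBasis ℝ L).reindex (finCongr hd)
    exact ⟨b.repr.toLinearEquiv, fun x y ↦ b.repr.inner_map_map x y⟩
  let br₀ : 𝔼 d →ₗ[ℝ] 𝔼 d →ₗ[ℝ] 𝔼 d := LinearMap.mk₂ ℝ (fun x y ↦ Φ ⁅Φ.symm x, Φ.symm y⁆)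
    (by simp) (by simp) (by simp) (by simp)
  let br : 𝔼 d →L[ℝ] 𝔼 d →L[ℝ] 𝔼 d :=
    LinearMap.toContinuousLinearMap (LinearMap.toContinuousLinearMap.toLinearMap ∘ₗ br₀)
  have hb : ∀ x y, br x y = Φ ⁅Φ.symm x, Φ.symm y⁆ := fun _ _ ↦ rfl
  have hinv : ∀ x y z, inner ℝ (br x y) z = -inner ℝ y (br x z) := by
    intro x y z
    have h1 := hΦ ⁅Φ.symm x, Φ.symm y⁆ (Φ.symm z)
    have h2 := hΦ (Φ.symm y) ⁅Φ.symm x, Φ.symm z⁆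
    simp only [LinearEquiv.apply_symm_apply] at h1 h2
    rw [hb, hb, h1, h2, ← lie_skew, map_neg, LinearMap.neg_apply,
      LieModule.traceForm_apply_lie_apply]
  refine ⟨Φ, br, hΦ, fun x y ↦ by simp [hb], fun x y ↦ ?_, fun x y z ↦ ?_, hinv, fun x y ↦ ?_⟩
  · rw [hb, hb, ← lie_skew, map_neg]
  · simp only [hb, LinearEquiv.symm_apply_apply, ← map_sub]
    rw [lie_lie]
  -- For minus the Killing form, `‖x‖²` is the squared Hilbert–Schmidt norm of `ad x`. It dominates
  -- the operator norm, so the bracket has norm at most one, whatever `d` is.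
  · have htr : ∑ i, ‖br x (EuclideanSpace.basisFun (Fin d) ℝ i)‖ ^ 2 = ‖x‖ ^ 2 := by
      have h1 := hΦ (Φ.symm x) (Φ.symm x)
      rw [LinearEquiv.apply_symm_apply, real_inner_self_eq_norm_sq] at h1
      rw [h1, killingForm_apply_apply, ← LinearMap.trace_conj' _ Φ,
        LinearMap.trace_eq_sum_inner _ (EuclideanSpace.basisFun (Fin d) ℝ),
        ← Finset.sum_neg_distrib]
      refine Finset.sum_congr rfl fun i _ ↦ ?_
      rw [← real_inner_self_eq_norm_sq, hinv]
      simp [LinearEquiv.conj_apply, hb]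
    have hy : br x y = ∑ i, y i • br x (EuclideanSpace.basisFun (Fin d) ℝ i) := by
      conv_lhs => rw [← (EuclideanSpace.basisFun (Fin d) ℝ).sum_repr y]
      simp
    have h2 : ‖br x y‖ ≤ ∑ i, |y i| * ‖br x (EuclideanSpace.basisFun (Fin d) ℝ i)‖ := by
      rw [hy]
      refine (norm_sum_le _ _).trans (Finset.sum_le_sum fun i _ ↦ ?_)
      rw [norm_smul, Real.norm_eq_abs]
    have h3 := Finset.sum_mul_sq_le_sq_mul_sq Finset.univ (fun i ↦ |y i|)
      (fun i ↦ ‖br x (EuclideanSpace.basisFun (Fin d) ℝ i)‖)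
    rw [htr] at h3
    have hyn : ∑ i, |y i| ^ 2 = ‖y‖ ^ 2 := by
      rw [EuclideanSpace.norm_sq_eq]; simp
    rw [hyn] at h3
    rw [← mul_pow] at h3
    exact (h2.trans (abs_le_of_sq_le_sq h3 (by positivity) |> le_of_abs_le)).trans_eq (mul_comm _ _)

end InvariantForm

end YangMills

namespace YangMills

/-! ### Derivatives of maps between manifolds, read in the preferred charts -/

section MDeriv

variable {n m k l : ℕ}
  {N : Type*} [TopologicalSpace N] [ChartedSpace (𝔼 n) N]
  {N' : Type*} [TopologicalSpace N'] [ChartedSpace (𝔼 m) N']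
  {N'' : Type*} [TopologicalSpace N''] [ChartedSpace (𝔼 k) N'']
  {K : Type*} [TopologicalSpace K] [ChartedSpace (𝔼 l) K]

variable (n m) in
/-- The derivative of a map between manifolds as a linear map between the model spaces. -/
def mderiv (f : N → N') (x : N) : 𝔼 n →L[ℝ] 𝔼 m := mfderiv (𝓡 n) (𝓡 m) f x

theorem mderiv_comp {g : N' → N''} {f : N → N'} {x : N}
    (hg : MDifferentiableAt (𝓡 m) (𝓡 k) g (f x)) (hf : MDifferentiableAt (𝓡 n) (𝓡 m) f x) :
    mderiv n k (fun z ↦ g (f z)) x = (mderiv m k g (f x)).comp (mderiv n m f x) :=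
  mfderiv_comp x hg hf

theorem mderiv_comp_of_eq {g : N' → N''} {f : N → N'} {x : N} {y : N'} (hy : f x = y)
    (hg : MDifferentiableAt (𝓡 m) (𝓡 k) g y) (hf : MDifferentiableAt (𝓡 n) (𝓡 m) f x) :
    mderiv n k (fun z ↦ g (f z)) x = (mderiv m k g y).comp (mderiv n m f x) := by
  subst hy; exact mderiv_comp hg hf

theorem mderiv_id (x : N) : mderiv n n (fun z : N ↦ z) x = ContinuousLinearMap.id ℝ (𝔼 n) :=
  mfderiv_id

theorem mderiv_congr {f g : N → N'} {x : N} (h : f =ᶠ[nhds x] g) :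
    mderiv n m f x = mderiv n m g x :=
  h.mfderiv_eq

theorem mderiv_eq_fderiv (f : 𝔼 n → 𝔼 m) (x : 𝔼 n) : mderiv n m f x = fderiv ℝ f x :=
  mfderiv_eq_fderiv

/-- The tangent space at `x` is identified with the model space through the preferred chart at `x`,
so this chart has the identity as its derivative there. -/
theorem mderiv_chartAt_self [IsManifold (𝓡 n) 1 N] (x : N) :
    mderiv n n (chartAt (𝔼 n) x) x = ContinuousLinearMap.id ℝ (𝔼 n) := by
  have := mfderiv_extChartAt_self (I := 𝓡 n) (x := x)
  exact this

theorem mdifferentiableAt_chartAt [IsManifold (𝓡 n) 1 N] {c x : N}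
    (hx : x ∈ (chartAt (𝔼 n) c).source) : MDifferentiableAt (𝓡 n) (𝓡 n) (chartAt (𝔼 n) c) x :=
  mdifferentiableAt_atlas (ChartedSpace.chart_mem_atlas c) hx

theorem mdifferentiableAt_chartAt_symm [IsManifold (𝓡 n) 1 N] {c : N} {y : 𝔼 n}
    (hy : y ∈ (chartAt (𝔼 n) c).target) :
    MDifferentiableAt (𝓡 n) (𝓡 n) (chartAt (𝔼 n) c).symm y :=
  mdifferentiableAt_atlas_symm (ChartedSpace.chart_mem_atlas c) hy

theorem mderiv_chartAt_comp_symm [IsManifold (𝓡 n) 1 N] {c : N} {y : 𝔼 n}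
    (hy : y ∈ (chartAt (𝔼 n) c).target) :
    (mderiv n n (chartAt (𝔼 n) c) ((chartAt (𝔼 n) c).symm y)).comp
      (mderiv n n (chartAt (𝔼 n) c).symm y) = ContinuousLinearMap.id ℝ (𝔼 n) := by
  rw [← mderiv_comp (mdifferentiableAt_chartAt ((chartAt (𝔼 n) c).map_target hy))
    (mdifferentiableAt_chartAt_symm hy), ← mderiv_id y]
  refine mderiv_congr ?_
  filter_upwards [(chartAt (𝔼 n) c).open_target.mem_nhds hy] with z hz
  exact (chartAt (𝔼 n) c).right_inv hz

theorem mderiv_chartAt_symm_comp [IsManifold (𝓡 n) 1 N] {c x : N}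
    (hx : x ∈ (chartAt (𝔼 n) c).source) :
    (mderiv n n (chartAt (𝔼 n) c).symm (chartAt (𝔼 n) c x)).comp (mderiv n n (chartAt (𝔼 n) c) x)
      = ContinuousLinearMap.id ℝ (𝔼 n) := by
  rw [← mderiv_comp (mdifferentiableAt_chartAt_symm ((chartAt (𝔼 n) c).map_source hx))
    (mdifferentiableAt_chartAt hx), ← mderiv_id x]
  refine mderiv_congr ?_
  filter_upwards [(chartAt (𝔼 n) c).open_source.mem_nhds hx] with z hz
  exact (chartAt (𝔼 n) c).left_inv hz

theorem mderiv_chartAt_symm_self [IsManifold (𝓡 n) 1 N] (c : N) :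
    mderiv n n (chartAt (𝔼 n) c).symm (chartAt (𝔼 n) c c) = ContinuousLinearMap.id ℝ (𝔼 n) := by
  have := mderiv_chartAt_symm_comp (mem_chart_source (𝔼 n) c)
  rwa [mderiv_chartAt_self, ContinuousLinearMap.comp_id] at this

theorem mderiv_prod {F : N × N' → N''} {k₁ : K → N} {k₂ : K → N'} {z : K}
    (hF : MDifferentiableAt ((𝓡 n).prod (𝓡 m)) (𝓡 k) F (k₁ z, k₂ z))
    (h₁ : MDifferentiableAt (𝓡 l) (𝓡 n) k₁ z) (h₂ : MDifferentiableAt (𝓡 l) (𝓡 m) k₂ z) :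
    mderiv l k (fun w ↦ F (k₁ w, k₂ w)) z
      = (mderiv n k (fun a ↦ F (a, k₂ z)) (k₁ z)).comp (mderiv l n k₁ z)
        + (mderiv m k (fun b ↦ F (k₁ z, b)) (k₂ z)).comp (mderiv l m k₂ z) := by
  have h := mfderiv_comp (I := 𝓡 l) (I' := (𝓡 n).prod (𝓡 m)) (I'' := 𝓡 k) z hF (h₁.prodMk h₂)
  have hd := mfderiv_prodMk h₁ h₂
  ext1 v
  have h1 : mderiv l k (fun w ↦ F (k₁ w, k₂ w)) z v
      = mfderiv ((𝓡 n).prod (𝓡 m)) (𝓡 k) F (k₁ z, k₂ z)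
        (mfderiv (𝓡 l) ((𝓡 n).prod (𝓡 m)) (fun w ↦ (k₁ w, k₂ w)) z v) :=
    congrArg (fun L ↦ L v) h
  rw [h1, hd, mfderiv_prod_eq_add_apply hF]
  rfl

end MDeriv

end YangMills

namespace YangMills

/-! ### Lie groups in the chart at the identity -/

section LieGroups

variable {d : ℕ} {G : Type*} [TopologicalSpace G] [ChartedSpace (𝔼 d) G] [Group G]

variable (d G) in
/-- The chart at the identity. -/
abbrev oneChart : OpenPartialHomeomorph G (𝔼 d) := chartAt (𝔼 d) (1 : G)

variable (d G) in
/-- The coordinates of the identity. -/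
abbrev origin : 𝔼 d := oneChart d G 1

/-- A binary operation of a Lie group in the chart at the identity. -/
def chartExpr (f : G → G → G) (p : 𝔼 d × 𝔼 d) : 𝔼 d :=
  oneChart d G (f ((oneChart d G).symm p.1) ((oneChart d G).symm p.2))

variable (d G) in
theorem oneChart_symm_origin : (oneChart d G).symm (origin d G) = 1 :=
  (oneChart d G).left_inv (mem_chart_source _ _)

variable (d G) in
theorem origin_mem_target : origin d G ∈ (oneChart d G).target :=
  (oneChart d G).map_source (mem_chart_source _ _)

variable (d G) in
theorem eventually_mem_target : ∀ᶠ x in nhds (origin d G), x ∈ (oneChart d G).target :=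
  (oneChart d G).open_target.mem_nhds (origin_mem_target d G)

variable (d G) in
theorem tendsto_oneChart_symm :
    Filter.Tendsto (oneChart d G).symm (nhds (origin d G)) (nhds 1) := by
  have := (oneChart d G).continuousAt_symm (origin_mem_target d G)
  rwa [ContinuousAt, oneChart_symm_origin] at this

theorem fderiv_chartExpr_snd {f : G → G → G} {p : 𝔼 d × 𝔼 d}
    (h : ContDiffAt ℝ ∞ (chartExpr f) p) (v : 𝔼 d) :
    fderiv ℝ (chartExpr f) p (0, v) = fderiv ℝ (fun y ↦ chartExpr f (p.1, y)) p.2 v := by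
  have h1 : HasFDerivAt (fun y : 𝔼 d ↦ (p.1, y)) (ContinuousLinearMap.inr ℝ (𝔼 d) (𝔼 d)) p.2 :=
    hasFDerivAt_prodMk_right _ _
  have h2 := ((h.differentiableAt (by simp)).hasFDerivAt (x := (p.1, p.2))).comp p.2 h1
  have h3 := h2.fderiv
  change _ = fderiv ℝ (chartExpr f ∘ fun y ↦ (p.1, y)) p.2 v
  rw [h3]; rfl

theorem fderiv_chartExpr_fst {f : G → G → G} {p : 𝔼 d × 𝔼 d}
    (h : ContDiffAt ℝ ∞ (chartExpr f) p) (v : 𝔼 d) :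
    fderiv ℝ (chartExpr f) p (v, 0) = fderiv ℝ (fun x ↦ chartExpr f (x, p.2)) p.1 v := by
  have h1 : HasFDerivAt (fun y : 𝔼 d ↦ (y, p.2)) (ContinuousLinearMap.inl ℝ (𝔼 d) (𝔼 d)) p.1 :=
    hasFDerivAt_prodMk_left _ _
  have h2 := ((h.differentiableAt (by simp)).hasFDerivAt (x := (p.1, p.2))).comp p.1 h1
  have h3 := h2.fderiv
  change _ = fderiv ℝ (chartExpr f ∘ fun y ↦ (y, p.2)) p.1 v
  rw [h3]; rfl

/-- The adjoint representation on the model space. -/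
def adL (g : G) : 𝔼 d →L[ℝ] 𝔼 d := mderiv d d (fun h : G ↦ g * h * g⁻¹) 1

theorem adL_one : adL (d := d) (1 : G) = ContinuousLinearMap.id ℝ (𝔼 d) := by
  unfold adL
  rw [← mderiv_id (1 : G)]
  congr 1
  ext b; group

theorem tendsto_prodMk_origin : Filter.Tendsto (fun x : 𝔼 d ↦ (x, origin d G))
    (nhds (origin d G)) (nhds (origin d G, origin d G)) :=
  (Continuous.prodMk_left _).tendsto _

variable [LieGroup (𝓡 d) ∞ G]

theorem contDiffAt_chartExpr {f : G → G → G}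
    (hf : ContMDiff ((𝓡 d).prod (𝓡 d)) (𝓡 d) ∞ (fun p : G × G ↦ f p.1 p.2)) {p : 𝔼 d × 𝔼 d}
    (h₁ : p.1 ∈ (oneChart d G).target) (h₂ : p.2 ∈ (oneChart d G).target)
    (h : f ((oneChart d G).symm p.1) ((oneChart d G).symm p.2) ∈ (oneChart d G).source) :
    ContDiffAt ℝ ∞ (chartExpr f) p := by
  have hs : ∀ x ∈ (oneChart d G).target, ContMDiffAt (𝓡 d) (𝓡 d) ∞ (oneChart d G).symm x :=
    fun x hx ↦ (contMDiffOn_chart_symm x hx).contMDiffAt ((oneChart d G).open_target.mem_nhds hx)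
  have hs1 : ContMDiffAt 𝓘(ℝ, 𝔼 d × 𝔼 d) (𝓡 d) ∞
      (fun q : 𝔼 d × 𝔼 d ↦ (oneChart d G).symm q.1) p :=
    (hs p.1 h₁).comp p (contDiffAt_fst (𝕜 := ℝ) (n := ∞)).contMDiffAt
  have hs2 : ContMDiffAt 𝓘(ℝ, 𝔼 d × 𝔼 d) (𝓡 d) ∞
      (fun q : 𝔼 d × 𝔼 d ↦ (oneChart d G).symm q.2) p :=
    (hs p.2 h₂).comp p (contDiffAt_snd (𝕜 := ℝ) (n := ∞)).contMDiffAt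
  have hc : ContMDiffAt (𝓡 d) (𝓡 d) ∞ (oneChart d G)
      (f ((oneChart d G).symm p.1) ((oneChart d G).symm p.2)) :=
    (contMDiffOn_chart _ h).contMDiffAt ((oneChart d G).open_source.mem_nhds h)
  exact (hc.comp p ((hf _).comp p (hs1.prodMk hs2))).contDiffAt

theorem eventually_contDiffAt_chartExpr {f : G → G → G}
    (hf : ContMDiff ((𝓡 d).prod (𝓡 d)) (𝓡 d) ∞ (fun p : G × G ↦ f p.1 p.2)) (h1 : f 1 1 = 1) :
    ∀ᶠ p in nhds (origin d G, origin d G), ContDiffAt ℝ ∞ (chartExpr f) p := by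
  have ht : Filter.Tendsto
      (fun p : 𝔼 d × 𝔼 d ↦ f ((oneChart d G).symm p.1) ((oneChart d G).symm p.2))
      (nhds (origin d G, origin d G)) (nhds 1) := by
    have := (hf.continuous.tendsto (1, 1)).comp (((tendsto_oneChart_symm d G).comp
      (continuous_fst.tendsto (origin d G, origin d G))).prodMk_nhds ((tendsto_oneChart_symm d G).comp
      (continuous_snd.tendsto (origin d G, origin d G))))
    rwa [h1] at this
  filter_upwards [ht ((oneChart d G).open_source.mem_nhds (mem_chart_source _ _)),
    (continuous_fst.tendsto (origin d G, origin d G)) (eventually_mem_target d G),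
    (continuous_snd.tendsto (origin d G, origin d G)) (eventually_mem_target d G)] with p h h₁ h₂
  exact contDiffAt_chartExpr hf h₁ h₂ h

theorem contMDiff_mul' : ContMDiff ((𝓡 d).prod (𝓡 d)) (𝓡 d) ∞ (fun p : G × G ↦ p.1 * p.2) :=
  contMDiff_mul (𝓡 d) ∞

variable (d G) in
/-- Second derivative of the multiplication at the identity. -/
def mulHess : 𝔼 d × 𝔼 d →L[ℝ] 𝔼 d × 𝔼 d →L[ℝ] 𝔼 d :=
  fderiv ℝ (fderiv ℝ (chartExpr (d := d) (fun g h : G ↦ g * h))) (origin d G, origin d G)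

variable (d G) in
theorem contDiffAt_mulChart :
    ContDiffAt ℝ ∞ (chartExpr (d := d) (fun g h : G ↦ g * h)) (origin d G, origin d G) :=
  (eventually_contDiffAt_chartExpr contMDiff_mul' (mul_one 1)).self_of_nhds

variable (d G) in
theorem mulHess_symm (p q : 𝔼 d × 𝔼 d) : mulHess d G p q = mulHess d G q p :=
  ((contDiffAt_mulChart d G).isSymmSndFDerivAt (by simpa using ENat.LEInfty.out)).eq p q

variable (d G) in
theorem hasFDerivAt_fderiv_mulChart :
    HasFDerivAt (fderiv ℝ (chartExpr (d := d) (fun g h : G ↦ g * h))) (mulHess d G)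
      (origin d G, origin d G) :=
  (((contDiffAt_mulChart d G).fderiv_right (m := 1) (by norm_cast)).differentiableAt
    (by simp)).hasFDerivAt

theorem mdifferentiableAt_mul_left (g h : G) :
    MDifferentiableAt (𝓡 d) (𝓡 d) (fun b : G ↦ g * b) h :=
  (contMDiff_mul_left (I := 𝓡 d) (n := ∞)).mdifferentiableAt (by simp)

/-- Directional second derivative of a map, first in the direction of the first factor. -/
theorem hasFDerivAt_mulChart_snd (ξ : 𝔼 d) :
    HasFDerivAt (fun x ↦ fderiv ℝ (chartExpr (d := d) (fun g h : G ↦ g * h)) (x, origin d G) (0, ξ))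
      (((mulHess d G).comp (ContinuousLinearMap.inl ℝ (𝔼 d) (𝔼 d))).flip (0, ξ)) (origin d G) := by
  have h1 : HasFDerivAt (fun y : 𝔼 d ↦ (y, origin d G)) (ContinuousLinearMap.inl ℝ (𝔼 d) (𝔼 d))
    (origin d G) := hasFDerivAt_prodMk_left _ _
  have h2 := HasFDerivAt.comp (origin d G) (f := fun y : 𝔼 d ↦ (y, origin d G))
    (hasFDerivAt_fderiv_mulChart d G) h1
  exact ((ContinuousLinearMap.apply ℝ (𝔼 d) ((0, ξ) : 𝔼 d × 𝔼 d)).hasFDerivAt).comp (origin d G) h2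

theorem mderiv_oneChart_symm :
    mderiv d d (oneChart d G).symm (origin d G) = ContinuousLinearMap.id ℝ (𝔼 d) :=
  mderiv_chartAt_symm_self 1

/-- The bracket of vectors in the model space. -/
def brk (G : Type*) [TopologicalSpace G] [ChartedSpace (𝔼 d) G] [Group G] (ξ η : 𝔼 d) : 𝔼 d :=
  @Bracket.bracket (GroupLieAlgebra (𝓡 d) G) (GroupLieAlgebra (𝓡 d) G) _ ξ η

/-- The chain rule through the chart at the identity. The right-hand side is the left-invariant
field generated by `ξ`, which is thus a partial derivative of the multiplication. -/
theorem mul_chart_fderiv_eq : ∀ᶠ x in nhds (origin d G), ∀ ξ : 𝔼 d,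
    fderiv ℝ (chartExpr (d := d) (fun g h : G ↦ g * h)) (x, origin d G) (0, ξ)
      = mderiv d d (oneChart d G) ((oneChart d G).symm x)
        (mderiv d d (fun b : G ↦ (oneChart d G).symm x * b) 1 ξ) := by
  have h0 := eventually_contDiffAt_chartExpr (d := d) (G := G) contMDiff_mul' (mul_one 1)
  have h1 : Filter.Tendsto (fun x : 𝔼 d ↦ (x, origin d G)) (nhds (origin d G))
      (nhds (origin d G, origin d G)) := (Continuous.prodMk_left _).tendsto _
  filter_upwards [h1.eventually h0, eventually_mem_target d G] with x hx hxt ξ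
  rw [fderiv_chartExpr_snd hx, ← mderiv_eq_fderiv]
  have hsrc := (oneChart d G).map_target hxt
  have hmul : MDifferentiableAt (𝓡 d) (𝓡 d) (fun y ↦ (oneChart d G).symm x * (oneChart d G).symm y)
      (origin d G) := by
    have := (mdifferentiableAt_mul_left (d := d) ((oneChart d G).symm x)
      ((oneChart d G).symm (origin d G)))
    exact this.comp (origin d G) (mdifferentiableAt_chartAt_symm (origin_mem_target d G))
  have e1 := mderiv_comp_of_eq (g := oneChart d G) (y := (oneChart d G).symm x)
    (by simp) (mdifferentiableAt_chartAt hsrc) hmul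
  have e2 := mderiv_comp_of_eq (g := fun b : G ↦ (oneChart d G).symm x * b)
    (oneChart_symm_origin d G) (mdifferentiableAt_mul_left _ _)
    (mdifferentiableAt_chartAt_symm (origin_mem_target d G))
  unfold chartExpr
  rw [e1, e2, mderiv_oneChart_symm]
  rfl

theorem fderiv_mulChart_snd_origin (ζ : 𝔼 d) :
    fderiv ℝ (chartExpr (d := d) (fun g h : G ↦ g * h)) (origin d G, origin d G) (0, ζ) = ζ := by
  rw [fderiv_chartExpr_snd (contDiffAt_mulChart d G)]
  have h : (fun y ↦ chartExpr (d := d) (fun g h : G ↦ g * h) (origin d G, y))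
      =ᶠ[nhds (origin d G)] id := by
    filter_upwards [eventually_mem_target d G] with y hy
    simp only [chartExpr, oneChart_symm_origin, one_mul, id]
    exact (oneChart d G).right_inv hy
  rw [h.fderiv_eq, fderiv_id]
  rfl

/-- The bracket is that of left-invariant fields. In the chart these are partial derivatives of the
multiplication, so their Lie bracket at the identity is a skew-symmetrized mixed second derivative.
-/
theorem brk_eq (ξ η : 𝔼 d) :
    brk G ξ η = mulHess d G (ξ, 0) (0, η) - mulHess d G (η, 0) (0, ξ) := by
  have hD : ∀ x : 𝔼 d, mfderivWithin 𝓘(ℝ, 𝔼 d) (𝓡 d) (extChartAt (𝓡 d) (1 : G)).symm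
      (Set.range (𝓡 d)) x = mderiv d d (oneChart d G).symm x := by
    intro x
    rw [show Set.range (𝓡 d) = Set.univ by simp, mfderivWithin_univ]
    rfl
  have hV : ∀ ζ : 𝔼 d, VectorField.mpullbackWithin 𝓘(ℝ, 𝔼 d) (𝓡 d)
      (extChartAt (𝓡 d) (1 : G)).symm
      (@mulInvariantVectorField _ _ _ _ _ _ _ (𝓡 d) G _ _ _ ζ)
      (Set.range (𝓡 d)) =ᶠ[nhds (origin d G)]
      (fun x ↦ fderiv ℝ (chartExpr (d := d) (fun g h : G ↦ g * h)) (x, origin d G) (0, ζ)) := by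
    intro ζ
    filter_upwards [mul_chart_fderiv_eq (d := d) (G := G), eventually_mem_target d G] with x hx hxt
    rw [hx ζ, VectorField.mpullbackWithin_apply, hD x]
    have hinv : ContinuousLinearMap.inverse (mderiv d d (oneChart d G).symm x)
        = mderiv d d (oneChart d G) ((oneChart d G).symm x) := by
      have e2 := mderiv_chartAt_symm_comp (n := d) ((oneChart d G).map_target hxt)
      rw [(oneChart d G).right_inv hxt] at e2
      exact ContinuousLinearMap.inverse_eq e2 (mderiv_chartAt_comp_symm hxt)
    exact congrArg (fun L : 𝔼 d →L[ℝ] 𝔼 d ↦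
      L (mderiv d d (fun b : G ↦ (oneChart d G).symm x * b) 1 ζ)) hinv
  have hbr2 : brk G ξ η = VectorField.lieBracket ℝ
      (fun x ↦ fderiv ℝ (chartExpr (d := d) (fun g h : G ↦ g * h)) (x, origin d G) (0, ξ))
      (fun x ↦ fderiv ℝ (chartExpr (d := d) (fun g h : G ↦ g * h)) (x, origin d G) (0, η))
      (origin d G) := by
    rw [← Filter.EventuallyEq.lieBracket_vectorField_eq (hV ξ) (hV η)]
    have h1 := VectorField.mlieBracketWithin_apply (I := 𝓡 d) (s := Set.univ) (x₀ := (1 : G))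
      (V := @mulInvariantVectorField _ _ _ _ _ _ _ (𝓡 d) G _ _ _ ξ)
      (W := @mulInvariantVectorField _ _ _ _ _ _ _ (𝓡 d) G _ _ _ η)
    rw [mfderiv_extChartAt_self,
      show (extChartAt (𝓡 d) (1 : G)).symm ⁻¹' Set.univ ∩ Set.range (𝓡 d) = Set.univ by simp] at h1
    have h2 : ∀ v : 𝔼 d, ContinuousLinearMap.inverse (ContinuousLinearMap.id ℝ (𝔼 d)) v = v := by
      simp
    exact (h1.trans (h2 _)).trans (congrFun (VectorField.lieBracketWithin_univ (𝕜 := ℝ)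
      (E := 𝔼 d)) _)
  have ho : ∀ ζ : 𝔼 d, fderiv ℝ (chartExpr (d := d) (fun g h : G ↦ g * h))
      (origin d G, origin d G) (0, ζ) = ζ := fderiv_mulChart_snd_origin
  rw [hbr2, VectorField.lieBracket, (hasFDerivAt_mulChart_snd ξ).fderiv,
    (hasFDerivAt_mulChart_snd η).fderiv, ho, ho]
  rfl

/-! ### The adjoint representation and the Maurer–Cartan form -/

theorem mdifferentiableAt_conj (g h : G) :
    MDifferentiableAt (𝓡 d) (𝓡 d) (fun b : G ↦ g * b * g⁻¹) h :=
  ((contMDiff_mul_right (I := 𝓡 d) (n := ∞) (a := g⁻¹)).comp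
    (contMDiff_mul_left (I := 𝓡 d) (n := ∞) (a := g))).mdifferentiableAt (by simp)

theorem adL_mul (g h : G) : adL (d := d) (g * h) = (adL g).comp (adL h) := by
  have := mderiv_comp_of_eq (g := fun b : G ↦ g * b * g⁻¹) (f := fun b : G ↦ h * b * h⁻¹)
    (x := 1) (y := 1) (by simp) (mdifferentiableAt_conj (d := d) g 1) (mdifferentiableAt_conj h 1)
  unfold adL
  rw [← this]
  congr 1
  ext b; group

theorem contMDiff_inv_conj : ContMDiff ((𝓡 d).prod (𝓡 d)) (𝓡 d) ∞
    (fun p : G × G ↦ p.1⁻¹ * p.2 * p.1) :=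
  (((contMDiff_inv (𝓡 d) ∞).comp contMDiff_fst).mul contMDiff_snd).mul contMDiff_fst

theorem contMDiff_leftDiv : ContMDiff ((𝓡 d).prod (𝓡 d)) (𝓡 d) ∞
    (fun p : G × G ↦ p.1⁻¹ * p.2) :=
  ((contMDiff_inv (𝓡 d) ∞).comp contMDiff_fst).mul contMDiff_snd

theorem adL_inv_eq : ∀ᶠ x in nhds (origin d G), adL (d := d) ((oneChart d G).symm x)⁻¹
    = (fderiv ℝ (chartExpr (d := d) (fun g h : G ↦ g⁻¹ * h * g)) (x, origin d G)).comp
      (ContinuousLinearMap.inr ℝ (𝔼 d) (𝔼 d)) := by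
  have h0 := eventually_contDiffAt_chartExpr (d := d) (G := G) (f := fun g h ↦ g⁻¹ * h * g)
    contMDiff_inv_conj (by simp)
  filter_upwards [tendsto_prodMk_origin.eventually h0] with x hx
  ext1 v
  set g := (oneChart d G).symm x with hg
  have hconj : adL (d := d) g⁻¹ = mderiv d d (fun h : G ↦ g⁻¹ * h * g) 1 := by
    unfold adL; congr 1; ext b; group
  have hmd : MDifferentiableAt (𝓡 d) (𝓡 d) (fun h : G ↦ g⁻¹ * h * g) 1 := by
    have := mdifferentiableAt_conj (d := d) g⁻¹ 1
    simpa only [inv_inv] using this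
  have e1 := mderiv_comp_of_eq (g := oneChart d G) (f := fun h : G ↦ g⁻¹ * h * g) (x := 1)
    (y := (1 : G)) (by simp) (mdifferentiableAt_chartAt (mem_chart_source _ _)) hmd
  have e2 := mderiv_comp_of_eq (g := fun h : G ↦ oneChart d G (g⁻¹ * h * g))
    (oneChart_symm_origin d G)
    (MDifferentiableAt.comp (I' := 𝓡 d) (1 : G) (g := oneChart d G) (by
      simpa using mdifferentiableAt_chartAt (n := d) (mem_chart_source (𝔼 d) (1 : G))) hmd)
    (mdifferentiableAt_chartAt_symm (origin_mem_target d G))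
  change _ = fderiv ℝ (chartExpr (d := d) (fun g h : G ↦ g⁻¹ * h * g)) (x, origin d G) (0, v)
  rw [fderiv_chartExpr_snd hx, ← mderiv_eq_fderiv, hconj]
  unfold chartExpr
  rw [e2, e1, mderiv_oneChart_symm, mderiv_chartAt_self]
  rfl

/-- Differentiate `g (g⁻¹ h g) = h g` in `h` at the identity. This implicit equation for `Ad g⁻¹`
yields its derivative without second derivatives of the inversion. -/
theorem mul_adL_inv_eq : ∀ᶠ x in nhds (origin d G), ∀ ξ : 𝔼 d,
    fderiv ℝ (chartExpr (d := d) (fun g h : G ↦ g * h)) (x, origin d G)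
        (0, adL ((oneChart d G).symm x)⁻¹ ξ)
      = fderiv ℝ (chartExpr (d := d) (fun g h : G ↦ g * h)) (origin d G, x) (ξ, 0) := by
  have h0 := eventually_contDiffAt_chartExpr (d := d) (G := G) contMDiff_mul' (mul_one 1)
  have h1 : Filter.Tendsto (fun x : 𝔼 d ↦ (origin d G, x)) (nhds (origin d G))
      (nhds (origin d G, origin d G)) := (Continuous.prodMk_right _).tendsto _
  filter_upwards [mul_chart_fderiv_eq (d := d) (G := G), h1.eventually h0,
    eventually_mem_target d G] with x hm hx hxt ξ
  rw [hm, fderiv_chartExpr_fst hx, ← mderiv_eq_fderiv]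
  set g := (oneChart d G).symm x with hg
  have hsrc : g ∈ (oneChart d G).source := (oneChart d G).map_target hxt
  have hright : MDifferentiableAt (𝓡 d) (𝓡 d) (fun h : G ↦ h * g) 1 :=
    (contMDiff_mul_right (I := 𝓡 d) (n := ∞) (a := g)).mdifferentiableAt (by simp)
  have e1 := mderiv_comp_of_eq (g := fun b : G ↦ g * b) (f := fun h : G ↦ g⁻¹ * h * g⁻¹⁻¹)
    (x := 1) (y := (1 : G)) (by simp) (mdifferentiableAt_mul_left (d := d) g 1)
    (mdifferentiableAt_conj g⁻¹ 1)
  have e0 : (fun z : G ↦ g * (g⁻¹ * z * g⁻¹⁻¹)) = fun h ↦ h * g := by ext z; group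
  rw [e0] at e1
  have e2 := mderiv_comp_of_eq (g := oneChart d G) (f := fun h : G ↦ h * g) (x := 1) (y := g)
    (one_mul g) (mdifferentiableAt_chartAt hsrc) hright
  have e3 := mderiv_comp_of_eq (g := fun h : G ↦ oneChart d G (h * g))
    (oneChart_symm_origin d G)
    (MDifferentiableAt.comp (I' := 𝓡 d) (1 : G) (g := oneChart d G) (by
      rw [one_mul]; exact mdifferentiableAt_chartAt (n := d) hsrc) hright)
    (mdifferentiableAt_chartAt_symm (origin_mem_target d G))
  unfold chartExpr
  rw [e3, e2, e1, mderiv_oneChart_symm]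
  rfl

/-- The derivative of `g ↦ Ad g⁻¹` at the identity is minus the bracket. -/
theorem hasFDerivAt_adL_inv : ∃ T : 𝔼 d →L[ℝ] 𝔼 d →L[ℝ] 𝔼 d,
    HasFDerivAt (fun x ↦ adL (d := d) ((oneChart d G).symm x)⁻¹) T (origin d G) ∧
      ∀ ζ ξ, T ζ ξ = brk G ξ ζ := by
  have hl : HasFDerivAt (fun y : 𝔼 d ↦ (y, origin d G)) (ContinuousLinearMap.inl ℝ (𝔼 d) (𝔼 d))
    (origin d G) := hasFDerivAt_prodMk_left _ _
  have hr : HasFDerivAt (fun y : 𝔼 d ↦ (origin d G, y)) (ContinuousLinearMap.inr ℝ (𝔼 d) (𝔼 d))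
    (origin d G) := hasFDerivAt_prodMk_right _ _
  have hc := (eventually_contDiffAt_chartExpr (d := d) (G := G) (f := fun g h ↦ g⁻¹ * h * g)
    contMDiff_inv_conj (by simp)).self_of_nhds
  have hc1 : DifferentiableAt ℝ (fderiv ℝ (chartExpr (d := d) (fun g h : G ↦ g⁻¹ * h * g)))
      (origin d G, origin d G) :=
    (hc.fderiv_right (m := 1) (by norm_cast)).differentiableAt (by simp)
  have hA : DifferentiableAt ℝ (fun x ↦ adL (d := d) ((oneChart d G).symm x)⁻¹) (origin d G) := by
    refine DifferentiableAt.congr_of_eventuallyEq ?_ adL_inv_eq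
    exact (DifferentiableAt.comp (origin d G) (f := fun y : 𝔼 d ↦ (y, origin d G)) hc1
      hl.differentiableAt).clm_comp (differentiableAt_const _)
  refine ⟨_, hA.hasFDerivAt, fun ζ ξ ↦ ?_⟩
  set T := fderiv ℝ (fun x ↦ adL (d := d) ((oneChart d G).symm x)⁻¹) (origin d G)
  have h1 := HasFDerivAt.comp (origin d G) (f := fun y : 𝔼 d ↦ (y, origin d G))
    (hasFDerivAt_fderiv_mulChart d G) hl
  have h2 := HasFDerivAt.comp (origin d G) (f := fun y : 𝔼 d ↦ (origin d G, y))
    (hasFDerivAt_fderiv_mulChart d G) hr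
  have h3 := (ContinuousLinearMap.inr ℝ (𝔼 d) (𝔼 d)).hasFDerivAt.comp (origin d G)
    (((ContinuousLinearMap.apply ℝ (𝔼 d) ξ).hasFDerivAt).comp (origin d G) hA.hasFDerivAt)
  have h4 := h1.clm_apply h3
  have h5 := ((ContinuousLinearMap.apply ℝ (𝔼 d) ((ξ, 0) : 𝔼 d × 𝔼 d)).hasFDerivAt).comp
    (origin d G) h2
  have h6 := h5.congr_of_eventuallyEq ((mul_adL_inv_eq (d := d) (G := G)).mono fun x hx ↦ hx ξ)
  have h7 := congrArg (fun L : 𝔼 d →L[ℝ] 𝔼 d ↦ L ζ) (h4.unique h6)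
  -- Both sides of `mul_adL_inv_eq` differentiated at the identity along `ζ`. By symmetry of the
  -- second derivative the difference of the two Hessian terms is the bracket.
  have h8 : fderiv ℝ (chartExpr (d := d) (fun g h : G ↦ g * h)) (origin d G, origin d G)
      (0, T ζ ξ) + mulHess d G (ζ, 0) (0, adL (d := d) ((oneChart d G).symm (origin d G))⁻¹ ξ)
      = mulHess d G (0, ζ) (ξ, 0) := h7
  rw [fderiv_mulChart_snd_origin, oneChart_symm_origin, inv_one, adL_one] at h8
  rw [brk_eq, mulHess_symm d G (ξ, 0), ← h8]
  simp

/-- The left-logarithmic derivative in the chart at the identity. -/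
def maurerCartan (G : Type*) [TopologicalSpace G] [ChartedSpace (𝔼 d) G] [Group G]
    (x : 𝔼 d) : 𝔼 d →L[ℝ] 𝔼 d :=
  mderiv d d (fun y ↦ ((oneChart d G).symm x)⁻¹ * (oneChart d G).symm y) x

theorem mdifferentiableAt_leftDiv {x : 𝔼 d} (hx : x ∈ (oneChart d G).target) (g : G) :
    MDifferentiableAt (𝓡 d) (𝓡 d) (fun y ↦ g * (oneChart d G).symm y) x :=
  (mdifferentiableAt_mul_left (d := d) g ((oneChart d G).symm x)).comp x
    (mdifferentiableAt_chartAt_symm hx)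

/-- Left translation undoes the left-logarithmic derivative. As above, the implicit equation is what
gets differentiated at the identity. -/
theorem mul_maurerCartan_eq : ∀ᶠ x in nhds (origin d G), ∀ v : 𝔼 d,
    fderiv ℝ (chartExpr (d := d) (fun g h : G ↦ g * h)) (x, origin d G) (0, maurerCartan G x v)
      = v := by
  filter_upwards [mul_chart_fderiv_eq (d := d) (G := G), eventually_mem_target d G] with x hm hxt v
  rw [hm]
  set g := (oneChart d G).symm x with hg
  have e1 := mderiv_comp_of_eq (g := fun b : G ↦ g * b) (f := fun y ↦ g⁻¹ * (oneChart d G).symm y)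
    (x := x) (y := (1 : G)) (by simp [hg]) (mdifferentiableAt_mul_left (d := d) g 1)
    (mdifferentiableAt_leftDiv hxt _)
  have e0 : (fun z ↦ g * (g⁻¹ * (oneChart d G).symm z)) = (oneChart d G).symm := by ext z; simp
  rw [e0] at e1
  have e2 := mderiv_chartAt_comp_symm (n := d) (c := (1 : G)) hxt
  rw [e1] at e2
  exact congrArg (fun L : 𝔼 d →L[ℝ] 𝔼 d ↦ L v) e2

theorem maurerCartan_eq : ∀ᶠ x in nhds (origin d G), maurerCartan G x
    = (fderiv ℝ (chartExpr (d := d) (fun g h : G ↦ g⁻¹ * h)) (x, x)).comp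
      (ContinuousLinearMap.inr ℝ (𝔼 d) (𝔼 d)) := by
  have h0 := eventually_contDiffAt_chartExpr (d := d) (G := G) (f := fun g h ↦ g⁻¹ * h)
    contMDiff_leftDiv (by simp)
  have h1 : Filter.Tendsto (fun x : 𝔼 d ↦ (x, x)) (nhds (origin d G))
      (nhds (origin d G, origin d G)) := (continuous_id.prodMk continuous_id).tendsto _
  filter_upwards [h1.eventually h0, eventually_mem_target d G] with x hx hxt
  ext1 v
  have e1 := mderiv_comp_of_eq (g := oneChart d G) (x := x)
    (f := fun y ↦ ((oneChart d G).symm x)⁻¹ * (oneChart d G).symm y)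
    (y := (1 : G)) (by simp) (mdifferentiableAt_chartAt (mem_chart_source _ _))
    (mdifferentiableAt_leftDiv hxt _)
  change _ = fderiv ℝ (chartExpr (d := d) (fun g h : G ↦ g⁻¹ * h)) (x, x) (0, v)
  rw [fderiv_chartExpr_snd hx, ← mderiv_eq_fderiv]
  unfold chartExpr
  rw [e1, mderiv_chartAt_self]
  rfl

theorem maurerCartan_origin :
    maurerCartan (d := d) G (origin d G) = ContinuousLinearMap.id ℝ (𝔼 d) := by
  ext1 v
  have := (mul_maurerCartan_eq (d := d) (G := G)).self_of_nhds v
  rw [fderiv_mulChart_snd_origin] at this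
  rw [this]; rfl

/-- The Maurer–Cartan equation at the identity. -/
theorem hasFDerivAt_maurerCartan : ∃ T : 𝔼 d →L[ℝ] 𝔼 d →L[ℝ] 𝔼 d,
    HasFDerivAt (maurerCartan (d := d) G) T (origin d G) ∧
      ∀ u v, T u v - T v u = -brk G u v := by
  have hl : HasFDerivAt (fun y : 𝔼 d ↦ (y, origin d G)) (ContinuousLinearMap.inl ℝ (𝔼 d) (𝔼 d))
    (origin d G) := hasFDerivAt_prodMk_left _ _
  have hc := (eventually_contDiffAt_chartExpr (d := d) (G := G) (f := fun g h ↦ g⁻¹ * h)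
    contMDiff_leftDiv (by simp)).self_of_nhds
  have hc1 : DifferentiableAt ℝ (fderiv ℝ (chartExpr (d := d) (fun g h : G ↦ g⁻¹ * h)))
      (origin d G, origin d G) :=
    (hc.fderiv_right (m := 1) (by norm_cast)).differentiableAt (by simp)
  have hA : DifferentiableAt ℝ (maurerCartan (d := d) G) (origin d G) := by
    refine DifferentiableAt.congr_of_eventuallyEq ?_ maurerCartan_eq
    exact (DifferentiableAt.comp (origin d G) (f := fun y : 𝔼 d ↦ (y, y)) hc1
      (differentiableAt_id.prodMk (𝕜 := ℝ) differentiableAt_id)).clm_comp (differentiableAt_const _)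
  set T := fderiv ℝ (maurerCartan (d := d) G) (origin d G) with hT
  -- The right-hand side of `mul_maurerCartan_eq` is constant in `x`, so the derivative of the
  -- Maurer–Cartan form cancels the Hessian of the multiplication.
  have key : ∀ u v, T u v = -mulHess d G (u, 0) (0, v) := by
    intro u v
    have h1 := HasFDerivAt.comp (origin d G) (f := fun y : 𝔼 d ↦ (y, origin d G))
      (hasFDerivAt_fderiv_mulChart d G) hl
    have h3 := (ContinuousLinearMap.inr ℝ (𝔼 d) (𝔼 d)).hasFDerivAt.comp (origin d G)
      (((ContinuousLinearMap.apply ℝ (𝔼 d) v).hasFDerivAt).comp (origin d G) hA.hasFDerivAt)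
    have h4 := h1.clm_apply h3
    have h6 := (hasFDerivAt_const (𝕜 := ℝ) v (origin d G)).congr_of_eventuallyEq
      ((mul_maurerCartan_eq (d := d) (G := G)).mono fun x hx ↦ hx v)
    have h7 := congrArg (fun L : 𝔼 d →L[ℝ] 𝔼 d ↦ L u) (h4.unique h6)
    have h8 : fderiv ℝ (chartExpr (d := d) (fun g h : G ↦ g * h)) (origin d G, origin d G)
        (0, T u v) + mulHess d G (u, 0) (0, maurerCartan G (origin d G) v) = 0 := h7
    rw [fderiv_mulChart_snd_origin, maurerCartan_origin] at h8
    exact eq_neg_of_add_eq_zero_left h8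
  refine ⟨T, hA.hasFDerivAt, fun u v ↦ ?_⟩
  rw [key, key, brk_eq]
  abel

/-- The adjoint representation acts by automorphisms of the bracket. -/
theorem adL_brk (g : G) (ξ η : 𝔼 d) : adL g (brk G ξ η) = brk G (adL g ξ) (adL g η) := by
  obtain ⟨T, hT, hTb⟩ := hasFDerivAt_adL_inv (d := d) (G := G)
  have ho := oneChart_symm_origin d G
  set c : 𝔼 d → 𝔼 d := fun x ↦ oneChart d G (g * (oneChart d G).symm x * g⁻¹) with hc
  have hco : c (origin d G) = origin d G := by simp [hc]
  have hmd1 : MDifferentiableAt (𝓡 d) (𝓡 d) (fun h : G ↦ oneChart d G (g * h * g⁻¹)) 1 :=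
    MDifferentiableAt.comp (I' := 𝓡 d) (1 : G) (g := oneChart d G) (by
      simpa using mdifferentiableAt_chartAt (n := d) (mem_chart_source (𝔼 d) (1 : G)))
      (mdifferentiableAt_conj g 1)
  have hmd : MDifferentiableAt (𝓡 d) (𝓡 d) c (origin d G) := by
    refine MDifferentiableAt.comp (I' := 𝓡 d) (origin d G) (g := fun h : G ↦ oneChart d G (g * h * g⁻¹))
      (by rwa [ho]) (mdifferentiableAt_chartAt_symm (origin_mem_target d G))
  have hder : fderiv ℝ c (origin d G) = adL g := by
    rw [← mderiv_eq_fderiv, hc, mderiv_comp_of_eq (g := fun h : G ↦ oneChart d G (g * h * g⁻¹)) ho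
      hmd1 (mdifferentiableAt_chartAt_symm (origin_mem_target d G)), mderiv_oneChart_symm,
      mderiv_comp_of_eq (g := oneChart d G) (f := fun h : G ↦ g * h * g⁻¹) (x := 1) (y := (1 : G))
        (by simp) (mdifferentiableAt_chartAt (mem_chart_source _ _)) (mdifferentiableAt_conj g 1),
      mderiv_chartAt_self]
    rfl
  have hcd : HasFDerivAt c (adL g) (origin d G) := by
    rw [← hder]; exact hmd.differentiableAt.hasFDerivAt
  have hT' : HasFDerivAt (fun x ↦ adL (d := d) ((oneChart d G).symm x)⁻¹) T (c (origin d G)) := by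
    rwa [hco]
  have h1 := (hT'.comp (origin d G) hcd).clm_comp (hasFDerivAt_const (adL g) (origin d G))
  have h2 := (hasFDerivAt_const (adL g) (origin d G)).clm_comp hT
  -- The relation `(g x g⁻¹)⁻¹ g = g x⁻¹`, read through `Ad`. Its derivative at `x = 1` along `η`,
  -- applied to `ξ`, is the claim.
  have hev : (fun x ↦ (adL (d := d) ((oneChart d G).symm (c x))⁻¹).comp (adL g))
      =ᶠ[nhds (origin d G)] fun x ↦ (adL g).comp (adL (d := d) ((oneChart d G).symm x)⁻¹) := by
    have ht : Filter.Tendsto (fun x ↦ g * (oneChart d G).symm x * g⁻¹) (nhds (origin d G))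
        (nhds (1 : G)) := by
      have hcont : ContinuousAt (fun b : G ↦ g * b * g⁻¹) 1 :=
        (mdifferentiableAt_conj (d := d) g 1).continuousAt
      have h := hcont.tendsto.comp (tendsto_oneChart_symm d G)
      rw [show g * 1 * g⁻¹ = 1 by simp] at h
      exact h
    filter_upwards [ht ((oneChart d G).open_source.mem_nhds (mem_chart_source _ _))] with x hx
    rw [hc, (oneChart d G).left_inv hx, ← adL_mul, ← adL_mul]
    congr 1; group
  have h3 := congrArg (fun L : 𝔼 d →L[ℝ] (𝔼 d →L[ℝ] 𝔼 d) ↦ L η ξ)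
    (h1.unique (h2.congr_of_eventuallyEq hev))
  simp only [ContinuousLinearMap.comp_apply,
    ContinuousLinearMap.compL_apply, ContinuousLinearMap.flip_apply,
    ContinuousLinearMap.comp_zero, add_zero, zero_add, hTb] at h3
  exact h3.symm

end LieGroups

end YangMills

namespace YangMills

/-! ### Compact semisimple Lie groups -/

section CompactGroups

variable {d : ℕ} {G : Type*} [TopologicalSpace G] [ChartedSpace (𝔼 d) G] [Group G]
  [LieGroup (𝓡 d) ∞ G]

/-- Differentiability gives continuity at the identity, and multiplicativity of `Ad` transports it
to every point. -/
theorem continuous_adL_inv : Continuous (fun g : G ↦ adL (d := d) g⁻¹) := by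
  have : IsTopologicalGroup G := topologicalGroup_of_lieGroup (𝓡 d) ∞
  have h1 : ContinuousAt (fun g : G ↦ adL (d := d) g⁻¹) 1 := by
    obtain ⟨T, hT, -⟩ := hasFDerivAt_adL_inv (d := d) (G := G)
    have h2 : ContinuousAt (fun g : G ↦ adL (d := d) ((oneChart d G).symm (oneChart d G g))⁻¹) 1 :=
      ContinuousAt.comp (f := oneChart d G) hT.continuousAt
        ((oneChart d G).continuousAt (mem_chart_source _ _))
    refine h2.congr ?_
    filter_upwards [(oneChart d G).open_source.mem_nhds (mem_chart_source _ (1 : G))] with g hg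
    rw [(oneChart d G).left_inv hg]
  refine continuous_iff_continuousAt.2 fun g₀ ↦ ?_
  have h3 : (fun g : G ↦ adL (d := d) g⁻¹)
      = fun g ↦ (adL (d := d) (g₀⁻¹ * g)⁻¹).comp (adL g₀⁻¹) := by
    ext1 g
    rw [← adL_mul]
    congr 1; group
  rw [h3]
  have h4 : ContinuousAt (fun g : G ↦ adL (d := d) (g₀⁻¹ * g)⁻¹) g₀ := by
    refine ContinuousAt.comp (f := fun g : G ↦ g₀⁻¹ * g) (g := fun g : G ↦ adL (d := d) g⁻¹) ?_
      (continuous_const_mul g₀⁻¹).continuousAt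
    simpa using h1
  exact h4.clm_comp continuousAt_const

theorem adL_inv_apply_adL (g : G) (ξ : 𝔼 d) : adL g⁻¹ (adL g ξ) = ξ := by
  have : (adL (d := d) g⁻¹).comp (adL g) = ContinuousLinearMap.id ℝ _ := by
    rw [← adL_mul, inv_mul_cancel, adL_one]
  exact congrArg (fun L : 𝔼 d →L[ℝ] 𝔼 d ↦ L ξ) this

/-- A compact Lie group has an invariant inner product on its Lie algebra. -/
theorem exists_adL_invariant_form [CompactSpace G] : ∃ Q : 𝔼 d →L[ℝ] 𝔼 d →L[ℝ] ℝ,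
    (∀ x y, Q x y = Q y x) ∧ (∀ x, x ≠ 0 → 0 < Q x x) ∧
      ∀ (g : G) x y, Q (adL g x) (adL g y) = Q x y := by
  have : IsTopologicalGroup G := topologicalGroup_of_lieGroup (𝓡 d) ∞
  let _ : MeasurableSpace G := borel G
  have : BorelSpace G := ⟨rfl⟩
  let μ : Measure G := Measure.haar
  have hcont : ∀ x y : 𝔼 d, Continuous fun g : G ↦ inner ℝ (adL g⁻¹ x) (adL g⁻¹ y) := fun x y ↦
    (continuous_adL_inv.clm_apply continuous_const).inner
      (continuous_adL_inv.clm_apply continuous_const)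
  have hint : ∀ x y : 𝔼 d, Integrable (fun g : G ↦ inner ℝ (adL g⁻¹ x) (adL g⁻¹ y)) μ :=
    fun x y ↦ (hcont x y).integrable_of_hasCompactSupport (HasCompactSupport.of_compactSpace _)
  let Q₀ : 𝔼 d →ₗ[ℝ] 𝔼 d →ₗ[ℝ] ℝ := LinearMap.mk₂ ℝ
    (fun x y ↦ ∫ g : G, inner ℝ (adL g⁻¹ x) (adL g⁻¹ y) ∂μ)
    (fun x x' y ↦ by
      simp only [map_add, inner_add_left]; exact integral_add (hint x y) (hint x' y))
    (fun r x y ↦ by simp only [map_smul, real_inner_smul_left]; exact integral_const_mul _ _)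
    (fun x y y' ↦ by
      simp only [map_add, inner_add_right]; exact integral_add (hint x y) (hint x y'))
    (fun r x y ↦ by simp only [map_smul, real_inner_smul_right]; exact integral_const_mul _ _)
  refine ⟨LinearMap.toContinuousLinearMap (LinearMap.toContinuousLinearMap.toLinearMap ∘ₗ Q₀),
    fun x y ↦ ?_, fun x hx ↦ ?_, fun g x y ↦ ?_⟩
  · change ∫ g : G, inner ℝ (adL g⁻¹ x) (adL g⁻¹ y) ∂μ
      = ∫ g : G, inner ℝ (adL g⁻¹ y) (adL g⁻¹ x) ∂μ
    simp only [real_inner_comm]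
  · change 0 < ∫ g : G, inner ℝ (adL g⁻¹ x) (adL g⁻¹ x) ∂μ
    refine (hcont x x).integral_pos_of_hasCompactSupport_nonneg_nonzero
      (HasCompactSupport.of_compactSpace _) (fun g ↦ real_inner_self_nonneg) (x := 1) ?_
    simpa [adL_one] using hx
  · change ∫ h : G, inner ℝ (adL h⁻¹ (adL g x)) (adL h⁻¹ (adL g y)) ∂μ
      = ∫ h : G, inner ℝ (adL h⁻¹ x) (adL h⁻¹ y) ∂μ
    -- Left invariance of Haar measure under the substitution `h ↦ g⁻¹ h`.
    rw [← integral_mul_left_eq_self (fun h : G ↦ inner ℝ (adL h⁻¹ x) (adL h⁻¹ y)) g⁻¹]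
    refine integral_congr_ae (Filter.Eventually.of_forall fun h ↦ ?_)
    have e : ∀ z : 𝔼 d, adL (g⁻¹ * h)⁻¹ z = adL h⁻¹ (adL g z) := by
      intro z
      rw [mul_inv_rev, inv_inv, adL_mul]; rfl
    simp only [e]

/-- The function `g ↦ Q (Ad g⁻¹ ξ) (Ad g⁻¹ η)` is constant; its derivative at the identity along `ζ`
vanishes. -/
theorem brk_invariant_of_adL_invariant {Q : 𝔼 d →L[ℝ] 𝔼 d →L[ℝ] ℝ}
    (hQ : ∀ (g : G) x y, Q (adL g x) (adL g y) = Q x y) (ζ ξ η : 𝔼 d) :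
    Q (brk G ξ ζ) η + Q ξ (brk G η ζ) = 0 := by
  obtain ⟨T, hT, hTb⟩ := hasFDerivAt_adL_inv (d := d) (G := G)
  have h1 : ∀ z : 𝔼 d, HasFDerivAt (fun x ↦ adL (d := d) ((oneChart d G).symm x)⁻¹ z)
      (T.flip z) (origin d G) := fun z ↦
    ((ContinuousLinearMap.apply ℝ (𝔼 d) z).hasFDerivAt).comp (origin d G) hT
  have h2 := (Q.hasFDerivAt.comp (origin d G) (h1 ξ)).clm_apply (h1 η)
  have h3 := h2.unique ((hasFDerivAt_const (𝕜 := ℝ) (Q ξ η) (origin d G)).congr_of_eventuallyEq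
    (Filter.Eventually.of_forall fun x ↦ hQ _ ξ η))
  have h4 : Q (adL (d := d) ((oneChart d G).symm (origin d G))⁻¹ ξ) (T ζ η)
      + Q (T ζ ξ) (adL (d := d) ((oneChart d G).symm (origin d G))⁻¹ η) = 0 :=
    congrArg (fun L : 𝔼 d →L[ℝ] ℝ ↦ L ζ) h3
  rw [oneChart_symm_origin, inv_one, adL_one, hTb, hTb, add_comm] at h4
  exact h4

instance : FiniteDimensional ℝ (GroupLieAlgebra (𝓡 d) G) :=
  inferInstanceAs (FiniteDimensional ℝ (𝔼 d))

theorem finrank_groupLieAlgebra {d : ℕ} {G : Type*} [TopologicalSpace G] [ChartedSpace (𝔼 d) G]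
    [Group G] : Module.finrank ℝ (GroupLieAlgebra (𝓡 d) G) = d := by
  have : Module.finrank ℝ (𝔼 d) = d := by simp
  exact this

theorem killingForm_groupLieAlgebra_neg [CompactSpace G]
    [LieAlgebra.IsSemisimple ℝ (GroupLieAlgebra (𝓡 d) G)] {x : GroupLieAlgebra (𝓡 d) G}
    (hx : x ≠ 0) : killingForm ℝ (GroupLieAlgebra (𝓡 d) G) x x < 0 := by
  obtain ⟨Q, hsymm, hpos, hinv⟩ := exists_adL_invariant_form (d := d) (G := G)
  let Q' : GroupLieAlgebra (𝓡 d) G →ₗ[ℝ] GroupLieAlgebra (𝓡 d) G →ₗ[ℝ] ℝ :=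
    LinearMap.mk₂ ℝ (fun x y ↦ Q x y) (fun a b c ↦ congrArg (fun L : 𝔼 d →L[ℝ] ℝ ↦ L c) (map_add Q a b))
      (fun r a b ↦ congrArg (fun L : 𝔼 d →L[ℝ] ℝ ↦ L b) (map_smul Q r a))
      (fun a b c ↦ map_add (Q a) b c) (fun r a b ↦ map_smul (Q a) r b)
  refine killingForm_neg_of_invariant Q' hsymm hpos (fun a b c ↦ ?_) hx
  have h := brk_invariant_of_adL_invariant hinv a b c
  have e1 : ⁅a, b⁆ = -⁅b, a⁆ := (lie_skew a b).symm
  have e2 : ⁅a, c⁆ = -⁅c, a⁆ := (lie_skew a c).symm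
  rw [e1, e2, map_neg, map_neg, LinearMap.neg_apply, neg_neg]
  exact neg_eq_of_add_eq_zero_right h

/-- The adjoint representation by Lie algebra automorphisms. -/
def adEquiv (g : G) : GroupLieAlgebra (𝓡 d) G ≃ₗ⁅ℝ⁆ GroupLieAlgebra (𝓡 d) G where
  toFun := fun x ↦ adL (d := d) g x
  map_add' := map_add (adL (d := d) g)
  map_smul' := map_smul (adL (d := d) g)
  map_lie' := fun {x y} ↦ adL_brk g x y
  invFun := fun x ↦ adL (d := d) g⁻¹ x
  left_inv := fun x ↦ adL_inv_apply_adL g x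
  right_inv := fun x ↦ by
    have := adL_inv_apply_adL (d := d) g⁻¹ x
    rwa [inv_inv] at this

/-- The Lie algebra of a compact semisimple Lie group as a Euclidean space, with minus the Killing
form as inner product. -/
theorem exists_groupLieAlgebra_model (d : ℕ) (G : Type*) [TopologicalSpace G]
    [ChartedSpace (𝔼 d) G] [Group G] [LieGroup (𝓡 d) ∞ G] [CompactSpace G]
    [LieAlgebra.IsSemisimple ℝ (GroupLieAlgebra (𝓡 d) G)] :
    ∃ (Φ : 𝔼 d ≃L[ℝ] 𝔼 d) (br : 𝔼 d →L[ℝ] 𝔼 d →L[ℝ] 𝔼 d),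
      (∀ x y : GroupLieAlgebra (𝓡 d) G,
        inner ℝ (Φ x) (Φ y) = -killingForm ℝ (GroupLieAlgebra (𝓡 d) G) x y) ∧
      (∀ x y, Φ (brk G x y) = br (Φ x) (Φ y)) ∧
      (∀ x y, br x y = -br y x) ∧
      (∀ x y z, br (br x y) z = br x (br y z) - br y (br x z)) ∧
      (∀ x y z, inner ℝ (br x y) z = -inner ℝ y (br x z)) ∧
      (∀ x y, ‖br x y‖ ≤ ‖x‖ * ‖y‖) ∧
      ∀ (g : G) x y, inner ℝ (Φ (adL g x)) (Φ (adL g y)) = inner ℝ (Φ x) (Φ y) := by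
  obtain ⟨Φ, br, h1, h2, h3, h4, h5, h6⟩ := exists_euclidean_model
    (L := GroupLieAlgebra (𝓡 d) G) finrank_groupLieAlgebra
    fun x hx ↦ killingForm_groupLieAlgebra_neg hx
  let Φ' : 𝔼 d ≃ₗ[ℝ] 𝔼 d := Φ
  refine ⟨Φ'.toContinuousLinearEquiv, br, h1, h2, h3, h4, h5, h6, fun g x y ↦ ?_⟩
  have := LieAlgebra.killingForm_of_equiv_apply (adEquiv (d := d) g) x y
  refine (h1 (adL (d := d) g x) (adL (d := d) g y)).trans (Eq.trans ?_ (h1 x y).symm)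
  exact congrArg Neg.neg this

end CompactGroups

end YangMills

namespace YangMills

/-! ### Curvature of Lie algebra valued one-forms -/

section CurvForm

variable {n d : ℕ} {G : Type v} [TopologicalSpace G] [ChartedSpace (𝔼 d) G] [Group G]

variable (d G) in
/-- The bracket as a continuous bilinear map, in the model space. -/
def brkL [LieGroup (𝓡 d) ∞ G] : 𝔼 d →L[ℝ] 𝔼 d →L[ℝ] 𝔼 d :=
  (((mulHess d G).comp (ContinuousLinearMap.inl ℝ (𝔼 d) (𝔼 d))).flip.comp
      (ContinuousLinearMap.inr ℝ (𝔼 d) (𝔼 d))).flip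
    - (((mulHess d G).comp (ContinuousLinearMap.inl ℝ (𝔼 d) (𝔼 d))).flip.comp
      (ContinuousLinearMap.inr ℝ (𝔼 d) (𝔼 d)))

theorem brkL_apply [LieGroup (𝓡 d) ∞ G] (ξ η : 𝔼 d) : brkL d G ξ η = brk G ξ η := by
  rw [brk_eq]; rfl

/-- The curvature `dA + [A, A]/2` of a one-form with values in the model space of a Lie algebra. -/
def curvForm (br : 𝔼 d →L[ℝ] 𝔼 d →L[ℝ] 𝔼 d) (a : 𝔼 n → 𝔼 n →L[ℝ] 𝔼 d) (y v w : 𝔼 n) : 𝔼 d :=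
  fderiv ℝ a y v w - fderiv ℝ a y w v + br (a y v) (a y w)

variable {br : 𝔼 d →L[ℝ] 𝔼 d →L[ℝ] 𝔼 d}

theorem curvForm_congr {a a' : 𝔼 n → 𝔼 n →L[ℝ] 𝔼 d} {y : 𝔼 n} (h : a' =ᶠ[nhds y] a) (v w : 𝔼 n) :
    curvForm br a' y v w = curvForm br a y v w := by
  simp only [curvForm, h.fderiv_eq, h.self_of_nhds]

/-- The second derivative of `τ` is symmetric and drops out of the skew-symmetrized derivative. -/
theorem curvForm_pullback {a : 𝔼 n → 𝔼 n →L[ℝ] 𝔼 d} {τ : 𝔼 n → 𝔼 n} {y : 𝔼 n}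
    (hτ : ContDiffAt ℝ ∞ τ y) (ha : DifferentiableAt ℝ a (τ y)) (v w : 𝔼 n) :
    curvForm br (fun z ↦ (a (τ z)).comp (fderiv ℝ τ z)) y v w
      = curvForm br a (τ y) (fderiv ℝ τ y v) (fderiv ℝ τ y w) := by
  have h1 := (hτ.differentiableAt (by simp)).hasFDerivAt
  have h2 : HasFDerivAt (fderiv ℝ τ) (fderiv ℝ (fderiv ℝ τ) y) y :=
    ((hτ.fderiv_right (m := 1) (by norm_cast)).differentiableAt (by simp)).hasFDerivAt
  have h3 := (ha.hasFDerivAt.comp y h1).clm_comp h2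
  have h4 : ∀ u u' : 𝔼 n, fderiv ℝ (fun z ↦ (a (τ z)).comp (fderiv ℝ τ z)) y u u'
      = a (τ y) (fderiv ℝ (fderiv ℝ τ) y u u') + fderiv ℝ a (τ y) (fderiv ℝ τ y u) (fderiv ℝ τ y u') := by
    intro u u'
    have := congrArg (fun L : 𝔼 n →L[ℝ] 𝔼 n →L[ℝ] 𝔼 d ↦ L u u') h3.fderiv
    exact this
  have h5 : fderiv ℝ (fderiv ℝ τ) y v w = fderiv ℝ (fderiv ℝ τ) y w v :=
    (hτ.isSymmSndFDerivAt (by simpa using ENat.LEInfty.out)).eq v w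
  simp only [curvForm, h4, h5, ContinuousLinearMap.comp_apply]
  abel

theorem curvForm_clm_comp {br' : 𝔼 d →L[ℝ] 𝔼 d →L[ℝ] 𝔼 d} {a : 𝔼 n → 𝔼 n →L[ℝ] 𝔼 d} {y : 𝔼 n}
    (L : 𝔼 d →L[ℝ] 𝔼 d)
    (hL : ∀ x y, L (br x y) = br' (L x) (L y)) (ha : DifferentiableAt ℝ a y) (v w : 𝔼 n) :
    curvForm br' (fun z ↦ L.comp (a z)) y v w = L (curvForm br a y v w) := by
  have h3 := (hasFDerivAt_const (𝕜 := ℝ) L y).clm_comp ha.hasFDerivAt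
  have h4 : ∀ u u' : 𝔼 n, fderiv ℝ (fun z ↦ L.comp (a z)) y u u' = L (fderiv ℝ a y u u') := by
    intro u u'
    have := congrArg (fun L : 𝔼 n →L[ℝ] 𝔼 n →L[ℝ] 𝔼 d ↦ L u u') h3.fderiv
    simpa using this
  simp only [curvForm, h4, ContinuousLinearMap.comp_apply, map_add, map_sub, hL]

variable [LieGroup (𝓡 d) ∞ G]

/-- Gauge invariance of the curvature at a point where the gauge transformation is trivial; the
gauge transformation is given by its coordinates `x`. -/
theorem curvForm_gauge {a : 𝔼 n → 𝔼 n →L[ℝ] 𝔼 d} {x : 𝔼 n → 𝔼 d} {y : 𝔼 n}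
    (ha : DifferentiableAt ℝ a y) (hx : ContDiffAt ℝ ∞ x y) (hxy : x y = origin d G) (v w : 𝔼 n) :
    curvForm (brkL d G) (fun z ↦ (adL (d := d) ((oneChart d G).symm (x z))⁻¹).comp (a z)
        + (maurerCartan G (x z)).comp (fderiv ℝ x z)) y v w
      = curvForm (brkL d G) a y v w := by
  obtain ⟨T, hT, hTb⟩ := hasFDerivAt_adL_inv (d := d) (G := G)
  obtain ⟨S, hS, hSb⟩ := hasFDerivAt_maurerCartan (d := d) (G := G)
  rw [← hxy] at hT hS
  have h1 := (hx.differentiableAt (by simp)).hasFDerivAt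
  have h2 : HasFDerivAt (fderiv ℝ x) (fderiv ℝ (fderiv ℝ x) y) y :=
    ((hx.fderiv_right (m := 1) (by norm_cast)).differentiableAt (by simp)).hasFDerivAt
  have h3 := ((hT.comp y h1).clm_comp ha.hasFDerivAt).add ((hS.comp y h1).clm_comp h2)
  have e1 : adL (d := d) ((oneChart d G).symm (x y))⁻¹ = ContinuousLinearMap.id ℝ _ := by
    rw [hxy, oneChart_symm_origin, inv_one, adL_one]
  have e2 : maurerCartan (d := d) G (x y) = ContinuousLinearMap.id ℝ _ := by
    rw [hxy, maurerCartan_origin]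
  have h4 : ∀ u u' : 𝔼 n, fderiv ℝ (fun z ↦ (adL (d := d) ((oneChart d G).symm (x z))⁻¹).comp (a z)
        + (maurerCartan G (x z)).comp (fderiv ℝ x z)) y u u'
      = (adL (d := d) ((oneChart d G).symm (x y))⁻¹ (fderiv ℝ a y u u')
          + T (fderiv ℝ x y u) (a y u'))
        + (maurerCartan (d := d) G (x y) (fderiv ℝ (fderiv ℝ x) y u u')
          + S (fderiv ℝ x y u) (fderiv ℝ x y u')) := by
    intro u u'
    have := congrArg (fun L : 𝔼 n →L[ℝ] 𝔼 n →L[ℝ] 𝔼 d ↦ L u u') h3.fderiv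
    exact this
  have h5 : fderiv ℝ (fderiv ℝ x) y v w = fderiv ℝ (fderiv ℝ x) y w v :=
    (hx.isSymmSndFDerivAt (by simpa using ENat.LEInfty.out)).eq v w
  -- The Maurer–Cartan equation cancels the bracket of the two inhomogeneous terms. In the same way
  -- `hTb` makes the derivative of `Ad` cancel the mixed brackets.
  have h6 : S (fderiv ℝ x y v) (fderiv ℝ x y w)
      = S (fderiv ℝ x y w) (fderiv ℝ x y v) - brkL d G (fderiv ℝ x y v) (fderiv ℝ x y w) := by
    rw [brkL_apply, sub_eq_add_neg, ← hSb]; abel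
  have hanti : brkL d G (fderiv ℝ x y v) (a y w) = -brkL d G (a y w) (fderiv ℝ x y v) := by
    rw [brkL_apply, brkL_apply, brk_eq, brk_eq]; abel
  simp only [curvForm, h4, h5, h6, hTb, e1, e2, ContinuousLinearMap.comp_apply, map_add,
    add_apply, ContinuousLinearMap.id_apply, ← brkL_apply, hanti]
  abel

end CurvForm

/-! ### The potential of a connection in a local section -/

section Potential

variable {n d : ℕ}
  {M : Type u} [TopologicalSpace M] [ChartedSpace (𝔼 n) M]
  {G : Type v} [TopologicalSpace G] [ChartedSpace (𝔼 d) G] [Group G]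
  {P : Type w} [TopologicalSpace P] [ChartedSpace (𝔼 (n + d)) P] [IsManifold (𝓡 (n + d)) ∞ P]
  {B : PrincipalBundle (n := n) (d := d) M G P} (A : Connection B)

namespace Connection

/-- The connection form as a linear map of the model spaces. -/
def formL (p : P) : 𝔼 (n + d) →L[ℝ] 𝔼 d := A.form p

/-- The potential of the connection in a parametrized local section. -/
def pot (σ : 𝔼 n → P) (y : 𝔼 n) : 𝔼 n →L[ℝ] 𝔼 d :=
  (A.formL (σ y)).comp (mderiv n (n + d) σ y)

/-- Smoothness of the connection form is available on the tangent bundle of `P`, so it is composed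
with the tangent map of the section along constant vector fields. -/
theorem contDiffOn_pot {σ : 𝔼 n → P} {U : Set (𝔼 n)} (hU : IsOpen U)
    (hσ : ContMDiffOn (𝓡 n) (𝓡 (n + d)) ∞ σ U) : ContDiffOn ℝ ∞ (A.pot σ) U := by
  refine contDiffOn_clm_apply.2 fun v ↦ ?_
  have h1 : ContMDiffOn (𝓡 n) (𝓡 n).tangent ∞
      (fun z : 𝔼 n ↦ (⟨z, v⟩ : TangentBundle (𝓡 n) (𝔼 n))) U :=
    (contMDiffOn_vectorSpace_iff_contDiffOn (V := fun _ : 𝔼 n ↦ v)).2 contDiffOn_const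
  have h2 := hσ.contMDiffOn_tangentMapWithin (m := ∞) (by simp) hU.uniqueMDiffOn
  have h3 := A.contMDiff_form.comp_contMDiffOn (h2.comp h1 (fun z hz ↦ hz))
  refine (contMDiffOn_iff_contDiffOn.1 h3).congr fun z hz ↦ ?_
  have h4 : mfderivWithin (𝓡 n) (𝓡 (n + d)) σ U z = mderiv n (n + d) σ z :=
    mfderivWithin_of_isOpen hU hz
  exact congrArg (fun L : 𝔼 n →L[ℝ] 𝔼 (n + d) ↦ A.formL (σ z) (L v)) h4.symm

theorem pot_congr {σ σ' : 𝔼 n → P} {y : 𝔼 n} (h : σ' =ᶠ[nhds y] σ) :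
    A.pot σ' =ᶠ[nhds y] A.pot σ := by
  filter_upwards [h.eventuallyEq_nhds] with z hz
  rw [pot, pot, hz.self_of_nhds, mderiv_congr hz]

theorem pot_comp {σ : 𝔼 n → P} {τ : 𝔼 n → 𝔼 n} {y : 𝔼 n}
    (hσ : MDifferentiableAt (𝓡 n) (𝓡 (n + d)) σ (τ y)) (hτ : DifferentiableAt ℝ τ y) :
    A.pot (fun z ↦ σ (τ z)) y = (A.pot σ (τ y)).comp (fderiv ℝ τ y) := by
  rw [pot, mderiv_comp hσ hτ.mdifferentiableAt, mderiv_eq_fderiv]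
  rfl

variable [LieGroup (𝓡 d) ∞ G]

theorem mdifferentiableAt_act (p : P) (g : G) :
    MDifferentiableAt ((𝓡 (n + d)).prod (𝓡 d)) (𝓡 (n + d)) (fun q : P × G ↦ B.act q.1 q.2) (p, g) :=
  B.contMDiff_act.mdifferentiableAt (by simp)

theorem mdifferentiableAt_act_left (p : P) (g : G) :
    MDifferentiableAt (𝓡 (n + d)) (𝓡 (n + d)) (fun q : P ↦ B.act q g) p :=
  (B.contMDiff_act.comp (contMDiff_id.prodMk contMDiff_const)).mdifferentiableAt (by simp)

theorem mdifferentiableAt_act_right (p : P) (g : G) :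
    MDifferentiableAt (𝓡 d) (𝓡 (n + d)) (fun h : G ↦ B.act p h) g :=
  (B.contMDiff_act.comp (contMDiff_const.prodMk contMDiff_id)).mdifferentiableAt (by simp)

theorem formL_act (p : P) (g : G) :
    (A.formL (B.act p g)).comp (mderiv (n + d) (n + d) (fun q : P ↦ B.act q g) p)
      = (adL g⁻¹).comp (A.formL p) :=
  ContinuousLinearMap.ext fun v ↦ A.equivariant p g v

theorem formL_vertical (p : P) (ξ : 𝔼 d) :
    A.formL p (mderiv d (n + d) (fun g : G ↦ B.act p g) 1 ξ) = ξ := by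
  have h := A.vertical p ξ
  have h1 : A.formL (B.act p 1) (mderiv d (n + d) (fun g : G ↦ B.act p g) 1 ξ) = ξ := h
  rwa [B.act_one] at h1

/-- Since `p · h = (p · g) · (g⁻¹ h)`, the normalization on vertical vectors at `p · g` applies. -/
theorem formL_vertical' (p : P) (g : G) (w : 𝔼 d) :
    A.formL (B.act p g) (mderiv d (n + d) (fun h : G ↦ B.act p h) g w)
      = mderiv d d (fun h : G ↦ g⁻¹ * h) g w := by
  have h1 := mderiv_comp_of_eq (g := fun h : G ↦ B.act (B.act p g) h) (f := fun h : G ↦ g⁻¹ * h)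
    (x := g) (y := (1 : G)) (by simp) (mdifferentiableAt_act_right (B := B) _ _)
    (mdifferentiableAt_mul_left (d := d) g⁻¹ g)
  have h2 : (fun h : G ↦ B.act (B.act p g) (g⁻¹ * h)) = fun h ↦ B.act p h := by
    ext h; rw [← B.act_mul]; simp
  rw [h2] at h1
  rw [h1]
  exact A.formL_vertical _ _

theorem pot_act_const {σ : 𝔼 n → P} {y : 𝔼 n} (g : G)
    (hσ : MDifferentiableAt (𝓡 n) (𝓡 (n + d)) σ y) :
    A.pot (fun z ↦ B.act (σ z) g) y = (adL g⁻¹).comp (A.pot σ y) := by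
  rw [pot, mderiv_comp (g := fun q : P ↦ B.act q g) (mdifferentiableAt_act_left _ _) hσ, pot,
    ← ContinuousLinearMap.comp_assoc, ← ContinuousLinearMap.comp_assoc, formL_act]

/-- The rule `A' = Ad(h⁻¹) A + h⁻¹ dh`. The product rule for the action gives two terms:
equivariance evaluates the first, the normalization on vertical vectors the second. -/
theorem pot_act {σ : 𝔼 n → P} {x : 𝔼 n → 𝔼 d} {y : 𝔼 n}
    (hσ : MDifferentiableAt (𝓡 n) (𝓡 (n + d)) σ y) (hx : DifferentiableAt ℝ x y)
    (hxy : x y ∈ (oneChart d G).target) :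
    A.pot (fun z ↦ B.act (σ z) ((oneChart d G).symm (x z))) y
      = (adL ((oneChart d G).symm (x y))⁻¹).comp (A.pot σ y)
        + (maurerCartan G (x y)).comp (fderiv ℝ x y) := by
  have hs := mdifferentiableAt_chartAt_symm (n := d) (c := (1 : G)) hxy
  have hk : MDifferentiableAt (𝓡 n) (𝓡 d) (fun z ↦ (oneChart d G).symm (x z)) y :=
    hs.comp y hx.mdifferentiableAt
  have hk1 : mderiv n d (fun z ↦ (oneChart d G).symm (x z)) y
      = (mderiv d d (oneChart d G).symm (x y)).comp (fderiv ℝ x y) := by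
    rw [mderiv_comp (g := (oneChart d G).symm) hs hx.mdifferentiableAt, mderiv_eq_fderiv]
  have h1 := mderiv_prod (F := fun q : P × G ↦ B.act q.1 q.2) (z := y)
    (mdifferentiableAt_act (B := B) _ _) hσ hk
  have h2 : maurerCartan G (x y) = (mderiv d d (fun h : G ↦ ((oneChart d G).symm (x y))⁻¹ * h)
      ((oneChart d G).symm (x y))).comp (mderiv d d (oneChart d G).symm (x y)) :=
    mderiv_comp (g := fun h : G ↦ ((oneChart d G).symm (x y))⁻¹ * h)
      (mdifferentiableAt_mul_left _ _) hs
  ext1 v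
  rw [pot, h1, h2, hk1]
  simp only [ContinuousLinearMap.comp_apply, add_apply, map_add, formL_vertical']
  congr 1
  exact congrArg (fun L : 𝔼 (n + d) →L[ℝ] 𝔼 d ↦ L (mderiv n (n + d) σ y v)) (A.formL_act _ _)

/-- The curvature transforms by the adjoint representation under gauge transformations. -/
theorem curvForm_pot_act {σ : 𝔼 n → P} {h : 𝔼 n → G} {U : Set (𝔼 n)} {y : 𝔼 n} (hU : IsOpen U)
    (hy : y ∈ U) (hσ : ContMDiffOn (𝓡 n) (𝓡 (n + d)) ∞ σ U)
    (hh : ContMDiffOn (𝓡 n) (𝓡 d) ∞ h U) (v w : 𝔼 n) :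
    curvForm (brkL d G) (A.pot (fun z ↦ B.act (σ z) (h z))) y v w
      = adL (h y)⁻¹ (curvForm (brkL d G) (A.pot σ) y v w) := by
  set g := h y with hg
  have hmd : ∀ z ∈ U, MDifferentiableAt (𝓡 n) (𝓡 (n + d)) σ z := fun z hz ↦
    (hσ.contMDiffAt (hU.mem_nhds hz)).mdifferentiableAt (by simp)
  set σ' : 𝔼 n → P := fun z ↦ B.act (σ z) g with hσ'
  have hσ's : ContMDiffOn (𝓡 n) (𝓡 (n + d)) ∞ σ' U :=
    B.contMDiff_act.comp_contMDiffOn (hσ.prodMk contMDiffOn_const)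
  -- The gauge transformation is split as `h = g k` with `g` constant and `k y = 1`. The constant
  -- factor acts by the automorphism `Ad g⁻¹`, and `k` stays in the chart at the identity near `y`,
  -- where `curvForm_gauge` applies.
  set k : 𝔼 n → G := fun z ↦ g⁻¹ * h z with hk
  have hks : ContMDiffOn (𝓡 n) (𝓡 d) ∞ k U :=
    (contMDiff_mul_left (I := 𝓡 d) (n := ∞) (a := g⁻¹)).comp_contMDiffOn hh
  have hky : k y = 1 := by simp [hk, hg]
  set x : 𝔼 n → 𝔼 d := fun z ↦ oneChart d G (k z) with hx
  have hsrc : ∀ᶠ z in nhds y, k z ∈ (oneChart d G).source := by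
    have hc : ContinuousAt k y := (hks.continuousOn.continuousAt (hU.mem_nhds hy))
    exact hc.eventually_mem ((oneChart d G).open_source.mem_nhds (by
      rw [hky]; exact mem_chart_source _ _))
  have hxs : ∀ z ∈ U, k z ∈ (oneChart d G).source → ContDiffAt ℝ ∞ x z := by
    intro z hz hkz
    have h1 : ContMDiffAt (𝓡 d) (𝓡 d) ∞ (oneChart d G) (k z) :=
      (contMDiffOn_chart _ hkz).contMDiffAt ((oneChart d G).open_source.mem_nhds hkz)
    exact (h1.comp z (hks.contMDiffAt (hU.mem_nhds hz))).contDiffAt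
  have hxy : x y = origin d G := by simp only [hx, hky]
  have hcs : ContDiffOn ℝ ∞ (A.pot σ) U := A.contDiffOn_pot hU hσ
  have hcs' : ContDiffOn ℝ ∞ (A.pot σ') U := A.contDiffOn_pot hU hσ's
  have e1 : A.pot (fun z ↦ B.act (σ z) (h z)) =ᶠ[nhds y]
      fun z ↦ (adL (d := d) ((oneChart d G).symm (x z))⁻¹).comp (A.pot σ' z)
        + (maurerCartan G (x z)).comp (fderiv ℝ x z) := by
    have e0 : (fun z ↦ B.act (σ z) (h z)) =ᶠ[nhds y]
        fun z ↦ B.act (σ' z) ((oneChart d G).symm (x z)) := by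
      filter_upwards [hsrc] with z hz
      rw [hx, (oneChart d G).left_inv hz, hσ', hk, ← B.act_mul, mul_inv_cancel_left]
    filter_upwards [A.pot_congr e0, hsrc, hU.mem_nhds hy] with z hz1 hz2 hz3
    rw [hz1]
    exact A.pot_act ((hσ's.contMDiffAt (hU.mem_nhds hz3)).mdifferentiableAt (by simp))
      ((hxs z hz3 hz2).differentiableAt (by simp)) ((oneChart d G).map_source hz2)
  have e2 : A.pot σ' =ᶠ[nhds y] fun z ↦ (adL g⁻¹).comp (A.pot σ z) := by
    filter_upwards [hU.mem_nhds hy] with z hz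
    exact A.pot_act_const g (hmd z hz)
  rw [curvForm_congr e1, curvForm_gauge (differentiableAt_of_contDiffOn hU hy hcs')
    (hxs y hy hsrc.self_of_nhds) hxy, curvForm_congr e2]
  exact curvForm_clm_comp (adL g⁻¹) (fun a b ↦ by rw [brkL_apply, brkL_apply, adL_brk])
    (differentiableAt_of_contDiffOn hU hy hcs) v w

end Connection

end Potential

end YangMills

namespace YangMills

/-! ### Coordinate changes -/

section Frames

variable {n : ℕ} {M : Type u} [TopologicalSpace M] [ChartedSpace (𝔼 n) M]

/-- The coordinate frame of a chart, in the model space. -/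
def frame (c : M) (y : 𝔼 n) : 𝔼 n →L[ℝ] 𝔼 n := mderiv n n (chartAt (𝔼 n) c).symm y

variable [IsManifold (𝓡 n) ∞ M]

theorem frame_injective {c : M} {y : 𝔼 n} (hy : y ∈ (chartAt (𝔼 n) c).target) :
    Function.Injective (frame c y) := by
  have h := mderiv_chartAt_comp_symm (n := n) hy
  exact Function.LeftInverse.injective (g := mderiv n n (chartAt (𝔼 n) c)
    ((chartAt (𝔼 n) c).symm y)) fun v ↦ congrArg (fun L : 𝔼 n →L[ℝ] 𝔼 n ↦ L v) h

/-- The change of coordinates from the chart at `c` to the chart at `c'`. -/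
def transition (c c' : M) (y : 𝔼 n) : 𝔼 n := chartAt (𝔼 n) c' ((chartAt (𝔼 n) c).symm y)

theorem contDiffAt_transition {c c' : M} {y : 𝔼 n} (hy : y ∈ (chartAt (𝔼 n) c).target)
    (hy' : (chartAt (𝔼 n) c).symm y ∈ (chartAt (𝔼 n) c').source) :
    ContDiffAt ℝ ∞ (transition c c') y := by
  have h1 : ContMDiffAt (𝓡 n) (𝓡 n) ∞ (chartAt (𝔼 n) c') ((chartAt (𝔼 n) c).symm y) :=
    (contMDiffOn_chart _ hy').contMDiffAt ((chartAt (𝔼 n) c').open_source.mem_nhds hy')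
  have h2 : ContMDiffAt (𝓡 n) (𝓡 n) ∞ (chartAt (𝔼 n) c).symm y :=
    (contMDiffOn_chart_symm y hy).contMDiffAt ((chartAt (𝔼 n) c).open_target.mem_nhds hy)
  exact (h1.comp y h2).contDiffAt

theorem frame_transition {c c' : M} {y : 𝔼 n} (hy : y ∈ (chartAt (𝔼 n) c).target)
    (hy' : (chartAt (𝔼 n) c).symm y ∈ (chartAt (𝔼 n) c').source) :
    frame c y = (frame c' (transition c c' y)).comp (fderiv ℝ (transition c c') y) := by
  have h1 := mderiv_comp (g := (chartAt (𝔼 n) c').symm) (f := transition c c') (x := y)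
    (mdifferentiableAt_chartAt_symm ((chartAt (𝔼 n) c').map_source hy'))
    ((contDiffAt_transition hy hy').differentiableAt (by simp)).mdifferentiableAt
  rw [mderiv_eq_fderiv] at h1
  refine Eq.trans (mderiv_congr ?_) h1
  have hc := (chartAt (𝔼 n) c).continuousAt_symm hy
  filter_upwards [hc.eventually_mem ((chartAt (𝔼 n) c').open_source.mem_nhds hy')] with z hz
  exact ((chartAt (𝔼 n) c').left_inv hz).symm

end Frames

/-! ### The metric in charts -/

section Metric

variable {n : ℕ} {M : Type u} [TopologicalSpace M] [ChartedSpace (𝔼 n) M]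
  [RiemannianBundle (fun x : M ↦ TangentSpace (𝓡 n) x)]

/-- The Riemannian metric at a point as a bilinear form on the model space. -/
def ginner (x : M) : 𝔼 n →ₗ[ℝ] 𝔼 n →ₗ[ℝ] ℝ :=
  LinearMap.mk₂ ℝ (fun v w ↦ @inner ℝ (TangentSpace (𝓡 n) x) _ v w)
    (fun a b c ↦ inner_add_left (𝕜 := ℝ) (E := TangentSpace (𝓡 n) x) a b c)
    (fun r a b ↦ real_inner_smul_left (F := TangentSpace (𝓡 n) x) a b r)
    (fun a b c ↦ inner_add_right (𝕜 := ℝ) (E := TangentSpace (𝓡 n) x) a b c)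
    (fun r a b ↦ real_inner_smul_right (F := TangentSpace (𝓡 n) x) a b r)

theorem ginner_symm (x : M) (v w : 𝔼 n) : ginner x v w = ginner x w v :=
  real_inner_comm (F := TangentSpace (𝓡 n) x) w v

theorem ginner_self_pos (x : M) {v : 𝔼 n} (hv : v ≠ 0) : 0 < ginner x v v :=
  real_inner_self_pos (F := TangentSpace (𝓡 n) x) |>.2 hv

theorem ginner_self_nonneg (x : M) (v : 𝔼 n) : 0 ≤ ginner x v v :=
  real_inner_self_nonneg (F := TangentSpace (𝓡 n) x)

theorem metric_apply (c : M) (y : 𝔼 n) (i j : Fin n) :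
    metric c y i j = ginner ((chartAt (𝔼 n) c).symm y)
      (frame c y (EuclideanSpace.single i 1)) (frame c y (EuclideanSpace.single j 1)) := rfl

theorem sum_smul_single (v : 𝔼 n) : ∑ i, v i • EuclideanSpace.single i (1 : ℝ) = v := by
  simpa using (EuclideanSpace.basisFun (Fin n) ℝ).sum_repr v

theorem ginner_frame (c : M) (y v w : 𝔼 n) :
    ginner ((chartAt (𝔼 n) c).symm y) (frame c y v) (frame c y w)
      = ∑ i, ∑ j, metric c y i j * v i * w j := by
  conv_lhs => rw [← sum_smul_single v, ← sum_smul_single w]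
  simp only [map_sum, map_smul, LinearMap.sum_apply, LinearMap.smul_apply, smul_eq_mul,
    metric_apply, Finset.mul_sum]
  rw [Finset.sum_comm]
  exact Finset.sum_congr rfl fun i _ ↦ Finset.sum_congr rfl fun j _ ↦ by ring

variable [IsManifold (𝓡 n) ∞ M]

theorem contDiffOn_metric [IsContMDiffRiemannianBundle (𝓡 n) ∞ (𝔼 n)
      (fun x : M ↦ TangentSpace (𝓡 n) x)] (c : M) (i j : Fin n) :
    ContDiffOn ℝ ∞ (fun y ↦ metric c y i j) (chartAt (𝔼 n) c).target := by
  have hU := (chartAt (𝔼 n) c).open_target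
  have hs : ∀ i : Fin n, ContMDiffOn (𝓡 n) (𝓡 n).tangent ∞
      (fun y ↦ (⟨(chartAt (𝔼 n) c).symm y, coordVec c i y⟩ : TangentBundle (𝓡 n) M))
      (chartAt (𝔼 n) c).target := by
    intro i
    have h1 : ContMDiffOn (𝓡 n) (𝓡 n).tangent ∞
        (fun z : 𝔼 n ↦ (⟨z, EuclideanSpace.single i (1 : ℝ)⟩ : TangentBundle (𝓡 n) (𝔼 n)))
        (chartAt (𝔼 n) c).target :=
      (contMDiffOn_vectorSpace_iff_contDiffOn
        (V := fun _ : 𝔼 n ↦ EuclideanSpace.single i (1 : ℝ))).2 contDiffOn_const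
    have h2 := (contMDiffOn_chart_symm (I := 𝓡 n) (n := ∞) (x := c)).contMDiffOn_tangentMapWithin
      (m := ∞) (by simp) hU.uniqueMDiffOn
    refine (h2.comp h1 (fun z hz ↦ hz)).congr fun z hz ↦ ?_
    have h4 : mfderivWithin (𝓡 n) (𝓡 n) (chartAt (𝔼 n) c).symm (chartAt (𝔼 n) c).target z
        = mfderiv (𝓡 n) (𝓡 n) (chartAt (𝔼 n) c).symm z := mfderivWithin_of_isOpen hU hz
    simp only [Function.comp, tangentMapWithin, h4]
    rfl
  exact (ContMDiffOn.inner_bundle (hs i) (hs j)).contDiffOn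

theorem isMetricOn_metric [IsContMDiffRiemannianBundle (𝓡 n) ∞ (𝔼 n)
      (fun x : M ↦ TangentSpace (𝓡 n) x)] (c : M) :
    IsMetricOn (metric c) (chartAt (𝔼 n) c).target where
  isOpen := (chartAt (𝔼 n) c).open_target
  contDiffOn := contDiffOn_metric c
  posDef y hy := by
    refine Matrix.PosDef.of_dotProduct_mulVec_pos ?_ fun v hv ↦ ?_
    · ext i j
      simp only [Matrix.conjTranspose_apply, star_trivial, metric_apply]
      exact ginner_symm _ _ _
    · have h := ginner_frame c y (WithLp.toLp 2 v) (WithLp.toLp 2 v)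
      have hpos : 0 < ginner ((chartAt (𝔼 n) c).symm y) (frame c y (WithLp.toLp 2 v))
          (frame c y (WithLp.toLp 2 v)) := by
        refine ginner_self_pos _ fun h0 ↦ hv ?_
        have := frame_injective hy (h0.trans (map_zero _).symm)
        simpa using this
      rw [h] at hpos
      refine hpos.trans_eq ?_
      simp only [dotProduct, Matrix.mulVec, Pi.star_apply, star_trivial, Finset.mul_sum]
      exact Finset.sum_congr rfl fun i _ ↦ Finset.sum_congr rfl fun j _ ↦ by ring

/-- The Jacobian matrix of a map. -/
def jacobian (τ : 𝔼 n → 𝔼 n) (y : 𝔼 n) : Matrix (Fin n) (Fin n) ℝ :=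
  Matrix.of fun k i ↦ fderiv ℝ τ y (EuclideanSpace.single i 1) k

theorem jacobian_det (τ : 𝔼 n → 𝔼 n) (y : 𝔼 n) : (jacobian τ y).det = (fderiv ℝ τ y).det := by
  have h : LinearMap.toMatrix (EuclideanSpace.basisFun (Fin n) ℝ).toBasis
      (EuclideanSpace.basisFun (Fin n) ℝ).toBasis (fderiv ℝ τ y : 𝔼 n →ₗ[ℝ] 𝔼 n)
      = jacobian τ y := by
    ext k i
    simp [LinearMap.toMatrix_apply, jacobian]
  rw [← h, LinearMap.det_toMatrix]

theorem metric_transition {c c' : M} {y : 𝔼 n} (hy : y ∈ (chartAt (𝔼 n) c).target)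
    (hy' : (chartAt (𝔼 n) c).symm y ∈ (chartAt (𝔼 n) c').source) :
    metric c y = (jacobian (transition c c') y).transpose * metric c' (transition c c' y)
      * jacobian (transition c c') y := by
  have hx : (chartAt (𝔼 n) c').symm (transition c c' y) = (chartAt (𝔼 n) c).symm y :=
    (chartAt (𝔼 n) c').left_inv hy'
  ext i j
  rw [metric_apply, frame_transition hy hy', ← hx, ContinuousLinearMap.comp_apply,
    ContinuousLinearMap.comp_apply, ginner_frame]
  simp only [Matrix.mul_apply, Matrix.transpose_apply, Finset.sum_mul]
  rw [Finset.sum_comm]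
  refine Finset.sum_congr rfl fun k _ ↦ Finset.sum_congr rfl fun l _ ↦ ?_
  rw [mul_comm (metric c' _ _ _)]; rfl

end Metric

theorem sum_mul_conj {n : ℕ} (M J h : Matrix (Fin n) (Fin n) ℝ) :
    ∑ i, ∑ a, M i a * ∑ k, ∑ k', J k i * J k' a * h k k'
      = ∑ k, ∑ k', (J * M * J.transpose) k k' * h k k' := by
  have htr : ∀ X Y : Matrix (Fin n) (Fin n) ℝ,
      ∑ i, ∑ a, X i a * Y i a = (X * Y.transpose).trace := by
    intro X Y
    simp only [Matrix.trace, Matrix.diag, Matrix.mul_apply, Matrix.transpose_apply]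
  have h1 : ∀ i a, ∑ k, ∑ k', J k i * J k' a * h k k' = (J.transpose * h * J) i a := by
    intro i a
    simp only [Matrix.mul_apply, Matrix.transpose_apply, Finset.sum_mul]
    rw [Finset.sum_comm]
    exact Finset.sum_congr rfl fun _ _ ↦ Finset.sum_congr rfl fun _ _ ↦ by ring
  simp only [h1]
  rw [htr, htr, Matrix.transpose_mul, Matrix.transpose_mul, Matrix.transpose_transpose,
    ← Matrix.mul_assoc, Matrix.mul_assoc (J * M), Matrix.mul_assoc J, Matrix.trace_mul_comm J]
  congr 1
  simp only [Matrix.mul_assoc]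

theorem pairing_pullback_left {n : ℕ} {V : Type*} [NormedAddCommGroup V] [InnerProductSpace ℝ V]
    (M N J : Matrix (Fin n) (Fin n) ℝ) (S T : Fin n → Fin n → V) :
    pairing M N (fun i j ↦ ∑ k, J k i • S k j) (fun i j ↦ ∑ k, J k i • T k j)
      = pairing (J * M * J.transpose) N S T := by
  simp only [pairing]
  refine Eq.trans ?_ (sum_mul_conj M J
    (Matrix.of fun k k' ↦ ∑ j, ∑ b, N j b * inner ℝ (S k j) (T k' b)))
  refine Finset.sum_congr rfl fun i _ ↦ Finset.sum_congr rfl fun a _ ↦ congrArg _ ?_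
  simp only [sum_inner, inner_sum, real_inner_smul_left, real_inner_smul_right, Finset.mul_sum,
    Matrix.of_apply]
  conv_rhs => rw [Finset.sum_comm]
  rw [Finset.sum_congr rfl fun j _ ↦ Finset.sum_comm, Finset.sum_comm]
  refine Finset.sum_congr rfl fun k _ ↦ ?_
  rw [Finset.sum_congr rfl fun j _ ↦ Finset.sum_comm, Finset.sum_comm]
  exact Finset.sum_congr rfl fun _ _ ↦ Finset.sum_congr rfl fun _ _ ↦
    Finset.sum_congr rfl fun _ _ ↦ by ring

/-- Change of variables in a contraction of two-tensors. -/
theorem pairing_pullback {n : ℕ} {V : Type*} [NormedAddCommGroup V] [InnerProductSpace ℝ V]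
    (M N J : Matrix (Fin n) (Fin n) ℝ) (S T : Fin n → Fin n → V) :
    pairing M N (fun i j ↦ ∑ k, J k i • ∑ l, J l j • S k l)
        (fun i j ↦ ∑ k, J k i • ∑ l, J l j • T k l)
      = pairing (J * M * J.transpose) (J * N * J.transpose) S T := by
  rw [pairing_pullback_left M N J (fun k j ↦ ∑ l, J l j • S k l) (fun k j ↦ ∑ l, J l j • T k l),
    pairing_swap, pairing_pullback_left N _ J (fun l k ↦ S k l) (fun l k ↦ T k l), pairing_swap]

end YangMills

namespace YangMills

/-! ### Field strength and energy density in arbitrary charts and gauges -/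

section LocalEnergy

variable {n d : ℕ}

theorem curvForm_eq_sum (br : 𝔼 d →L[ℝ] 𝔼 d →L[ℝ] 𝔼 d) (a : 𝔼 n → 𝔼 n →L[ℝ] 𝔼 d) (y v w : 𝔼 n) :
    curvForm br a y v w = ∑ k, v k • ∑ l, w l •
      curvForm br a y (EuclideanSpace.single k 1) (EuclideanSpace.single l 1) := by
  set L : 𝔼 n →L[ℝ] 𝔼 n →L[ℝ] 𝔼 d :=
    fderiv ℝ a y - (fderiv ℝ a y).flip + ((br.comp (a y)).flip.comp (a y)).flip with hL
  have h : ∀ v w, curvForm br a y v w = L v w := fun v w ↦ rfl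
  simp only [h]
  conv_lhs => rw [← sum_smul_single v, ← sum_smul_single w]
  simp only [map_sum, map_smul, sum_apply, smul_apply, Finset.smul_sum]
  rw [Finset.sum_comm]
  exact Finset.sum_congr rfl fun _ _ ↦ Finset.sum_congr rfl fun _ _ ↦ smul_comm _ _ _

variable {M : Type u} [TopologicalSpace M] [ChartedSpace (𝔼 n) M] [IsManifold (𝓡 n) ∞ M]
  {G : Type v} [TopologicalSpace G] [ChartedSpace (𝔼 d) G] [Group G] [LieGroup (𝓡 d) ∞ G]
  {P : Type w} [TopologicalSpace P] [ChartedSpace (𝔼 (n + d)) P] [IsManifold (𝓡 (n + d)) ∞ P]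
  {B : PrincipalBundle (n := n) (d := d) M G P} (A : Connection B)

namespace Connection

variable (B) in
/-- A local gauge in the coordinates of a chart. -/
def locSec (c b : M) (z : 𝔼 n) : P := B.sec b ((chartAt (𝔼 n) c).symm z)

theorem isOpen_localDom (c b : M) : IsOpen (A.localDom c b) :=
  (chartAt (𝔼 n) c).isOpen_inter_preimage_symm (B.isOpen_dom b)

theorem contMDiffOn_locSec (c b : M) :
    ContMDiffOn (𝓡 n) (𝓡 (n + d)) ∞ (locSec B c b) (A.localDom c b) :=
  (B.contMDiffOn_sec b).comp (contMDiffOn_chart_symm.mono fun _ hy ↦ hy.1) fun _ hy ↦ hy.2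

theorem contDiffOn_pot_locSec (c b : M) :
    ContDiffOn ℝ ∞ (A.pot (locSec B c b)) (A.localDom c b) :=
  A.contDiffOn_pot (A.isOpen_localDom c b) (A.contMDiffOn_locSec c b)

/-- The components of the potential, with values in the model space. -/
def potL (c b : M) (μ : Fin n) (y : 𝔼 n) : 𝔼 d := A.potential c b μ y

/-- The components of the field strength, with values in the model space. -/
def fieldL (c b : M) (μ l : Fin n) (y : 𝔼 n) : 𝔼 d := A.fieldStrength c b μ l y

theorem fieldL_eq_curv (c b : M) (μ l : Fin n) (y : 𝔼 n) :
    A.fieldL c b μ l y = curv (brkL d G) (A.potL c b) μ l y :=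
  congrArg (fun z : 𝔼 d ↦ pd μ (A.potL c b l) y - pd l (A.potL c b μ) y + z)
    (brkL_apply _ _).symm

theorem contDiffOn_potL (c b : M) (μ : Fin n) :
    ContDiffOn ℝ ∞ (A.potL c b μ) (A.localDom c b) :=
  (contDiffOn_clm_apply.1 (A.contDiffOn_pot_locSec c b) (EuclideanSpace.single μ 1))

theorem fieldL_eq {c b : M} {y : 𝔼 n} (hy : y ∈ A.localDom c b) (μ l : Fin n) :
    A.fieldL c b μ l y = curvForm (brkL d G) (A.pot (locSec B c b)) y
      (EuclideanSpace.single μ 1) (EuclideanSpace.single l 1) := by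
  have hd := differentiableAt_of_contDiffOn (A.isOpen_localDom c b) hy (A.contDiffOn_pot_locSec c b)
  have h : ∀ μ l, pd μ (A.potL c b l) y
      = fderiv ℝ (A.pot (locSec B c b)) y (EuclideanSpace.single μ 1)
        (EuclideanSpace.single l 1) := by
    intro μ l
    have h1 := ((ContinuousLinearMap.apply ℝ (𝔼 d)
      (EuclideanSpace.single l 1 : 𝔼 n)).hasFDerivAt).comp y hd.hasFDerivAt
    exact congrArg (fun L : 𝔼 n →L[ℝ] 𝔼 d ↦ L (EuclideanSpace.single μ 1)) h1.fderiv
  rw [fieldL_eq_curv, curv, h, h]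
  rfl

/-- Transformation of the field strength under changes of charts and gauges. -/
theorem fieldL_transition {c c' b b' : M} {y : 𝔼 n} (hy : y ∈ A.localDom c b)
    (hc : (chartAt (𝔼 n) c).symm y ∈ (chartAt (𝔼 n) c').source)
    (hb : (chartAt (𝔼 n) c).symm y ∈ B.dom b') :
    ∃ g : G, ∀ μ l, A.fieldL c b μ l y = adL g (∑ k, jacobian (transition c c') y k μ •
      ∑ k', jacobian (transition c c') y k' l • A.fieldL c' b' k k' (transition c c' y)) := by
  set U : Set (𝔼 n) := A.localDom c b ∩ ((chartAt (𝔼 n) c).target ∩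
    (chartAt (𝔼 n) c).symm ⁻¹' ((chartAt (𝔼 n) c').source ∩ B.dom b')) with hUdef
  have hU : IsOpen U := (A.isOpen_localDom c b).inter ((chartAt (𝔼 n) c).isOpen_inter_preimage_symm
    ((chartAt (𝔼 n) c').open_source.inter (B.isOpen_dom b')))
  have hyU : y ∈ U := ⟨hy, hy.1, hc, hb⟩
  set τ : 𝔼 n → 𝔼 n := transition c c' with hτ
  have hτU : ∀ z ∈ U, ContDiffAt ℝ ∞ τ z := fun z hz ↦ contDiffAt_transition hz.1.1 hz.2.2.1
  have hτx : ∀ z ∈ U, (chartAt (𝔼 n) c').symm (τ z) = (chartAt (𝔼 n) c).symm z := fun z hz ↦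
    (chartAt (𝔼 n) c').left_inv hz.2.2.1
  have hτd : ∀ z ∈ U, τ z ∈ A.localDom c' b' := fun z hz ↦
    ⟨(chartAt (𝔼 n) c').map_source hz.2.2.1, by rw [hτx z hz]; exact hz.2.2.2⟩
  -- The transition function of the two gauges: the fibre coordinate of one local section in the
  -- trivialization that belongs to the other.
  set h : 𝔼 n → G := fun z ↦ B.coord b' (locSec B c b z) with hh
  have hσ : ContMDiffOn (𝓡 n) (𝓡 (n + d)) ∞ (fun z ↦ locSec B c' b' (τ z)) U := by
    refine (A.contMDiffOn_locSec c' b').comp (fun z hz ↦ ?_) hτd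
    exact (hτU z hz).contMDiffAt.contMDiffWithinAt
  have hproj : ∀ z ∈ U, B.proj (locSec B c b z) = (chartAt (𝔼 n) c).symm z := fun z hz ↦
    B.proj_sec b _ hz.1.2
  have hhs : ContMDiffOn (𝓡 n) (𝓡 d) ∞ h U :=
    (B.contMDiffOn_coord b').comp ((A.contMDiffOn_locSec c b).mono fun z hz ↦ hz.1) fun z hz ↦ by
      change B.proj (locSec B c b z) ∈ B.dom b'
      rw [hproj z hz]; exact hz.2.2.2
  have heq : locSec B c b =ᶠ[nhds y] fun z ↦ B.act (locSec B c' b' (τ z)) (h z) := by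
    filter_upwards [hU.mem_nhds hyU] with z hz
    have h1 := B.act_coord b' (locSec B c b z) (by
      change B.proj (locSec B c b z) ∈ B.dom b'
      rw [hproj z hz]; exact hz.2.2.2)
    rw [hproj z hz] at h1
    have h2 : locSec B c' b' (τ z) = B.sec b' ((chartAt (𝔼 n) c).symm z) :=
      congrArg (B.sec b') (hτx z hz)
    rw [h2]
    exact h1.symm
  have hpot : A.pot (fun z ↦ locSec B c' b' (τ z)) =ᶠ[nhds y]
      fun z ↦ (A.pot (locSec B c' b') (τ z)).comp (fderiv ℝ τ z) := by
    filter_upwards [hU.mem_nhds hyU] with z hz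
    exact A.pot_comp (((A.contMDiffOn_locSec c' b').contMDiffAt
      ((A.isOpen_localDom c' b').mem_nhds (hτd z hz))).mdifferentiableAt (by simp))
      ((hτU z hz).differentiableAt (by simp))
  refine ⟨(h y)⁻¹, fun μ l ↦ ?_⟩
  rw [A.fieldL_eq hy, curvForm_congr (A.pot_congr heq), A.curvForm_pot_act hU hyU hσ hhs,
    curvForm_congr hpot, curvForm_pullback (hτU y hyU) (differentiableAt_of_contDiffOn
      (A.isOpen_localDom c' b') (hτd y hyU) (A.contDiffOn_pot_locSec c' b')), curvForm_eq_sum]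
  simp only [A.fieldL_eq (hτd y hyU)]
  rfl

variable [RiemannianBundle (fun x : M ↦ TangentSpace (𝓡 n) x)]
  [IsContMDiffRiemannianBundle (𝓡 n) ∞ (𝔼 n) (fun x : M ↦ TangentSpace (𝓡 n) x)]

/-- The energy density in an arbitrary chart and gauge. -/
theorem energyDensity_eq_pairing {Φ : 𝔼 d ≃L[ℝ] 𝔼 d}
    (hΦ : ∀ x y : GroupLieAlgebra (𝓡 d) G,
      inner ℝ (Φ x) (Φ y) = -killingForm ℝ (GroupLieAlgebra (𝓡 d) G) x y)
    (hAd : ∀ (g : G) x y, inner ℝ (Φ (adL g x)) (Φ (adL g y)) = inner ℝ (Φ x) (Φ y))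
    {c b : M} {y : 𝔼 n} (hy : y ∈ A.localDom c b) :
    A.energyDensity ((chartAt (𝔼 n) c).symm y)
      = pairing (metric c y)⁻¹ (metric c y)⁻¹ (fun i j ↦ Φ (A.fieldL c b i j y))
        (fun i j ↦ Φ (A.fieldL c b i j y)) := by
  set x := (chartAt (𝔼 n) c).symm y with hx
  set yx := chartAt (𝔼 n) x x with hyx
  have hyx' : transition c x y = yx := rfl
  have hself : A.energyDensity x = pairing (metric x yx)⁻¹ (metric x yx)⁻¹
      (fun i j ↦ Φ (A.fieldL x x i j yx)) (fun i j ↦ Φ (A.fieldL x x i j yx)) := by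
    simp only [energyDensity, pairing, Finset.mul_sum]
    refine Finset.sum_congr rfl fun i _ ↦ ?_
    rw [Finset.sum_comm]
    refine Finset.sum_congr rfl fun a _ ↦ Finset.sum_congr rfl fun j _ ↦
      Finset.sum_congr rfl fun b _ ↦ ?_
    rw [← mul_assoc]
    exact congrArg _ (hΦ _ _).symm
  -- Comparison with the chart and gauge at `x` itself, in which the density is defined. The
  -- Jacobian is absorbed by the change of `g⁻¹`, and the group element by the `Ad`-invariance of
  -- the inner product.
  obtain ⟨g, hg⟩ := A.fieldL_transition (c' := x) (b' := x) hy (mem_chart_source _ _) (B.mem_dom x)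
  have hyt := hy.1
  have hdet : IsUnit (metric c y).det := (isMetricOn_metric c).isUnit_det hyt
  have hdet' : IsUnit (metric x yx).det :=
    (isMetricOn_metric x).isUnit_det ((chartAt (𝔼 n) x).map_source (mem_chart_source _ _))
  set J := jacobian (transition c x) y with hJ
  have hm : metric c y = J.transpose * metric x yx * J :=
    metric_transition hyt (mem_chart_source _ _)
  have hJdet : IsUnit J.det := by
    rw [hm, Matrix.det_mul, Matrix.det_mul] at hdet
    exact isUnit_of_mul_isUnit_right hdet
  have hinv : J * (metric c y)⁻¹ * J.transpose = (metric x yx)⁻¹ := by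
    rw [hm, Matrix.mul_inv_rev, Matrix.mul_inv_rev, ← Matrix.mul_assoc, ← Matrix.mul_assoc,
      Matrix.mul_nonsing_inv _ hJdet, Matrix.one_mul, Matrix.mul_assoc,
      Matrix.nonsing_inv_mul _ (by rwa [Matrix.det_transpose]), Matrix.mul_one]
  rw [hself, ← hinv, ← pairing_pullback]
  simp only [pairing]
  refine Finset.sum_congr rfl fun i _ ↦ Finset.sum_congr rfl fun a _ ↦ congrArg _
    (Finset.sum_congr rfl fun j _ ↦ Finset.sum_congr rfl fun k _ ↦ congrArg _ ?_)
  rw [hg, hg, hAd]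
  simp only [map_sum, map_smul]
  rfl

end Connection

end LocalEnergy

end YangMills

namespace YangMills

theorem gradSq_congr {n : ℕ} {g : 𝔼 n → Matrix (Fin n) (Fin n) ℝ} {U : Set (𝔼 n)} (hU : IsOpen U)
    {f f' : 𝔼 n → ℝ} (h : ∀ z ∈ U, f z = f' z) {y : 𝔼 n} (hy : y ∈ U) :
    gradSq g f y = gradSq g f' y := by
  simp only [gradSq, pd_congr hU hy _ h]

theorem laplacian_congr {n : ℕ} {g : 𝔼 n → Matrix (Fin n) (Fin n) ℝ} {U : Set (𝔼 n)}
    (hU : IsOpen U) {f f' : 𝔼 n → ℝ} (h : ∀ z ∈ U, f z = f' z) {y : 𝔼 n} (hy : y ∈ U) :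
    laplacian g f y = laplacian g f' y := by
  have h2 : ∀ k l, pd k (pd l f) y = pd k (pd l f') y := fun k l ↦
    pd_congr hU hy k fun z hz ↦ pd_congr hU hz l h
  simp only [laplacian, pd_congr hU hy _ h, h2]

/-- By Cauchy–Schwarz `S` pairs to zero with every tensor. The test tensor `T` is built from rows of
`g` that cancel the two inverse metrics, so that pairing with it isolates `‖S i j‖²`. -/
theorem eq_zero_of_pairing_self_eq_zero {n : ℕ} {V : Type*} [NormedAddCommGroup V]
    [InnerProductSpace ℝ V] {g B : Matrix (Fin n) (Fin n) ℝ} (hg : IsUnit g.det)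
    (hB : g⁻¹ = B.transpose * B) {S : Fin n → Fin n → V} (h : pairing g⁻¹ g⁻¹ S S = 0)
    (i j : Fin n) : S i j = 0 := by
  set T : Fin n → Fin n → V := fun a b ↦ (g a i * g b j) • S i j with hT
  have h1 := pairing_sq_le hB S T
  rw [h, zero_mul] at h1
  have h2 : pairing g⁻¹ g⁻¹ S T = 0 := pow_eq_zero_iff (two_ne_zero) |>.1 (le_antisymm h1 (sq_nonneg _))
  have hone : ∀ k l, ∑ a, g⁻¹ k a * g a l = if k = l then 1 else 0 := by
    intro k l
    rw [← Matrix.mul_apply, Matrix.nonsing_inv_mul _ hg, Matrix.one_apply]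
  have h3 : pairing g⁻¹ g⁻¹ S T = inner ℝ (S i j) (S i j) := by
    have h4 : pairing g⁻¹ g⁻¹ S T = ∑ k, (∑ a, g⁻¹ k a * g a i) *
        ∑ l, (∑ b, g⁻¹ l b * g b j) * inner ℝ (S k l) (S i j) := by
      simp only [pairing, hT, real_inner_smul_right]
      refine Finset.sum_congr rfl fun k _ ↦ ?_
      rw [Finset.sum_mul]
      refine Finset.sum_congr rfl fun a _ ↦ ?_
      rw [mul_assoc]
      refine congrArg _ ?_
      rw [Finset.mul_sum]
      refine Finset.sum_congr rfl fun l _ ↦ ?_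
      rw [Finset.sum_mul, Finset.mul_sum]
      exact Finset.sum_congr rfl fun b _ ↦ by ring
    rw [h4]
    simp [hone]
  rw [h3] at h2
  exact inner_self_eq_zero.1 h2

/-! ### The energy density of a Yang–Mills connection -/

section Energy

variable {n d : ℕ}
  {M : Type u} [TopologicalSpace M] [ChartedSpace (𝔼 n) M] [IsManifold (𝓡 n) ∞ M]
  {G : Type v} [TopologicalSpace G] [ChartedSpace (𝔼 d) G] [Group G] [LieGroup (𝓡 d) ∞ G]
  {P : Type w} [TopologicalSpace P] [ChartedSpace (𝔼 (n + d)) P] [IsManifold (𝓡 (n + d)) ∞ P]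
  {B : PrincipalBundle (n := n) (d := d) M G P} (A : Connection B)
  [RiemannianBundle (fun x : M ↦ TangentSpace (𝓡 n) x)]
  [IsContMDiffRiemannianBundle (𝓡 n) ∞ (𝔼 n) (fun x : M ↦ TangentSpace (𝓡 n) x)]

namespace Connection

theorem contDiffOn_fieldL (c b : M) (i j : Fin n) :
    ContDiffOn ℝ ∞ (A.fieldL c b i j) (A.localDom c b) := by
  refine (contDiffOn_curv (brkL d G) (A.isOpen_localDom c b)
    (fun k ↦ A.contDiffOn_potL c b k) i j).congr fun y _ ↦ A.fieldL_eq_curv c b i j y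

theorem mem_localDom_self {c : M} {y : 𝔼 n} (hy : y ∈ (chartAt (𝔼 n) c).target) :
    y ∈ A.localDom c ((chartAt (𝔼 n) c).symm y) :=
  ⟨hy, B.mem_dom _⟩

variable [CompactSpace G] [LieAlgebra.IsSemisimple ℝ (GroupLieAlgebra (𝓡 d) G)]

/-- The definition switches chart and gauge at every point; near a given point, one fixed chart and
gauge compute all the values. -/
theorem contDiffOn_energyDensity (c : M) :
    ContDiffOn ℝ ∞ (fun y ↦ A.energyDensity ((chartAt (𝔼 n) c).symm y))
      (chartAt (𝔼 n) c).target := by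
  obtain ⟨Φ, br, hΦ, -, -, -, -, -, hAd⟩ := exists_groupLieAlgebra_model d G
  intro y hy
  have hyb := A.mem_localDom_self hy
  set b := (chartAt (𝔼 n) c).symm y
  have hg : IsMetricOn (metric c) (A.localDom c b) :=
    ⟨A.isOpen_localDom c b, fun i j ↦ (contDiffOn_metric c i j).mono fun z hz ↦ hz.1,
      fun z hz ↦ (isMetricOn_metric c).posDef z hz.1⟩
  have hF : ∀ i j, ContDiffOn ℝ ∞ (fun z ↦ Φ (A.fieldL c b i j z)) (A.localDom c b) := fun i j ↦
    Φ.contDiff.comp_contDiffOn (A.contDiffOn_fieldL c b i j)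
  have h1 := (contDiffOn_pairing hg hF hF).contDiffAt ((A.isOpen_localDom c b).mem_nhds hyb)
  refine (h1.congr_of_eventuallyEq ?_).contDiffWithinAt
  filter_upwards [(A.isOpen_localDom c b).mem_nhds hyb] with z hz
  exact A.energyDensity_eq_pairing hΦ hAd hz

theorem energyDensity_nonneg (x : M) : 0 ≤ A.energyDensity x := by
  obtain ⟨Φ, br, hΦ, -, -, -, -, -, hAd⟩ := exists_groupLieAlgebra_model d G
  have hy : chartAt (𝔼 n) x x ∈ A.localDom x x :=
    ⟨(chartAt (𝔼 n) x).map_source (mem_chart_source _ _), by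
      rw [(chartAt (𝔼 n) x).left_inv (mem_chart_source _ _)]; exact B.mem_dom x⟩
  have h := A.energyDensity_eq_pairing hΦ hAd hy
  rw [(chartAt (𝔼 n) x).left_inv (mem_chart_source _ _)] at h
  obtain ⟨C, hC⟩ := (isMetricOn_metric x).exists_inv_eq hy.1
  rw [h]
  exact pairing_self_nonneg hC _

theorem isFlat_of_energyDensity_eq_zero (h : ∀ x, A.energyDensity x = 0) : A.IsFlat := by
  obtain ⟨Φ, br, hΦ, -, -, -, -, -, hAd⟩ := exists_groupLieAlgebra_model d G
  intro c b y hy μ l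
  have h1 := A.energyDensity_eq_pairing hΦ hAd hy
  rw [h] at h1
  obtain ⟨C, hC⟩ := (isMetricOn_metric c).exists_inv_eq hy.1
  have h2 := eq_zero_of_pairing_self_eq_zero ((isMetricOn_metric c).isUnit_det hy.1) hC h1.symm μ l
  exact Φ.injective (h2.trans (map_zero Φ).symm)

/-- The Bochner inequality for Yang–Mills fields. -/
theorem gradSq_energyDensity_le (hcurv : NonnegCurvatureOnTwoForms n M) (hYM : A.IsYangMills)
    {c : M} {y : 𝔼 n} (hy : y ∈ (chartAt (𝔼 n) c).target) {e : 𝔼 n → ℝ}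
    (he : e = fun y ↦ A.energyDensity ((chartAt (𝔼 n) c).symm y)) {a : ℝ} (ha : 0 < a)
    (hea : e y ≤ a) :
    gradSq (metric c) e y / (2 * a) - 4 * n ^ 3 * (e y * Real.sqrt (e y))
      ≤ laplacian (metric c) e y := by
  obtain ⟨Φ, br, hΦ, hΦb, hanti, hjac, hinv, hbr, hAd⟩ := exists_groupLieAlgebra_model d G
  have hyb := A.mem_localDom_self hy
  set b := (chartAt (𝔼 n) c).symm y with hb
  set U := A.localDom c b with hU
  have hUo : IsOpen U := A.isOpen_localDom c b
  have hg : IsMetricOn (metric c) U :=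
    ⟨hUo, fun i j ↦ (contDiffOn_metric c i j).mono fun z hz ↦ hz.1,
      fun z hz ↦ (isMetricOn_metric c).posDef z hz.1⟩
  -- The potential carried to the Euclidean model of the Lie algebra. Since `Φ` intertwines the
  -- brackets, the field strength and the Yang–Mills equation are carried along.
  set A' : Fin n → 𝔼 n → 𝔼 d := fun i z ↦ Φ (A.potL c b i z) with hA'
  have hA's : ∀ k, ContDiffOn ℝ ∞ (A' k) U := fun k ↦
    Φ.contDiff.comp_contDiffOn (A.contDiffOn_potL c b k)
  have hdA : ∀ k, ∀ z ∈ U, DifferentiableAt ℝ (A.potL c b k) z := fun k z hz ↦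
    differentiableAt_of_contDiffOn hUo hz (A.contDiffOn_potL c b k)
  have hcv : ∀ z ∈ U, ∀ i j, curv br A' i j z = Φ (A.fieldL c b i j z) := by
    intro z hz i j
    have h1 : ∀ i k, pd i (A' k) z = Φ (pd i (A.potL c b k) z) := fun i k ↦
      pd_clm (Φ : 𝔼 d →L[ℝ] 𝔼 d) i (hdA k z hz)
    rw [A.fieldL_eq_curv, curv, curv, h1, h1, map_add, map_sub, brkL_apply, hΦb]
  have hYM' : ∀ z ∈ U, ∀ j, ∑ k, ∑ l, (metric c z)⁻¹ k l •
      tensorD br A' (leviCivita (metric c)) (curv br A') k l j z = 0 := by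
    intro z hz j
    set D : Fin n → Fin n → 𝔼 d := fun k l ↦ A.covDeriv c b l j k z with hD
    have h0 : ∑ k, ∑ l, (metric c z)⁻¹ k l • D k l = 0 := hYM c b z hz j
    have h1 : ∀ k l, tensorD br A' (leviCivita (metric c)) (curv br A') k l j z
        = Φ (D k l) := by
      intro k l
      have h2 : pd k (curv br A' l j) z = Φ (pd k (A.fieldL c b l j) z) := by
        rw [pd_congr hUo hz k fun z' hz' ↦ hcv z' hz' l j]
        exact pd_clm (Φ : 𝔼 d →L[ℝ] 𝔼 d) k
          (differentiableAt_of_contDiffOn hUo hz (A.contDiffOn_fieldL c b l j))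
      have h3 : D k l = pd k (A.fieldL c b l j) z
          + brk G (A.potL c b k z) (A.fieldL c b l j z)
          - ∑ s, leviCivita (metric c) k z s l • A.fieldL c b s j z
          - ∑ s, leviCivita (metric c) k z s j • A.fieldL c b l s z := rfl
      rw [h3, tensorD, h2, tensorAct]
      simp only [hcv z hz, map_sub, map_add, map_sum, map_smul, hΦb]
      simp only [hA']
      abel
    have h4 := congrArg Φ h0
    simp only [map_sum, map_smul, map_zero] at h4
    simp only [h1, h4]
  set e' : 𝔼 n → ℝ := fun z ↦ pairing (metric c z)⁻¹ (metric c z)⁻¹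
    (fun i j ↦ curv br A' i j z) (fun i j ↦ curv br A' i j z) with he'
  have hee : ∀ z ∈ U, e z = e' z := by
    intro z hz
    rw [he, he']
    simp only [hcv z hz]
    exact A.energyDensity_eq_pairing hΦ hAd hz
  have hey := hee y hyb
  rw [gradSq_congr hUo hee hyb, laplacian_congr hUo hee hyb, hey]
  rw [hey] at hea
  exact gradSq_div_sub_le_laplacian br hg hanti hjac hinv hbr hA's hYM' hyb
    (fun L hL ↦ hcurv c y hy L hL) he' ha hea

end Connection

end Energy

end YangMills

namespace YangMills

/-! ### The Riemannian volume measure -/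

section ChartMeasurability

variable {n : ℕ} {M : Type u} [TopologicalSpace M] [ChartedSpace (𝔼 n) M]
  [MeasurableSpace M] [BorelSpace M]

theorem measurableSet_target_inter_preimage (c : M) {S : Set M} (hS : MeasurableSet S) :
    MeasurableSet ((chartAt (𝔼 n) c).target ∩ (chartAt (𝔼 n) c).symm ⁻¹' S) := by
  have h1 : Measurable ((chartAt (𝔼 n) c).target.domRestrict (chartAt (𝔼 n) c).symm) :=
    (chartAt (𝔼 n) c).continuousOn_symm.domRestrict.measurable
  have h2 := MeasurableSet.subtype_image (chartAt (𝔼 n) c).open_target.measurableSet (h1 hS)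
  convert h2 using 1
  ext y
  simp [Set.domRestrict, and_comm]

theorem aemeasurable_chartAt_symm (c : M) :
    AEMeasurable (chartAt (𝔼 n) c).symm
      ((volume : Measure (𝔼 n)).restrict (chartAt (𝔼 n) c).target) :=
  (chartAt (𝔼 n) c).continuousOn_symm.aemeasurable (chartAt (𝔼 n) c).open_target.measurableSet

end ChartMeasurability

section Volume

variable {n : ℕ} {M : Type u} [TopologicalSpace M] [ChartedSpace (𝔼 n) M]
  [RiemannianBundle (fun x : M ↦ TangentSpace (𝓡 n) x)]

/-- The density of the Riemannian volume in the chart at `c`. -/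
def volDensity (c : M) (y : 𝔼 n) : ℝ := √(metric c y).det

theorem volDensity_nonneg (c : M) (y : 𝔼 n) : 0 ≤ volDensity c y := Real.sqrt_nonneg _

variable [IsManifold (𝓡 n) ∞ M]
  [IsContMDiffRiemannianBundle (𝓡 n) ∞ (𝔼 n) (fun x : M ↦ TangentSpace (𝓡 n) x)]

theorem volDensity_pos {c : M} {y : 𝔼 n} (hy : y ∈ (chartAt (𝔼 n) c).target) :
    0 < volDensity c y :=
  Real.sqrt_pos.2 ((isMetricOn_metric c).det_pos hy)

theorem continuousOn_volDensity (c : M) :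
    ContinuousOn (volDensity c) (chartAt (𝔼 n) c).target :=
  (contDiffOn_det (fun i j ↦ contDiffOn_metric c i j) |>.continuousOn).sqrt

theorem volDensity_transition {c c' : M} {y : 𝔼 n} (hy : y ∈ (chartAt (𝔼 n) c).target)
    (hy' : (chartAt (𝔼 n) c).symm y ∈ (chartAt (𝔼 n) c').source) :
    volDensity c y = |(fderiv ℝ (transition c c') y).det| * volDensity c' (transition c c' y) := by
  rw [volDensity, metric_transition hy hy', Matrix.det_mul, Matrix.det_mul, Matrix.det_transpose,
    jacobian_det, mul_right_comm, ← sq, Real.sqrt_mul (sq_nonneg _), Real.sqrt_sq_eq_abs]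
  rfl

variable [MeasurableSpace M]

theorem chartVolume_eq (c : M) : chartVolume (n := n) c
    = (((volume : Measure (𝔼 n)).restrict (chartAt (𝔼 n) c).target).withDensity
      (fun y ↦ ENNReal.ofReal (volDensity c y))).map (chartAt (𝔼 n) c).symm := rfl

theorem aemeasurable_ofReal_volDensity (c : M) :
    AEMeasurable (fun y ↦ ENNReal.ofReal (volDensity c y))
      ((volume : Measure (𝔼 n)).restrict (chartAt (𝔼 n) c).target) :=
  ((continuousOn_volDensity c).aemeasurable
    (chartAt (𝔼 n) c).open_target.measurableSet).ennreal_ofReal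

variable [BorelSpace M]

theorem aemeasurable_chartAt_symm_withDensity (c : M) :
    AEMeasurable (chartAt (𝔼 n) c).symm
      (((volume : Measure (𝔼 n)).restrict (chartAt (𝔼 n) c).target).withDensity
      (fun y ↦ ENNReal.ofReal (volDensity c y))) :=
  (aemeasurable_chartAt_symm c).mono_ac (withDensity_absolutelyContinuous _ _)

theorem chartVolume_apply (c : M) {S : Set M} (hS : MeasurableSet S) :
    chartVolume (n := n) c S
      = ∫⁻ y in (chartAt (𝔼 n) c).target ∩ (chartAt (𝔼 n) c).symm ⁻¹' S,
        ENNReal.ofReal (volDensity c y) := by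
  rw [chartVolume_eq, Measure.map_apply_of_aemeasurable (aemeasurable_chartAt_symm_withDensity c) hS,
    withDensity_apply', Measure.restrict_restrict₀ ((aemeasurable_chartAt_symm c).nullMeasurable hS),
    Set.inter_comm]

/-- Change of variables under the transition map: its Jacobian determinant is exactly the ratio of
the two densities. -/
theorem chartVolume_eq_of_subset {c c' : M} {S : Set M} (hS : MeasurableSet S)
    (h : S ⊆ (chartAt (𝔼 n) c).source) (h' : S ⊆ (chartAt (𝔼 n) c').source) :
    chartVolume (n := n) c S = chartVolume (n := n) c' S := by
  rw [chartVolume_apply c hS, chartVolume_apply c' hS]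
  set D := (chartAt (𝔼 n) c).target ∩ (chartAt (𝔼 n) c).symm ⁻¹' S with hD
  have hDm : MeasurableSet D := measurableSet_target_inter_preimage c hS
  have hinv : ∀ y ∈ D, transition c' c (transition c c' y) = y := fun y hy ↦ by
    simp only [transition]
    rw [(chartAt (𝔼 n) c').left_inv (h' hy.2), (chartAt (𝔼 n) c).right_inv hy.1]
  have himg : transition c c' '' D
      = (chartAt (𝔼 n) c').target ∩ (chartAt (𝔼 n) c').symm ⁻¹' S := by
    ext z
    constructor
    · rintro ⟨y, hy, rfl⟩
      refine ⟨(chartAt (𝔼 n) c').map_source (h' hy.2), ?_⟩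
      simp only [transition, Set.mem_preimage]
      rw [(chartAt (𝔼 n) c').left_inv (h' hy.2)]
      exact hy.2
    · rintro ⟨hz, hzS⟩
      refine ⟨transition c' c z, ⟨(chartAt (𝔼 n) c).map_source (h hzS), ?_⟩, ?_⟩
      · simp only [transition, Set.mem_preimage]
        rw [(chartAt (𝔼 n) c).left_inv (h hzS)]
        exact hzS
      · simp only [transition]
        rw [(chartAt (𝔼 n) c).left_inv (h hzS), (chartAt (𝔼 n) c').right_inv hz]
  rw [← himg, lintegral_image_eq_lintegral_abs_det_fderiv_mul volume hDm
    (fun y hy ↦ (((contDiffAt_transition hy.1 (h' hy.2)).differentiableAt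
      (by simp)).hasFDerivAt).hasFDerivWithinAt)
    (fun a ha b hb hab ↦ by rw [← hinv a ha, ← hinv b hb, hab])]
  refine setLIntegral_congr_fun hDm fun y hy ↦ ?_
  rw [volDensity_transition hy.1 (h' hy.2), ENNReal.ofReal_mul (abs_nonneg _)]

theorem chartVolume_compl_source (c : M) :
    chartVolume (n := n) c (chartAt (𝔼 n) c).sourceᶜ = 0 := by
  rw [chartVolume_apply c (chartAt (𝔼 n) c).open_source.measurableSet.compl]
  have : (chartAt (𝔼 n) c).target ∩ (chartAt (𝔼 n) c).symm ⁻¹' (chartAt (𝔼 n) c).sourceᶜ = ∅ := by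
    ext y
    simp only [Set.mem_inter_iff, Set.mem_preimage, Set.mem_compl_iff, Set.mem_empty_iff_false,
      iff_false, not_and, not_not]
    exact (chartAt (𝔼 n) c).map_target
  rw [this, Measure.restrict_empty, lintegral_zero_measure]

theorem chartVolume_restrict_source (c : M) :
    (chartVolume (n := n) c).restrict (chartAt (𝔼 n) c).source = chartVolume (n := n) c :=
  Measure.restrict_eq_self_of_ae_mem (chartVolume_compl_source c)

theorem chartVolume_restrict_le (c c' : M) :
    (chartVolume (n := n) c').restrict (chartAt (𝔼 n) c).source ≤ chartVolume (n := n) c := by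
  refine Measure.le_iff.2 fun S hS ↦ ?_
  have hc := (chartAt (𝔼 n) c).open_source.measurableSet
  have hc' := (chartAt (𝔼 n) c').open_source.measurableSet
  rw [Measure.restrict_apply hS, ← chartVolume_restrict_source c',
    Measure.restrict_apply (hS.inter hc),
    chartVolume_eq_of_subset ((hS.inter hc).inter hc') (c := c') (c' := c)
      Set.inter_subset_right (Set.inter_subset_left.trans Set.inter_subset_right)]
  exact measure_mono (Set.inter_subset_left.trans Set.inter_subset_left)

/-- On the domain of `c` every chart measure is bounded by that of `c`, so the supremum adds nothing
there. For the upper bound, a single measure is exhibited that dominates all chart measures: the one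
of `c`, plus the supremum restricted to the complement of the domain. -/
theorem riemannianVolume_restrict_source (c : M) :
    (riemannianVolume n M).restrict (chartAt (𝔼 n) c).source = chartVolume (n := n) c := by
  have hc := (chartAt (𝔼 n) c).open_source.measurableSet
  refine le_antisymm ?_ ?_
  · have h : riemannianVolume n M ≤ chartVolume (n := n) c
        + (riemannianVolume n M).restrict (chartAt (𝔼 n) c).sourceᶜ := by
      refine iSup_le fun c' ↦ ?_
      rw [← Measure.restrict_add_restrict_compl (μ := chartVolume (n := n) c') hc]
      exact add_le_add (chartVolume_restrict_le c c')
        (Measure.restrict_mono le_rfl (le_iSup (fun c : M ↦ chartVolume (n := n) c) c'))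
    refine (Measure.restrict_mono le_rfl h).trans ?_
    rw [Measure.restrict_add, Measure.restrict_restrict hc]
    simp [chartVolume_restrict_source]
  · rw [← chartVolume_restrict_source]
    exact Measure.restrict_mono le_rfl (le_iSup (fun c : M ↦ chartVolume (n := n) c) c)

theorem map_chartAt_chartVolume (c : M) :
    (chartVolume (n := n) c).map (chartAt (𝔼 n) c)
      = ((volume : Measure (𝔼 n)).restrict (chartAt (𝔼 n) c).target).withDensity
      (fun y ↦ ENNReal.ofReal (volDensity c y)) := by
  have h1 : AEMeasurable (chartAt (𝔼 n) c) (chartVolume (n := n) c) := by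
    rw [← chartVolume_restrict_source]
    exact (chartAt (𝔼 n) c).continuousOn.aemeasurable (chartAt (𝔼 n) c).open_source.measurableSet
  rw [chartVolume_eq] at h1 ⊢
  rw [AEMeasurable.map_map_of_aemeasurable h1 (aemeasurable_chartAt_symm_withDensity c)]
  refine (Measure.map_congr ?_).trans Measure.map_id
  refine (withDensity_absolutelyContinuous _ _).ae_le ?_
  filter_upwards [ae_restrict_mem (chartAt (𝔼 n) c).open_target.measurableSet] with y hy
  exact (chartAt (𝔼 n) c).right_inv hy

theorem aestronglyMeasurable_chartVolume {E : Type*} [TopologicalSpace E] {f : M → E} {c : M}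
    (hf : AEStronglyMeasurable (fun y ↦ f ((chartAt (𝔼 n) c).symm y))
      ((volume : Measure (𝔼 n)).restrict (chartAt (𝔼 n) c).target)) :
    AEStronglyMeasurable f (chartVolume (n := n) c) := by
  have h1 : AEMeasurable (chartAt (𝔼 n) c) (chartVolume (n := n) c) := by
    rw [← chartVolume_restrict_source]
    exact (chartAt (𝔼 n) c).continuousOn.aemeasurable (chartAt (𝔼 n) c).open_source.measurableSet
  have h2 := hf.mono_ac (withDensity_absolutelyContinuous _
    (fun y ↦ ENNReal.ofReal (volDensity c y)))
  rw [← map_chartAt_chartVolume] at h2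
  refine (h2.comp_aemeasurable h1).congr ?_
  rw [← chartVolume_restrict_source]
  filter_upwards [ae_restrict_mem (chartAt (𝔼 n) c).open_source.measurableSet] with x hx
  simp [(chartAt (𝔼 n) c).left_inv hx]

theorem integral_chartVolume {f : M → ℝ} {c : M}
    (hf : AEStronglyMeasurable (fun y ↦ f ((chartAt (𝔼 n) c).symm y))
      ((volume : Measure (𝔼 n)).restrict (chartAt (𝔼 n) c).target)) :
    ∫ x, f x ∂(chartVolume (n := n) c)
      = ∫ y in (chartAt (𝔼 n) c).target, volDensity c y * f ((chartAt (𝔼 n) c).symm y) := by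
  have h1 := aestronglyMeasurable_chartVolume hf
  rw [chartVolume_eq] at h1 ⊢
  rw [integral_map (aemeasurable_chartAt_symm_withDensity c) h1,
    integral_withDensity_eq_integral_toReal_smul₀ (aemeasurable_ofReal_volDensity c)
      (Filter.Eventually.of_forall fun _ ↦ ENNReal.ofReal_lt_top)]
  refine integral_congr_ae (Filter.Eventually.of_forall fun y ↦ ?_)
  simp [ENNReal.toReal_ofReal (volDensity_nonneg c y)]

theorem integrable_chartVolume_iff {f : M → ℝ} {c : M}
    (hf : AEStronglyMeasurable (fun y ↦ f ((chartAt (𝔼 n) c).symm y))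
      ((volume : Measure (𝔼 n)).restrict (chartAt (𝔼 n) c).target)) :
    Integrable f (chartVolume (n := n) c)
      ↔ IntegrableOn (fun y ↦ volDensity c y * f ((chartAt (𝔼 n) c).symm y))
        (chartAt (𝔼 n) c).target := by
  have h1 := aestronglyMeasurable_chartVolume hf
  rw [chartVolume_eq] at h1 ⊢
  rw [integrable_map_measure h1 (aemeasurable_chartAt_symm_withDensity c),
    integrable_withDensity_iff_integrable_smul₀' (aemeasurable_ofReal_volDensity c)
      (Filter.Eventually.of_forall fun _ ↦ ENNReal.ofReal_lt_top)]
  refine integrable_congr (Filter.Eventually.of_forall fun y ↦ ?_)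
  simp [ENNReal.toReal_ofReal (volDensity_nonneg c y)]

theorem isLocallyFiniteMeasure_riemannianVolume :
    IsLocallyFiniteMeasure (riemannianVolume n M) := by
  refine ⟨fun x ↦ ?_⟩
  have hx := mem_chart_target (𝔼 n) x
  have hU := (chartAt (𝔼 n) x).open_target.mem_nhds hx
  have hc : ContinuousAt (volDensity x) (chartAt (𝔼 n) x x) :=
    (continuousOn_volDensity x).continuousAt hU
  set C := volDensity x (chartAt (𝔼 n) x x) + 1 with hC
  have h1 : ∀ᶠ y in nhds (chartAt (𝔼 n) x x), volDensity x y < C ∧ y ∈ (chartAt (𝔼 n) x).target :=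
    (hc.eventually_lt_const (lt_add_one _)).and hU
  obtain ⟨r, hr, hball⟩ := Metric.eventually_nhds_iff_ball.1 h1
  set V := (chartAt (𝔼 n) x).source ∩ chartAt (𝔼 n) x ⁻¹' Metric.ball (chartAt (𝔼 n) x x) r with hV
  have hVo : IsOpen V := (chartAt (𝔼 n) x).isOpen_inter_preimage Metric.isOpen_ball
  refine ⟨V, hVo.mem_nhds ⟨mem_chart_source _ _, Metric.mem_ball_self hr⟩, ?_⟩
  have h2 : riemannianVolume n M V = chartVolume (n := n) x V := by
    rw [← riemannianVolume_restrict_source, Measure.restrict_apply hVo.measurableSet,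
      Set.inter_eq_left.2 Set.inter_subset_left]
  rw [h2, chartVolume_apply x hVo.measurableSet]
  have h3 : (chartAt (𝔼 n) x).target ∩ (chartAt (𝔼 n) x).symm ⁻¹' V
      ⊆ Metric.ball (chartAt (𝔼 n) x x) r := by
    rintro y ⟨hy, -, hy2⟩
    rw [Set.mem_preimage, (chartAt (𝔼 n) x).right_inv hy] at hy2
    exact hy2
  refine (lintegral_mono_set h3).trans_lt ((setLIntegral_mono' (g := fun _ ↦ ENNReal.ofReal C)
    measurableSet_ball fun y hy ↦ ENNReal.ofReal_le_ofReal (hball y hy).1.le).trans_lt ?_)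
  rw [setLIntegral_const]
  exact ENNReal.mul_lt_top ENNReal.ofReal_lt_top measure_ball_lt_top

theorem riemannianVolume_pos_of_isOpen {U : Set M} (hU : IsOpen U) (hne : U.Nonempty) :
    0 < riemannianVolume n M U := by
  obtain ⟨x, hx⟩ := hne
  have h1 : chartVolume (n := n) x U ≤ riemannianVolume n M U :=
    Measure.le_iff.1 (le_iSup (fun c : M ↦ chartVolume (n := n) c) x) _ hU.measurableSet
  refine lt_of_lt_of_le ?_ h1
  rw [chartVolume_apply x hU.measurableSet]
  have hO : IsOpen ((chartAt (𝔼 n) x).target ∩ (chartAt (𝔼 n) x).symm ⁻¹' U) :=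
    (chartAt (𝔼 n) x).isOpen_inter_preimage_symm hU
  have hne : ((chartAt (𝔼 n) x).target ∩ (chartAt (𝔼 n) x).symm ⁻¹' U).Nonempty :=
    ⟨chartAt (𝔼 n) x x, mem_chart_target _ _, by simpa using hx⟩
  refine pos_iff_ne_zero.2 fun h0 ↦ (hO.measure_pos volume hne).ne' ?_
  rw [lintegral_eq_zero_iff' ((aemeasurable_ofReal_volDensity x).mono_measure
    (Measure.restrict_mono Set.inter_subset_left le_rfl))] at h0
  rw [← Measure.restrict_apply_univ, Measure.measure_univ_eq_zero, ← ae_eq_bot,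
    ← Filter.eventually_false_iff_eq_bot]
  filter_upwards [h0, ae_restrict_mem hO.measurableSet] with y hy hyO
  simp only [Pi.zero_apply, ENNReal.ofReal_eq_zero] at hy
  exact (volDensity_pos hyO.1).not_ge hy

end Volume

end YangMills

namespace YangMills

/-! ### Differentials and the inner product of covectors -/

section Cometric

variable {n : ℕ} {M : Type u} [TopologicalSpace M] [ChartedSpace (𝔼 n) M]

variable (n) in
/-- The differential of a real function, as a covector on the model space. -/
def dM (w : M → ℝ) (x : M) : 𝔼 n →L[ℝ] ℝ := mfderiv (𝓡 n) 𝓘(ℝ, ℝ) w x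

theorem mdifferentiableAt_comp_chartAt_symm_iff [IsManifold (𝓡 n) ∞ M] {c : M} {y : 𝔼 n}
    (hy : y ∈ (chartAt (𝔼 n) c).target) {w : M → ℝ} :
    DifferentiableAt ℝ (fun z ↦ w ((chartAt (𝔼 n) c).symm z)) y
      ↔ MDifferentiableAt (𝓡 n) 𝓘(ℝ, ℝ) w ((chartAt (𝔼 n) c).symm y) := by
  constructor
  · intro h
    have hx := (chartAt (𝔼 n) c).map_target hy
    have h1 : MDifferentiableAt (𝓡 n) 𝓘(ℝ, ℝ) (fun z ↦ w ((chartAt (𝔼 n) c).symm z))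
        (chartAt (𝔼 n) c ((chartAt (𝔼 n) c).symm y)) := by
      rw [(chartAt (𝔼 n) c).right_inv hy]
      exact h.mdifferentiableAt
    refine (h1.comp ((chartAt (𝔼 n) c).symm y) (mdifferentiableAt_chartAt hx)).congr_of_eventuallyEq ?_
    filter_upwards [(chartAt (𝔼 n) c).open_source.mem_nhds hx] with z hz
    simp [(chartAt (𝔼 n) c).left_inv hz]
  · intro h
    exact (h.comp y (mdifferentiableAt_chartAt_symm hy)).differentiableAt

/-- The chain rule when `w` is differentiable. Otherwise neither derivative exists and both take the
default value zero, so no hypothesis on `w` is needed. -/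
theorem dM_frame [IsManifold (𝓡 n) ∞ M] {c : M} {y : 𝔼 n} (hy : y ∈ (chartAt (𝔼 n) c).target)
    (w : M → ℝ) (v : 𝔼 n) :
    dM n w ((chartAt (𝔼 n) c).symm y) (frame c y v)
      = fderiv ℝ (fun z ↦ w ((chartAt (𝔼 n) c).symm z)) y v := by
  by_cases h : MDifferentiableAt (𝓡 n) 𝓘(ℝ, ℝ) w ((chartAt (𝔼 n) c).symm y)
  · have h1 := mfderiv_comp y h (mdifferentiableAt_chartAt_symm hy)
    rw [mfderiv_eq_fderiv] at h1
    exact (congrArg (fun L : 𝔼 n →L[ℝ] ℝ ↦ L v) h1).symm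
  · rw [fderiv_zero_of_not_differentiableAt
      (fun h' ↦ h ((mdifferentiableAt_comp_chartAt_symm_iff hy).1 h')), dM,
      mfderiv_zero_of_not_mdifferentiableAt h]
    rfl

variable [RiemannianBundle (fun x : M ↦ TangentSpace (𝓡 n) x)]

theorem ginner_injective (x : M) : Function.Injective (ginner (n := n) x) := by
  intro v w h
  by_contra hne
  have h1 := ginner_self_pos x (sub_ne_zero.2 hne)
  rw [LinearMap.map_sub₂, h, sub_self] at h1
  exact h1.false

/-- The vector that represents a covector with respect to the Riemannian metric. -/
def sharp (x : M) (α : 𝔼 n →L[ℝ] ℝ) : 𝔼 n :=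
  (LinearEquiv.ofInjectiveOfFinrankEq (ginner (n := n) x) (ginner_injective x)
    (by rw [Subspace.dual_finrank_eq])).symm (α : 𝔼 n →ₗ[ℝ] ℝ)

theorem ginner_sharp (x : M) (α : 𝔼 n →L[ℝ] ℝ) (v : 𝔼 n) : ginner x (sharp x α) v = α v := by
  have h := LinearEquiv.apply_symm_apply (LinearEquiv.ofInjectiveOfFinrankEq
    (ginner (n := n) x) (ginner_injective x)
    (by rw [Subspace.dual_finrank_eq])) (α : 𝔼 n →ₗ[ℝ] ℝ)
  exact congrArg (fun L : 𝔼 n →ₗ[ℝ] ℝ ↦ L v) h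

theorem eq_sharp {x : M} {α : 𝔼 n →L[ℝ] ℝ} {v : 𝔼 n} (h : ∀ u, ginner x v u = α u) :
    v = sharp x α := by
  refine ginner_injective x (LinearMap.ext fun u ↦ ?_)
  rw [h, ginner_sharp]

/-- The inner product of covectors. -/
def cometric (x : M) (α β : 𝔼 n →L[ℝ] ℝ) : ℝ := ginner x (sharp x α) (sharp x β)

theorem cometric_eq_left (x : M) (α β : 𝔼 n →L[ℝ] ℝ) : cometric x α β = α (sharp x β) :=
  ginner_sharp x α _

theorem cometric_comm (x : M) (α β : 𝔼 n →L[ℝ] ℝ) : cometric x α β = cometric x β α :=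
  ginner_symm _ _ _

theorem cometric_add_left (x : M) (α α' β : 𝔼 n →L[ℝ] ℝ) :
    cometric x (α + α') β = cometric x α β + cometric x α' β := by
  simp [cometric_eq_left]

theorem cometric_smul_left (x : M) (r : ℝ) (α β : 𝔼 n →L[ℝ] ℝ) :
    cometric x (r • α) β = r * cometric x α β := by
  simp [cometric_eq_left]

theorem cometric_sum_left {ι : Type*} (s : Finset ι) (x : M) (α : ι → 𝔼 n →L[ℝ] ℝ)
    (β : 𝔼 n →L[ℝ] ℝ) : cometric x (∑ i ∈ s, α i) β = ∑ i ∈ s, cometric x (α i) β := by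
  simp [cometric_eq_left]

theorem cometric_self_nonneg (x : M) (α : 𝔼 n →L[ℝ] ℝ) : 0 ≤ cometric x α α :=
  ginner_self_nonneg _ _

/-- Evaluation at the vector that represents `α` gives `|α|² ≤ K |α|`. -/
theorem cometric_self_le {x : M} {α : 𝔼 n →L[ℝ] ℝ} {K : ℝ}
    (h : ∀ v, α v ≤ K * √(ginner x v v)) : cometric x α α ≤ K ^ 2 := by
  have h1 := h (sharp x α)
  rw [← cometric_eq_left] at h1
  change cometric x α α ≤ K * √(cometric x α α) at h1
  set t := √(cometric x α α) with ht
  have h2 : cometric x α α = t ^ 2 := (Real.sq_sqrt (cometric_self_nonneg x α)).symm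
  have h3 : 0 ≤ t := Real.sqrt_nonneg _
  rw [h2] at h1 ⊢
  rcases h3.eq_or_lt with h0 | h0
  · rw [← h0, zero_pow two_ne_zero]; positivity
  · have : t ≤ K := le_of_mul_le_mul_right (by nlinarith) h0
    exact pow_le_pow_left₀ h3 this 2

variable [IsManifold (𝓡 n) ∞ M]
  [IsContMDiffRiemannianBundle (𝓡 n) ∞ (𝔼 n) (fun x : M ↦ TangentSpace (𝓡 n) x)]

theorem cometric_eq_sum {c : M} {y : 𝔼 n} (hy : y ∈ (chartAt (𝔼 n) c).target)
    (α β : 𝔼 n →L[ℝ] ℝ) :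
    cometric ((chartAt (𝔼 n) c).symm y) α β = ∑ k, ∑ l, (metric c y)⁻¹ k l
      * α (frame c y (EuclideanSpace.single k 1)) * β (frame c y (EuclideanSpace.single l 1)) := by
  have hg := isMetricOn_metric (n := n) c
  set v : 𝔼 n := WithLp.toLp 2 fun k ↦
    ∑ l, (metric c y)⁻¹ k l * β (frame c y (EuclideanSpace.single l 1)) with hv
  have hsurj : Function.Surjective (frame c y) :=
    (LinearMap.injective_iff_surjective (f := (frame c y : 𝔼 n →ₗ[ℝ] 𝔼 n))).1 (frame_injective hy)
  have hone : ∀ j l, ∑ i, (metric c y)⁻¹ l i * metric c y i j = if l = j then 1 else 0 := by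
    intro j l
    rw [← Matrix.mul_apply, Matrix.nonsing_inv_mul _ (hg.isUnit_det hy), Matrix.one_apply]
  have hs : frame c y v = sharp ((chartAt (𝔼 n) c).symm y) β := by
    refine eq_sharp fun u ↦ ?_
    obtain ⟨u, rfl⟩ := hsurj u
    rw [ginner_frame]
    have h2 : β (frame c y u) = ∑ j, u j * β (frame c y (EuclideanSpace.single j 1)) := by
      conv_lhs => rw [← sum_smul_single u]
      simp [map_sum, map_smul]
    rw [h2, Finset.sum_comm]
    refine Finset.sum_congr rfl fun j _ ↦ ?_
    have h3 : ∑ i, metric c y i j * v i * u j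
        = u j * ∑ l, (∑ i, (metric c y)⁻¹ l i * metric c y i j)
          * β (frame c y (EuclideanSpace.single l 1)) := by
      simp only [hv, Finset.sum_mul, Finset.mul_sum]
      rw [Finset.sum_comm]
      refine Finset.sum_congr rfl fun l _ ↦ Finset.sum_congr rfl fun i _ ↦ ?_
      rw [hg.inv_symm hy i l]; ring
    rw [h3]
    simp [hone]
  rw [cometric_eq_left, ← hs]
  conv_lhs => rw [← sum_smul_single v]
  simp only [map_sum, map_smul, smul_eq_mul, hv, Finset.sum_mul]
  exact Finset.sum_congr rfl fun k _ ↦ Finset.sum_congr rfl fun l _ ↦ by ring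

theorem cometric_dM {c : M} {y : 𝔼 n} (hy : y ∈ (chartAt (𝔼 n) c).target) (u w : M → ℝ) :
    cometric ((chartAt (𝔼 n) c).symm y) (dM n u ((chartAt (𝔼 n) c).symm y))
        (dM n w ((chartAt (𝔼 n) c).symm y))
      = ∑ k, ∑ l, (metric c y)⁻¹ k l * pd k (fun z ↦ u ((chartAt (𝔼 n) c).symm z)) y
        * pd l (fun z ↦ w ((chartAt (𝔼 n) c).symm z)) y := by
  simp only [cometric_eq_sum hy, dM_frame hy, pd]

theorem cometric_dM_self {c : M} {y : 𝔼 n} (hy : y ∈ (chartAt (𝔼 n) c).target) (w : M → ℝ) :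
    cometric ((chartAt (𝔼 n) c).symm y) (dM n w ((chartAt (𝔼 n) c).symm y))
        (dM n w ((chartAt (𝔼 n) c).symm y))
      = gradSq (metric c) (fun z ↦ w ((chartAt (𝔼 n) c).symm z)) y :=
  cometric_dM hy w w

end Cometric

theorem locallyLipschitzOn_mul {n : ℕ} {U : Set (𝔼 n)} {f g : 𝔼 n → ℝ}
    (hf : LocallyLipschitzOn U f) (hg : LocallyLipschitzOn U g) :
    LocallyLipschitzOn U (fun x ↦ f x * g x) := by
  intro y hy
  obtain ⟨K, t, ht, h⟩ := hf hy
  obtain ⟨K', t', ht', h'⟩ := hg hy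
  have hm : ContDiff ℝ 1 (fun p : ℝ × ℝ ↦ p.1 * p.2) := contDiff_fst.mul contDiff_snd
  obtain ⟨L, s, hs, hL⟩ := hm.locallyLipschitz (f y, g y)
  have hcont : ContinuousWithinAt (fun z ↦ (f z, g z)) U y :=
    (hf.continuousOn y hy).prodMk (hg.continuousOn y hy)
  refine ⟨L * max K K', t ∩ t' ∩ (fun z ↦ (f z, g z)) ⁻¹' s,
    Filter.inter_mem (Filter.inter_mem ht ht') (hcont hs), ?_⟩
  exact hL.comp ((h.mono (Set.inter_subset_left.trans Set.inter_subset_left)).prodMk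
    (h'.mono (Set.inter_subset_left.trans Set.inter_subset_right))) (fun z hz ↦ hz.2)

theorem locallyLipschitzOn_of_contDiffOn {n : ℕ} {U : Set (𝔼 n)} (hU : IsOpen U) {f : 𝔼 n → ℝ}
    (hf : ContDiffOn ℝ ∞ f U) : LocallyLipschitzOn U f := by
  intro y hy
  obtain ⟨K, t, ht, h⟩ := ((hf.contDiffAt (hU.mem_nhds hy)).of_le
    (m := 1) (by simp)).exists_lipschitzOnWith
  exact ⟨K, t, mem_nhdsWithin_of_mem_nhds ht, h⟩

/-! ### Functions that are smooth or locally Lipschitz in charts -/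

section SmoothInCharts

variable {n : ℕ} {M : Type u} [TopologicalSpace M] [ChartedSpace (𝔼 n) M]

theorem continuous_of_chart {E : Type*} [TopologicalSpace E] {f : M → E}
    (hf : ∀ c : M, ContinuousOn (fun y ↦ f ((chartAt (𝔼 n) c).symm y)) (chartAt (𝔼 n) c).target) :
    Continuous f := by
  refine continuous_iff_continuousAt.2 fun x ↦ ?_
  have h1 := (hf x).continuousAt ((chartAt (𝔼 n) x).open_target.mem_nhds (mem_chart_target _ x))
  have h2 : ContinuousAt (fun z ↦ f ((chartAt (𝔼 n) x).symm (chartAt (𝔼 n) x z))) x :=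
    ContinuousAt.comp (f := chartAt (𝔼 n) x) (g := fun y ↦ f ((chartAt (𝔼 n) x).symm y)) h1
      ((chartAt (𝔼 n) x).continuousAt (mem_chart_source _ x))
  refine h2.congr ?_
  filter_upwards [chart_source_mem_nhds (𝔼 n) x] with z hz
  simp [(chartAt (𝔼 n) x).left_inv hz]

variable (n) in
/-- Smoothness in all the charts `chartAt _ c`. -/
def ChartSmooth (f : M → ℝ) : Prop :=
  ∀ c : M, ContDiffOn ℝ ∞ (fun y ↦ f ((chartAt (𝔼 n) c).symm y)) (chartAt (𝔼 n) c).target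

variable (n) in
/-- Local Lipschitz continuity in all the charts `chartAt _ c`. -/
def ChartLipschitz (f : M → ℝ) : Prop :=
  ∀ c : M, LocallyLipschitzOn (chartAt (𝔼 n) c).target (fun y ↦ f ((chartAt (𝔼 n) c).symm y))

theorem ChartSmooth.continuous {f : M → ℝ} (hf : ChartSmooth n f) : Continuous f :=
  continuous_of_chart fun c ↦ (hf c).continuousOn

theorem ChartLipschitz.continuous {f : M → ℝ} (hf : ChartLipschitz n f) : Continuous f :=
  continuous_of_chart fun c ↦ (hf c).continuousOn

theorem ChartSmooth.mdifferentiableAt [IsManifold (𝓡 n) ∞ M] {f : M → ℝ} (hf : ChartSmooth n f)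
    (x : M) : MDifferentiableAt (𝓡 n) 𝓘(ℝ, ℝ) f x := by
  have h := (mdifferentiableAt_comp_chartAt_symm_iff (w := f) (mem_chart_target (𝔼 n) x)).1
    (((hf x).contDiffAt ((chartAt (𝔼 n) x).open_target.mem_nhds
      (mem_chart_target _ x))).differentiableAt (by simp))
  simpa using h

theorem chartSmooth_of_contMDiff [IsManifold (𝓡 n) ∞ M] {f : M → ℝ}
    (hf : ContMDiff (𝓡 n) 𝓘(ℝ, ℝ) ∞ f) : ChartSmooth n f := fun _ ↦
  (hf.comp_contMDiffOn contMDiffOn_chart_symm).contDiffOn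

theorem ChartSmooth.chartLipschitz {f : M → ℝ} (hf : ChartSmooth n f) : ChartLipschitz n f :=
  fun c ↦ locallyLipschitzOn_of_contDiffOn (chartAt (𝔼 n) c).open_target (hf c)

theorem ChartLipschitz.mul {f g : M → ℝ} (hf : ChartLipschitz n f) (hg : ChartLipschitz n g) :
    ChartLipschitz n (fun x ↦ f x * g x) := fun c ↦ locallyLipschitzOn_mul (hf c) (hg c)

theorem continuous_cometric_dM_self [IsManifold (𝓡 n) ∞ M]
    [RiemannianBundle (fun x : M ↦ TangentSpace (𝓡 n) x)]
    [IsContMDiffRiemannianBundle (𝓡 n) ∞ (𝔼 n) (fun x : M ↦ TangentSpace (𝓡 n) x)]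
    {f : M → ℝ} (hf : ChartSmooth n f) :
    Continuous fun x : M ↦ cometric (n := n) x (dM n f x) (dM n f x) := by
  refine continuous_of_chart (n := n) fun c ↦ ?_
  have hU := (chartAt (𝔼 n) c).open_target
  have : ContinuousOn (gradSq (metric c) (fun z ↦ f ((chartAt (𝔼 n) c).symm z)))
      (chartAt (𝔼 n) c).target := by
    refine continuousOn_finsetSum _ fun k _ ↦ continuousOn_finsetSum _ fun l _ ↦ ?_
    exact (((isMetricOn_metric c).contDiffOn_inv k l).continuousOn.mul
      (contDiffOn_pd hU (hf c) k).continuousOn).mul (contDiffOn_pd hU (hf c) l).continuousOn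
  exact this.congr fun y hy ↦ cometric_dM_self hy f

end SmoothInCharts

/-! ### Null sets in charts -/

section AlmostEverywhere

variable {n : ℕ} {M : Type u} [TopologicalSpace M] [ChartedSpace (𝔼 n) M]
  [RiemannianBundle (fun x : M ↦ TangentSpace (𝓡 n) x)] [IsManifold (𝓡 n) ∞ M]
  [IsContMDiffRiemannianBundle (𝓡 n) ∞ (𝔼 n) (fun x : M ↦ TangentSpace (𝓡 n) x)]
  [MeasurableSpace M] [BorelSpace M] [SecondCountableTopology M]

/-- Countably many chart domains cover the manifold, and in each chart the volume is absolutely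
continuous with respect to Lebesgue measure. -/
theorem ae_of_chart {p : M → Prop}
    (h : ∀ c : M, ∀ᵐ y ∂((volume : Measure (𝔼 n)).restrict (chartAt (𝔼 n) c).target),
      p ((chartAt (𝔼 n) c).symm y)) : ∀ᵐ x ∂(riemannianVolume n M), p x := by
  obtain ⟨s, hs, hU⟩ := TopologicalSpace.countable_cover_nhds
    (fun x : M ↦ chart_source_mem_nhds (𝔼 n) x)
  have := hs.to_subtype
  have h2 : ∀ᵐ x ∂((riemannianVolume n M).restrict (⋃ c : s, (chartAt (𝔼 n) (c : M)).source)),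
      p x := by
    refine (ae_restrict_iUnion_iff _ _).2 fun c ↦ ?_
    have h1 : AEMeasurable (chartAt (𝔼 n) (c : M)) (chartVolume (n := n) (c : M)) := by
      rw [← chartVolume_restrict_source]
      exact (chartAt (𝔼 n) (c : M)).continuousOn.aemeasurable
        (chartAt (𝔼 n) (c : M)).open_source.measurableSet
    have h3 := (withDensity_absolutelyContinuous _
      (fun y ↦ ENNReal.ofReal (volDensity (c : M) y))).ae_le (h c)
    rw [← map_chartAt_chartVolume] at h3
    have h4 := ae_of_ae_map h1 h3
    rw [riemannianVolume_restrict_source]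
    rw [← chartVolume_restrict_source] at h4 ⊢
    filter_upwards [h4, ae_restrict_mem (chartAt (𝔼 n) (c : M)).open_source.measurableSet]
      with x hx hxs
    rwa [(chartAt (𝔼 n) (c : M)).left_inv hxs] at hx
  rwa [Set.iUnion_coe_set, hU, Measure.restrict_univ] at h2

end AlmostEverywhere

end YangMills

namespace YangMills

/-! ### Integration by parts for Lipschitz functions -/

section Lipschitz

variable {n : ℕ}

/-- On a large closed ball compactness gives one constant. A point outside that ball has distance at
least `1` from the support, so for such pairs the supremum of `|f|` serves as a Lipschitz constant.
-/
theorem exists_lipschitzWith {U : Set (𝔼 n)} (hU : IsOpen U) {f : 𝔼 n → ℝ}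
    (hf : LocallyLipschitzOn U f) (hc : HasCompactSupport f) (hs : tsupport f ⊆ U) :
    ∃ K, LipschitzWith K f := by
  have hloc : LocallyLipschitz f := by
    intro x
    by_cases hx : x ∈ tsupport f
    · obtain ⟨K, t, ht, h⟩ := hf (hs hx)
      exact ⟨K, t, by rwa [hU.nhdsWithin_eq (hs hx)] at ht, h⟩
    · have h0 := notMem_tsupport_iff_eventuallyEq.1 hx
      refine ⟨0, _, h0, fun y hy z hz ↦ ?_⟩
      simp only [Set.mem_ofPred_eq] at hy hz
      rw [hy, hz]
      simp
  have hcont : Continuous f := hloc.continuous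
  obtain ⟨R, hR⟩ := hc.isCompact.isBounded.subset_closedBall 0
  obtain ⟨K, hK⟩ := (hloc.locallyLipschitzOn (s := Metric.closedBall 0 (R + 1))
    ).exists_lipschitzOnWith_of_compact (isCompact_closedBall (0 : 𝔼 n) (R + 1))
  obtain ⟨C, hC⟩ := hcont.bounded_above_of_compact_support hc
  have hC0 : 0 ≤ C := (norm_nonneg _).trans (hC 0)
  have key : ∀ x y, y ∉ Metric.closedBall (0 : 𝔼 n) (R + 1) → dist (f x) (f y)
      ≤ max K C.toNNReal * dist x y := by
    intro x y hy
    have hy0 : f y = 0 := by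
      refine image_eq_zero_of_notMem_tsupport fun h ↦ hy ?_
      exact Metric.closedBall_subset_closedBall (by linarith) (hR h)
    rw [hy0]
    by_cases hx : x ∈ tsupport f
    · have h1 : 1 ≤ dist x y := by
        have h2 := hR hx
        rw [mem_closedBall_zero_iff] at h2 hy
        rw [dist_comm, dist_eq_norm]
        linarith [norm_sub_norm_le y x]
      calc dist (f x) 0 ≤ C * 1 := by simpa using hC x
        _ ≤ C * dist x y := by gcongr
        _ ≤ _ := by
          refine mul_le_mul_of_nonneg_right ?_ dist_nonneg
          rw [NNReal.coe_max, Real.coe_toNNReal _ hC0]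
          exact le_max_right _ _
    · rw [image_eq_zero_of_notMem_tsupport hx, dist_self]
      positivity
  refine ⟨max K C.toNNReal, LipschitzWith.of_dist_le_mul fun x y ↦ ?_⟩
  by_cases hy : y ∈ Metric.closedBall (0 : 𝔼 n) (R + 1)
  · by_cases hx : x ∈ Metric.closedBall (0 : 𝔼 n) (R + 1)
    · refine (hK.dist_le_mul x hx y hy).trans ?_
      gcongr
      exact_mod_cast le_max_left _ _
    · rw [dist_comm, dist_comm x]
      exact key y x hx
  · exact key x y hy

theorem integrable_pd {f : 𝔼 n → ℝ} {K : NNReal} (hf : LipschitzWith K f)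
    (hc : HasCompactSupport f) (k : Fin n) : Integrable (pd k f) := by
  have hm : AEStronglyMeasurable (pd k f) (volume.restrict (tsupport f)) :=
    (measurable_fderiv_apply_const ℝ f _).aestronglyMeasurable
  have hb : ∀ x, ‖pd k f x‖ ≤ K := fun x ↦ by
    refine (ContinuousLinearMap.le_opNorm _ _).trans ?_
    have := norm_fderiv_le_of_lipschitz ℝ (x₀ := x) hf
    simpa using this
  have h1 : IntegrableOn (pd k f) (tsupport f) :=
    Measure.integrableOn_of_bounded hc.isCompact.measure_lt_top.ne
      (measurable_fderiv_apply_const ℝ f _).aestronglyMeasurable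
      (Filter.Eventually.of_forall hb)
  refine (integrableOn_iff_integrable_of_support_subset ?_).1 h1
  refine fun x hx ↦ ?_
  by_contra h
  refine hx ?_
  have h0 := notMem_tsupport_iff_eventuallyEq.1 h
  simp [pd, h0.fderiv_eq]

/-- Integration by parts for Lipschitz functions, with the constant function `1` as the other
factor. -/
theorem integral_pd_eq_zero {f : 𝔼 n → ℝ} {K : NNReal} (hf : LipschitzWith K f)
    (hc : HasCompactSupport f) (k : Fin n) : ∫ y, pd k f y = 0 := by
  have h := LipschitzWith.integral_lineDeriv_mul_eq (μ := (volume : Measure (𝔼 n)))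
    (f := fun _ ↦ (1 : ℝ)) (C := 0) (LipschitzWith.const 1) hf hc (EuclideanSpace.single k 1)
  have h2 : ∀ᵐ y ∂(volume : Measure (𝔼 n)),
      lineDeriv ℝ f y (-EuclideanSpace.single k 1) * 1 = -pd k f y := by
    filter_upwards [hf.ae_differentiableAt] with y hy
    rw [hy.lineDeriv_eq_fderiv, map_neg, mul_one]
    rfl
  rw [integral_congr_ae h2, integral_neg] at h
  have h3 : ∀ x : 𝔼 n, lineDeriv ℝ (fun _ : 𝔼 n ↦ (1 : ℝ)) x (EuclideanSpace.single k 1) = 0 := by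
    intro x; simp [lineDeriv]
  simp only [h3, zero_mul, integral_zero] at h
  linarith

theorem ae_differentiableAt_of_locallyLipschitzOn {U : Set (𝔼 n)} (hU : IsOpen U)
    {f : 𝔼 n → ℝ} (hf : LocallyLipschitzOn U f) :
    ∀ᵐ y ∂(volume : Measure (𝔼 n)).restrict U, DifferentiableAt ℝ f y := by
  rw [ae_restrict_iff' hU.measurableSet, ae_iff]
  refine measure_null_of_locally_null _ fun x hx ↦ ?_
  simp only [Classical.not_imp, Set.mem_ofPred_eq] at hx
  obtain ⟨K, t, ht, h⟩ := hf hx.1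
  rw [hU.nhdsWithin_eq hx.1] at ht
  obtain ⟨o, hot, ho, hxo⟩ := mem_nhds_iff.1 ht
  refine ⟨_, Filter.inter_mem (mem_nhdsWithin_of_mem_nhds (ho.mem_nhds hxo))
    self_mem_nhdsWithin, ?_⟩
  have h1 := (h.mono hot).ae_differentiableWithinAt_of_mem (μ := (volume : Measure (𝔼 n)))
  rw [ae_iff] at h1
  refine measure_mono_null (fun y hy ↦ ?_) h1
  simp only [Classical.not_imp, Set.mem_ofPred_eq, Set.mem_inter_iff] at hy ⊢
  exact ⟨hy.1, fun hd ↦ hy.2.2 (hd.differentiableAt (ho.mem_nhds hy.1))⟩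

/-- The integrand is almost everywhere the divergence of `w √det g · ∇e`, a Lipschitz vector field
with compact support. -/
theorem integrable_and_integral_eq_zero {g : 𝔼 n → Matrix (Fin n) (Fin n) ℝ} {U : Set (𝔼 n)}
    (hg : IsMetricOn g U) {e w : 𝔼 n → ℝ} (he : ContDiffOn ℝ ∞ e U)
    (hw : LocallyLipschitzOn U w) (hc : HasCompactSupport w) (hs : tsupport w ⊆ U) :
    IntegrableOn (fun y ↦ √(g y).det * (∑ k, ∑ l, (g y)⁻¹ k l * pd k w y * pd l e y
        + w y * laplacian g e y)) U ∧
      ∫ y in U, √(g y).det * (∑ k, ∑ l, (g y)⁻¹ k l * pd k w y * pd l e y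
        + w y * laplacian g e y) = 0 := by
  have hU := hg.isOpen
  set X : Fin n → 𝔼 n → ℝ := fun k z ↦ √(g z).det * ∑ l, (g z)⁻¹ k l * pd l e z with hX
  have hXs : ∀ k, ContDiffOn ℝ ∞ (X k) U := by
    intro k
    refine ((contDiffOn_det hg.contDiffOn).sqrt fun y hy ↦ (hg.det_pos hy).ne').mul ?_
    exact ContDiffOn.sum fun l _ ↦ (hg.contDiffOn_inv k l).mul (contDiffOn_pd hU he l)
  have hts : ∀ k, tsupport (fun z ↦ w z * X k z) ⊆ tsupport w := fun k ↦
    closure_mono fun z hz h0 ↦ hz (by simp [h0])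
  have hcs : ∀ k, HasCompactSupport (fun z ↦ w z * X k z) := fun k ↦ hc.mul_right
  choose K hK using fun k ↦ exists_lipschitzWith hU
    (locallyLipschitzOn_mul hw (locallyLipschitzOn_of_contDiffOn hU (hXs k))) (hcs k) ((hts k).trans hs)
  have hint : Integrable (fun y ↦ ∑ k, pd k (fun z ↦ w z * X k z) y) :=
    integrable_finsetSum _ fun k _ ↦ integrable_pd (hK k) (hcs k) k
  have hzero : ∫ y, ∑ k, pd k (fun z ↦ w z * X k z) y = 0 := by
    rw [integral_finsetSum _ fun k _ ↦ integrable_pd (hK k) (hcs k) k]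
    exact Finset.sum_eq_zero fun k _ ↦ integral_pd_eq_zero (hK k) (hcs k) k
  have hae : (fun y ↦ ∑ k, pd k (fun z ↦ w z * X k z) y) =ᵐ[volume.restrict U]
      fun y ↦ √(g y).det * (∑ k, ∑ l, (g y)⁻¹ k l * pd k w y * pd l e y
        + w y * laplacian g e y) := by
    filter_upwards [ae_differentiableAt_of_locallyLipschitzOn hU hw,
      ae_restrict_mem hU.measurableSet] with y hyd hy
    have h1 : ∀ k, pd k (fun z ↦ w z * X k z) y = pd k w y * X k y + w y * pd k (X k) y := by
      intro k
      have hXd := differentiableAt_of_contDiffOn hU hy (hXs k)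
      simp only [pd]
      rw [fderiv_fun_mul hyd hXd]
      simp
      ring
    simp only [h1]
    rw [Finset.sum_add_distrib, ← Finset.mul_sum]
    have h2 := hg.sum_pd_sqrt_det_mul he hy
    rw [h2]
    simp only [hX, mul_add, Finset.mul_sum]
    congr 1
    · exact Finset.sum_congr rfl fun k _ ↦ Finset.sum_congr rfl fun l _ ↦ by ring
    · ring
  have hout : ∀ y ∉ U, ∑ k, pd k (fun z ↦ w z * X k z) y = 0 := by
    intro y hy
    refine Finset.sum_eq_zero fun k _ ↦ ?_
    have h0 := notMem_tsupport_iff_eventuallyEq.1 (fun h ↦ hy (hs (hts k h)))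
    simp [pd, h0.fderiv_eq]
  refine ⟨hint.integrableOn.congr hae, ?_⟩
  rw [← integral_congr_ae hae, setIntegral_eq_integral_of_forall_compl_eq_zero hout, hzero]

end Lipschitz

end YangMills

namespace YangMills

/-! ### Metric geometry -/

section LengthSpace

variable {n : ℕ} {M : Type u} [EMetricSpace M] [ChartedSpace (𝔼 n) M] [IsManifold (𝓡 n) ∞ M]
  [RiemannianBundle (fun x : M ↦ TangentSpace (𝓡 n) x)]
  [IsRiemannianManifold (𝓡 n) M]

variable (n) in
include n in
-- A curve from `x` to `y` of length less than `r + δ` meets the sphere of radius `r` by the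
-- intermediate value theorem. The part before that point has length at least `r`, so less than `δ`
-- is left. The second alternative is the case where `y` lies in the ball.
theorem exists_edist_le_of_edist_lt_add {x y : M} {r δ : ENNReal} (hr : r ≠ ⊤)
    (h : edist x y < r + δ) : ∃ z, edist x z ≤ r ∧ edist z y < δ ∨ edist x z ≤ r ∧ z = y := by
  by_cases hxy : edist x y ≤ r
  · exact ⟨y, Or.inr ⟨hxy, rfl⟩⟩
  rw [IsRiemannianManifold.out (I := 𝓡 n)] at h
  obtain ⟨γ, h0, h1, hγ, hlen⟩ := Manifold.exists_lt_of_riemannianEDist_lt h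
  have hcont : ContinuousOn (fun t ↦ edist x (γ t)) (Set.Icc 0 1) :=
    (continuous_const.edist continuous_id).comp_continuousOn hγ.continuousOn
  have hivt := intermediate_value_Icc zero_le_one hcont
  obtain ⟨t, ht, hxt⟩ := hivt ⟨by simp [h0], by simpa [h1] using (not_le.1 hxy).le⟩
  simp only at hxt
  refine ⟨γ t, Or.inl ⟨hxt.le, ?_⟩⟩
  have h2 : edist x (γ t) ≤ Manifold.pathELength (𝓡 n) γ 0 t := by
    rw [IsRiemannianManifold.out (I := 𝓡 n)]
    exact Manifold.riemannianEDist_le_pathELength (hγ.mono (Set.Icc_subset_Icc_right ht.2)) h0 rfl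
      ht.1
  have h3 : edist (γ t) y ≤ Manifold.pathELength (𝓡 n) γ t 1 := by
    rw [IsRiemannianManifold.out (I := 𝓡 n)]
    exact Manifold.riemannianEDist_le_pathELength (hγ.mono (Set.Icc_subset_Icc_left ht.1)) rfl h1
      ht.2
  have h4 : r + edist (γ t) y < r + δ := by
    rw [← hxt]
    refine (add_le_add h2 h3).trans_lt ?_
    rw [Manifold.pathELength_add ht.1 ht.2, hxt]
    exact hlen
  exact (ENNReal.add_lt_add_iff_left hr).1 h4

variable (n) in
include n in
/-- **Hopf–Rinow**: in a complete Riemannian manifold closed balls of finite radius are compact. -/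
theorem isCompact_closedEBall [CompleteSpace M] (x : M) (R : NNReal) :
    IsCompact {y | edist x y ≤ (R : ENNReal)} := by
  have : LocallyCompactSpace M := ChartedSpace.locallyCompactSpace (𝔼 n) M
  have hclosed : ∀ r : ENNReal, IsClosed {y | edist x y ≤ r} := fun r ↦
    isClosed_le (continuous_const.edist continuous_id) continuous_const
  by_contra hR
  -- The radii of compact balls form an initial segment. If it were bounded, its supremum would
  -- belong to it, and then so would a larger radius.
  set A : Set NNReal := {r | IsCompact {y | edist x y ≤ (r : ENNReal)}} with hA
  have hdown : ∀ r ∈ A, ∀ r' ≤ r, r' ∈ A := fun r hr r' hr' ↦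
    IsCompact.of_isClosed_subset hr (hclosed r') fun y hy ↦
      le_trans (α := ENNReal) hy (by exact_mod_cast hr')
  have h0 : (0 : NNReal) ∈ A := by
    have : {y | edist x y ≤ ((0 : NNReal) : ENNReal)} = {x} := by
      ext y; simp [eq_comm]
    simp only [hA, Set.mem_ofPred_eq, this]
    exact isCompact_singleton
  have hbdd : BddAbove A := ⟨R, fun r hr ↦ le_of_not_ge fun h ↦ hR (hdown r hr R h)⟩
  set T := sSup A with hT
  -- The ball of radius `T` is closed, hence complete. Each of its points is within `ε / 2` of some
  -- compact ball of radius `r ∈ A` close to `T`, so finite nets pass from that ball to this one.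
  have hTA : T ∈ A := by
    refine isCompact_iff_totallyBounded_isComplete.2 ⟨?_, (hclosed T).isComplete⟩
    refine EMetric.totallyBounded_iff.2 fun ε hε ↦ ?_
    obtain ⟨δ, hδ, hδε⟩ := ENNReal.lt_iff_exists_nnreal_btwn.1 (ENNReal.half_pos hε.ne')
    have hδ0 : 0 < δ := by exact_mod_cast hδ
    obtain ⟨r, hr, hTr⟩ : ∃ r ∈ A, T < r + δ := by
      by_cases hTδ : T < δ
      · exact ⟨0, h0, by simpa using hTδ⟩
      · have hlt : T - δ < sSup A := tsub_lt_self (lt_of_lt_of_le hδ0 (not_lt.1 hTδ)) hδ0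
        obtain ⟨r, hr, hlt⟩ := exists_lt_of_lt_csSup ⟨0, h0⟩ hlt
        exact ⟨r, hr, by rwa [tsub_lt_iff_right (not_lt.1 hTδ)] at hlt⟩
    obtain ⟨t, htf, ht⟩ := EMetric.totallyBounded_iff.1 hr.totallyBounded (ε / 2)
      (ENNReal.half_pos hε.ne')
    refine ⟨t, htf, fun y hy ↦ ?_⟩
    have hlt : edist x y < (r : ENNReal) + δ :=
      lt_of_le_of_lt (α := ENNReal) hy (by exact_mod_cast hTr)
    obtain ⟨z, hz⟩ := exists_edist_le_of_edist_lt_add n ENNReal.coe_ne_top hlt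
    have hzr : edist x z ≤ r := hz.elim And.left And.left
    have hzy : edist y z < ε / 2 := by
      rcases hz with hz | hz
      · rw [edist_comm]; exact hz.2.trans hδε
      · rw [hz.2, edist_self]; exact ENNReal.half_pos hε.ne'
    obtain ⟨p, hp, hzp⟩ := Set.mem_iUnion₂.1 (ht hzr)
    refine Set.mem_iUnion₂.2 ⟨p, hp, ?_⟩
    calc edist y p ≤ edist y z + edist z p := edist_triangle _ _ _
      _ < ε / 2 + ε / 2 := ENNReal.add_lt_add hzy hzp
      _ = ε := ENNReal.add_halves ε
  -- Local compactness: a compact set contains a thickening of the ball of radius `T`, and this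
  -- thickening contains the ball of radius `T + δ / 2`.
  obtain ⟨K, hK, hTK⟩ := exists_compact_superset hTA
  obtain ⟨δ, hδ, hsub⟩ := hTA.exists_thickening_subset_open isOpen_interior hTK
  have hδ2 : 0 < (δ / 2).toNNReal := by simpa using hδ
  have hmem : T + (δ / 2).toNNReal ∈ A := by
    refine hK.of_isClosed_subset (hclosed _) fun y hy ↦ ?_
    have hlt : edist x y < (T : ENNReal) + ENNReal.ofReal δ := by
      refine lt_of_le_of_lt (α := ENNReal) hy ?_
      rw [ENNReal.coe_add]
      refine (ENNReal.add_lt_add_iff_left ENNReal.coe_ne_top).2 ?_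
      exact (ENNReal.ofReal_lt_ofReal_iff hδ).2 (by linarith)
    obtain ⟨z, hz⟩ := exists_edist_le_of_edist_lt_add n ENNReal.coe_ne_top hlt
    refine interior_subset (hsub ?_)
    rw [Metric.mem_thickening_iff_exists_edist_lt]
    refine ⟨z, hz.elim And.left And.left, ?_⟩
    rcases hz with hz | hz
    · rw [edist_comm]; exact hz.2
    · rw [hz.2, edist_self]; exact ENNReal.ofReal_pos.2 hδ
  have := le_csSup hbdd hmem
  exact absurd this (not_le.2 (lt_add_of_pos_right _ hδ2))

theorem enorm_eq_ofReal_sqrt_ginner {n : ℕ} {M : Type u} [TopologicalSpace M]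
    [ChartedSpace (𝔼 n) M] [RiemannianBundle (fun x : M ↦ TangentSpace (𝓡 n) x)] (x : M)
    (v : TangentSpace (𝓡 n) x) : ‖v‖ₑ = ENNReal.ofReal √(ginner x v v) := by
  rw [← ofReal_norm, norm_eq_sqrt_real_inner]
  rfl

/-- The image of the coordinate segment is a competitor for the distance, and its speed is at most
`L`. -/
theorem edist_chart_symm_le {c : M} {p q : 𝔼 n} {L : ℝ}
    (hseg : ∀ s ∈ Set.Icc (0 : ℝ) 1, p + s • (q - p) ∈ (chartAt (𝔼 n) c).target)
    (hL : ∀ s ∈ Set.Icc (0 : ℝ) 1,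
      √(ginner ((chartAt (𝔼 n) c).symm (p + s • (q - p))) (frame c (p + s • (q - p)) (q - p))
        (frame c (p + s • (q - p)) (q - p))) ≤ L) :
    edist ((chartAt (𝔼 n) c).symm p) ((chartAt (𝔼 n) c).symm q) ≤ ENNReal.ofReal L := by
  rw [IsRiemannianManifold.out (I := 𝓡 n)]
  set γ : ℝ → M := fun s ↦ (chartAt (𝔼 n) c).symm (p + s • (q - p)) with hγ
  have hline : ContDiff ℝ ∞ fun s : ℝ ↦ p + s • (q - p) := by fun_prop
  have hγs : ContMDiffOn 𝓘(ℝ, ℝ) (𝓡 n) 1 γ (Set.Icc 0 1) :=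
    ((contMDiffOn_chart_symm (I := 𝓡 n) (n := ∞) (x := c)).comp
      hline.contMDiff.contMDiffOn hseg).of_le (by simp)
  refine (Manifold.riemannianEDist_le_pathELength (γ := γ) (a := 0) (b := 1) hγs (by simp [hγ])
    (by simp [hγ]) zero_le_one).trans ?_
  rw [Manifold.pathELength_eq_lintegral_mfderiv_Icc]
  have hb : ∀ s ∈ Set.Icc (0 : ℝ) 1,
      ‖mfderiv 𝓘(ℝ, ℝ) (𝓡 n) γ s (1 : ℝ)‖ₑ ≤ ENNReal.ofReal L := by
    intro s hs
    have hd : HasDerivAt (fun s : ℝ ↦ p + s • (q - p)) (q - p) s := by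
      simpa using ((hasDerivAt_id s).smul_const (q - p)).const_add p
    have h1 := mfderiv_comp s (mdifferentiableAt_chartAt_symm (n := n) (hseg s hs))
      hd.differentiableAt.mdifferentiableAt
    rw [mfderiv_eq_fderiv] at h1
    have h2 : mfderiv 𝓘(ℝ, ℝ) (𝓡 n) γ s (1 : ℝ) = frame c (p + s • (q - p)) (q - p) := by
      refine (congrArg (fun L : ℝ →L[ℝ] 𝔼 n ↦ L 1) h1).trans ?_
      change frame c (p + s • (q - p)) (fderiv ℝ (fun s : ℝ ↦ p + s • (q - p)) s 1) = _
      rw [fderiv_apply_one_eq_deriv, hd.deriv]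
    have key : ∀ v : 𝔼 n, v = frame c (p + s • (q - p)) (q - p) → √(ginner (γ s) v v) ≤ L := by
      rintro _ rfl; exact hL s hs
    exact (enorm_eq_ofReal_sqrt_ginner _ _).trans_le (ENNReal.ofReal_le_ofReal (key _ h2))
  calc _ ≤ ∫⁻ _ in Set.Icc (0 : ℝ) 1, ENNReal.ofReal L := setLIntegral_mono' measurableSet_Icc hb
    _ = _ := by simp

end LengthSpace

/-! ### Lipschitz functions on a Riemannian manifold -/

section LipschitzFunctions

variable {n : ℕ} {M : Type u} [EMetricSpace M] [ChartedSpace (𝔼 n) M] [IsManifold (𝓡 n) ∞ M]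
  [RiemannianBundle (fun x : M ↦ TangentSpace (𝓡 n) x)]
  [IsContMDiffRiemannianBundle (𝓡 n) ∞ (𝔼 n) (fun x : M ↦ TangentSpace (𝓡 n) x)]

theorem exists_sqrt_ginner_frame_le {c : M} {y : 𝔼 n} (hy : y ∈ (chartAt (𝔼 n) c).target) :
    ∃ C : NNReal, ∀ᶠ z in nhds y, ∀ v,
      √(ginner ((chartAt (𝔼 n) c).symm z) (frame c z v) (frame c z v)) ≤ C * ‖v‖ := by
  have hU := (chartAt (𝔼 n) c).open_target
  have hc : ContinuousAt (fun z ↦ ∑ i, ∑ j, |metric c z i j|) y :=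
    (continuousOn_finsetSum _ fun i _ ↦ continuousOn_finsetSum _ fun j _ ↦
      (contDiffOn_metric c i j).continuousOn.abs).continuousAt (hU.mem_nhds hy)
  set D := ∑ i, ∑ j, |metric c y i j| + 1 with hD
  have hD0 : 0 ≤ D := by positivity
  refine ⟨(√D).toNNReal, ?_⟩
  filter_upwards [hc.eventually_lt_const (lt_add_one _)] with z hz v
  rw [Real.coe_toNNReal _ (Real.sqrt_nonneg _), ← Real.sqrt_sq (norm_nonneg v), ← Real.sqrt_mul hD0]
  refine Real.sqrt_le_sqrt ?_
  rw [ginner_frame]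
  calc ∑ i, ∑ j, metric c z i j * v i * v j
      ≤ ∑ i, ∑ j, |metric c z i j| * ‖v‖ ^ 2 := by
        refine Finset.sum_le_sum fun i _ ↦ Finset.sum_le_sum fun j _ ↦ ?_
        refine (le_abs_self _).trans ?_
        rw [mul_assoc, abs_mul, abs_mul, sq]
        have hi := PiLp.norm_apply_le v i
        have hj := PiLp.norm_apply_le v j
        rw [Real.norm_eq_abs] at hi hj
        gcongr
    _ = (∑ i, ∑ j, |metric c z i j|) * ‖v‖ ^ 2 := by simp only [Finset.sum_mul]
    _ ≤ D * ‖v‖ ^ 2 := by gcongr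

variable [IsRiemannianManifold (𝓡 n) M]

/-- Near `y` the metric is bounded, so coordinate segments have Riemannian length at most `C` times
their Euclidean length. -/
theorem chartLipschitz_of_lipschitzWith {f : M → ℝ} {K : NNReal} (hf : LipschitzWith K f) :
    ChartLipschitz n f := by
  intro c y hy
  have hU := (chartAt (𝔼 n) c).open_target
  obtain ⟨C, hC⟩ := exists_sqrt_ginner_frame_le hy
  obtain ⟨r, hr, hball⟩ := Metric.eventually_nhds_iff_ball.1 (hC.and (hU.mem_nhds hy))
  refine ⟨K * C, Metric.ball y r, mem_nhdsWithin_of_mem_nhds (Metric.ball_mem_nhds y hr),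
    fun p hp q hq ↦ (hf _ _).trans ?_⟩
  rw [ENNReal.coe_mul, mul_assoc]
  refine mul_le_mul_right ?_ _
  have hseg : ∀ s ∈ Set.Icc (0 : ℝ) 1, p + s • (q - p) ∈ Metric.ball y r := fun s hs ↦
    (convex_ball y r).add_smul_sub_mem hp hq hs
  refine (edist_chart_symm_le (L := C * ‖q - p‖) (fun s hs ↦ (hball _ (hseg s hs)).2)
    fun s hs ↦ (hball _ (hseg s hs)).1 _).trans_eq ?_
  rw [edist_comm, edist_dist, dist_eq_norm, ENNReal.ofReal_mul C.coe_nonneg,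
    ENNReal.ofReal_coe_nnreal]

/-- The increment of `f` along the coordinate line `y + t v` is at most `K` times the length of the
short segment, which by continuity of the metric is at most `|t|` times a number close to the norm
of `v` at `x`. Where `f` is not differentiable the differential is zero by default. -/
theorem dM_le_of_lipschitzWith {f : M → ℝ} {K : NNReal} (hf : LipschitzWith K f) (x : M)
    (v : 𝔼 n) : dM n f x v ≤ K * √(ginner x v v) := by
  have hU := (chartAt (𝔼 n) x).open_target
  set y := chartAt (𝔼 n) x x with hy
  have hyt : y ∈ (chartAt (𝔼 n) x).target := mem_chart_target _ x
  have hsymm : (chartAt (𝔼 n) x).symm y = x := (chartAt (𝔼 n) x).left_inv (mem_chart_source _ x)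
  have hframe : frame x y = ContinuousLinearMap.id ℝ (𝔼 n) := mderiv_chartAt_symm_self x
  have hdM := dM_frame hyt f v
  rw [hframe, hsymm] at hdM
  simp only [ContinuousLinearMap.id_apply] at hdM
  rw [hdM]
  set F : 𝔼 n → ℝ := fun z ↦ f ((chartAt (𝔼 n) x).symm z) with hF
  by_cases hd : DifferentiableAt ℝ F y
  swap
  · rw [fderiv_zero_of_not_differentiableAt hd]
    simpa using by positivity
  set ℓ : 𝔼 n → ℝ := fun z ↦
    √(ginner ((chartAt (𝔼 n) x).symm z) (frame x z v) (frame x z v)) with hℓ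
  have hℓc : ContinuousAt ℓ y := by
    have h1 : ContinuousOn ℓ (chartAt (𝔼 n) x).target := by
      simp only [hℓ, ginner_frame]
      exact (continuousOn_finsetSum _ fun i _ ↦ continuousOn_finsetSum _ fun j _ ↦
        ((contDiffOn_metric x i j).continuousOn.mul continuousOn_const).mul
          continuousOn_const).sqrt
    exact h1.continuousAt (hU.mem_nhds hyt)
  have hℓy : ℓ y = √(ginner x v v) := by
    simp only [hℓ, hframe, hsymm, ContinuousLinearMap.id_apply]
  rw [← hℓy]
  refine le_of_forall_pos_le_add fun ε hε ↦ ?_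
  -- The `1` in the denominator covers `K = 0` and still gives `K δ ≤ ε`.
  set δ := ε / (K + 1) with hδ
  have hδ0 : 0 < δ := by positivity
  obtain ⟨r, hr, hball⟩ := Metric.eventually_nhds_iff_ball.1
    ((hℓc.eventually_lt_const (lt_add_of_pos_right (ℓ y) hδ0)).and (hU.mem_nhds hyt))
  have hline : HasDerivAt (fun t : ℝ ↦ y + t • v) v 0 := by
    simpa using ((hasDerivAt_id (0 : ℝ)).smul_const v).const_add y
  have hcomp : HasDerivAt (fun t : ℝ ↦ F (y + t • v)) (fderiv ℝ F y v) 0 := by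
    have h1 : HasFDerivAt F (fderiv ℝ F y) (y + (0 : ℝ) • v) := by
      simpa using hd.hasFDerivAt
    exact h1.comp_hasDerivAt (0 : ℝ) hline
  have hlip : ∀ᶠ t in nhds (0 : ℝ),
      ‖F (y + t • v) - F (y + (0 : ℝ) • v)‖ ≤ (K * (ℓ y + δ)) * ‖t - 0‖ := by
    have hev : ∀ᶠ t in nhds (0 : ℝ), y + t • v ∈ Metric.ball y r :=
      hline.continuousAt.eventually_mem (by simpa using Metric.ball_mem_nhds y hr)
    filter_upwards [hev] with t ht
    have hseg : ∀ s ∈ Set.Icc (0 : ℝ) 1,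
        y + (0 : ℝ) • v + s • (y + t • v - (y + (0 : ℝ) • v)) ∈ Metric.ball y r := fun s hs ↦
      (convex_ball y r).add_smul_sub_mem (by simpa using hr) ht hs
    have h1 := edist_chart_symm_le (c := x) (p := y + (0 : ℝ) • v) (q := y + t • v)
      (L := |t| * (ℓ y + δ)) (fun s hs ↦ (hball _ (hseg s hs)).2) fun s hs ↦ ?_
    · have h2 := (hf _ _).trans (mul_le_mul_right h1 (K : ENNReal))
      rw [edist_dist, ← ENNReal.ofReal_coe_nnreal, ← ENNReal.ofReal_mul K.coe_nonneg,
        ENNReal.ofReal_le_ofReal_iff (by positivity), dist_comm, dist_eq_norm] at h2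
      refine h2.trans_eq ?_
      rw [sub_zero, Real.norm_eq_abs]; ring
    · have h3 := (hball _ (hseg s hs)).1
      have h4 : y + t • v - (y + (0 : ℝ) • v) = t • v := by simp
      rw [h4] at h3 ⊢
      simp only [map_smul, LinearMap.smul_apply, smul_eq_mul]
      rw [← mul_assoc, ← sq, Real.sqrt_mul (sq_nonneg _), Real.sqrt_sq_eq_abs]
      exact mul_le_mul_of_nonneg_left h3.le (abs_nonneg t)
  have hfin := (le_abs_self _).trans (hcomp.le_of_lip' (by positivity) hlip)
  refine hfin.trans ?_
  have : (K : ℝ) * δ ≤ ε := by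
    rw [hδ, mul_div_assoc', div_le_iff₀ (by positivity)]
    nlinarith [K.coe_nonneg]
  linarith [mul_add (K : ℝ) (ℓ y) δ]

theorem cometric_dM_le_of_lipschitzWith {f : M → ℝ} {K : NNReal} (hf : LipschitzWith K f) (x : M) :
    cometric x (dM n f x) (dM n f x) ≤ K ^ 2 :=
  cometric_self_le (dM_le_of_lipschitzWith hf x)

end LipschitzFunctions

/-! ### Cutoff functions -/

section Cutoff

variable {M : Type u} [EMetricSpace M]

/-- The cutoff function that is `1` on the ball of radius `R` and vanishes outside the ball of
radius `2 R`. -/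
def cutoff (x₀ : M) (R : ℝ) (x : M) : ℝ :=
  min 1 (2 - R⁻¹ * (min (edist x₀ x) (ENNReal.ofReal (2 * R))).toReal)

theorem cutoff_eq_one {x₀ : M} {R : ℝ} (hR : 0 < R) {x : M} (hx : edist x₀ x ≤ ENNReal.ofReal R) :
    cutoff x₀ R x = 1 := by
  refine min_eq_left ?_
  have h : (min (edist x₀ x) (ENNReal.ofReal (2 * R))).toReal ≤ R :=
    ENNReal.toReal_le_of_le_ofReal hR.le ((min_le_left _ _).trans hx)
  have := mul_le_mul_of_nonneg_left h (inv_nonneg.2 hR.le)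
  have h2 : R⁻¹ * R = 1 := by field_simp
  linarith

theorem cutoff_eq_zero {x₀ : M} {R : ℝ} (hR : 0 < R) {x : M}
    (hx : ENNReal.ofReal (2 * R) ≤ edist x₀ x) : cutoff x₀ R x = 0 := by
  rw [cutoff, min_eq_right hx, ENNReal.toReal_ofReal (by positivity)]
  have h2 : R⁻¹ * (2 * R) = 2 := by field_simp
  rw [h2]; simp

/-- Truncation at `2 R` precedes the passage to real numbers because distances may be infinite, and
an infinite distance would become `0`. The truncated distance is `1`-Lipschitz by the triangle
inequality. -/
theorem lipschitzWith_cutoff (x₀ : M) {R : ℝ} (hR : 0 < R) :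
    LipschitzWith (R⁻¹).toNNReal (cutoff x₀ R) := by
  have h1 : LipschitzWith 1
      (fun x ↦ (min (edist x₀ x) (ENNReal.ofReal (2 * R))).toReal) := by
    have key : ∀ x y : M, edist x y ≠ ⊤ →
        (min (edist x₀ x) (ENNReal.ofReal (2 * R))).toReal
          ≤ (min (edist x₀ y) (ENNReal.ofReal (2 * R))).toReal + (edist x y).toReal := by
      intro x y hxy
      rw [← ENNReal.toReal_add (ne_top_of_le_ne_top ENNReal.ofReal_ne_top (min_le_right _ _)) hxy]
      refine ENNReal.toReal_mono (ENNReal.add_ne_top.2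
        ⟨ne_top_of_le_ne_top ENNReal.ofReal_ne_top (min_le_right _ _), hxy⟩) ?_
      rw [← min_add_add_right]
      refine min_le_min ?_ le_self_add
      rw [edist_comm x y]
      exact edist_triangle _ _ _
    intro x y
    by_cases hxy : edist x y = ⊤
    · simp [hxy]
    rw [ENNReal.coe_one, one_mul, edist_dist, ← ENNReal.ofReal_toReal hxy]
    refine ENNReal.ofReal_le_ofReal ?_
    rw [Real.dist_eq, abs_sub_le_iff]
    have h := key y x (by rwa [edist_comm])
    rw [edist_comm y x] at h
    constructor <;> linarith [key x y hxy]
  have h2 : LipschitzWith (R⁻¹).toNNReal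
      (fun x ↦ 2 - R⁻¹ * (min (edist x₀ x) (ENNReal.ofReal (2 * R))).toReal) := by
    intro x y
    have h3 := h1 x y
    rw [ENNReal.coe_one, one_mul] at h3
    refine le_trans (le_of_eq ?_) (mul_le_mul_right h3 ((R⁻¹).toNNReal : ENNReal))
    rw [edist_dist, edist_dist, Real.dist_eq, Real.dist_eq]
    change _ = ENNReal.ofReal _ * _
    rw [← ENNReal.ofReal_mul (inv_nonneg.2 hR.le), sub_sub_sub_cancel_left, ← mul_sub, abs_mul,
      abs_of_nonneg (inv_nonneg.2 hR.le), abs_sub_comm]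
  exact h2.const_min 1

end Cutoff

end YangMills

namespace YangMills

/-! ### The weak form of a differential inequality for the Laplacian -/

section DifferentialCalculus

variable {n : ℕ} {M : Type u} [TopologicalSpace M] [ChartedSpace (𝔼 n) M] [IsManifold (𝓡 n) ∞ M]

theorem dM_eq_fderiv (f : M → ℝ) (x : M) :
    dM n f x = fderiv ℝ (fun z ↦ f ((chartAt (𝔼 n) x).symm z)) (chartAt (𝔼 n) x x) := by
  ext v
  have h := dM_frame (mem_chart_target (𝔼 n) x) f v
  have hframe : frame x (chartAt (𝔼 n) x x) = ContinuousLinearMap.id ℝ (𝔼 n) :=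
    mderiv_chartAt_symm_self x
  rwa [hframe, (chartAt (𝔼 n) x).left_inv (mem_chart_source _ x)] at h

theorem differentiableAt_of_mdifferentiableAt {f : M → ℝ} {x : M}
    (hf : MDifferentiableAt (𝓡 n) 𝓘(ℝ, ℝ) f x) :
    DifferentiableAt ℝ (fun z ↦ f ((chartAt (𝔼 n) x).symm z)) (chartAt (𝔼 n) x x) := by
  refine (mdifferentiableAt_comp_chartAt_symm_iff (mem_chart_target _ x)).2 ?_
  rwa [(chartAt (𝔼 n) x).left_inv (mem_chart_source _ x)]

theorem dM_mul {f g : M → ℝ} {x : M} (hf : MDifferentiableAt (𝓡 n) 𝓘(ℝ, ℝ) f x)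
    (hg : MDifferentiableAt (𝓡 n) 𝓘(ℝ, ℝ) g x) :
    dM n (fun z ↦ f z * g z) x = f x • dM n g x + g x • dM n f x := by
  simp only [dM_eq_fderiv]
  rw [fderiv_fun_mul (differentiableAt_of_mdifferentiableAt hf)
    (differentiableAt_of_mdifferentiableAt hg), (chartAt (𝔼 n) x).left_inv (mem_chart_source _ x)]

theorem dM_sum {ι : Type*} {s : Finset ι} {f : ι → M → ℝ} {x : M}
    (hf : ∀ i ∈ s, MDifferentiableAt (𝓡 n) 𝓘(ℝ, ℝ) (f i) x) :
    dM n (fun z ↦ ∑ i ∈ s, f i z) x = ∑ i ∈ s, dM n (f i) x := by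
  simp only [dM_eq_fderiv]
  exact fderiv_fun_sum fun i hi ↦ differentiableAt_of_mdifferentiableAt (hf i hi)

theorem dM_comp {f : M → ℝ} {x : M} {θ : ℝ → ℝ} {θ' : ℝ}
    (hf : MDifferentiableAt (𝓡 n) 𝓘(ℝ, ℝ) f x) (hθ : HasDerivAt θ θ' (f x)) :
    dM n (fun z ↦ θ (f z)) x = θ' • dM n f x := by
  simp only [dM_eq_fderiv]
  have h := differentiableAt_of_mdifferentiableAt hf
  have hx : f ((chartAt (𝔼 n) x).symm (chartAt (𝔼 n) x x)) = f x := by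
    rw [(chartAt (𝔼 n) x).left_inv (mem_chart_source _ x)]
  rw [← hx] at hθ
  exact (hθ.comp_hasFDerivAt (f := fun z ↦ f ((chartAt (𝔼 n) x).symm z)) _ h.hasFDerivAt).fderiv

theorem dM_eq_zero_of_notMem_tsupport {f : M → ℝ} {x : M} (hx : x ∉ tsupport f) :
    dM n f x = 0 := by
  have h0 := notMem_tsupport_iff_eventuallyEq.1 hx
  have h1 : mfderiv (𝓡 n) 𝓘(ℝ, ℝ) f x = mfderiv (𝓡 n) 𝓘(ℝ, ℝ) (0 : M → ℝ) x := h0.mfderiv_eq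
  exact h1.trans mfderiv_const

variable [RiemannianBundle (fun x : M ↦ TangentSpace (𝓡 n) x)]
  [IsContMDiffRiemannianBundle (𝓡 n) ∞ (𝔼 n) (fun x : M ↦ TangentSpace (𝓡 n) x)]
  [MeasurableSpace M] [BorelSpace M]

theorem ChartLipschitz.ae_mdifferentiableAt [SecondCountableTopology M] {f : M → ℝ}
    (hf : ChartLipschitz n f) :
    ∀ᵐ x ∂(riemannianVolume n M), MDifferentiableAt (𝓡 n) 𝓘(ℝ, ℝ) f x := by
  refine ae_of_chart fun c ↦ ?_
  have hU := (chartAt (𝔼 n) c).open_target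
  filter_upwards [ae_differentiableAt_of_locallyLipschitzOn hU (hf c),
    ae_restrict_mem hU.measurableSet] with y hy hyU
  exact (mdifferentiableAt_comp_chartAt_symm_iff hyU).1 hy

theorem aestronglyMeasurable_cometric_chart {w e : M → ℝ} (c : M) :
    AEStronglyMeasurable (fun y ↦ cometric ((chartAt (𝔼 n) c).symm y)
      (dM n w ((chartAt (𝔼 n) c).symm y)) (dM n e ((chartAt (𝔼 n) c).symm y)))
      ((volume : Measure (𝔼 n)).restrict (chartAt (𝔼 n) c).target) := by
  have hU := (chartAt (𝔼 n) c).open_target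
  have h1 : AEStronglyMeasurable (fun y ↦ ∑ k, ∑ l, (metric c y)⁻¹ k l
      * pd k (fun z ↦ w ((chartAt (𝔼 n) c).symm z)) y
      * pd l (fun z ↦ e ((chartAt (𝔼 n) c).symm z)) y)
      ((volume : Measure (𝔼 n)).restrict (chartAt (𝔼 n) c).target) := by
    refine Finset.aestronglyMeasurable_fun_sum _ fun k _ ↦
      Finset.aestronglyMeasurable_fun_sum _ fun l _ ↦ ?_
    refine AEStronglyMeasurable.mul (AEStronglyMeasurable.mul ?_ ?_) ?_
    · exact ((isMetricOn_metric c).contDiffOn_inv k l).continuousOn.aestronglyMeasurable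
        hU.measurableSet
    · exact (measurable_fderiv_apply_const ℝ _ _).aestronglyMeasurable
    · exact (measurable_fderiv_apply_const ℝ _ _).aestronglyMeasurable
  refine h1.congr ?_
  filter_upwards [ae_restrict_mem hU.measurableSet] with y hy
  exact (cometric_dM hy w e).symm

theorem aestronglyMeasurable_comp_chart {f : M → ℝ} (hf : Continuous f) (c : M) :
    AEStronglyMeasurable (fun y ↦ f ((chartAt (𝔼 n) c).symm y))
      ((volume : Measure (𝔼 n)).restrict (chartAt (𝔼 n) c).target) :=
  (hf.comp_continuousOn (chartAt (𝔼 n) c).continuousOn_symm).aestronglyMeasurable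
    (chartAt (𝔼 n) c).open_target.measurableSet

/-- The weak form of a lower bound for the Laplacian of `e`, in one chart. -/
theorem weak_laplacian_ge_of_tsupport_subset [T2Space M] {c : M} {w e q : M → ℝ}
    (hw : ChartLipschitz n w)
    (hc : HasCompactSupport w) (hs : tsupport w ⊆ (chartAt (𝔼 n) c).source) (hw0 : ∀ x, 0 ≤ w x)
    (he : ChartSmooth n e) (hq : Continuous q)
    (hqe : ∀ y ∈ (chartAt (𝔼 n) c).target, q ((chartAt (𝔼 n) c).symm y)
      ≤ laplacian (metric c) (fun z ↦ e ((chartAt (𝔼 n) c).symm z)) y) :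
    Integrable (fun x ↦ w x * q x + cometric x (dM n w x) (dM n e x)) (riemannianVolume n M) ∧
      ∫ x, w x * q x + cometric x (dM n w x) (dM n e x) ∂(riemannianVolume n M) ≤ 0 := by
  have hU := (chartAt (𝔼 n) c).open_target
  have hg := isMetricOn_metric (n := n) c
  set φ := chartAt (𝔼 n) c with hφ
  set F : M → ℝ := fun x ↦ w x * q x + cometric x (dM n w x) (dM n e x) with hF
  set ew : 𝔼 n → ℝ := fun z ↦ e (φ.symm z) with hew
  -- The test function in coordinates, extended by zero. Its support is compact inside the chart
  -- target, so the Euclidean integration by parts applies to it.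
  set W : 𝔼 n → ℝ := φ.target.indicator fun z ↦ w (φ.symm z) with hW
  have hWU : ∀ z ∈ φ.target, W z = w (φ.symm z) := fun z hz ↦ Set.indicator_of_mem hz _
  have hK : IsCompact (φ '' tsupport w) := hc.isCompact.image_of_continuousOn (φ.continuousOn.mono hs)
  have hKU : φ '' tsupport w ⊆ φ.target := by
    rintro _ ⟨x, hx, rfl⟩; exact φ.map_source (hs hx)
  have hWs : Function.support W ⊆ φ '' tsupport w := by
    intro z hz
    have hzU : z ∈ φ.target := Set.mem_of_indicator_ne_zero hz
    refine ⟨φ.symm z, subset_tsupport _ ?_, φ.right_inv hzU⟩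
    rw [Function.mem_support, hWU z hzU] at hz
    exact hz
  have hWt : tsupport W ⊆ φ '' tsupport w := closure_minimal hWs hK.isClosed
  have hWc : HasCompactSupport W := hK.of_isClosed_subset (isClosed_tsupport _) hWt
  have hWL : LocallyLipschitzOn φ.target W := by
    intro y hy
    obtain ⟨K, t, ht, h⟩ := hw c hy
    refine ⟨K, t ∩ φ.target, Filter.inter_mem ht self_mem_nhdsWithin, fun p hp r hr ↦ ?_⟩
    rw [hWU p hp.2, hWU r hr.2]
    exact h hp.1 hr.1
  obtain ⟨hGi, hG0⟩ := integrable_and_integral_eq_zero hg (he c) hWL hWc (hWt.trans hKU)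
  set G : 𝔼 n → ℝ := fun y ↦ √(metric c y).det * (∑ k, ∑ l, (metric c y)⁻¹ k l * pd k W y
    * pd l ew y + W y * laplacian (metric c) ew y) with hG
  -- The defect in the differential inequality, weighted by `w`. It is nonnegative, and the
  -- integrand in question is a divergence `G` minus `H`.
  set H : 𝔼 n → ℝ := fun y ↦ volDensity c y * (W y * (laplacian (metric c) ew y - q (φ.symm y)))
    with hH
  have hFG : ∀ y ∈ φ.target, volDensity c y * F (φ.symm y) = G y - H y := by
    intro y hy
    have h1 : ∀ k, pd k W y = pd k (fun z ↦ w (φ.symm z)) y := fun k ↦ pd_congr hU hy k hWU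
    simp only [hG, hH, hF, h1, hWU y hy, volDensity]
    rw [cometric_dM hy]
    ring
  have hHc : ContinuousOn H φ.target := by
    have h1 : ContinuousOn (fun y ↦ √(metric c y).det * laplacian (metric c) ew y) φ.target := by
      have h2 : ContinuousOn (fun y ↦ ∑ k, pd k (fun z ↦ √(metric c z).det
          * ∑ l, (metric c z)⁻¹ k l * pd l ew z) y) φ.target := by
        refine continuousOn_finsetSum _ fun k _ ↦ ?_
        have hX : ContDiffOn ℝ ∞ (fun z ↦ √(metric c z).det
            * ∑ l, (metric c z)⁻¹ k l * pd l ew z) φ.target :=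
          ((contDiffOn_det hg.contDiffOn).sqrt fun y hy ↦ (hg.det_pos hy).ne').mul
            (ContDiffOn.sum fun l _ ↦ (hg.contDiffOn_inv k l).mul (contDiffOn_pd hU (he c) l))
        exact (contDiffOn_pd hU hX k).continuousOn
      exact h2.congr fun y hy ↦ (hg.sum_pd_sqrt_det_mul (he c) hy).symm
    have h3 : ContinuousOn (fun y ↦ W y * (√(metric c y).det * laplacian (metric c) ew y
        - volDensity c y * q (φ.symm y))) φ.target :=
      hWL.continuousOn.mul (h1.sub ((continuousOn_volDensity c).mul
        (hq.comp_continuousOn φ.continuousOn_symm)))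
    refine h3.congr fun y _ ↦ ?_
    simp only [hH, volDensity]; ring
  have hHi : IntegrableOn H φ.target := by
    refine IntegrableOn.of_forall_sdiff_eq_zero ((hHc.mono hKU).integrableOn_compact hK)
      hU.measurableSet fun y hy ↦ ?_
    have : W y = 0 := by
      by_contra h; exact hy.2 (hWs h)
    simp [hH, this]
  have hH0 : ∀ y ∈ φ.target, 0 ≤ H y := fun y hy ↦
    mul_nonneg (volDensity_nonneg c y) (mul_nonneg (by rw [hWU y hy]; exact hw0 _)
      (sub_nonneg.2 (hqe y hy)))
  have hae : (fun y ↦ G y - H y) =ᵐ[volume.restrict φ.target]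
      fun y ↦ volDensity c y * F (φ.symm y) := by
    filter_upwards [ae_restrict_mem hU.measurableSet] with y hy
    exact (hFG y hy).symm
  have hFm : AEStronglyMeasurable (fun y ↦ F (φ.symm y)) (volume.restrict φ.target) :=
    ((aestronglyMeasurable_comp_chart hw.continuous c).mul
      (aestronglyMeasurable_comp_chart hq c)).add (aestronglyMeasurable_cometric_chart c)
  -- Off the support of `w` both terms vanish, so the global integral is an integral over one chart.
  have hF0 : ∀ x ∉ φ.source, F x = 0 := by
    intro x hx
    have hxs : x ∉ tsupport w := fun h ↦ hx (hs h)
    simp only [hF]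
    rw [image_eq_zero_of_notMem_tsupport hxs, dM_eq_zero_of_notMem_tsupport hxs]
    simp [cometric_eq_left]
  constructor
  · have h1 : Integrable F (chartVolume (n := n) c) :=
      (integrable_chartVolume_iff hFm).2 ((hGi.sub hHi).congr hae)
    rw [← riemannianVolume_restrict_source] at h1
    exact IntegrableOn.integrable_of_forall_notMem_eq_zero h1 hF0
  · rw [← setIntegral_eq_integral_of_forall_compl_eq_zero hF0, riemannianVolume_restrict_source,
      integral_chartVolume hFm, ← integral_congr_ae hae, integral_sub hGi hHi, hG0, zero_sub,
      neg_nonpos]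
    exact setIntegral_nonneg hU.measurableSet hH0

/-- The weak form of a lower bound for the Laplacian of `e`. -/
theorem weak_laplacian_ge [T2Space M] [SecondCountableTopology M] {w e q : M → ℝ}
    (hw : ChartLipschitz n w) (hc : HasCompactSupport w) (hw0 : ∀ x, 0 ≤ w x)
    (he : ChartSmooth n e) (hq : Continuous q)
    (hqe : ∀ c : M, ∀ y ∈ (chartAt (𝔼 n) c).target, q ((chartAt (𝔼 n) c).symm y)
      ≤ laplacian (metric c) (fun z ↦ e ((chartAt (𝔼 n) c).symm z)) y) :
    Integrable (fun x ↦ w x * q x + cometric x (dM n w x) (dM n e x)) (riemannianVolume n M) ∧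
      ∫ x, w x * q x + cometric x (dM n w x) (dM n e x) ∂(riemannianVolume n M) ≤ 0 := by
  have : LocallyCompactSpace M := ChartedSpace.locallyCompactSpace (𝔼 n) M
  -- The claim is linear in `w`, and a partition of unity reduces it to test functions supported in
  -- a chart domain. Only finitely many of its members meet the compact support of `w`.
  obtain ⟨ρ, hρ⟩ := SmoothPartitionOfUnity.exists_isSubordinate (𝓡 n) (isClosed_tsupport w)
    (fun c : M ↦ (chartAt (𝔼 n) c).source) (fun c ↦ (chartAt (𝔼 n) c).open_source)
    (fun x _ ↦ Set.mem_iUnion.2 ⟨x, mem_chart_source _ x⟩)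
  have hfin := ρ.locallyFinite.finite_nonempty_inter_compact hc.isCompact
  set S := hfin.toFinset with hS
  have hρs : ∀ i, ChartSmooth n (ρ i) := fun i ↦ chartSmooth_of_contMDiff (ρ i).contMDiff
  have hts : ∀ i, tsupport (fun x ↦ ρ i x * w x) ⊆ tsupport (ρ i) := fun i ↦
    closure_mono fun x hx h0 ↦ hx (by simp [h0])
  have hloc := fun i ↦ weak_laplacian_ge_of_tsupport_subset (c := i)
    ((hρs i).chartLipschitz.mul hw) (hc.mul_left (f := ρ i)) ((hts i).trans (hρ i))
    (fun x ↦ mul_nonneg (ρ.nonneg i x) (hw0 x)) he hq (hqe i)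
  have hsum : ∀ x, w x = ∑ i ∈ S, ρ i x * w x := by
    intro x
    by_cases hx : x ∈ tsupport w
    · have h1 := ρ.sum_eq_one hx
      rw [finsum_eq_sum_of_support_subset (s := S)] at h1
      · rw [← Finset.sum_mul, h1, one_mul]
      · intro i hi
        simp only [hS, Set.Finite.coe_toFinset, Set.mem_ofPred_eq]
        exact ⟨x, hi, hx⟩
    · simp [image_eq_zero_of_notMem_tsupport hx]
  have hae : (fun x ↦ ∑ i ∈ S, (ρ i x * w x * q x
        + cometric x (dM n (fun z ↦ ρ i z * w z) x) (dM n e x))) =ᵐ[riemannianVolume n M]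
      fun x ↦ w x * q x + cometric x (dM n w x) (dM n e x) := by
    filter_upwards [hw.ae_mdifferentiableAt] with x hx
    have h1 : dM n w x = ∑ i ∈ S, dM n (fun z ↦ ρ i z * w z) x := by
      rw [← dM_sum]
      · exact congrArg (fun f ↦ dM n f x) (funext hsum)
      · exact fun i _ ↦ ((hρs i).mdifferentiableAt x).mul hx
    rw [Finset.sum_add_distrib, ← Finset.sum_mul, ← hsum, ← cometric_sum_left, ← h1]
  refine ⟨(integrable_finsetSum _ fun i _ ↦ (hloc i).1).congr hae, ?_⟩
  rw [← integral_congr_ae hae, integral_finsetSum _ fun i _ ↦ (hloc i).1]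
  exact Finset.sum_nonpos fun i _ ↦ (hloc i).2

end DifferentialCalculus

end YangMills

namespace YangMills

/-! ### Lipschitz functions with compact support in the Sobolev inequality -/

section Sobolev

variable {n : ℕ} {M : Type u} [TopologicalSpace M] [ChartedSpace (𝔼 n) M] [IsManifold (𝓡 n) ∞ M]
  [RiemannianBundle (fun x : M ↦ TangentSpace (𝓡 n) x)]
  [IsContMDiffRiemannianBundle (𝓡 n) ∞ (𝔼 n) (fun x : M ↦ TangentSpace (𝓡 n) x)]

/-- The gradient of a function. -/
def grad (u : M → ℝ) (x : M) : TangentSpace (𝓡 n) x := sharp x (dM n u x)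

theorem enorm_grad_sq (u : M → ℝ) (x : M) :
    ‖grad (n := n) u x‖ₑ ^ 2 = ENNReal.ofReal (cometric x (dM n u x) (dM n u x)) := by
  rw [← ofReal_norm, ← ENNReal.ofReal_pow (norm_nonneg _), ← real_inner_self_eq_norm_sq]
  rfl

theorem inner_grad_coordVec {c : M} {y : 𝔼 n} (hy : y ∈ (chartAt (𝔼 n) c).target) (u : M → ℝ)
    (i : Fin n) :
    inner ℝ (grad (n := n) u ((chartAt (𝔼 n) c).symm y)) (coordVec c i y)
      = pd i (fun z ↦ u ((chartAt (𝔼 n) c).symm z)) y :=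
  (ginner_sharp ((chartAt (𝔼 n) c).symm y) _ (frame c y (EuclideanSpace.single i 1))).trans
    (dM_frame hy u _)

/-- The product `f ψ` is Lipschitz with compact support, so its partial derivative integrates to
zero; the product rule holds almost everywhere. -/
theorem setIntegral_mul_pd_eq_neg {U : Set (𝔼 n)} (hU : IsOpen U) {f ψ : 𝔼 n → ℝ}
    (hf : LocallyLipschitzOn U f) (hψ : ContDiff ℝ ∞ ψ) (hc : HasCompactSupport ψ)
    (hs : tsupport ψ ⊆ U) (i : Fin n) :
    ∫ y in U, f y * pd i ψ y = -∫ y in U, pd i f y * ψ y := by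
  have hts : tsupport (fun z ↦ f z * ψ z) ⊆ tsupport ψ :=
    closure_mono fun z hz h0 ↦ hz (by simp [h0])
  have hcs : HasCompactSupport (fun z ↦ f z * ψ z) := hc.mul_left
  obtain ⟨K, hK⟩ := exists_lipschitzWith hU (locallyLipschitzOn_mul hf
    (locallyLipschitzOn_of_contDiffOn hU hψ.contDiffOn)) hcs (hts.trans hs)
  have h0 := integral_pd_eq_zero hK hcs i
  have hout : ∀ y ∉ U, pd i (fun z ↦ f z * ψ z) y = 0 := by
    intro y hy
    have h0 := notMem_tsupport_iff_eventuallyEq.1 (fun h ↦ hy (hs (hts h)))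
    simp [pd, h0.fderiv_eq]
  rw [← setIntegral_eq_integral_of_forall_compl_eq_zero hout] at h0
  have hi := (integrable_pd hK hcs i).integrableOn (s := U)
  have hpdψ : Continuous (pd i ψ) :=
    (hψ.continuous_fderiv (by simp)).clm_apply continuous_const
  have hi2 : IntegrableOn (fun y ↦ f y * pd i ψ y) U := by
    refine IntegrableOn.of_forall_sdiff_eq_zero
      (((hf.continuousOn.mul hpdψ.continuousOn).mono hs).integrableOn_compact hc.isCompact)
      hU.measurableSet fun y hy ↦ ?_
    have h1 := notMem_tsupport_iff_eventuallyEq.1 hy.2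
    simp [pd, h1.fderiv_eq]
  have hae : (fun y ↦ pd i (fun z ↦ f z * ψ z) y - f y * pd i ψ y)
      =ᵐ[volume.restrict U] fun y ↦ pd i f y * ψ y := by
    filter_upwards [ae_differentiableAt_of_locallyLipschitzOn hU hf] with y hy
    simp only [pd]
    rw [fderiv_fun_mul hy ((hψ.differentiable (by simp)) y)]
    simp
    ring
  rw [← integral_congr_ae hae, integral_sub hi hi2, h0]
  ring

variable [MeasurableSpace M] [BorelSpace M]

/-- The pointwise gradient exists almost everywhere and is the weak gradient. This makes the cut-off
powers of `e + δ` admissible in the Sobolev inequality. -/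
theorem isH12_of_chartLipschitz [T2Space M] [SecondCountableTopology M] {u : M → ℝ}
    (hu : ChartLipschitz n u) (hc : HasCompactSupport u)
    (hfin : ∫⁻ x, ENNReal.ofReal (cometric x (dM n u x) (dM n u x)) ∂(riemannianVolume n M) < ⊤) :
    IsH12 u (grad (n := n) u) where
  memLp := by
    have := isLocallyFiniteMeasure_riemannianVolume (n := n) (M := M)
    exact hu.continuous.memLp_of_hasCompactSupport hc
  aestronglyMeasurable_grad c i := by
    have h1 : AEStronglyMeasurable (fun y ↦ pd i (fun z ↦ u ((chartAt (𝔼 n) c).symm z)) y)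
        ((volume : Measure (𝔼 n)).restrict (chartAt (𝔼 n) c).target) :=
      (measurable_fderiv_apply_const ℝ _ _).aestronglyMeasurable
    refine h1.congr ?_
    filter_upwards [ae_restrict_mem (chartAt (𝔼 n) c).open_target.measurableSet] with y hy
    exact (inner_grad_coordVec hy u i).symm
  lintegral_grad_lt_top := by simpa only [enorm_grad_sq] using hfin
  weak_deriv c i ψ hψ hψc hψs := by
    have hU := (chartAt (𝔼 n) c).open_target
    rw [setIntegral_mul_pd_eq_neg hU (hu c) hψ hψc hψs]
    refine congrArg Neg.neg (setIntegral_congr_fun hU.measurableSet fun y hy ↦ ?_)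
    simp only [inner_grad_coordVec hy u i]

theorem SobolevInequality.lintegral_le [T2Space M] [SecondCountableTopology M] {c₁ : ℝ}
    (h : SobolevInequality n M c₁) {u : M → ℝ} (hu : ChartLipschitz n u)
    (hc : HasCompactSupport u)
    (hfin : ∫⁻ x, ENNReal.ofReal (cometric x (dM n u x) (dM n u x)) ∂(riemannianVolume n M) < ⊤) :
    (∫⁻ x, ‖u x‖ₑ ^ (2 * (n : ℝ) / ((n : ℝ) - 2)) ∂(riemannianVolume n M))
        ^ (((n : ℝ) - 2) / (n : ℝ))
      ≤ ENNReal.ofReal c₁ * ∫⁻ x, ENNReal.ofReal (cometric x (dM n u x) (dM n u x))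
          ∂(riemannianVolume n M) := by
  have h1 := h u (grad (n := n) u) (isH12_of_chartLipschitz hu hc hfin)
  simpa only [enorm_grad_sq] using h1

end Sobolev

/-! ### Young's inequality for covectors -/

section CauchySchwarz

variable {n : ℕ} {M : Type u} [TopologicalSpace M] [ChartedSpace (𝔼 n) M]
  [RiemannianBundle (fun x : M ↦ TangentSpace (𝓡 n) x)]

theorem cometric_smul_add_smul_self (x : M) (r s : ℝ) (α β : 𝔼 n →L[ℝ] ℝ) :
    cometric x (r • α + s • β) (r • α + s • β)
      = r ^ 2 * cometric x α α + 2 * (r * s) * cometric x α β + s ^ 2 * cometric x β β := by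
  simp only [cometric_add_left, cometric_smul_left]
  rw [cometric_comm x α, cometric_comm x β]
  simp only [cometric_add_left, cometric_smul_left]
  rw [cometric_comm x β α]
  ring

theorem two_mul_cometric_le (x : M) (r s : ℝ) (α β : 𝔼 n →L[ℝ] ℝ) :
    2 * (r * s) * cometric x α β ≤ r ^ 2 * cometric x α α + s ^ 2 * cometric x β β := by
  have h := cometric_self_nonneg x (r • α + (-s) • β)
  rw [cometric_smul_add_smul_self] at h
  nlinarith

theorem cometric_smul_add_smul_self_le (x : M) (r s : ℝ) (α β : 𝔼 n →L[ℝ] ℝ) :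
    cometric x (r • α + s • β) (r • α + s • β)
      ≤ 2 * (r ^ 2 * cometric x α α) + 2 * (s ^ 2 * cometric x β β) := by
  rw [cometric_smul_add_smul_self]
  linarith [two_mul_cometric_le x r s α β]

end CauchySchwarz

end YangMills

namespace YangMills

/-! ### The Caccioppoli inequality -/

section Caccioppoli

variable {n : ℕ} {M : Type u} [EMetricSpace M] [ChartedSpace (𝔼 n) M] [IsManifold (𝓡 n) ∞ M]
  [SecondCountableTopology M]
  [RiemannianBundle (fun x : M ↦ TangentSpace (𝓡 n) x)]
  [IsContMDiffRiemannianBundle (𝓡 n) ∞ (𝔼 n) (fun x : M ↦ TangentSpace (𝓡 n) x)]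
  [IsRiemannianManifold (𝓡 n) M] [MeasurableSpace M] [BorelSpace M]

variable (n) in
/-- A nonnegative smooth function that satisfies, in every chart, the differential inequality that
the Bochner formula provides for the energy density of a Yang–Mills connection. -/
structure IsBochnerDensity (C : ℝ) (e : M → ℝ) : Prop where
  smooth : ChartSmooth n e
  nonneg : ∀ x, 0 ≤ e x
  le_laplacian : ∀ c : M, ∀ y ∈ (chartAt (𝔼 n) c).target, ∀ a : ℝ, 0 < a →
    e ((chartAt (𝔼 n) c).symm y) ≤ a →
    gradSq (metric c) (fun z ↦ e ((chartAt (𝔼 n) c).symm z)) y / (2 * a)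
      - C * (e ((chartAt (𝔼 n) c).symm y) * √(e ((chartAt (𝔼 n) c).symm y)))
      ≤ laplacian (metric c) (fun z ↦ e ((chartAt (𝔼 n) c).symm z)) y

namespace IsBochnerDensity

variable {C : ℝ} {e : M → ℝ}

/-- The shift by `δ` keeps the base positive, so that all real powers are smooth, also at the zeros
of `e`. -/
theorem chartSmooth_rpow (he : IsBochnerDensity n C e) {δ : ℝ} (hδ : 0 < δ) (p : ℝ) :
    ChartSmooth n fun x ↦ (e x + δ) ^ p := fun c ↦
  ((he.smooth c).add contDiffOn_const).rpow_const_of_ne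
    fun _ _ ↦ (add_pos_of_nonneg_of_pos (he.nonneg _) hδ).ne'

theorem continuous_rpow (he : IsBochnerDensity n C e) {δ : ℝ} (hδ : 0 < δ) (p : ℝ) :
    Continuous fun x ↦ (e x + δ) ^ p := (he.chartSmooth_rpow hδ p).continuous

theorem dM_rpow (he : IsBochnerDensity n C e) {δ : ℝ} (hδ : 0 < δ) (p : ℝ) (x : M) :
    dM n (fun z ↦ (e z + δ) ^ p) x = (p * (e x + δ) ^ (p - 1)) • dM n e x := by
  have ha : 0 < e x + δ := add_pos_of_nonneg_of_pos (he.nonneg _) hδ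
  refine dM_comp (θ := fun t ↦ (t + δ) ^ p) (he.smooth.mdifferentiableAt x) ?_
  have h := ((hasDerivAt_id (e x)).add_const δ).rpow_const (p := p) (Or.inl ha.ne')
  simpa using h

theorem dM_cutoff_mul_rpow (he : IsBochnerDensity n C e) {δ : ℝ} (hδ : 0 < δ) (p : ℝ)
    {η : M → ℝ} {x : M} (hx : MDifferentiableAt (𝓡 n) 𝓘(ℝ, ℝ) η x) :
    dM n (fun z ↦ η z * (e z + δ) ^ p) x
      = (η x * (p * (e x + δ) ^ (p - 1))) • dM n e x + (e x + δ) ^ p • dM n η x := by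
  rw [dM_mul hx ((he.chartSmooth_rpow hδ p).mdifferentiableAt x), he.dM_rpow hδ, smul_smul]

/-- The squared norm of the differential. -/
local notation "D" x:max => cometric x (dM n e x) (dM n e x)

theorem mul_cometric_dM_le {η : M → ℝ} {K : NNReal} (hη : LipschitzWith K η) {f : M → ℝ}
    (hf : ∀ x, 0 ≤ f x) (x : M) :
    f x * cometric x (dM n η x) (dM n η x) ≤ (K : ℝ) ^ 2 * (tsupport η).indicator f x := by
  by_cases hx : x ∈ tsupport η
  · rw [Set.indicator_of_mem hx, mul_comm]
    exact mul_le_mul_of_nonneg_right (cometric_dM_le_of_lipschitzWith hη x) (hf x)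
  · rw [Set.indicator_of_notMem hx, dM_eq_zero_of_notMem_tsupport hx]
    simp [cometric_eq_left]

theorem integrable_sq_mul {η f : M → ℝ} (hη : Continuous η)
    (hc : HasCompactSupport η) (hf : Continuous f) :
    Integrable (fun x ↦ η x ^ 2 * f x) (riemannianVolume n M) := by
  have := isLocallyFiniteMeasure_riemannianVolume (n := n) (M := M)
  refine ((hη.pow 2).mul hf).integrable_of_hasCompactSupport ?_
  exact hc.mono fun x hx h0 ↦ hx (by simp [h0])

theorem integrable_indicator_tsupport {η f : M → ℝ}
    (hc : HasCompactSupport η) (hf : Continuous f) :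
    Integrable ((tsupport η).indicator f) (riemannianVolume n M) := by
  have := isLocallyFiniteMeasure_riemannianVolume (n := n) (M := M)
  exact (hf.continuousOn.integrableOn_compact hc.isCompact).integrable_indicator
    (isClosed_tsupport η).measurableSet

theorem continuous_rpow_mul_D (he : IsBochnerDensity n C e) {δ : ℝ} (hδ : 0 < δ) (p : ℝ) :
    Continuous fun x : M ↦ (e x + δ) ^ p * D x :=
  (he.continuous_rpow hδ p).mul (continuous_cometric_dM_self he.smooth)

theorem continuous_rpow_mul_sqrt (he : IsBochnerDensity n C e) {δ : ℝ} (hδ : 0 < δ) (p : ℝ) :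
    Continuous fun x : M ↦ (e x + δ) ^ p * √(e x) :=
  (he.continuous_rpow hδ p).mul he.smooth.continuous.sqrt

/-- Testing the Bochner inequality with `η² (e + δ) ^ (n / 4 - 1)`. -/
theorem integral_sq_mul_le (he : IsBochnerDensity n C e) (hC : 0 ≤ C) (hn : 3 ≤ n) {δ : ℝ}
    (hδ : 0 < δ) {η : M → ℝ} {K : NNReal} (hη : LipschitzWith K η)
    (hc : HasCompactSupport η) :
    ∫ x, η x ^ 2 * ((e x + δ) ^ ((n : ℝ) / 4 - 2) * D x) ∂(riemannianVolume n M)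
      ≤ 4 / (((n : ℝ) - 2) / 4) ^ 2
          * ((K : ℝ) ^ 2 * ∫ x, (tsupport η).indicator (fun z ↦ (e z + δ) ^ ((n : ℝ) / 4)) x
            ∂(riemannianVolume n M))
        + 2 * C / (((n : ℝ) - 2) / 4)
          * ∫ x, η x ^ 2 * ((e x + δ) ^ ((n : ℝ) / 4) * √(e x)) ∂(riemannianVolume n M) := by
  -- `σ = s + 1/2`, where `s = n/4 - 1` comes from differentiating the test function and `1/2` from
  -- Kato's term. For `n = 3` the exponent `s` is negative, yet `σ` is positive.
  set σ : ℝ := ((n : ℝ) - 2) / 4 with hσ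
  have hn' : (3 : ℝ) ≤ n := by exact_mod_cast hn
  have hσ0 : 0 < σ := by rw [hσ]; linarith
  have hηL := chartLipschitz_of_lipschitzWith (n := n) hη
  have ha : ∀ x, 0 < e x + δ := fun x ↦ add_pos_of_nonneg_of_pos (he.nonneg x) hδ
  set s : ℝ := (n : ℝ) / 4 - 1 with hs
  -- The Bochner inequality is used with `a = e + δ`, which makes the lower bound continuous.
  have hq : Continuous fun x : M ↦ D x / (2 * (e x + δ)) - C * (e x * √(e x)) := by
    refine ((continuous_cometric_dM_self he.smooth).div
      (continuous_const.mul (he.smooth.continuous.add continuous_const))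
      fun x ↦ (mul_pos two_pos (ha x)).ne').sub ?_
    exact continuous_const.mul (he.smooth.continuous.mul he.smooth.continuous.sqrt)
  have hcw : HasCompactSupport (fun x ↦ η x * η x * (e x + δ) ^ s) := (hc.mul_right).mul_right
  obtain ⟨hFi, hF0⟩ := weak_laplacian_ge (w := fun x ↦ η x * η x * (e x + δ) ^ s) (e := e)
    ((hηL.mul hηL).mul (he.chartSmooth_rpow hδ s).chartLipschitz) hcw
    (fun x ↦ mul_nonneg (mul_self_nonneg _) (Real.rpow_nonneg (ha x).le _)) he.smooth hq
    (fun c y hy ↦ by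
      rw [cometric_dM_self hy]
      exact he.le_laplacian c y hy _ (ha _) (by linarith))
  set I := ∫ x, η x ^ 2 * ((e x + δ) ^ ((n : ℝ) / 4 - 2) * D x) ∂(riemannianVolume n M) with hI
  set J := ∫ x, (tsupport η).indicator (fun z ↦ (e z + δ) ^ ((n : ℝ) / 4)) x
    ∂(riemannianVolume n M) with hJ
  set P := ∫ x, η x ^ 2 * ((e x + δ) ^ ((n : ℝ) / 4) * √(e x)) ∂(riemannianVolume n M) with hP
  have hIi := integrable_sq_mul (n := n) hη.continuous hc
    (he.continuous_rpow_mul_D hδ ((n : ℝ) / 4 - 2))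
  have hPi := integrable_sq_mul (n := n) hη.continuous hc
    (he.continuous_rpow_mul_sqrt hδ ((n : ℝ) / 4))
  have hJi := integrable_indicator_tsupport (n := n) hc (he.continuous_rpow hδ ((n : ℝ) / 4))
  have hIJ : Integrable (fun x ↦ σ / 2 * (η x ^ 2 * ((e x + δ) ^ ((n : ℝ) / 4 - 2) * D x))
      - 2 / σ * ((K : ℝ) ^ 2 * (tsupport η).indicator (fun z ↦ (e z + δ) ^ ((n : ℝ) / 4)) x))
      (riemannianVolume n M) := (hIi.const_mul _).sub ((hJi.const_mul _).const_mul _)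
  have hle : ∫ x, (σ / 2 * (η x ^ 2 * ((e x + δ) ^ ((n : ℝ) / 4 - 2) * D x))
      - 2 / σ * ((K : ℝ) ^ 2 * (tsupport η).indicator (fun z ↦ (e z + δ) ^ ((n : ℝ) / 4)) x)
      - C * (η x ^ 2 * ((e x + δ) ^ ((n : ℝ) / 4) * √(e x)))) ∂(riemannianVolume n M) ≤ 0 := by
    refine le_trans (integral_mono_ae (hIJ.sub (hPi.const_mul _)) hFi ?_) hF0
    filter_upwards [hηL.ae_mdifferentiableAt] with x hx
    have hdw : dM n (fun z ↦ η z * η z * (e z + δ) ^ s) x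
        = (η x * η x * (s * (e x + δ) ^ (s - 1))) • dM n e x
          + ((e x + δ) ^ s * (2 * η x)) • dM n η x := by
      rw [he.dM_cutoff_mul_rpow hδ s (η := fun z ↦ η z * η z) (hx.mul hx), dM_mul hx hx, ← two_smul ℝ (η x • dM n η x),
        smul_smul, smul_smul]
      congr 2
      ring
    simp only [hdw, cometric_add_left, cometric_smul_left]
    -- Young's inequality, with weights chosen so that the cross term of `dη` and `de` costs `σ /
    -- 2`, half of the available coefficient.
    have h1 := two_mul_cometric_le x (-(2 / σ * (e x + δ))) (η x) (dM n η x) (dM n e x)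
    have h2 := mul_cometric_dM_le (n := n) hη (f := fun z ↦ (e z + δ) ^ ((n : ℝ) / 4))
      (fun z ↦ Real.rpow_nonneg (ha z).le _) x
    have hA1 : 0 < (e x + δ) ^ ((n : ℝ) / 4 - 2) := Real.rpow_pos_of_pos (ha x) _
    have es : (e x + δ) ^ s = (e x + δ) ^ ((n : ℝ) / 4 - 2) * (e x + δ) := by
      rw [hs, show (n : ℝ) / 4 - 1 = (n : ℝ) / 4 - 2 + 1 by ring, Real.rpow_add_one (ha x).ne']
    have es1 : (e x + δ) ^ (s - 1) = (e x + δ) ^ ((n : ℝ) / 4 - 2) := by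
      congr 1; rw [hs]; ring
    have es4 : (e x + δ) ^ ((n : ℝ) / 4) = (e x + δ) ^ ((n : ℝ) / 4 - 2) * (e x + δ) ^ 2 := by
      rw [show (n : ℝ) / 4 = (n : ℝ) / 4 - 2 + 1 + 1 by ring, Real.rpow_add_one (ha x).ne',
        Real.rpow_add_one (ha x).ne']
      ring_nf
    rw [es, es1]
    have hsσ : s = σ - 1 / 2 := by rw [hs, hσ]; ring
    rw [hsσ]
    beta_reduce at h2
    set T := (tsupport η).indicator (fun z ↦ (e z + δ) ^ ((n : ℝ) / 4)) x
    rw [es4] at h2 ⊢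
    have hax := ha x
    have hex := he.nonneg x
    have hea : e x ≤ e x + δ := by linarith
    set a := e x + δ
    set A := a ^ ((n : ℝ) / 4 - 2)
    set X := cometric x (dM n η x) (dM n η x)
    set Y := cometric x (dM n η x) (dM n e x)
    set Z := cometric x (dM n e x) (dM n e x)
    have hq0 := Real.sqrt_nonneg (e x)
    set r := √(e x)
    have h3 : A * (2 * η x * a) * (-Y) ≤ 2 / σ * (A * a ^ 2 * X) + σ / 2 * (A * η x ^ 2 * Z) := by
      have h4 := mul_le_mul_of_nonneg_left h1 (by positivity : 0 ≤ σ / 2 * A)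
      have e1 : σ / 2 * A * (2 * (-(2 / σ * a) * η x) * Y) = A * (2 * η x * a) * (-Y) := by
        field_simp
      have e2 : σ / 2 * A * ((-(2 / σ * a)) ^ 2 * X + η x ^ 2 * Z)
          = 2 / σ * (A * a ^ 2 * X) + σ / 2 * (A * η x ^ 2 * Z) := by
        field_simp
      rw [e1, e2] at h4
      exact h4
    have h5 : 2 / σ * (A * a ^ 2 * X) ≤ 2 / σ * ((K : ℝ) ^ 2 * T) :=
      mul_le_mul_of_nonneg_left h2 (by positivity)
    -- One factor `e` is replaced by `e + δ`, so that the cubic term carries the power `n / 4`.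
    have h6 : C * (η x ^ 2 * (A * a * (e x * r))) ≤ C * (η x ^ 2 * (A * a ^ 2 * r)) := by
      have : A * a * (e x * r) ≤ A * a ^ 2 * r := by
        have := mul_le_mul_of_nonneg_left hea (by positivity : 0 ≤ A * a * r)
        nlinarith
      gcongr
    have h7 : η x * η x * (A * a) * (Z / (2 * a) - C * (e x * r))
        = 1 / 2 * (A * η x ^ 2 * Z) - C * (η x ^ 2 * (A * a * (e x * r))) := by
      field_simp
    rw [h7]
    nlinarith
  rw [integral_sub hIJ (hPi.const_mul _),
    integral_sub (hIi.const_mul _) ((hJi.const_mul _).const_mul _)] at hle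
  simp only [integral_const_mul] at hle
  rw [← hI, ← hJ, ← hP] at hle
  have h8 : I * (σ / 2) ≤ 2 / σ * ((K : ℝ) ^ 2 * J) + C * P := by linarith
  have h9 : I ≤ (2 / σ * ((K : ℝ) ^ 2 * J) + C * P) / (σ / 2) := (le_div_iff₀ (by positivity)).2 h8
  refine h9.trans_eq ?_
  field_simp
  ring

/-- The gradient estimate for `η (e + δ) ^ (n / 8)`. -/
theorem lintegral_cometric_le (he : IsBochnerDensity n C e) (hC : 0 ≤ C) (hn : 3 ≤ n) {δ : ℝ}
    (hδ : 0 < δ) {η : M → ℝ} {K : NNReal} (hη : LipschitzWith K η)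
    (hc : HasCompactSupport η) :
    ∫⁻ x, ENNReal.ofReal (cometric x (dM n (fun z ↦ η z * (e z + δ) ^ ((n : ℝ) / 8)) x)
        (dM n (fun z ↦ η z * (e z + δ) ^ ((n : ℝ) / 8)) x)) ∂(riemannianVolume n M)
      ≤ ENNReal.ofReal ((2 + (n : ℝ) ^ 2 / 32 * (4 / (((n : ℝ) - 2) / 4) ^ 2))
          * ((K : ℝ) ^ 2 * ∫ x, (tsupport η).indicator (fun z ↦ (e z + δ) ^ ((n : ℝ) / 4)) x
            ∂(riemannianVolume n M))
        + (n : ℝ) ^ 2 / 32 * (2 * C / (((n : ℝ) - 2) / 4))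
          * ∫ x, η x ^ 2 * ((e x + δ) ^ ((n : ℝ) / 4) * √(e x)) ∂(riemannianVolume n M)) := by
  have hmain := he.integral_sq_mul_le hC hn hδ hη hc
  have hηL := chartLipschitz_of_lipschitzWith (n := n) hη
  have ha : ∀ x, 0 < e x + δ := fun x ↦ add_pos_of_nonneg_of_pos (he.nonneg x) hδ
  have hIi := integrable_sq_mul (n := n) hη.continuous hc
    (he.continuous_rpow_mul_D hδ ((n : ℝ) / 4 - 2))
  have hJi := integrable_indicator_tsupport (n := n) hc (he.continuous_rpow hδ ((n : ℝ) / 4))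
  have hint : Integrable (fun x ↦
      2 * ((K : ℝ) ^ 2 * (tsupport η).indicator (fun z ↦ (e z + δ) ^ ((n : ℝ) / 4)) x)
        + (n : ℝ) ^ 2 / 32 * (η x ^ 2 * ((e x + δ) ^ ((n : ℝ) / 4 - 2) * D x)))
      (riemannianVolume n M) :=
    ((hJi.const_mul ((K : ℝ) ^ 2)).const_mul 2).add (hIi.const_mul ((n : ℝ) ^ 2 / 32))
  -- The square of a sum is at most twice the sum of the squares; the exponent `n / 8` then
  -- contributes `2 (n / 8)² = n² / 32`.
  have hpt : ∀ᵐ x ∂(riemannianVolume n M),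
      cometric x (dM n (fun z ↦ η z * (e z + δ) ^ ((n : ℝ) / 8)) x)
        (dM n (fun z ↦ η z * (e z + δ) ^ ((n : ℝ) / 8)) x)
      ≤ 2 * ((K : ℝ) ^ 2 * (tsupport η).indicator (fun z ↦ (e z + δ) ^ ((n : ℝ) / 4)) x)
        + (n : ℝ) ^ 2 / 32 * (η x ^ 2 * ((e x + δ) ^ ((n : ℝ) / 4 - 2) * D x)) := by
    filter_upwards [hηL.ae_mdifferentiableAt] with x hx
    rw [he.dM_cutoff_mul_rpow hδ _ hx]
    refine (cometric_smul_add_smul_self_le x _ _ _ _).trans ?_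
    have h2 := mul_cometric_dM_le (n := n) hη (f := fun z ↦ (e z + δ) ^ ((n : ℝ) / 4))
      (fun z ↦ Real.rpow_nonneg (ha z).le _) x
    have e1 : ((e x + δ) ^ ((n : ℝ) / 8)) ^ 2 = (e x + δ) ^ ((n : ℝ) / 4) := by
      rw [← Real.rpow_natCast, ← Real.rpow_mul (ha x).le]
      congr 1; push_cast; ring
    have e2 : ((e x + δ) ^ ((n : ℝ) / 8 - 1)) ^ 2 = (e x + δ) ^ ((n : ℝ) / 4 - 2) := by
      rw [← Real.rpow_natCast, ← Real.rpow_mul (ha x).le]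
      congr 1; push_cast; ring
    rw [e1, mul_pow, mul_pow, e2]
    linarith
  refine (lintegral_mono_ae (hpt.mono fun x hx ↦ ENNReal.ofReal_le_ofReal hx)).trans ?_
  have hnn : ∀ x, 0 ≤ 2 * ((K : ℝ) ^ 2
      * (tsupport η).indicator (fun z ↦ (e z + δ) ^ ((n : ℝ) / 4)) x)
        + (n : ℝ) ^ 2 / 32 * (η x ^ 2 * ((e x + δ) ^ ((n : ℝ) / 4 - 2) * D x)) := by
    intro x
    have h1 : 0 ≤ (tsupport η).indicator (fun z ↦ (e z + δ) ^ ((n : ℝ) / 4)) x :=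
      Set.indicator_nonneg (fun z _ ↦ Real.rpow_nonneg (ha z).le _) x
    have h2 : 0 ≤ (e x + δ) ^ ((n : ℝ) / 4 - 2) := Real.rpow_nonneg (ha x).le _
    have h3 := cometric_self_nonneg x (dM n e x)
    positivity
  rw [← ofReal_integral_eq_lintegral_ofReal hint (Filter.Eventually.of_forall hnn)]
  refine ENNReal.ofReal_le_ofReal ?_
  rw [integral_add ((hJi.const_mul _).const_mul _) (hIi.const_mul _)]
  simp only [integral_const_mul]
  have h5 := mul_le_mul_of_nonneg_left hmain (by positivity : 0 ≤ (n : ℝ) ^ 2 / 32)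
  linarith

end IsBochnerDensity

end Caccioppoli

end YangMills

namespace YangMills

/-! ### The gap theorem for Bochner densities -/

section Gap

variable {n : ℕ} {M : Type u} [EMetricSpace M] [ChartedSpace (𝔼 n) M] [IsManifold (𝓡 n) ∞ M]
  [SecondCountableTopology M]
  [RiemannianBundle (fun x : M ↦ TangentSpace (𝓡 n) x)]
  [IsContMDiffRiemannianBundle (𝓡 n) ∞ (𝔼 n) (fun x : M ↦ TangentSpace (𝓡 n) x)]
  [IsRiemannianManifold (𝓡 n) M] [MeasurableSpace M] [BorelSpace M]

/-- Hölder with the exponents `N / (N - 2)` and `N / 2`. For `N = n` the first factor is the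
left-hand side of the Sobolev inequality, and for `f = √e` the second is the energy. -/
theorem lintegral_sq_mul_le {X : Type*} [MeasurableSpace X] {μ : Measure X} {N : ℝ} (hN : 2 < N)
    {u f : X → ℝ} (hu : AEMeasurable u μ) (hf : AEMeasurable f μ) :
    ∫⁻ x, ENNReal.ofReal (u x ^ 2 * f x) ∂μ
      ≤ (∫⁻ x, ‖u x‖ₑ ^ (2 * N / (N - 2)) ∂μ) ^ ((N - 2) / N)
        * (∫⁻ x, ENNReal.ofReal (f x) ^ (N / 2) ∂μ) ^ (2 / N) := by
  have hpq : (N / (N - 2)).HolderConjugate (N / 2) := by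
    rw [Real.holderConjugate_iff]
    constructor
    · rw [lt_div_iff₀ (by linarith)]; linarith
    · have : N - 2 ≠ 0 := by linarith
      field_simp
      ring
  have h := ENNReal.lintegral_mul_le_Lp_mul_Lq μ hpq (f := fun x ↦ ‖u x‖ₑ ^ 2)
    (g := fun x ↦ ENNReal.ofReal (f x)) (hu.enorm.pow_const 2) hf.ennreal_ofReal
  have e1 : ∀ x, ENNReal.ofReal (u x ^ 2 * f x) = ‖u x‖ₑ ^ 2 * ENNReal.ofReal (f x) := by
    intro x
    rw [ENNReal.ofReal_mul (sq_nonneg _), ← sq_abs, ENNReal.ofReal_pow (abs_nonneg _),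
      ← Real.norm_eq_abs, ofReal_norm]
  have e2 : ∀ x, (‖u x‖ₑ ^ 2) ^ (N / (N - 2)) = ‖u x‖ₑ ^ (2 * N / (N - 2)) := by
    intro x
    rw [← ENNReal.rpow_natCast, ← ENNReal.rpow_mul]
    congr 1; push_cast; ring
  simp only [Pi.mul_apply, e2, one_div, inv_div] at h
  simpa only [e1] using h

namespace IsBochnerDensity

variable {C : ℝ} {e : M → ℝ}

/-- The constant in front of the gradient of the cutoff function. -/
def cutoffConst (n : ℕ) : ℝ := 2 + (n : ℝ) ^ 2 / 32 * (4 / (((n : ℝ) - 2) / 4) ^ 2)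

/-- The constant in front of the term of higher order. -/
def nonlinearConst (n : ℕ) (C : ℝ) : ℝ := (n : ℝ) ^ 2 / 32 * (2 * C / (((n : ℝ) - 2) / 4))

theorem cutoffConst_nonneg (n : ℕ) : 0 ≤ cutoffConst n := by
  unfold cutoffConst; positivity

theorem nonlinearConst_nonneg (hn : 3 ≤ n) (hC : 0 ≤ C) : 0 ≤ nonlinearConst n C := by
  have hn' : (3 : ℝ) ≤ n := by exact_mod_cast hn
  have : 0 < ((n : ℝ) - 2) / 4 := by linarith
  unfold nonlinearConst; positivity

/-- The Sobolev inequality for `η (e + δ) ^ (n / 8)`, when the energy of `e` is small. -/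
theorem sobolev_le (he : IsBochnerDensity n C e) (hC : 0 ≤ C) (hn : 3 ≤ n) {c₁ c : ℝ}
    (hS : SobolevInequality n M c₁) (hc₁ : c₁ ≤ c) (hc0 : 0 ≤ c) {κ : ℝ} (hκ : 0 ≤ κ)
    (hcκ : c * nonlinearConst n C * κ ≤ 1 / 2)
    (hE : (∫⁻ x, ENNReal.ofReal (√(e x)) ^ ((n : ℝ) / 2) ∂(riemannianVolume n M)) ^ (2 / (n : ℝ))
      ≤ ENNReal.ofReal κ)
    {δ : ℝ} (hδ : 0 < δ) {η : M → ℝ} {K : NNReal} (hη : LipschitzWith K η)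
    (hc : HasCompactSupport η) :
    (∫⁻ x, ‖η x * (e x + δ) ^ ((n : ℝ) / 8)‖ₑ ^ (2 * (n : ℝ) / ((n : ℝ) - 2))
        ∂(riemannianVolume n M)) ^ (((n : ℝ) - 2) / (n : ℝ))
      ≤ ENNReal.ofReal (2 * c * cutoffConst n * ((K : ℝ) ^ 2
        * ∫ x, (tsupport η).indicator (fun z ↦ (e z + δ) ^ ((n : ℝ) / 4)) x
            ∂(riemannianVolume n M))) := by
  have hn' : (3 : ℝ) ≤ n := by exact_mod_cast hn
  have ha : ∀ x, 0 < e x + δ := fun x ↦ add_pos_of_nonneg_of_pos (he.nonneg x) hδ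
  have hgrad := he.lintegral_cometric_le hC hn hδ hη hc
  have huL : ChartLipschitz n (fun z ↦ η z * (e z + δ) ^ ((n : ℝ) / 8)) :=
    (chartLipschitz_of_lipschitzWith (n := n) hη).mul (he.chartSmooth_rpow hδ _).chartLipschitz
  have hsob := hS.lintegral_le huL hc.mul_right (hgrad.trans_lt ENNReal.ofReal_lt_top)
  have hhol := lintegral_sq_mul_le (μ := riemannianVolume n M) (N := n) (by linarith)
    huL.continuous.measurable.aemeasurable
    (he.smooth.continuous.sqrt.measurable.aemeasurable)
  have hPi := integrable_sq_mul (n := n) hη.continuous hc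
    (he.continuous_rpow_mul_sqrt hδ ((n : ℝ) / 4))
  have hP0 : ∀ x, 0 ≤ η x ^ 2 * ((e x + δ) ^ ((n : ℝ) / 4) * √(e x)) := fun x ↦
    mul_nonneg (sq_nonneg _) (mul_nonneg (Real.rpow_nonneg (ha x).le _) (Real.sqrt_nonneg _))
  have hJ0 : 0 ≤ ∫ x, (tsupport η).indicator (fun z ↦ (e z + δ) ^ ((n : ℝ) / 4)) x
      ∂(riemannianVolume n M) :=
    integral_nonneg fun x ↦ Set.indicator_nonneg (fun z _ ↦ Real.rpow_nonneg (ha z).le _) x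
  have hPeq : ENNReal.ofReal (∫ x, η x ^ 2 * ((e x + δ) ^ ((n : ℝ) / 4) * √(e x))
        ∂(riemannianVolume n M))
      = ∫⁻ x, ENNReal.ofReal ((η x * (e x + δ) ^ ((n : ℝ) / 8)) ^ 2 * √(e x))
        ∂(riemannianVolume n M) := by
    rw [ofReal_integral_eq_lintegral_ofReal hPi (Filter.Eventually.of_forall hP0)]
    refine lintegral_congr fun x ↦ ?_
    have e1 : ((e x + δ) ^ ((n : ℝ) / 8)) ^ 2 = (e x + δ) ^ ((n : ℝ) / 4) := by
      rw [← Real.rpow_natCast, ← Real.rpow_mul (ha x).le]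
      congr 1; push_cast; ring
    rw [mul_pow, e1, mul_assoc]
  change _ ≤ ENNReal.ofReal (cutoffConst n * _ + nonlinearConst n C * _) at hgrad
  have hK1 := cutoffConst_nonneg n
  have hK2 := nonlinearConst_nonneg hn hC
  set Q := (∫⁻ x, ‖η x * (e x + δ) ^ ((n : ℝ) / 8)‖ₑ ^ (2 * (n : ℝ) / ((n : ℝ) - 2))
        ∂(riemannianVolume n M)) ^ (((n : ℝ) - 2) / (n : ℝ)) with hQ
  set P := ∫ x, η x ^ 2 * ((e x + δ) ^ ((n : ℝ) / 4) * √(e x)) ∂(riemannianVolume n M) with hP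
  set J := ∫ x, (tsupport η).indicator (fun z ↦ (e z + δ) ^ ((n : ℝ) / 4)) x
      ∂(riemannianVolume n M) with hJ
  have hQle : Q ≤ ENNReal.ofReal (c * (cutoffConst n * ((K : ℝ) ^ 2 * J)
      + nonlinearConst n C * P)) := by
    rw [ENNReal.ofReal_mul hc0]
    exact hsob.trans (mul_le_mul' (ENNReal.ofReal_le_ofReal hc₁) hgrad)
  -- Absorbing a multiple of `Q` into the left-hand side requires `Q` to be finite, which the
  -- Sobolev inequality already provides.
  have hQtop : Q ≠ ⊤ := ne_top_of_le_ne_top ENNReal.ofReal_ne_top hQle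
  have hPnn : 0 ≤ P := integral_nonneg hP0
  have hPle : P ≤ Q.toReal * κ := by
    rw [← ENNReal.ofReal_le_ofReal_iff (by positivity), hPeq, ENNReal.ofReal_mul
      ENNReal.toReal_nonneg, ENNReal.ofReal_toReal hQtop]
    exact hhol.trans (mul_le_mul' le_rfl hE)
  have hQr : Q.toReal ≤ c * (cutoffConst n * ((K : ℝ) ^ 2 * J) + nonlinearConst n C * P) :=
    ENNReal.toReal_le_of_le_ofReal (by positivity) hQle
  rw [← ENNReal.ofReal_toReal hQtop]
  refine ENNReal.ofReal_le_ofReal ?_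
  -- Smallness of `κ` lets half of `Q` absorb the cubic term; this is the origin of the factor `2`
  -- in the conclusion.
  have h1 : c * nonlinearConst n C * P ≤ 1 / 2 * Q.toReal := by
    calc c * nonlinearConst n C * P ≤ c * nonlinearConst n C * (Q.toReal * κ) := by gcongr
      _ = c * nonlinearConst n C * κ * Q.toReal := by ring
      _ ≤ 1 / 2 * Q.toReal := by
        gcongr
  linarith

/-- The integral of `(e + δ) ^ (n / 4)` over a compact set is controlled by the energy, when `δ`
is small. -/
theorem exists_integral_indicator_le (he : IsBochnerDensity n C e) (hn : 3 ≤ n)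
    (hT : ∫⁻ x, ENNReal.ofReal (√(e x)) ^ ((n : ℝ) / 2) ∂(riemannianVolume n M) ≠ ⊤)
    {S : Set M} (hS : IsCompact S) :
    ∃ δ : ℝ, 0 < δ ∧ ∫ x, S.indicator (fun z ↦ (e z + δ) ^ ((n : ℝ) / 4)) x
        ∂(riemannianVolume n M)
      ≤ 2 ^ ((n : ℝ) / 4) * ((∫⁻ x, ENNReal.ofReal (√(e x)) ^ ((n : ℝ) / 2)
        ∂(riemannianVolume n M)).toReal + 1) := by
  have := isLocallyFiniteMeasure_riemannianVolume (n := n) (M := M)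
  have hn' : (3 : ℝ) ≤ n := by exact_mod_cast hn
  set μ := riemannianVolume n M with hμ
  set p : ℝ := (n : ℝ) / 4 with hp
  have hp0 : 0 < p := by rw [hp]; linarith
  have hSfin : μ S ≠ ⊤ := hS.measure_lt_top.ne
  set m := (μ S).toReal with hm
  have hm0 : 0 ≤ m := ENNReal.toReal_nonneg
  -- Chosen so that `δ ^ p` times the volume of `S` is at most one; adding `1` to the volume covers
  -- the case of volume zero.
  set δ : ℝ := ((m + 1)⁻¹) ^ (p⁻¹) with hδdef
  have hδ : 0 < δ := by positivity
  have hδp : δ ^ p = (m + 1)⁻¹ := by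
    rw [hδdef, ← Real.rpow_mul (by positivity), inv_mul_cancel₀ hp0.ne', Real.rpow_one]
  refine ⟨δ, hδ, ?_⟩
  have ha : ∀ x, 0 < e x + δ := fun x ↦ add_pos_of_nonneg_of_pos (he.nonneg x) hδ
  set T := ∫⁻ x, ENNReal.ofReal (√(e x)) ^ ((n : ℝ) / 2) ∂μ with hTdef
  have hTe : ∀ x, ENNReal.ofReal (√(e x)) ^ ((n : ℝ) / 2) = ENNReal.ofReal (e x ^ p) := by
    intro x
    rw [ENNReal.ofReal_rpow_of_nonneg (Real.sqrt_nonneg _) (by positivity), Real.sqrt_eq_rpow,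
      ← Real.rpow_mul (he.nonneg x)]
    congr 2; rw [hp]; ring
  have hpt : ∀ x, (e x + δ) ^ p ≤ 2 ^ p * (e x ^ p + δ ^ p) := by
    intro x
    have hmax : e x + δ ≤ 2 * max (e x) δ := by
      linarith [le_max_left (e x) δ, le_max_right (e x) δ]
    calc (e x + δ) ^ p ≤ (2 * max (e x) δ) ^ p := Real.rpow_le_rpow (ha x).le hmax hp0.le
      _ = 2 ^ p * (max (e x) δ) ^ p :=
        Real.mul_rpow two_pos.le ((he.nonneg x).trans (le_max_left _ _))
      _ ≤ 2 ^ p * (e x ^ p + δ ^ p) := by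
        refine mul_le_mul_of_nonneg_left ?_ (by positivity)
        have h1 : 0 ≤ e x ^ p := Real.rpow_nonneg (he.nonneg x) _
        have h2 : 0 ≤ δ ^ p := Real.rpow_nonneg hδ.le _
        rcases max_choice (e x) δ with h | h <;> rw [h] <;> linarith
  rw [← ENNReal.ofReal_le_ofReal_iff (by positivity), ofReal_integral_eq_lintegral_ofReal
    ((((he.continuous_rpow hδ p).continuousOn.integrableOn_compact hS).integrable_indicator
      hS.measurableSet)) (Filter.Eventually.of_forall fun x ↦
        Set.indicator_nonneg (fun z _ ↦ Real.rpow_nonneg (ha z).le _) x)]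
  have hle : ∫⁻ x, ENNReal.ofReal (S.indicator (fun z ↦ (e z + δ) ^ p) x) ∂μ
      ≤ ∫⁻ x, ENNReal.ofReal (2 ^ p) * (ENNReal.ofReal (√(e x)) ^ ((n : ℝ) / 2)
        + S.indicator (fun _ ↦ ENNReal.ofReal (δ ^ p)) x) ∂μ := by
    refine lintegral_mono fun x ↦ ?_
    by_cases hx : x ∈ S
    · simp only [Set.indicator_of_mem hx]
      rw [hTe, ← ENNReal.ofReal_add (Real.rpow_nonneg (he.nonneg x) _) (Real.rpow_nonneg hδ.le _),
        ← ENNReal.ofReal_mul (by positivity)]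
      exact ENNReal.ofReal_le_ofReal (hpt x)
    · simp [Set.indicator_of_notMem hx]
  refine hle.trans ?_
  rw [lintegral_const_mul' _ _ ENNReal.ofReal_ne_top, lintegral_add_right _
    (measurable_const.indicator hS.measurableSet), lintegral_indicator_const hS.measurableSet,
    ENNReal.ofReal_mul (by positivity), ENNReal.ofReal_add ENNReal.toReal_nonneg zero_le_one,
    ENNReal.ofReal_toReal hT]
  refine mul_le_mul' le_rfl (add_le_add le_rfl ?_)
  rw [← ENNReal.ofReal_toReal hSfin, ← ENNReal.ofReal_mul (by positivity), hδp]
  refine ENNReal.ofReal_le_ofReal ?_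
  rw [inv_mul_le_iff₀ (by positivity)]
  linarith

/-- For cutoffs of radius `R` around `x₀` the right-hand side of `sobolev_le` is a bounded quantity
divided by `R²`. Hence an integral of a power of `e` over the unit ball is zero, and `e` vanishes at
the center by continuity. -/
theorem eq_zero_of_energy_le [CompleteSpace M] (he : IsBochnerDensity n C e) (hC : 0 ≤ C)
    (hn : 3 ≤ n) {c₁ c : ℝ}
    (hS : SobolevInequality n M c₁) (hc₁ : c₁ ≤ c) (hc0 : 0 ≤ c) {κ : ℝ} (hκ : 0 ≤ κ)
    (hcκ : c * nonlinearConst n C * κ ≤ 1 / 2)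
    (hE : (∫⁻ x, ENNReal.ofReal (√(e x)) ^ ((n : ℝ) / 2) ∂(riemannianVolume n M)) ^ (2 / (n : ℝ))
      ≤ ENNReal.ofReal κ) (x₀ : M) : e x₀ = 0 := by
  have hn' : (3 : ℝ) ≤ n := by exact_mod_cast hn
  have hT : ∫⁻ x, ENNReal.ofReal (√(e x)) ^ ((n : ℝ) / 2) ∂(riemannianVolume n M) ≠ ⊤ := by
    intro h
    rw [h, ENNReal.top_rpow_of_pos (by positivity)] at hE
    exact absurd hE (not_le.2 ENNReal.ofReal_lt_top)
  set T := ∫⁻ x, ENNReal.ofReal (√(e x)) ^ ((n : ℝ) / 2) ∂(riemannianVolume n M) with hTdef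
  set q : ℝ := 2 * (n : ℝ) / ((n : ℝ) - 2) with hq
  have hq0 : 0 < q := div_pos (by linarith) (by linarith)
  set B : Set M := {y | edist x₀ y < 1} with hB
  have hBo : IsOpen B := isOpen_lt (continuous_const.edist continuous_id) continuous_const
  set W := ∫⁻ x in B, ENNReal.ofReal (e x ^ ((n : ℝ) / 8)) ^ q ∂(riemannianVolume n M) with hW
  set L : ℝ := 2 * c * cutoffConst n * (2 ^ ((n : ℝ) / 4) * (T.toReal + 1)) with hL
  have hL0 : 0 ≤ L := by
    have := cutoffConst_nonneg n
    positivity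
  have hbound : ∀ R : ℝ, 1 ≤ R → W ^ (((n : ℝ) - 2) / (n : ℝ)) ≤ ENNReal.ofReal (L * R⁻¹) := by
    intro R hR
    have hR0 : 0 < R := by linarith
    have hcs : HasCompactSupport (cutoff x₀ R) := by
      refine HasCompactSupport.intro (isCompact_closedEBall n x₀ (2 * R).toNNReal) fun x hx ↦ ?_
      exact cutoff_eq_zero hR0 (not_le.1 hx).le
    -- The shift is chosen after `R`, so the volume of the growing support does not enter the bound
    -- `L`.
    obtain ⟨δ, hδ, hJ⟩ := he.exists_integral_indicator_le hn hT hcs.isCompact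
    have hmain := he.sobolev_le hC hn hS hc₁ hc0 hκ hcκ hE hδ (lipschitzWith_cutoff x₀ hR0) hcs
    refine le_trans (ENNReal.rpow_le_rpow ?_ (div_nonneg (by linarith) (by linarith)))
      (hmain.trans (ENNReal.ofReal_le_ofReal ?_))
    · refine (setLIntegral_mono' hBo.measurableSet fun x hx ↦ ?_).trans (setLIntegral_le_lintegral B _)
      refine ENNReal.rpow_le_rpow ?_ hq0.le
      have hx1 : edist x₀ x ≤ ENNReal.ofReal R := by
        refine le_trans (le_of_lt hx) ?_
        rw [← ENNReal.ofReal_one]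
        exact ENNReal.ofReal_le_ofReal hR
      rw [cutoff_eq_one hR0 hx1, one_mul, ← ofReal_norm, Real.norm_eq_abs]
      refine ENNReal.ofReal_le_ofReal ((Real.rpow_le_rpow (he.nonneg x) ?_ (by positivity)).trans
        (le_abs_self _))
      linarith
    -- The decay `R⁻²` is weakened to `R⁻¹`, which suffices for the limit.
    · have h1 : ((R⁻¹).toNNReal : ℝ) ^ 2 ≤ R⁻¹ := by
        rw [Real.coe_toNNReal _ (by positivity), sq]
        exact mul_le_of_le_one_left (by positivity) (inv_le_one_of_one_le₀ hR)
      have hK1 := cutoffConst_nonneg n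
      calc _ ≤ 2 * c * cutoffConst n * (((R⁻¹).toNNReal : ℝ) ^ 2
            * (2 ^ ((n : ℝ) / 4) * (T.toReal + 1))) := by gcongr
        _ ≤ 2 * c * cutoffConst n * (R⁻¹ * (2 ^ ((n : ℝ) / 4) * (T.toReal + 1))) := by gcongr
        _ = L * R⁻¹ := by rw [hL]; ring
  have hlim : W ^ (((n : ℝ) - 2) / (n : ℝ)) = 0 := by
    have ht : Filter.Tendsto (fun R : ℝ ↦ ENNReal.ofReal (L * R⁻¹)) Filter.atTop (nhds 0) := by
      have := ENNReal.tendsto_ofReal (tendsto_inv_atTop_zero.const_mul L)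
      simpa using this
    refine le_antisymm (ge_of_tendsto ht ?_) bot_le
    filter_upwards [Filter.eventually_ge_atTop 1] with R hR using hbound R hR
  have hW0 : W = 0 := by
    rwa [ENNReal.rpow_eq_zero_iff_of_pos (div_pos (by linarith) (by linarith))] at hlim
  by_contra hne
  have hpos : 0 < e x₀ := lt_of_le_of_ne (he.nonneg x₀) (Ne.symm hne)
  -- If `e x₀ > 0`, then `e` is positive on a nonempty open subset of the ball. Such a set has
  -- positive volume, against the vanishing of the integral.
  have hU : IsOpen (B ∩ {y | 0 < e y}) :=
    hBo.inter (isOpen_lt continuous_const he.smooth.continuous)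
  refine (riemannianVolume_pos_of_isOpen (n := n) hU ⟨x₀, by simp [hB], hpos⟩).ne' ?_
  have hmeas : Measurable fun x ↦ ENNReal.ofReal (e x ^ ((n : ℝ) / 8)) ^ q :=
    ((he.smooth.continuous.measurable.pow_const _).ennreal_ofReal).pow_const q
  rw [hW, lintegral_eq_zero_iff hmeas, Filter.EventuallyEq, ae_restrict_iff' hBo.measurableSet,
    ae_iff] at hW0
  refine measure_mono_null (fun y hy ↦ ?_) hW0
  simp only [Set.mem_ofPred_eq, Classical.not_imp, Pi.zero_apply]
  refine ⟨hy.1, ?_⟩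
  rw [ENNReal.rpow_eq_zero_iff_of_pos hq0, ENNReal.ofReal_eq_zero, not_le]
  exact Real.rpow_pos_of_pos hy.2 _

end IsBochnerDensity

end Gap

end YangMills

namespace YangMills

/-- The energy density of a Yang–Mills connection satisfies the Bochner inequality. -/
theorem Connection.isBochnerDensity_energyDensity {n d : ℕ}
    {M : Type u} [EMetricSpace M] [ChartedSpace (𝔼 n) M] [IsManifold (𝓡 n) ∞ M]
    [RiemannianBundle (fun x : M ↦ TangentSpace (𝓡 n) x)]
    [IsContMDiffRiemannianBundle (𝓡 n) ∞ (𝔼 n) (fun x : M ↦ TangentSpace (𝓡 n) x)]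
    {G : Type v} [TopologicalSpace G] [ChartedSpace (𝔼 d) G] [Group G] [LieGroup (𝓡 d) ∞ G]
    [T2Space G] [CompactSpace G] [LieAlgebra.IsSemisimple ℝ (GroupLieAlgebra (𝓡 d) G)]
    {P : Type w} [TopologicalSpace P] [ChartedSpace (𝔼 (n + d)) P] [IsManifold (𝓡 (n + d)) ∞ P]
    {B : PrincipalBundle (n := n) (d := d) M G P} (A : Connection B)
    (hcurv : NonnegCurvatureOnTwoForms n M) (hYM : A.IsYangMills) :
    IsBochnerDensity n (4 * (n : ℝ) ^ 3) A.energyDensity where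
  smooth := A.contDiffOn_energyDensity
  nonneg := A.energyDensity_nonneg
  le_laplacian c y hy a ha hea := by
    have h := A.gradSq_energyDensity_le hcurv hYM hy rfl ha hea
    exact h

end YangMills

end

theorem theorem1p3 (n : ℕ) (hn : 3 ≤ n) (d : ℕ) (c₁ : ℝ) :
    ∃ κ₀ : ℝ, 0 < κ₀ ∧
      ∀ (M : Type u) [EMetricSpace M] [ChartedSpace (EuclideanSpace ℝ (Fin n)) M]
        [IsManifold (𝓡 n) ∞ M] [SecondCountableTopology M]
        [RiemannianBundle (fun x : M ↦ TangentSpace (𝓡 n) x)]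
        [IsContMDiffRiemannianBundle (𝓡 n) ∞ (EuclideanSpace ℝ (Fin n))
          (fun x : M ↦ TangentSpace (𝓡 n) x)]
        [IsRiemannianManifold (𝓡 n) M] [CompleteSpace M] [NoncompactSpace M]
        [MeasurableSpace M] [BorelSpace M],
        YangMills.NonnegCurvatureOnTwoForms n M →
        YangMills.SobolevInequality n M c₁ →
        ∀ (G : Type v) [TopologicalSpace G] [ChartedSpace (EuclideanSpace ℝ (Fin d)) G]
          [Group G] [LieGroup (𝓡 d) ∞ G] [T2Space G] [CompactSpace G]
          [LieAlgebra.IsSemisimple ℝ (GroupLieAlgebra (𝓡 d) G)]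
          (P : Type w) [TopologicalSpace P] [ChartedSpace (EuclideanSpace ℝ (Fin (n + d))) P]
          [IsManifold (𝓡 (n + d)) ∞ P]
          (B : YangMills.PrincipalBundle (n := n) (d := d) M G P)
          (A : YangMills.Connection B),
          A.IsYangMills → A.IsFlat ∨ ENNReal.ofReal κ₀ ≤ A.energy := by
  -- The Sobolev constant is made nonnegative so that it can be multiplied into inequalities.
  set c : ℝ := max c₁ 0 with hc
  have hc0 : 0 ≤ c := le_max_right _ _
  have hK := YangMills.IsBochnerDensity.nonlinearConst_nonneg (C := 4 * (n : ℝ) ^ 3) hn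
    (by positivity)
  set K := YangMills.IsBochnerDensity.nonlinearConst n (4 * (n : ℝ) ^ 3)
  -- The threshold satisfies `c K κ₀ ≤ 1/2`, as the absorption requires; the added `1` keeps it
  -- positive and finite when `c K = 0`.
  have hκ : 0 < 1 / (2 * (c * K + 1)) := by positivity
  refine ⟨1 / (2 * (c * K + 1)), hκ, ?_⟩
  intro M _ _ _ _ _ _ _ _ _ _ _ hcurv hS G _ _ _ _ _ _ _ P _ _ _ B A hYM
  refine or_iff_not_imp_right.2 fun hE ↦ A.isFlat_of_energyDensity_eq_zero ?_
  refine (A.isBochnerDensity_energyDensity hcurv hYM).eq_zero_of_energy_le (by positivity) hn hS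
    (le_max_left _ _) hc0 hκ.le ?_ (not_le.1 hE).le
  rw [mul_one_div, div_le_div_iff₀ (by positivity) two_pos]
  linarith
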